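/- Let $\Omega=(x_l,x_r)$ be a bounded interval, $T>0$, $\mu\in C^3([x_l,x_r])$ with $0<\mu_0\le\mu\le\mu_1$, $c:\Omega\to\mathbb R$ with $|c|\le\kappa$, $\kappa>0$, and $\mathcal L v=-(\mu v')'$. For $\alpha\in(0,1)$ consider $$\partial_t^\alpha u+\mathcal L u=c(x)u+f(x,t)\quad (x\in\Omega,\ 0<t\le T),\qquad u=u_b\ \text{ on }\partial\Omega\times(0,T],\qquad u(\cdot,0)=u_0\ \text{ on }\overline\Omega,$$ where $\partial_t^\alpha v(t)=\int_0^t\omega_{1-\alpha}(t-s)v'(s)\,ds$ is the Caputo derivative and $\omega_\beta(t)=t^{\beta-1}/\Gamma(\beta)$. The boundary data are assumed smooth in time: $u_b(x,\cdot)\in C^3([0,T])$ for $x\in\{x_l,x_r\}$. For a normed space $X$, $\sigma\in(0,1)\cup(1,2)$ and $m\ge1$, let $C^m_\sigma((0,T];X)$ be the set of $v\in C([0,T];X)\cap C^m((0,T];X)$ with $\|v^{(\ell)}(t)\|_X\le K(1+t^{\sigma-\ell})$ for $1\le\ell\le m$, $0<t\le T$ and some constant $K$. **Discretization.** Let $0=t_0<t_1<\dots<t_N=T$,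 $\tau_k=t_k-t_{k-1}$, $\rho_k=\tau_k/\tau_{k+1}$, $\tau=\max_{1\le k\le N}\tau_k$, $\theta=\alpha/2$, $t_{n-\theta}=\theta t_{n-1}+(1-\theta)t_n$ and $v^{n-\theta}=\theta v^{n-1}+(1-\theta)v^n$. The nonuniform Alikhanov formula is $(\partial_\tau^\alpha v)^{n-\theta}=\sum_{k=1}^nA^{(n)}_{n-k}(v^k-v^{k-1})$, where, with $$a^{(n)}_0=\frac1{\tau_n}\int_{t_{n-1}}^{t_{n-\theta}}\omega_{1-\alpha}(t_{n-\theta}-s)\,ds,\qquad a^{(n)}_{n-k}=\frac1{\tau_k}\int_{t_{k-1}}^{t_k}\omega_{1-\alpha}(t_{n-\theta}-s)\,ds,$$ $$b^{(n)}_{n-k}=\frac{2}{\tau_k(\tau_k+\tau_{k+1})}\int_{t_{k-1}}^{t_k}\Big(s-\frac{t_{k-1}+t_k}2\Big)\omega_{1-\alpha}(t_{n-\theta}-s)\,ds\qquad(1\le k\le n-1),$$ one sets $A^{(1)}_0=a^{(1)}_0$ and, for $n\ge2$, $A^{(n)}_0=a^{(n)}_0+\rho_{n-1}b^{(n)}_1$,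 $A^{(n)}_{n-k}=a^{(n)}_{n-k}+\rho_{k-1}b^{(n)}_{n-k+1}-b^{(n)}_{n-k}$ for $2\le k\le n-1$, and $A^{(n)}_{n-1}=a^{(n)}_{n-1}-b^{(n)}_{n-1}$. For $M\ge1$ let $h=(x_r-x_l)/M$ and $x_s=x_l+sh$. For a grid function $v$ put $$(\mathcal L_hv)_i=-\frac1{h^2}\big(\mu(x_{i+1/2})(v_{i+1}-v_i)-\mu(x_{i-1/2})(v_i-v_{i-1})\big)\quad(0<i<M),$$ $$\|v\|^2=h\sum_{0<i<M}v_i^2,\qquad |v|_1^2=h\sum_{i=1}^M\mu(x_{i-1/2})\Big(\frac{v_i-v_{i-1}}h\Big)^2 .$$ Let $C_\Omega>0$ be an embedding constant: $\|v\|^2\le C_\Omega|v|_1^2$ for every $M$ and every grid function $v$ with $v_0=v_M=0$. The fractional Crank–Nicolson scheme is $$(\partial^\alpha_\tau u_h)^{n-\theta}+\mathcal L_hu_h^{n-\theta}=c\,u_h^{n-\theta}+f(\cdot,t_{n-\theta})\ \text{ at } x_i,\ 0<i<M,\ 1\le n\le N,$$ with $u_h^n=u_b(\cdot,t_n)$ at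 $x_0,x_M$ for $1\le n\le N$, and $u_h^0=u_0$ at all grid points. **Theorem.** Suppose the problem has a solution $u\in C([0,T];H^4(\Omega))\cap C^2_\sigma((0,T];H^2(\Omega))\cap C^3_\sigma((0,T];H^1(\Omega))$, where $\sigma\in(0,1)\cup(1,2)$, and that the mesh satisfies $\rho_k\le7/4$ for $1\le k\le N-1$ and $\tau\le\big(6\,\Gamma(2-\alpha)\,\kappa^2C_\Omega\big)^{-1/\alpha}$. Then, for $1\le n\le N$, $$|u(t_n)-u_h^n|_1\le\frac{C_u}{\sigma(1-\alpha)}\Big(\tau_1^\sigma+\max_{2\le k\le n}\frac{t_k^\alpha t_{k-1}^{\sigma-3}\tau_k^3}{\tau_{k-1}^\alpha}+\max_{2\le k\le n}t_k^{\alpha/2}t_{k-1}^{\sigma-2}\tau_k^2+t_n^{\alpha/2}h^2\Big),$$ where the maxima are $0$ for $n=1$. If, in addition, for some $\gamma\ge1$ and $C_\gamma>0$ one has $\tau_k\le C_\gamma\tau\min\{1,t_k^{1-1/\gamma}\}$ for $1\le k\le N$, and $t_k\le C_\gamma t_{k-1}$ and $\tau_k/t_k\le C_\gamma\tau_{k-1}/t_{k-1}$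 for $2\le k\le N$, then $$|u(t_n)-u_h^n|_1\le\frac{C_u'}{\sigma(1-\alpha)}\big(\tau^{\min\{\gamma\sigma,2\}}+h^2\big)\qquad(1\le n\le N).$$ Here $C_u$ is independent of the meshes. It depends only on $x_l,x_r,T,\mu,\mu_0,\mu_1,c,\kappa,C_\Omega$, on a common bound $K$ for $\sup_{0\le t\le T}\|u(t)\|_{H^4}$, for the constants of $u$ in $C^2_\sigma((0,T];H^2)$ and $C^3_\sigma((0,T];H^1)$ and for $|\partial_t^3u_b|$, and on a lower bound $\alpha_0>0$ for $\alpha$. In particular it is uniform in $\alpha\in[\alpha_0,1)$ and in $\sigma\in(0,1)\cup(1,2)$. The constant $C_u'$ depends in addition only on $\gamma$ and $C_\gamma$. -/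

import Mathlib

open MeasureTheory Set

namespace FracCN

noncomputable section

/-! ## Sobolev spaces on a bounded interval, and time-dependent functions with values in them -/

/-- `L²(a,b)`. -/
abbrev L2 (a b : ℝ) : Type := Lp ℝ 2 (volume.restrict (Ioo a b))

/-- Test functions on `(a,b)`: smooth with compact support inside the open interval. -/
def IsTest (a b : ℝ) (φ : ℝ → ℝ) : Prop :=
  ContDiff ℝ (⊤ : ℕ∞) φ ∧ HasCompactSupport φ ∧ tsupport φ ⊆ Ioo a b

/-- `g` is the `j`-th weak derivative of `v` on `(a,b)`. -/
def IsWeakDeriv (a b : ℝ) (j : ℕ) (v g : L2 a b) : Prop :=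
  ∀ φ : ℝ → ℝ, IsTest a b φ →
    ∫ x in Ioo a b, v x * iteratedDeriv j φ x = (-1) ^ j * ∫ x in Ioo a b, g x * φ x

lemma IsTest.memLp {a b : ℝ} {φ : ℝ → ℝ} (h : IsTest a b φ) (j : ℕ) :
    MemLp (iteratedDeriv j φ) 2 (volume.restrict (Ioo a b)) := by
  have hc : HasCompactSupport (iteratedDeriv j φ) := by
    induction j with
    | zero => simpa using h.2.1
    | succ j ih => rw [iteratedDeriv_succ]; exact ih.deriv
  have hcont : Continuous (iteratedDeriv j φ) :=
    h.1.continuous_iteratedDeriv j (by exact_mod_cast le_top)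
  exact (hcont.memLp_of_hasCompactSupport hc).restrict _

lemma IsTest.integrable {a b : ℝ} {φ : ℝ → ℝ} (h : IsTest a b φ) (j : ℕ) (v : L2 a b) :
    Integrable (fun x => v x * iteratedDeriv j φ x) (volume.restrict (Ioo a b)) :=
  (Lp.memLp v).integrable_mul (h.memLp j)

lemma IsWeakDeriv.add {a b : ℝ} {j : ℕ} {v g v' g' : L2 a b} (h : IsWeakDeriv a b j v g)
    (h' : IsWeakDeriv a b j v' g') : IsWeakDeriv a b j (v + v') (g + g') := by
  intro φ hφ
  have i0 : ∀ w : L2 a b,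
      Integrable (fun x => w x * φ x) (volume.restrict (Ioo a b)) := fun w => by
    simpa using hφ.integrable 0 w
  have e1 : ∫ x in Ioo a b, (v + v' : L2 a b) x * iteratedDeriv j φ x
      = ∫ x in Ioo a b, (v x * iteratedDeriv j φ x + v' x * iteratedDeriv j φ x) := by
    refine integral_congr_ae ?_
    filter_upwards [Lp.coeFn_add v v'] with x hx
    rw [hx, Pi.add_apply, add_mul]
  have e2 : ∫ x in Ioo a b, (g + g' : L2 a b) x * φ x
      = ∫ x in Ioo a b, (g x * φ x + g' x * φ x) := by
    refine integral_congr_ae ?_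
    filter_upwards [Lp.coeFn_add g g'] with x hx
    rw [hx, Pi.add_apply, add_mul]
  rw [e1, e2, integral_add (hφ.integrable j v) (hφ.integrable j v'), integral_add (i0 g) (i0 g'),
    h φ hφ, h' φ hφ, mul_add]

lemma IsWeakDeriv.smul {a b : ℝ} {j : ℕ} {v g : L2 a b} (r : ℝ) (h : IsWeakDeriv a b j v g) :
    IsWeakDeriv a b j (r • v) (r • g) := by
  intro φ hφ
  have e1 : ∫ x in Ioo a b, (r • v : L2 a b) x * iteratedDeriv j φ x
      = ∫ x in Ioo a b, r * (v x * iteratedDeriv j φ x) := by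
    refine integral_congr_ae ?_
    filter_upwards [Lp.coeFn_smul r v] with x hx
    rw [hx, Pi.smul_apply, smul_eq_mul, mul_assoc]
  have e2 : ∫ x in Ioo a b, (r • g : L2 a b) x * φ x
      = ∫ x in Ioo a b, r * (g x * φ x) := by
    refine integral_congr_ae ?_
    filter_upwards [Lp.coeFn_smul r g] with x hx
    rw [hx, Pi.smul_apply, smul_eq_mul, mul_assoc]
  rw [e1, e2, integral_const_mul, integral_const_mul, h φ hφ]
  ring

lemma isWeakDeriv_zero {a b : ℝ} {j : ℕ} : IsWeakDeriv a b j (0 : L2 a b) 0 := by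
  intro φ _
  have hz : ∀ ψ : ℝ → ℝ, ∫ x in Ioo a b, (0 : L2 a b) x * ψ x = 0 := fun ψ => by
    rw [← integral_zero ℝ ℝ (μ := volume.restrict (Ioo a b))]
    refine integral_congr_ae ?_
    filter_upwards [Lp.coeFn_zero ℝ 2 (volume.restrict (Ioo a b))] with x hx
    rw [hx, Pi.zero_apply, zero_mul]
  rw [hz, hz, mul_zero]

/-- The Sobolev space `H^k(a,b)`: an element is the family `(v, v', …, v^{(k)})` of an `L²`
function and its weak derivatives up to order `k`, with the norm
`‖v‖² = ∑_{j ≤ k} ‖v^{(j)}‖²_{L²}`. -/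
def H (a b : ℝ) (k : ℕ) : Submodule ℝ (PiLp 2 (fun _ : Fin (k + 1) => L2 a b)) where
  carrier := {w | ∀ j : Fin (k + 1), IsWeakDeriv a b j (w 0) (w j)}
  add_mem' := fun h h' j => (h j).add (h' j)
  zero_mem' := fun _ => isWeakDeriv_zero
  smul_mem' := fun r _ h j => (h j).smul r

/-- The element `w` of `H^k(a,b)` is (the class of) the function `v`. -/
def Represents {a b : ℝ} {k : ℕ} (w : H a b k) (v : ℝ → ℝ) : Prop :=
  ((w : PiLp 2 (fun _ : Fin (k + 1) => L2 a b)) 0 : ℝ → ℝ) =ᵐ[volume.restrict (Ioo a b)] v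

/-- `v ∈ C^m_σ((0,T];X)` with constant `K`: `v ∈ C([0,T];X) ∩ C^m((0,T];X)` and
`‖v^{(l)}(t)‖ ≤ K (1 + t^{σ-l})` for `1 ≤ l ≤ m` and `0 < t ≤ T`. -/
def CSigma {X : Type*} [NormedAddCommGroup X] [NormedSpace ℝ X] (m : ℕ) (σ T K : ℝ)
    (v : ℝ → X) : Prop :=
  ContinuousOn v (Icc 0 T) ∧ ContDiffOn ℝ m v (Ioc 0 T) ∧
    ∀ l : ℕ, 1 ≤ l → l ≤ m → ∀ t ∈ Ioc 0 T,
      ‖iteratedDerivWithin l v (Ioc 0 T) t‖ ≤ K * (1 + t ^ (σ - l))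

/-- The function `u` (written `u t x`) belongs to
`C([0,T];H⁴(a,b)) ∩ C²_σ((0,T];H²(a,b)) ∩ C³_σ((0,T];H¹(a,b))`, with all bounds given by the
constant `K`; at every time `u t` is the continuous representative on `[a,b]`. -/
structure SolRegular (a b T σ K : ℝ) (u : ℝ → ℝ → ℝ) : Prop where
  cont : ∀ t ∈ Icc 0 T, ContinuousOn (u t) (Icc a b)
  h4 : ∃ U : ℝ → H a b 4, (∀ t ∈ Icc 0 T, Represents (U t) (u t)) ∧
    ContinuousOn U (Icc 0 T) ∧ ∀ t ∈ Icc 0 T, ‖U t‖ ≤ K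
  h2 : ∃ U : ℝ → H a b 2, (∀ t ∈ Icc 0 T, Represents (U t) (u t)) ∧ CSigma 2 σ T K U
  h1 : ∃ U : ℝ → H a b 1, (∀ t ∈ Icc 0 T, Represents (U t) (u t)) ∧ CSigma 3 σ T K U

/-! ## The reaction-subdiffusion problem -/

/-- `ω_β(t) = t^{β-1} / Γ(β)`. -/
def omega (β t : ℝ) : ℝ := t ^ (β - 1) / Real.Gamma β

/-- The Caputo derivative `∫_0^t ω_{1-α}(t-s) v'(s) ds`. -/
def caputo (α : ℝ) (v : ℝ → ℝ) (t : ℝ) : ℝ :=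
  ∫ s in (0 : ℝ)..t, omega (1 - α) (t - s) * deriv v s

/-- The elliptic operator `ℒ v = -(μ v')'`. -/
def ellip (μ v : ℝ → ℝ) (x : ℝ) : ℝ := -deriv (fun y => μ y * deriv v y) x

/-- `u` solves `∂_t^α u + ℒ u = c u + f` in `(a,b) × (0,T]`, with boundary values `ub t x`
and initial values `u0 x`. -/
structure IsSolution (a b T α : ℝ) (μ c : ℝ → ℝ) (f : ℝ → ℝ → ℝ) (ub : ℝ → ℝ → ℝ) (u0 : ℝ → ℝ)
    (u : ℝ → ℝ → ℝ) : Prop where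
  pde : ∀ x ∈ Ioo a b, ∀ t ∈ Ioc 0 T,
    caputo α (fun s => u s x) t + ellip μ (u t) x = c x * u t x + f x t
  boundary : ∀ t ∈ Ioc 0 T, u t a = ub t a ∧ u t b = ub t b
  initial : ∀ x ∈ Icc a b, u 0 x = u0 x

/-- The boundary data are three times continuously differentiable in time on `[0,T]`, with
third derivative bounded by `K`. -/
def BoundarySmooth (a b T K : ℝ) (ub : ℝ → ℝ → ℝ) : Prop :=
  ∀ x : ℝ, x = a ∨ x = b → ContDiffOn ℝ 3 (fun t => ub t x) (Icc 0 T) ∧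
    ∀ t ∈ Icc 0 T, |iteratedDerivWithin 3 (fun s => ub s x) (Icc 0 T) t| ≤ K

/-! ## Time meshes -/

/-- `0 = t_0 < t_1 < … < t_N = T`. -/
def IsMesh (T : ℝ) (N : ℕ) (t : ℕ → ℝ) : Prop :=
  1 ≤ N ∧ t 0 = 0 ∧ t N = T ∧ ∀ k < N, t k < t (k + 1)

/-- The step size `τ_k = t_k - t_{k-1}`, for `k ≥ 1`. -/
def tau (t : ℕ → ℝ) (k : ℕ) : ℝ := t k - t (k - 1)

/-- The step ratio `ρ_k = τ_k / τ_{k+1}`. -/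
def ratio (t : ℕ → ℝ) (k : ℕ) : ℝ := tau t k / tau t (k + 1)

/-- The maximum of `g i, …, g j` for a nonnegative `g`; it is `0` if the range is empty. -/
def maxOver (i j : ℕ) (g : ℕ → ℝ) : ℝ := (Finset.Icc i j).fold max 0 g

/-- The maximum step size `τ`. -/
def maxStep (N : ℕ) (t : ℕ → ℝ) : ℝ := maxOver 1 N (tau t)

/-- The step ratios `ρ_1, …, ρ_{N-1}` are at most `7/4`. -/
def RatioBound (N : ℕ) (t : ℕ → ℝ) : Prop := ∀ k, 1 ≤ k → k + 1 ≤ N → ratio t k ≤ 7 / 4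

/-- The condition for meshes that are graded towards `t = 0` with parameter `γ`. -/
def MeshConv (γ Cγ : ℝ) (N : ℕ) (t : ℕ → ℝ) : Prop :=
  (∀ k, 1 ≤ k → k ≤ N → tau t k ≤ Cγ * maxStep N t * min 1 (t k ^ (1 - 1 / γ))) ∧
  (∀ k, 2 ≤ k → k ≤ N → t k ≤ Cγ * t (k - 1)) ∧
  (∀ k, 2 ≤ k → k ≤ N → tau t k / t k ≤ Cγ * (tau t (k - 1) / t (k - 1)))

/-! ## The nonuniform Alikhanov formula, with offset `θ = α/2` -/

/-- The offset `θ = α/2`. -/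
def theta (α : ℝ) : ℝ := α / 2

/-- The offset point `t_{n-θ} = θ t_{n-1} + (1-θ) t_n`. -/
def tOff (α : ℝ) (t : ℕ → ℝ) (n : ℕ) : ℝ := theta α * t (n - 1) + (1 - theta α) * t n

/-- The coefficient `a^{(n)}_{n-k}`, that is `1/τ_k` times the integral of `ω_{1-α}(t_{n-θ} - s)`
over `[t_{k-1}, t_k]` if `k < n`, and over `[t_{n-1}, t_{n-θ}]` if `k = n`. -/
def coefA (α : ℝ) (t : ℕ → ℝ) (n k : ℕ) : ℝ :=
  (∫ s in t (k - 1)..(if k = n then tOff α t n else t k), omega (1 - α) (tOff α t n - s)) / tau t k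

/-- The coefficient `b^{(n)}_{n-k}`, for `1 ≤ k ≤ n - 1`. -/
def coefB (α : ℝ) (t : ℕ → ℝ) (n k : ℕ) : ℝ :=
  2 / (tau t k * (tau t k + tau t (k + 1))) *
    ∫ s in t (k - 1)..t k, (s - (t (k - 1) + t k) / 2) * omega (1 - α) (tOff α t n - s)

/-- The discrete convolution kernel `A^{(n,θ)}_{n-k}`, for `1 ≤ k ≤ n`: it is
`a_0` if `n = k = 1`, `a_0 + ρ_{n-1} b_1` if `k = n ≥ 2`,
`a_{n-k} + ρ_{k-1} b_{n-k+1} - b_{n-k}` if `2 ≤ k ≤ n-1`, and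
`a_{n-1} - b_{n-1}` if `k = 1 < n`. -/
def kernelA (α : ℝ) (t : ℕ → ℝ) (n k : ℕ) : ℝ :=
  coefA α t n k + (if 2 ≤ k then ratio t (k - 1) * coefB α t n (k - 1) else 0)
    - (if k < n then coefB α t n k else 0)

/-- The discrete Caputo derivative `∑_{k=1}^n A^{(n,θ)}_{n-k} (v^k - v^{k-1})`. -/
def discCaputo (α : ℝ) (t : ℕ → ℝ) (v : ℕ → ℝ) (n : ℕ) : ℝ :=
  ∑ k ∈ Finset.Icc 1 n, kernelA α t n k * (v k - v (k - 1))

/-- The weighted value `v^{n-θ} = θ v^{n-1} + (1-θ) v^n`. -/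
def wavg (α : ℝ) (v : ℕ → ℝ) (n : ℕ) : ℝ := theta α * v (n - 1) + (1 - theta α) * v n

/-! ## Spatial grid and the fully discrete scheme -/

/-- The mesh width `h = (b - a) / M`. -/
def width (a b : ℝ) (M : ℕ) : ℝ := (b - a) / M

/-- The point `x_s = a + s h`, for integer and half-integer `s`. -/
def pt (a b : ℝ) (M : ℕ) (s : ℝ) : ℝ := a + s * width a b M

/-- The difference operator `ℒ_h` at the interior grid point `x_i`, for `1 ≤ i ≤ M - 1`; a grid
function is given by its values `v i`, for `0 ≤ i ≤ M`. -/
def discEllip (a b : ℝ) (M : ℕ) (μ : ℝ → ℝ) (v : ℕ → ℝ) (i : ℕ) : ℝ :=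
  -(μ (pt a b M (i + 1 / 2)) * ((v (i + 1) - v i) / width a b M)
    - μ (pt a b M (i - 1 / 2)) * ((v i - v (i - 1)) / width a b M)) / width a b M

/-- The square of the discrete `L²` norm, `h ∑_{0 < i < M} v_i²`. -/
def discNormSq (a b : ℝ) (M : ℕ) (v : ℕ → ℝ) : ℝ :=
  width a b M * ∑ i ∈ Finset.Ioo 0 M, v i ^ 2

/-- The discrete `H¹` seminorm `|v|_1`, where `|v|_1² = h ∑_{i=1}^M μ(x_{i-1/2}) (∂_h v(x_{i-1/2}))²`.
For `v` vanishing at both ends this is `⟨v, ℒ_h v⟩`, see `discH1_sq_eq`. -/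
def discH1 (a b : ℝ) (M : ℕ) (μ : ℝ → ℝ) (v : ℕ → ℝ) : ℝ :=
  Real.sqrt (width a b M * ∑ i ∈ Finset.Icc 1 M,
    μ (pt a b M (i - 1 / 2)) * ((v i - v (i - 1)) / width a b M) ^ 2)

/-- `C` is an embedding constant: `‖v‖² ≤ C |v|_1²` for all grids and all grid functions that
vanish at both ends. -/
def IsEmbeddingConst (a b : ℝ) (μ : ℝ → ℝ) (C : ℝ) : Prop :=
  ∀ (M : ℕ) (v : ℕ → ℝ), 1 ≤ M → v 0 = 0 → v M = 0 →
    discNormSq a b M v ≤ C * discH1 a b M μ v ^ 2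

/-- `uh` (written `uh n i ≈ u(x_i, t_n)`) is a solution of the fractional Crank--Nicolson scheme. -/
structure IsDiscreteSolution (a b α : ℝ) (μ c : ℝ → ℝ) (f : ℝ → ℝ → ℝ) (ub : ℝ → ℝ → ℝ)
    (u0 : ℝ → ℝ) (N : ℕ) (t : ℕ → ℝ) (M : ℕ) (uh : ℕ → ℕ → ℝ) : Prop where
  scheme : ∀ n, 1 ≤ n → n ≤ N → ∀ i, 1 ≤ i → i < M →
    discCaputo α t (fun k => uh k i) n + discEllip a b M μ (fun j => wavg α (fun k => uh k j) n) i
      = c (pt a b M i) * wavg α (fun k => uh k i) n + f (pt a b M i) (tOff α t n)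
  boundary : ∀ n, 1 ≤ n → n ≤ N → uh n 0 = ub (t n) a ∧ uh n M = ub (t n) b
  initial : ∀ i, i ≤ M → uh 0 i = u0 (pt a b M i)

/-- The error `|u(t_n) - u_h^n|_1` in the discrete `H¹` norm. -/
def h1Error (a b : ℝ) (M : ℕ) (μ : ℝ → ℝ) (u : ℝ → ℝ → ℝ) (t : ℕ → ℝ) (uh : ℕ → ℕ → ℝ)
    (n : ℕ) : ℝ :=
  discH1 a b M μ (fun i => u (t n) (pt a b M i) - uh n i)

/-- The standing situation: the continuous problem with `α ∈ (0,1)`, `σ ∈ (0,1) ∪ (1,2)` and a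
solution `u` of the stated regularity; a time mesh that obeys the ratio and the step-size
restrictions; a spatial grid; and the discrete solution `uh` on these. -/
structure Setting (a b T κ CΩ K : ℝ) (μ c : ℝ → ℝ) (α σ : ℝ) (f : ℝ → ℝ → ℝ) (ub : ℝ → ℝ → ℝ)
    (u0 : ℝ → ℝ) (u : ℝ → ℝ → ℝ) (N : ℕ) (t : ℕ → ℝ) (M : ℕ) (uh : ℕ → ℕ → ℝ) : Prop where
  alpha_mem : α ∈ Ioo (0 : ℝ) 1
  sigma_mem : σ ∈ Ioo (0 : ℝ) 1 ∪ Ioo (1 : ℝ) 2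
  regular : SolRegular a b T σ K u
  boundarySmooth : BoundarySmooth a b T K ub
  solution : IsSolution a b T α μ c f ub u0 u
  mesh : IsMesh T N t
  ratio_le : RatioBound N t
  step_le : maxStep N t ≤ 1 / (6 * Real.Gamma (2 - α) * κ ^ 2 * CΩ) ^ (1 / α)
  grid : 1 ≤ M
  discrete : IsDiscreteSolution a b α μ c f ub u0 N t M uh

/-- Summation by parts: `|v|_1² = ⟨v, ℒ_h v⟩` for grid functions that vanish at both ends. -/
theorem discH1_sq_eq {a b : ℝ} (hab : a < b) {M : ℕ} (hM : 1 ≤ M) {μ : ℝ → ℝ}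
    (hμ : ∀ x ∈ Icc a b, 0 ≤ μ x) {v : ℕ → ℝ} (h0 : v 0 = 0) (h1 : v M = 0) :
    discH1 a b M μ v ^ 2
      = width a b M * ∑ i ∈ Finset.Ioo 0 M, v i * discEllip a b M μ v i := by
  have hMpos : (0 : ℝ) < M := by exact_mod_cast hM
  have hw : 0 < width a b M := div_pos (sub_pos.2 hab) hMpos
  rw [discH1, Real.sq_sqrt]
  · congr 1
    obtain ⟨m, rfl⟩ : ∃ m, M = m + 1 := ⟨M - 1, by omega⟩
    have key : ∀ w : ℝ, w ≠ 0 → ∀ q : ℝ → ℝ, ∀ m : ℕ,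
        ∑ i ∈ Finset.Icc 1 (m + 1), q (i - 1 / 2) * ((v i - v (i - 1)) / w) ^ 2
        = (∑ i ∈ Finset.Ioo 0 (m + 1), v i * (-(q (i + 1 / 2) * ((v (i + 1) - v i) / w)
            - q (i - 1 / 2) * ((v i - v (i - 1)) / w)) / w))
          + q ((m + 1 : ℕ) - 1 / 2) * ((v (m + 1) - v m) / w) * v (m + 1) / w := by
      intro w hw0 q m
      induction m with
      | zero =>
        have hE : Finset.Ioo 0 (0 + 1) = (∅ : Finset ℕ) := by
          decide
        rw [hE, Finset.sum_empty]
        simp [h0]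
        field_simp
      | succ m ih =>
        have hI : Finset.Ioo 0 (m + 1 + 1) = insert (m + 1) (Finset.Ioo 0 (m + 1)) := by
          ext x; simp only [Finset.mem_Ioo, Finset.mem_insert]; omega
        rw [Finset.sum_Icc_succ_top (by omega), ih, hI, Finset.sum_insert (by simp)]
        have e : ((m + 1 : ℕ) : ℝ) + 1 / 2 = ((m + 1 + 1 : ℕ) : ℝ) - 1 / 2 := by
          push_cast; ring
        simp only [Nat.add_sub_cancel, e]
        generalize (∑ i ∈ Finset.Ioo 0 (m + 1), v i * (-(q (i + 1 / 2) * ((v (i + 1) - v i) / w)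
            - q (i - 1 / 2) * ((v i - v (i - 1)) / w)) / w)) = S
        field_simp
        ring
    have := key (width a b (m + 1)) hw.ne' (fun s => μ (pt a b (m + 1) s)) m
    rw [h1, mul_zero, zero_div, add_zero] at this
    exact this
  · refine mul_nonneg hw.le (Finset.sum_nonneg fun i hi => mul_nonneg (hμ _ ?_) (sq_nonneg _))
    rw [Finset.mem_Icc] at hi
    have hi1 : (1 : ℝ) ≤ i := by exact_mod_cast hi.1
    have hi2 : (i : ℝ) ≤ M := by exact_mod_cast hi.2
    have hb : (M : ℝ) * width a b M = b - a := by
      rw [width]; field_simp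
    constructor
    · rw [pt]; nlinarith
    · rw [pt]; nlinarith

end

end FracCN

/-!
The error `e^n = u(t_n) - u_h^n` solves the scheme with three defects on the right: the truncation
error of the Alikhanov formula, the error of the weighted average `v^{n-θ}` at the offset point, and
the consistency error of `ℒ_h`. It vanishes initially and at the boundary.

*Stability.* Testing with `ℒ_h e^{n-θ}` and using the inequality
`2 v^{n-θ} (∂_τ^α v)^{n-θ} ≥ ∑_k A^{(n)}_{n-k} (v_k² - v_{k-1}²)` (`kernelA_energy`), which holds
because the kernel `A` decreases fast enough away from the diagonal for `ρ_k ≤ 7/4`, gives a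
discrete fractional differential inequality for `|e^n|_1²` (`energy_inequality`). The
complementary kernel `P`, with `∑_{j=k}^n P_{n,j} A^{(j)}_{j-k} = 1`, inverts it; the discrete
fractional Grönwall inequality `exists_gronwall` then bounds `|e^n|_1` by `∑_j P_{n,j} ξ_j` and the
square root of `∑_j P_{n,j} η_j²`. Here `ξ_j` bounds the part of the defect that is measured in
`|·|_1`, and `η_j` the part measured in the discrete `L²` norm. The restriction on `τ` makes the
reaction term small against the diagonal of `A`.

*Truncation in time.* Subtracting boundary values by linear interpolation makes the truncation error
vanish at both ends, so that it may be measured in `|·|_1`; the interpolant is controlled by the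
smooth boundary data and goes into `η_j`. On each interval the truncation error is an interpolation
error times an increment of `ω_{1-α}(t_{n-θ} - ·)`. Those increments are bounded by differences of
the kernel `A`, so that summation against `P` telescopes to the diagonal terms
`P_{n,k} A^{(k)}_0 E_k`, where `E_k` is the interpolation error, and
`∑_k P_{n,k} ω_{1-α}(t_k) ≤ 11/4` (`sum_complementary_omega_le`) turns their sum into a maximum over
the steps (`sum_truncBound_le`); the first step, with `P_{n,1} A^{(1)}_0 ≤ 1`, gives `τ_1^σ`.

*From functions of `t` to vectors.* Any norm of the vector of defects is a supremum over linear
functionals, and `∑_i p_i u(x_i, ·)` is a bounded functional applied to the map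
`t ↦ u(t)` into a Sobolev space, because point evaluation is bounded there. The scalar truncation
estimates thus apply to it with the constants of `u` (`CSigma.abs_sum_truncErr_le`). The one-variable
Sobolev calculus that this needs (evaluation at points, Taylor expansion with absolutely continuous
remainders, consistency of `ℒ_h` on `H⁴`) is built from the weak derivative.

*Graded meshes.* There each temporal term of the bound is at most a multiple of
`t_k^σ (τ_k / t_k)²`, and `τ_k / t_k ≤ C τ t_k^{-1/γ}` turns this into `τ^{min(γσ, 2)}`
(`MeshConv.errorBound_le`).
-/

namespace FracCN

/-! ### Integrals against a smooth weight -/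

section weight

variable {x y : ℝ} {w w' : ℝ → ℝ}

lemma integral_sub_left_mul (hxy : x ≤ y) (hw : ∀ s ∈ Icc x y, HasDerivAt w (w' s) s)
    (hc : ContinuousOn w' (Icc x y)) :
    ∫ s in x..y, (y - s) * w' s = (∫ s in x..y, w s) - (y - x) * w x := by
  rw [← uIcc_of_le hxy] at hw hc
  rw [intervalIntegral.integral_mul_deriv_eq_deriv_mul (u := fun s => y - s) (u' := fun _ => -1)
    (fun s _ => by simpa using (hasDerivAt_id s).const_sub y) hw
    (by simp) hc.intervalIntegrable]
  simp
  ring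

lemma integral_sub_right_mul (hxy : x ≤ y) (hw : ∀ s ∈ Icc x y, HasDerivAt w (w' s) s)
    (hc : ContinuousOn w' (Icc x y)) :
    ∫ s in x..y, (s - x) * w' s = (y - x) * w y - ∫ s in x..y, w s := by
  rw [← uIcc_of_le hxy] at hw hc
  rw [intervalIntegral.integral_mul_deriv_eq_deriv_mul (u := fun s => s - x) (u' := fun _ => 1)
    (fun s _ => by simpa using (hasDerivAt_id s).sub_const x) hw
    (by simp) hc.intervalIntegrable]
  simp

lemma integral_bubble_mul (hxy : x ≤ y) (hw : ∀ s ∈ Icc x y, HasDerivAt w (w' s) s)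
    (hc : ContinuousOn w' (Icc x y)) :
    ∫ s in x..y, (s - x) * (y - s) * w' s = 2 * ∫ s in x..y, (s - (x + y) / 2) * w s := by
  rw [← uIcc_of_le hxy] at hw hc
  rw [intervalIntegral.integral_mul_deriv_eq_deriv_mul (u := fun s => (s - x) * (y - s))
    (u' := fun s => (y - s) - (s - x))
    (fun s _ => ?_) hw (Continuous.intervalIntegrable (by fun_prop) _ _) hc.intervalIntegrable]
  · rw [← intervalIntegral.integral_const_mul]
    simp only [sub_self, mul_zero, zero_mul, zero_sub]
    rw [← intervalIntegral.integral_neg]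
    congr 1
    ext s
    ring
  · refine (((hasDerivAt_id' s).sub_const x).fun_mul
      ((hasDerivAt_id' s).const_sub y)).congr_deriv ?_
    ring

/-- The trapezoidal rule overestimates the integral of a convex function. -/
lemma half_increment_le_integral (hxy : x ≤ y) (hw : ∀ s ∈ Icc x y, HasDerivAt w (w' s) s)
    (hc : ContinuousOn w' (Icc x y)) (hm : MonotoneOn w' (Icc x y)) :
    (y - x) * (w y - w x) / 2 ≤ ∫ s in x..y, (s - x) * w' s := by
  have h1 := integral_sub_right_mul hxy hw hc
  have h2 := integral_sub_left_mul hxy hw hc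
  have hi : ∀ g : ℝ → ℝ, Continuous g → IntervalIntegrable (fun s => g s * w' s) volume x y :=
    fun g hg => ContinuousOn.intervalIntegrable (by
      rw [uIcc_of_le hxy]; exact hg.continuousOn.mul hc)
  have h3 : 0 ≤ ∫ s in x..y, (s - (x + y) / 2) * (w' s - w' ((x + y) / 2)) := by
    apply intervalIntegral.integral_nonneg hxy
    intro s hs
    have hmid : (x + y) / 2 ∈ Icc x y := ⟨by linarith, by linarith⟩
    rcases le_total s ((x + y) / 2) with h | h
    · exact mul_nonneg_of_nonpos_of_nonpos (by linarith) (by linarith [hm hs hmid h])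
    · exact mul_nonneg (by linarith) (by linarith [hm hmid hs h])
  have h4 : ∫ s in x..y, (s - (x + y) / 2) * (w' s - w' ((x + y) / 2))
      = (1 / 2) * (∫ s in x..y, (s - x) * w' s) - (1 / 2) * ∫ s in x..y, (y - s) * w' s := by
    have e0 : ∫ s in x..y, (s - (x + y) / 2) = 0 := by
      rw [intervalIntegral.integral_sub (by simp) (by simp)]
      simp
      ring
    have e1 : ∀ s, (s - (x + y) / 2) * (w' s - w' ((x + y) / 2))
        = ((1 / 2) * ((s - x) * w' s) - (1 / 2) * ((y - s) * w' s))
          - (s - (x + y) / 2) * w' ((x + y) / 2) := fun s => by ring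
    simp_rw [e1]
    rw [intervalIntegral.integral_sub, intervalIntegral.integral_sub,
      intervalIntegral.integral_const_mul, intervalIntegral.integral_const_mul,
      intervalIntegral.integral_mul_const, e0]
    · ring
    · exact (hi _ (by fun_prop)).const_mul _
    · exact (hi _ (by fun_prop)).const_mul _
    · exact ((hi _ (by fun_prop)).const_mul _).sub ((hi _ (by fun_prop)).const_mul _)
    · exact Continuous.intervalIntegrable (by fun_prop) _ _
  rw [h4] at h3
  nlinarith

lemma integral_bubble_le (hxy : x ≤ y) (hc : ContinuousOn w' (Icc x y))
    (h0 : ∀ s ∈ Icc x y, 0 ≤ w' s) :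
    ∫ s in x..y, (s - x) * (y - s) * w' s ≤ (y - x) * ∫ s in x..y, (y - s) * w' s := by
  rw [← intervalIntegral.integral_const_mul]
  have hi : ∀ g : ℝ → ℝ, Continuous g → IntervalIntegrable (fun s => g s * w' s) volume x y :=
    fun g hg => ContinuousOn.intervalIntegrable (by
      rw [uIcc_of_le hxy]; exact hg.continuousOn.mul hc)
  apply intervalIntegral.integral_mono_on hxy (hi _ (by fun_prop))
    ((hi _ (by fun_prop)).const_mul _)
  intro s hs
  have := mul_nonneg (mul_nonneg (sub_nonneg.2 hs.2) (sub_nonneg.2 hs.2)) (h0 s hs)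
  nlinarith

lemma integral_bubble_nonneg (hxy : x ≤ y) (h0 : ∀ s ∈ Icc x y, 0 ≤ w' s) :
    0 ≤ ∫ s in x..y, (s - x) * (y - s) * w' s :=
  intervalIntegral.integral_nonneg hxy fun s hs =>
    mul_nonneg (mul_nonneg (sub_nonneg.2 hs.1) (sub_nonneg.2 hs.2)) (h0 s hs)

lemma integral_bubble_le_cube {B : ℝ} (hxy : x ≤ y) (hc : ContinuousOn w' (Icc x y))
    (hB : ∀ s ∈ Icc x y, w' s ≤ B) :
    ∫ s in x..y, (s - x) * (y - s) * w' s ≤ B * ((y - x) ^ 3 / 6) := by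
  have e : ∫ s in x..y, (s - x) * (y - s) = (y - x) ^ 3 / 6 := by
    have : ∀ s ∈ uIcc x y, HasDerivAt (fun s => (s - x) ^ 2 * (y - x) / 2 - (s - x) ^ 3 / 3)
        ((s - x) * (y - s)) s := by
      intro s _
      have h := (hasDerivAt_id' s).sub_const x
      refine ((((h.fun_pow 2).mul_const (y - x)).div_const 2).fun_sub
        ((h.fun_pow 3).div_const 3)).congr_deriv ?_
      norm_num
      ring
    rw [intervalIntegral.integral_eq_sub_of_hasDerivAt this
      (Continuous.intervalIntegrable (by fun_prop) _ _)]
    ring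
  rw [← e, ← intervalIntegral.integral_const_mul]
  apply intervalIntegral.integral_mono_on hxy
  · apply ContinuousOn.intervalIntegrable
    rw [uIcc_of_le hxy]
    exact ContinuousOn.mul (by fun_prop) hc
  · exact Continuous.intervalIntegrable (by fun_prop) _ _
  intro s hs
  have := mul_le_mul_of_nonneg_left (hB s hs)
    (mul_nonneg (sub_nonneg.2 hs.1) (sub_nonneg.2 hs.2))
  linarith

lemma le_integral_sub_right_mul {B : ℝ} (hxy : x ≤ y) (hc : ContinuousOn w' (Icc x y))
    (hB : ∀ s ∈ Icc x y, B ≤ w' s) :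
    B * ((y - x) ^ 2 / 2) ≤ ∫ s in x..y, (s - x) * w' s := by
  have e : ∫ s in x..y, (s - x) = (y - x) ^ 2 / 2 := by
    rw [intervalIntegral.integral_sub (by simp) (by simp)]
    simp
    ring
  rw [← e, ← intervalIntegral.integral_const_mul]
  apply intervalIntegral.integral_mono_on hxy
  · exact Continuous.intervalIntegrable (by fun_prop) _ _
  · apply ContinuousOn.intervalIntegrable
    rw [uIcc_of_le hxy]
    exact ContinuousOn.mul (by fun_prop) hc
  intro s hs
  have := mul_le_mul_of_nonneg_left (hB s hs) (sub_nonneg.2 hs.1)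
  linarith

end weight

/-! ### The kernel `ω_{1-α}` -/

lemma Gamma_two_sub {α : ℝ} (hα : α ∈ Ioo (0 : ℝ) 1) :
    Real.Gamma (2 - α) = (1 - α) * Real.Gamma (1 - α) := by
  rw [← Real.Gamma_add_one (by linarith [hα.2])]
  congr 1
  ring

lemma Gamma_one_sub_pos {α : ℝ} (hα : α ∈ Ioo (0 : ℝ) 1) : 0 < Real.Gamma (1 - α) :=
  Real.Gamma_pos_of_pos (by linarith [hα.2])

lemma Gamma_two_sub_pos {α : ℝ} (hα : α ∈ Ioo (0 : ℝ) 1) : 0 < Real.Gamma (2 - α) :=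
  Real.Gamma_pos_of_pos (by linarith [hα.2])

/-- The derivative of `s ↦ ω_{1-α}(c - s)`. -/
noncomputable def omegaDeriv (α c s : ℝ) : ℝ := α * (c - s) ^ (-α - 1) / Real.Gamma (1 - α)

lemma hasDerivAt_omega {α c s : ℝ} (hs : s < c) :
    HasDerivAt (fun s => omega (1 - α) (c - s)) (omegaDeriv α c s) s := by
  have h1 : HasDerivAt (fun s : ℝ => c - s) (-1) s := by
    simpa using (hasDerivAt_id s).const_sub c
  have h2 := (h1.rpow_const (p := 1 - α - 1) (Or.inl (by linarith))).div_const
    (Real.Gamma (1 - α))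
  refine h2.congr_deriv ?_
  unfold omegaDeriv
  rw [show -α - 1 = 1 - α - 1 - 1 by ring]
  ring

lemma continuousOn_omegaDeriv {α c x y : ℝ} (hy : y < c) :
    ContinuousOn (omegaDeriv α c) (Icc x y) := by
  unfold omegaDeriv
  refine ContinuousOn.div_const (ContinuousOn.mul continuousOn_const ?_) _
  exact ContinuousOn.rpow_const (by fun_prop) fun s hs => Or.inl (by linarith [hs.2])

lemma omegaDeriv_nonneg {α c s : ℝ} (hα : α ∈ Ioo (0 : ℝ) 1) (hs : s < c) :
    0 ≤ omegaDeriv α c s :=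
  div_nonneg (mul_nonneg hα.1.le (Real.rpow_nonneg (by linarith) _)) (Gamma_one_sub_pos hα).le

lemma omegaDeriv_mono {α c s s' : ℝ} (hα : α ∈ Ioo (0 : ℝ) 1) (hss : s ≤ s') (hs : s' < c) :
    omegaDeriv α c s ≤ omegaDeriv α c s' := by
  unfold omegaDeriv
  have := Real.rpow_le_rpow_of_nonpos (z := -α - 1) (by linarith : 0 < c - s')
    (by linarith : c - s' ≤ c - s) (by linarith [hα.1])
  have h2 := Gamma_one_sub_pos hα
  have := hα.1
  gcongr

lemma omega_nonneg {α r : ℝ} (hα : α ∈ Ioo (0 : ℝ) 1) (hr : 0 ≤ r) : 0 ≤ omega (1 - α) r :=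
  div_nonneg (Real.rpow_nonneg hr _) (Gamma_one_sub_pos hα).le

lemma omega_pos {α r : ℝ} (hα : α ∈ Ioo (0 : ℝ) 1) (hr : 0 < r) : 0 < omega (1 - α) r :=
  div_pos (Real.rpow_pos_of_pos hr _) (Gamma_one_sub_pos hα)

lemma omega_anti {α r r' : ℝ} (hα : α ∈ Ioo (0 : ℝ) 1) (hr : 0 < r) (hrr : r ≤ r') :
    omega (1 - α) r' ≤ omega (1 - α) r := by
  unfold omega
  have := Real.rpow_le_rpow_of_nonpos (z := 1 - α - 1) hr hrr (by linarith [hα.1])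
  have h2 := Gamma_one_sub_pos hα
  gcongr

lemma intervalIntegrable_omega {α : ℝ} (hα : α ∈ Ioo (0 : ℝ) 1) (c x y : ℝ) :
    IntervalIntegrable (fun s => omega (1 - α) (c - s)) volume x y := by
  unfold omega
  apply IntervalIntegrable.div_const
  have := intervalIntegral.intervalIntegrable_rpow' (a := c - x) (b := c - y) (r := 1 - α - 1)
    (by linarith [hα.2])
  simpa using this.comp_sub_left c

lemma integral_omega {α : ℝ} (hα : α ∈ Ioo (0 : ℝ) 1) (c x y : ℝ) :
    ∫ s in x..y, omega (1 - α) (c - s)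
      = ((c - x) ^ (1 - α) - (c - y) ^ (1 - α)) / Real.Gamma (2 - α) := by
  unfold omega
  rw [intervalIntegral.integral_div,
    intervalIntegral.integral_comp_sub_left (fun r => r ^ (1 - α - 1)) c,
    integral_rpow (Or.inl (by linarith [hα.2])), Gamma_two_sub hα]
  have := (Gamma_one_sub_pos hα).ne'
  have : 1 - α ≠ 0 := by linarith [hα.2]
  rw [show 1 - α - 1 + 1 = 1 - α by ring]
  field_simp

/-! ### Meshes -/

section mesh

variable {α T : ℝ} {N : ℕ} {t : ℕ → ℝ}

lemma IsMesh.tau_pos (hm : IsMesh T N t) {k : ℕ} (h1 : 1 ≤ k) (hN : k ≤ N) : 0 < tau t k := by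
  have := hm.2.2.2 (k - 1) (by omega)
  rw [Nat.sub_add_cancel h1] at this
  exact sub_pos.2 this

lemma IsMesh.mono (hm : IsMesh T N t) {i j : ℕ} (hij : i ≤ j) (hj : j ≤ N) : t i ≤ t j := by
  induction j, hij using Nat.le_induction with
  | base => exact le_rfl
  | succ j _ ih => exact (ih (by omega)).trans (hm.2.2.2 j (by omega)).le

lemma IsMesh.nonneg (hm : IsMesh T N t) {j : ℕ} (hj : j ≤ N) : 0 ≤ t j := by
  have := hm.mono (Nat.zero_le j) hj
  rwa [hm.2.1] at this

lemma IsMesh.pos (hm : IsMesh T N t) {j : ℕ} (h1 : 1 ≤ j) (hj : j ≤ N) : 0 < t j := by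
  have h := hm.2.2.2 0 (by omega)
  rw [hm.2.1] at h
  exact h.trans_le (hm.mono h1 hj)

lemma IsMesh.le_T (hm : IsMesh T N t) {j : ℕ} (hj : j ≤ N) : t j ≤ T := by
  have := hm.mono hj le_rfl
  rwa [hm.2.2.1] at this

lemma tau_succ (k : ℕ) : tau t (k + 1) = t (k + 1) - t k := by simp [tau]

lemma IsMesh.tau_le (hm : IsMesh T N t) {k : ℕ} (hN : k ≤ N) : tau t k ≤ t k := by
  have := hm.nonneg (j := k - 1) (by omega)
  simp only [tau]
  linarith

lemma IsMesh.tau_one (hm : IsMesh T N t) : tau t 1 = t 1 := by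
  simp [tau, hm.2.1]

lemma RatioBound.tau_le (hr : RatioBound N t) (hm : IsMesh T N t) {k : ℕ} (h1 : 1 ≤ k)
    (hN : k + 1 ≤ N) : tau t k ≤ 7 / 4 * tau t (k + 1) := by
  have := hr k h1 hN
  rwa [ratio, div_le_iff₀ (hm.tau_pos (by omega) hN)] at this

lemma tOff_eq (n : ℕ) : tOff α t n = t (n - 1) + (1 - theta α) * tau t n := by
  unfold tOff tau; ring

lemma lt_tOff (hα : α ∈ Ioo (0 : ℝ) 1) (hm : IsMesh T N t) {n : ℕ} (h1 : 1 ≤ n) (hN : n ≤ N) :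
    t (n - 1) + tau t n / 2 < tOff α t n := by
  rw [tOff_eq]
  have := hm.tau_pos h1 hN
  have : theta α < 1 / 2 := by unfold theta; linarith [hα.2]
  nlinarith

lemma tOff_lt (hα : α ∈ Ioo (0 : ℝ) 1) (hm : IsMesh T N t) {n : ℕ} (h1 : 1 ≤ n) (hN : n ≤ N) :
    tOff α t n < t n := by
  have h2 := hm.tau_pos h1 hN
  have : 0 < theta α := by unfold theta; linarith [hα.1]
  have e : tOff α t n = t n - theta α * tau t n := by unfold tOff tau; ring
  rw [e]
  nlinarith

lemma lt_tOff_of_lt (hα : α ∈ Ioo (0 : ℝ) 1) (hm : IsMesh T N t) {k n : ℕ} (h1 : k < n)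
    (hN : n ≤ N) : t k < tOff α t n := by
  have h := lt_tOff hα hm (by omega : 1 ≤ n) hN
  have h2 := hm.mono (by omega : k ≤ n - 1) (by omega)
  have h3 := hm.tau_pos (by omega : 1 ≤ n) hN
  linarith

end mesh

/-! ### The coefficients of the Alikhanov formula -/

section kernel

variable {α T : ℝ} {N : ℕ} {t : ℕ → ℝ}

/-- The weight `s ↦ ω_{1-α}(t_{n-θ} - s)` of the formula at the offset point `t_{n-θ}`. -/
noncomputable def wt (α : ℝ) (t : ℕ → ℝ) (n : ℕ) (s : ℝ) : ℝ := omega (1 - α) (tOff α t n - s)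

lemma wt_nonneg (hα : α ∈ Ioo (0 : ℝ) 1) {n : ℕ} {s : ℝ} (hs : s ≤ tOff α t n) :
    0 ≤ wt α t n s := omega_nonneg hα (by linarith)

lemma wt_mono (hα : α ∈ Ioo (0 : ℝ) 1) {n : ℕ} {s s' : ℝ} (hss : s ≤ s') (hs : s' < tOff α t n) :
    wt α t n s ≤ wt α t n s' := omega_anti hα (by linarith) (by linarith)

lemma coefA_of_lt {n k : ℕ} (hk : k < n) :
    coefA α t n k = (∫ s in t (k - 1)..t k, wt α t n s) / tau t k := by
  rw [coefA, if_neg hk.ne]; rfl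

lemma coefB_eq (hα : α ∈ Ioo (0 : ℝ) 1) (hm : IsMesh T N t) {n k : ℕ} (h1 : 1 ≤ k) (hk : k < n)
    (hN : n ≤ N) :
    coefB α t n k = (∫ s in t (k - 1)..t k, (s - t (k - 1)) * (t k - s)
      * omegaDeriv α (tOff α t n) s) / (tau t k * (tau t k + tau t (k + 1))) := by
  have h := lt_tOff_of_lt hα hm hk hN
  rw [integral_bubble_mul (w := wt α t n) (hm.mono (by omega) (by omega))
    (fun s hs => hasDerivAt_omega (hs.2.trans_lt h)) (continuousOn_omegaDeriv h), coefB]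
  simp only [wt]
  ring

lemma coefB_nonneg (hα : α ∈ Ioo (0 : ℝ) 1) (hm : IsMesh T N t) {n k : ℕ} (h1 : 1 ≤ k)
    (hk : k < n) (hN : n ≤ N) : 0 ≤ coefB α t n k := by
  have h := lt_tOff_of_lt hα hm hk hN
  rw [coefB_eq hα hm h1 hk hN]
  have h2 := hm.tau_pos h1 (by omega)
  have h3 := hm.tau_pos (by omega : 1 ≤ k + 1) (by omega)
  exact div_nonneg (integral_bubble_nonneg (hm.mono (by omega) (by omega))
    fun s hs => omegaDeriv_nonneg hα (hs.2.trans_lt h)) (by positivity)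

lemma coefB_le_coefA_sub (hα : α ∈ Ioo (0 : ℝ) 1) (hm : IsMesh T N t) {n k : ℕ} (h1 : 1 ≤ k)
    (hk : k < n) (hN : n ≤ N) : coefB α t n k ≤ coefA α t n k - wt α t n (t (k - 1)) := by
  have h := lt_tOff_of_lt hα hm hk hN
  have hle := hm.mono (by omega : k - 1 ≤ k) (by omega)
  have h2 := hm.tau_pos h1 (by omega)
  have h3 := hm.tau_pos (by omega : 1 ≤ k + 1) (by omega)
  have e1 := integral_sub_left_mul (w := wt α t n) hle
    (fun s hs => hasDerivAt_omega (hs.2.trans_lt h)) (continuousOn_omegaDeriv h)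
  have e2 := integral_bubble_le hle (continuousOn_omegaDeriv h)
    (fun s hs => omegaDeriv_nonneg hα (hs.2.trans_lt h))
  have e3 : 0 ≤ ∫ s in t (k - 1)..t k, (t k - s) * omegaDeriv α (tOff α t n) s :=
    intervalIntegral.integral_nonneg hle fun s hs =>
      mul_nonneg (sub_nonneg.2 hs.2) (omegaDeriv_nonneg hα (hs.2.trans_lt h))
  have e4 : coefA α t n k - wt α t n (t (k - 1))
      = (∫ s in t (k - 1)..t k, (t k - s) * omegaDeriv α (tOff α t n) s) / tau t k := by
    rw [e1, coefA_of_lt hk]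
    change _ = (_ - tau t k * _) / _
    field_simp
  rw [e4, coefB_eq hα hm h1 hk hN, div_le_div_iff₀ (by positivity) h2]
  change _ ≤ tau t k * _ at e2
  nlinarith [mul_nonneg e3 h3.le, mul_nonneg e3 h2.le, mul_nonneg (mul_nonneg e3 h3.le) h2.le]

lemma wt_sub_coefA (hα : α ∈ Ioo (0 : ℝ) 1) (hm : IsMesh T N t) {n k : ℕ} (h1 : 1 ≤ k)
    (hk : k < n) (hN : n ≤ N) : wt α t n (t k) - coefA α t n k
      = (∫ s in t (k - 1)..t k, (s - t (k - 1)) * omegaDeriv α (tOff α t n) s) / tau t k := by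
  have h := lt_tOff_of_lt hα hm hk hN
  have h2 := hm.tau_pos h1 (by omega)
  rw [integral_sub_right_mul (w := wt α t n) (hm.mono (by omega : k - 1 ≤ k) (by omega))
    (fun s hs => hasDerivAt_omega (hs.2.trans_lt h)) (continuousOn_omegaDeriv h), coefA_of_lt hk]
  change _ = (tau t k * _ - _) / _
  field_simp

lemma half_increment_le_wt_sub_coefA (hα : α ∈ Ioo (0 : ℝ) 1) (hm : IsMesh T N t) {n k : ℕ}
    (h1 : 1 ≤ k) (hk : k < n) (hN : n ≤ N) :
    (wt α t n (t k) - wt α t n (t (k - 1))) / 2 ≤ wt α t n (t k) - coefA α t n k := by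
  have h := lt_tOff_of_lt hα hm hk hN
  have h2 := hm.tau_pos h1 (by omega)
  rw [wt_sub_coefA hα hm h1 hk hN, le_div_iff₀ h2]
  have := half_increment_le_integral (w := wt α t n) (hm.mono (by omega : k - 1 ≤ k) (by omega))
    (fun s hs => hasDerivAt_omega (hs.2.trans_lt h)) (continuousOn_omegaDeriv h)
    (fun s _ s' hs' hss => omegaDeriv_mono hα hss (hs'.2.trans_lt h))
  change tau t k * _ / 2 ≤ _ at this
  linarith

lemma wt_sub_coefA_nonneg (hα : α ∈ Ioo (0 : ℝ) 1) (hm : IsMesh T N t) {n k : ℕ}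
    (h1 : 1 ≤ k) (hk : k < n) (hN : n ≤ N) : 0 ≤ wt α t n (t k) - coefA α t n k := by
  have h := half_increment_le_wt_sub_coefA hα hm h1 hk hN
  have := wt_mono hα (hm.mono (by omega : k - 1 ≤ k) (by omega)) (lt_tOff_of_lt hα hm hk hN)
  linarith

/-- The quadratic correction from the interval to the left is at most two thirds of
`ω(t_{k+1}) - a`; this is where the bound `7/4` for the step ratios enters. -/
lemma ratio_mul_coefB_le (hα : α ∈ Ioo (0 : ℝ) 1) (hm : IsMesh T N t) (hr : RatioBound N t)
    {n k : ℕ} (h1 : 1 ≤ k) (hk : k + 1 < n) (hN : n ≤ N) :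
    ratio t k * coefB α t n k ≤ 2 / 3 * (wt α t n (t (k + 1)) - coefA α t n (k + 1)) := by
  have h := lt_tOff_of_lt hα hm hk hN
  have h' := lt_tOff_of_lt hα hm (by omega : k < n) hN
  have h2 := hm.tau_pos h1 (by omega)
  have h3 := hm.tau_pos (by omega : 1 ≤ k + 1) (by omega)
  set B := omegaDeriv α (tOff α t n) (t k) with hB
  have hB0 : 0 ≤ B := omegaDeriv_nonneg hα h'
  have e1 := integral_bubble_le_cube (B := B) (hm.mono (by omega : k - 1 ≤ k) (by omega))
    (continuousOn_omegaDeriv (α := α) h') (fun s hs => omegaDeriv_mono hα hs.2 h')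
  have e2 := le_integral_sub_right_mul (B := B) (hm.mono (by omega : k ≤ k + 1) (by omega))
    (continuousOn_omegaDeriv (α := α) h)
    (fun s hs => omegaDeriv_mono hα hs.1 (hs.2.trans_lt h))
  rw [wt_sub_coefA hα hm (by omega) hk hN, coefB_eq hα hm h1 (by omega) hN, ratio,
    Nat.add_sub_cancel, div_mul_div_comm, ← mul_div_assoc,
    div_le_div_iff₀ (by positivity) h3]
  rw [← tau_succ] at e2
  change _ ≤ B * (tau t k ^ 3 / 6) at e1
  have hρ := hr.tau_le hm h1 (by omega)
  set p := tau t k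
  set q := tau t (k + 1)
  -- with `ρ = p / q ≤ 7/4` the claim is `ρ³ ≤ 2 (1 + ρ)`
  have key : p ^ 3 ≤ 2 * (q ^ 2 * (p + q)) := by
    have : p * p ≤ 49 / 16 * (q * q) := by nlinarith
    nlinarith [mul_pos h3 h3, mul_pos h2 h3]
  calc p * (∫ s in t (k - 1)..t k, (s - t (k - 1)) * (t k - s) * omegaDeriv α (tOff α t n) s) * q
      ≤ p * (B * (p ^ 3 / 6)) * q := by gcongr
    _ ≤ p * (B * (2 * (q ^ 2 * (p + q)) / 6)) * q := by gcongr
    _ = 2 / 3 * (B * (q ^ 2 / 2)) * (q * (p * (p + q))) := by ring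
    _ ≤ _ := by gcongr

lemma one_sub_theta_pos (hα : α ∈ Ioo (0 : ℝ) 1) : 0 < 1 - theta α := by
  unfold theta; linarith [hα.2]

lemma wt_last (n : ℕ) : wt α t n (t (n - 1))
    = ((1 - theta α) * tau t n) ^ (-α) / Real.Gamma (1 - α) := by
  rw [wt, omega, tOff_eq]
  congr 2 <;> ring

lemma coefA_self (hα : α ∈ Ioo (0 : ℝ) 1) (n : ℕ) :
    coefA α t n n = ((1 - theta α) * tau t n) ^ (1 - α) / (tau t n * Real.Gamma (2 - α)) := by
  rw [coefA, if_pos rfl, integral_omega hα, sub_self, Real.zero_rpow (by linarith [hα.2]),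
    sub_zero]
  rw [show tOff α t n - t (n - 1) = (1 - theta α) * tau t n by rw [tOff_eq]; ring]
  rw [div_div, mul_comm (Real.Gamma _)]

lemma coefA_self_eq_wt (hα : α ∈ Ioo (0 : ℝ) 1) (hm : IsMesh T N t) {n : ℕ} (h1 : 1 ≤ n)
    (hN : n ≤ N) : (1 - α) * coefA α t n n = (1 - theta α) * wt α t n (t (n - 1)) := by
  have h2 := hm.tau_pos h1 hN
  have h3 := one_sub_theta_pos hα
  have h4 := Gamma_one_sub_pos hα
  have h5 : 1 - α ≠ 0 := by linarith [hα.2]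
  rw [coefA_self hα, wt_last, Gamma_two_sub hα, sub_eq_add_neg 1 α,
    Real.rpow_add (by positivity), Real.rpow_one, ← sub_eq_add_neg]
  field_simp

lemma wt_le_coefA_self (hα : α ∈ Ioo (0 : ℝ) 1) (hm : IsMesh T N t) {n : ℕ} (h1 : 1 ≤ n)
    (hN : n ≤ N) : wt α t n (t (n - 1)) ≤ coefA α t n n := by
  have h := coefA_self_eq_wt hα hm h1 hN
  have h0 : 0 ≤ wt α t n (t (n - 1)) :=
    wt_nonneg hα (lt_tOff_of_lt hα hm (by omega : n - 1 < n) hN).le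
  have h5 : 0 < 1 - α := by linarith [hα.2]
  have h6 : 1 - α ≤ 1 - theta α := by unfold theta; linarith [hα.1]
  nlinarith

lemma kernelA_of_lt {n k : ℕ} (hk : k < n) : kernelA α t n k =
    coefA α t n k + (if 2 ≤ k then ratio t (k - 1) * coefB α t n (k - 1) else 0)
      - coefB α t n k := by
  rw [kernelA, if_pos hk]

lemma kernelA_self (n : ℕ) : kernelA α t n n =
    coefA α t n n + (if 2 ≤ n then ratio t (n - 1) * coefB α t n (n - 1) else 0) := by
  simp [kernelA]

lemma ratio_pos (hm : IsMesh T N t) {k : ℕ} (h1 : 1 ≤ k) (hk : k < N) : 0 < ratio t k :=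
  div_pos (hm.tau_pos h1 (by omega)) (hm.tau_pos (by omega) hk)

/-- The increments of the kernel dominate the increments of the weight. -/
lemma wt_increment_le_kernelA (hα : α ∈ Ioo (0 : ℝ) 1) (hm : IsMesh T N t) (hr : RatioBound N t)
    {n k : ℕ} (h1 : 1 ≤ k) (hk : k < n) (hN : n ≤ N) :
    (wt α t n (t k) - wt α t n (t (k - 1))) / 6 ≤ kernelA α t n (k + 1) - kernelA α t n k := by
  have e1 : (if 2 ≤ k then ratio t (k - 1) * coefB α t n (k - 1) else 0)
      ≤ 2 / 3 * (wt α t n (t k) - coefA α t n k) := by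
    split_ifs with h
    · have := ratio_mul_coefB_le hα hm hr (by omega : 1 ≤ k - 1) (by omega) hN
      rwa [Nat.sub_add_cancel h1] at this
    · have := wt_sub_coefA_nonneg hα hm h1 hk hN
      positivity
  have e2 : wt α t n (t k) ≤ coefA α t n (k + 1) - (if k + 1 < n then coefB α t n (k + 1) else 0) := by
    split_ifs with h
    · have := coefB_le_coefA_sub hα hm (by omega : 1 ≤ k + 1) h hN
      rw [Nat.add_sub_cancel] at this
      linarith
    · obtain rfl : n = k + 1 := by omega
      simpa using wt_le_coefA_self hα hm (by omega) hN
  have e3 := half_increment_le_wt_sub_coefA hα hm h1 hk hN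
  have e4 := mul_nonneg (ratio_pos hm h1 (by omega)).le (coefB_nonneg hα hm h1 hk hN)
  have e5 := coefB_nonneg hα hm h1 hk hN
  rw [kernelA_of_lt hk]
  unfold kernelA
  rw [if_pos (by omega : 2 ≤ k + 1), Nat.add_sub_cancel]
  linarith

lemma kernelA_mono (hα : α ∈ Ioo (0 : ℝ) 1) (hm : IsMesh T N t) (hr : RatioBound N t)
    {n k : ℕ} (h1 : 1 ≤ k) (hk : k < n) (hN : n ≤ N) :
    kernelA α t n k ≤ kernelA α t n (k + 1) := by
  have h := wt_increment_le_kernelA hα hm hr h1 hk hN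
  have := wt_mono hα (hm.mono (by omega : k - 1 ≤ k) (by omega)) (lt_tOff_of_lt hα hm hk hN)
  linarith

/-- The relation between the two leading coefficients that makes the offset `θ = α/2` stable. -/
lemma kernelA_offset (hα : α ∈ Ioo (0 : ℝ) 1) (hm : IsMesh T N t) (hr : RatioBound N t)
    {n k : ℕ} (h1 : 1 ≤ k) (hk : k + 1 = n) (hN : n ≤ N) :
    (1 - theta α) * kernelA α t n k ≤ (1 - α) * kernelA α t n n := by
  subst hk
  have e1 : (if 2 ≤ k then ratio t (k - 1) * coefB α t (k + 1) (k - 1) else 0)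
      ≤ 2 / 3 * (wt α t (k + 1) (t k) - coefA α t (k + 1) k) := by
    split_ifs with h
    · have := ratio_mul_coefB_le hα hm hr (by omega : 1 ≤ k - 1) (by omega) hN
      rwa [Nat.sub_add_cancel h1] at this
    · have := wt_sub_coefA_nonneg hα hm h1 (by omega) hN
      positivity
  have e2 := wt_sub_coefA_nonneg hα hm h1 (Nat.lt_succ_self k) hN
  have e3 := coefA_self_eq_wt hα hm (by omega : 1 ≤ k + 1) hN
  have e5 := coefB_nonneg hα hm h1 (Nat.lt_succ_self k) hN
  have e4 := mul_nonneg (ratio_pos hm h1 (by omega)).le e5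
  rw [kernelA_of_lt (by omega), kernelA_self, if_pos (by omega : 2 ≤ k + 1)]
  simp only [Nat.add_sub_cancel, Nat.succ_eq_add_one] at *
  have h6 := one_sub_theta_pos hα
  have h7 : 0 < 1 - α := by linarith [hα.2]
  rw [mul_add, e3]
  have : (1 - theta α) * (coefA α t (k + 1) k
      + (if 2 ≤ k then ratio t (k - 1) * coefB α t (k + 1) (k - 1) else 0) - coefB α t (k + 1) k)
      ≤ (1 - theta α) * wt α t (k + 1) (t k) := by
    apply mul_le_mul_of_nonneg_left _ h6.le
    linarith
  have := mul_nonneg h7.le e4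
  linarith

lemma coefB_le_mul_coefA (hα : α ∈ Ioo (0 : ℝ) 1) (hm : IsMesh T N t) (hr : RatioBound N t)
    {n k : ℕ} (h1 : 1 ≤ k) (hk : k < n) (hN : n ≤ N) :
    coefB α t n k ≤ 7 / 11 * coefA α t n k := by
  have h := lt_tOff_of_lt hα hm hk hN
  have hle := hm.mono (by omega : k - 1 ≤ k) (by omega)
  have h2 := hm.tau_pos h1 (by omega)
  have h3 := hm.tau_pos (by omega : 1 ≤ k + 1) (by omega)
  have hρ := hr.tau_le hm h1 (by omega)
  have hint := intervalIntegrable_omega hα (tOff α t n) (t (k - 1)) (t k)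
  have e1 : ∫ s in t (k - 1)..t k, (s - (t (k - 1) + t k) / 2) * omega (1 - α) (tOff α t n - s)
      ≤ tau t k / 2 * ∫ s in t (k - 1)..t k, omega (1 - α) (tOff α t n - s) := by
    rw [← intervalIntegral.integral_const_mul]
    apply intervalIntegral.integral_mono_on hle (hint.continuousOn_mul (by fun_prop))
      (hint.const_mul _)
    intro s hs
    apply mul_le_mul_of_nonneg_right _ (omega_nonneg hα (by linarith [hs.2]))
    unfold tau
    linarith [hs.2]
  have e0 : 0 ≤ ∫ s in t (k - 1)..t k, omega (1 - α) (tOff α t n - s) :=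
    intervalIntegral.integral_nonneg hle fun s hs => omega_nonneg hα (by linarith [hs.2])
  rw [coefA_of_lt hk, coefB]
  unfold wt
  set J := ∫ s in t (k - 1)..t k, omega (1 - α) (tOff α t n - s)
  set p := tau t k
  set q := tau t (k + 1)
  calc _ ≤ 2 / (p * (p + q)) * (p / 2 * J) := by gcongr
    _ = p / (p + q) * (J / p) := by field_simp
    _ ≤ 7 / 11 * (J / p) := by
      apply mul_le_mul_of_nonneg_right _ (by positivity)
      rw [div_le_div_iff₀ (by positivity) (by positivity)]
      linarith

lemma rpow_one_sub_theta_ge (hα : α ∈ Ioo (0 : ℝ) 1) : 1 / 2 ≤ (1 - theta α) ^ (1 - α) := by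
  have h1 : 1 / 2 ≤ 1 - theta α := by unfold theta; linarith [hα.2]
  calc (1 : ℝ) / 2 ≤ (1 - theta α) ^ (1 : ℝ) := by rwa [Real.rpow_one]
    _ ≤ _ := Real.rpow_le_rpow_of_exponent_ge (by linarith) (by unfold theta; linarith [hα.1])
      (by linarith [hα.1])

lemma coefA_self_ge (hα : α ∈ Ioo (0 : ℝ) 1) (hm : IsMesh T N t) {n : ℕ} (h1 : 1 ≤ n)
    (hN : n ≤ N) : 1 / 2 * (tau t n ^ (-α) / Real.Gamma (2 - α)) ≤ coefA α t n n := by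
  have h2 := hm.tau_pos h1 hN
  have h3 := one_sub_theta_pos hα
  have h4 := Gamma_two_sub_pos hα
  have e : coefA α t n n = (1 - theta α) ^ (1 - α) * (tau t n ^ (-α) / Real.Gamma (2 - α)) := by
    rw [coefA_self hα, Real.mul_rpow h3.le h2.le, sub_eq_add_neg 1 α, Real.rpow_add h2,
      Real.rpow_one, ← sub_eq_add_neg]
    field_simp
  rw [e]
  exact mul_le_mul_of_nonneg_right (rpow_one_sub_theta_ge hα) (by positivity)

lemma coefA_self_le (hα : α ∈ Ioo (0 : ℝ) 1) (hm : IsMesh T N t) {n : ℕ} (h1 : 1 ≤ n)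
    (hN : n ≤ N) : coefA α t n n ≤ tau t n ^ (-α) / Real.Gamma (2 - α) := by
  have h2 := hm.tau_pos h1 hN
  have h3 := one_sub_theta_pos hα
  have h4 := Gamma_two_sub_pos hα
  have e : coefA α t n n = (1 - theta α) ^ (1 - α) * (tau t n ^ (-α) / Real.Gamma (2 - α)) := by
    rw [coefA_self hα, Real.mul_rpow h3.le h2.le, sub_eq_add_neg 1 α, Real.rpow_add h2,
      Real.rpow_one, ← sub_eq_add_neg]
    field_simp
  rw [e]
  refine mul_le_of_le_one_left (by positivity) (Real.rpow_le_one h3.le ?_ (by linarith [hα.2]))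
  unfold theta; linarith [hα.1]

/-- The kernel is bounded below by a multiple of the means of `ω_{1-α}(t_n - s)`. -/
lemma kernelA_ge (hα : α ∈ Ioo (0 : ℝ) 1) (hm : IsMesh T N t) (hr : RatioBound N t)
    {n k : ℕ} (h1 : 1 ≤ k) (hk : k ≤ n) (hN : n ≤ N) :
    4 / 11 * ∫ s in t (k - 1)..t k, omega (1 - α) (t n - s) ≤ kernelA α t n k * tau t k := by
  have h2 := hm.tau_pos h1 (by omega)
  have hle := hm.mono (by omega : k - 1 ≤ k) (by omega)
  rcases hk.lt_or_eq with hk | rfl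
  · have h := lt_tOff_of_lt hα hm hk hN
    have hb := coefB_le_mul_coefA hα hm hr h1 hk hN
    have h0 : 0 ≤ (if 2 ≤ k then ratio t (k - 1) * coefB α t n (k - 1) else 0) := by
      split_ifs with h
      · exact mul_nonneg (ratio_pos hm (by omega) (by omega)).le
          (coefB_nonneg hα hm (by omega) (by omega) hN)
      · exact le_rfl
    have h3 : ∫ s in t (k - 1)..t k, omega (1 - α) (t n - s) ≤ coefA α t n k * tau t k := by
      rw [coefA_of_lt hk, div_mul_cancel₀ _ h2.ne']
      apply intervalIntegral.integral_mono_on hle (intervalIntegrable_omega hα _ _ _)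
        (intervalIntegrable_omega hα _ _ _)
      intro s hs
      exact omega_anti hα (by linarith [hs.2])
        (by linarith [tOff_lt hα hm (by omega : 1 ≤ n) hN])
    rw [kernelA_of_lt hk]
    have : 4 / 11 * coefA α t n k * tau t k ≤ (coefA α t n k
      + (if 2 ≤ k then ratio t (k - 1) * coefB α t n (k - 1) else 0) - coefB α t n k) * tau t k :=
      mul_le_mul_of_nonneg_right (by linarith) h2.le
    linarith
  · have h0 : 0 ≤ (if 2 ≤ k then ratio t (k - 1) * coefB α t k (k - 1) else 0) := by
      split_ifs with h
      · exact mul_nonneg (ratio_pos hm (by omega) (by omega)).le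
          (coefB_nonneg hα hm (by omega) (by omega) hN)
      · exact le_rfl
    have h4 := Gamma_two_sub_pos hα
    have h3 := coefA_self_ge hα hm h1 hN
    have e : ∫ s in t (k - 1)..t k, omega (1 - α) (t k - s)
        = tau t k ^ (-α) / Real.Gamma (2 - α) * tau t k := by
      rw [integral_omega hα, sub_self, Real.zero_rpow (by linarith [hα.2]), sub_zero]
      change tau t k ^ (1 - α) / _ = _
      rw [sub_eq_add_neg 1 α, Real.rpow_add h2, Real.rpow_one]
      ring
    rw [kernelA_self, e, ← mul_assoc]
    apply mul_le_mul_of_nonneg_right _ h2.le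
    have : 0 ≤ tau t k ^ (-α) / Real.Gamma (2 - α) := by positivity
    linarith

lemma kernelA_ge_omega (hα : α ∈ Ioo (0 : ℝ) 1) (hm : IsMesh T N t) (hr : RatioBound N t)
    {n k : ℕ} (h1 : 1 ≤ k) (hk : k ≤ n) (hN : n ≤ N) :
    4 / 11 * omega (1 - α) (t n - t (k - 1)) ≤ kernelA α t n k := by
  have h2 := hm.tau_pos h1 (by omega)
  have hle := hm.mono (by omega : k - 1 ≤ k) (by omega)
  have h := kernelA_ge hα hm hr h1 hk hN
  have hkn := hm.mono hk hN
  have h3 : tau t k * omega (1 - α) (t n - t (k - 1))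
      ≤ ∫ s in t (k - 1)..t k, omega (1 - α) (t n - s) := by
    have e : ∫ s in t (k - 1)..t k, omega (1 - α) (t n - t (k - 1))
        = tau t k * omega (1 - α) (t n - t (k - 1)) := by
      rw [intervalIntegral.integral_const]; rfl
    rw [← e]
    apply intervalIntegral.integral_mono_on_of_le_Ioo hle (by simp)
      (intervalIntegrable_omega hα _ _ _)
    intro s hs
    exact omega_anti hα (by linarith [hs.2]) (by linarith [hs.1])
  have h4 : 4 / 11 * omega (1 - α) (t n - t (k - 1)) * tau t k ≤ kernelA α t n k * tau t k := by
    linarith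
  exact le_of_mul_le_mul_right h4 h2

lemma kernelA_pos (hα : α ∈ Ioo (0 : ℝ) 1) (hm : IsMesh T N t) (hr : RatioBound N t)
    {n k : ℕ} (h1 : 1 ≤ k) (hk : k ≤ n) (hN : n ≤ N) : 0 < kernelA α t n k := by
  refine lt_of_lt_of_le ?_ (kernelA_ge_omega hα hm hr h1 hk hN)
  have h2 := hm.tau_pos h1 (by omega)
  have hkn := hm.mono hk hN
  have := omega_pos hα (r := t n - t (k - 1)) (by unfold tau at h2; linarith)
  positivity

lemma kernelA_self_ge (hα : α ∈ Ioo (0 : ℝ) 1) (hm : IsMesh T N t)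
    {n : ℕ} (h1 : 1 ≤ n) (hN : n ≤ N) :
    1 / 2 * (tau t n ^ (-α) / Real.Gamma (2 - α)) ≤ kernelA α t n n := by
  have h0 : 0 ≤ (if 2 ≤ n then ratio t (n - 1) * coefB α t n (n - 1) else 0) := by
    split_ifs with h
    · exact mul_nonneg (ratio_pos hm (by omega) (by omega)).le
        (coefB_nonneg hα hm (by omega) (by omega) hN)
    · exact le_rfl
  rw [kernelA_self]
  linarith [coefA_self_ge hα hm h1 hN]

lemma wt_last_le (hα : α ∈ Ioo (0 : ℝ) 1) (hm : IsMesh T N t) {n : ℕ} (h1 : 1 ≤ n)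
    (hN : n ≤ N) : wt α t n (t (n - 1)) ≤ tau t n ^ (-α) / Real.Gamma (2 - α) :=
  (wt_le_coefA_self hα hm h1 hN).trans (coefA_self_le hα hm h1 hN)

lemma kernelA_self_le (hα : α ∈ Ioo (0 : ℝ) 1) (hm : IsMesh T N t) (hr : RatioBound N t)
    {n : ℕ} (h1 : 1 ≤ n) (hN : n ≤ N) :
    kernelA α t n n ≤ 3 * (tau t n ^ (-α) / Real.Gamma (2 - α)) := by
  have h3 := coefA_self_le hα hm h1 hN
  have h4 := wt_last_le hα hm h1 hN
  rw [kernelA_self]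
  split_ifs with h
  · have h5 := coefB_le_mul_coefA hα hm hr (by omega : 1 ≤ n - 1) (by omega : n - 1 < n) hN
    have h6 := wt_sub_coefA_nonneg hα hm (by omega : 1 ≤ n - 1) (by omega : n - 1 < n) hN
    have h7 := hr (n - 1) (by omega) (by omega)
    have h8 := coefB_nonneg hα hm (by omega : 1 ≤ n - 1) (by omega : n - 1 < n) hN
    have : ratio t (n - 1) * coefB α t n (n - 1) ≤ 7 / 4 * coefB α t n (n - 1) := by gcongr
    linarith
  · have := hm.tau_pos h1 hN
    have := Gamma_two_sub_pos hα
    have : 0 ≤ tau t n ^ (-α) / Real.Gamma (2 - α) := by positivity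
    linarith

end kernel

/-! ### Complementary kernels and stability in time -/

/-- The weights `p 1, …, p n` are complementary to the lower triangular kernel `A` at level `n`:
they invert the discrete convolution in the sense that `∑_{j=k}^n p_j A_{j,k} = 1`. -/
def IsComplementary (A : ℕ → ℕ → ℝ) (n : ℕ) (p : ℕ → ℝ) : Prop :=
  (∀ j, 0 ≤ p j) ∧ ∀ k, 1 ≤ k → k ≤ n → ∑ j ∈ Finset.Icc k n, p j * A j k = 1

/-- Complementary weights exist and are nonnegative if each row of the kernel decreases away from the
diagonal: they are found by downward recursion, where `p_k A_{k,k} = 1 - ∑_{j>k} p_j A_{j,k}`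
is nonnegative because of `∑_{j>k} p_j A_{j,k} ≤ ∑_{j>k} p_j A_{j,k+1} = 1`. -/
lemma exists_isComplementary {A : ℕ → ℕ → ℝ} {n : ℕ} (hpos : ∀ j, 1 ≤ j → j ≤ n → 0 < A j j)
    (hmono : ∀ k j, 1 ≤ k → k < j → j ≤ n → A j k ≤ A j (k + 1)) :
    ∃ p, IsComplementary A n p := by
  have key : ∀ i ≤ n, ∃ p : ℕ → ℝ, (∀ j, 0 ≤ p j) ∧
      ∀ k, n - i < k → k ≤ n → ∑ j ∈ Finset.Icc k n, p j * A j k = 1 := by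
    intro i
    induction i with
    | zero => exact fun _ => ⟨0, by simp, fun k h1 h2 => by omega⟩
    | succ i ih =>
      intro hi
      obtain ⟨p, hp0, hp⟩ := ih (by omega)
      set k0 := n - i with hk0
      have hA := hpos k0 (by omega) (by omega)
      have hle : ∑ j ∈ Finset.Icc (k0 + 1) n, p j * A j k0 ≤ 1 := by
        by_cases h : k0 < n
        · rw [← hp (k0 + 1) (by omega) (by omega)]
          refine Finset.sum_le_sum fun j hj => ?_
          rw [Finset.mem_Icc] at hj
          exact mul_le_mul_of_nonneg_left (hmono k0 j (by omega) (by omega) hj.2) (hp0 j)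
        · rw [Finset.Icc_eq_empty (by omega)]
          simp
      have hsum : ∀ (x : ℝ) (k l : ℕ), k0 < k → ∑ j ∈ Finset.Icc k n,
          Function.update p k0 x j * A j l = ∑ j ∈ Finset.Icc k n, p j * A j l := by
        intro x k l hk
        refine Finset.sum_congr rfl fun j hj => ?_
        rw [Finset.mem_Icc] at hj
        rw [Function.update_of_ne (by omega)]
      refine ⟨Function.update p k0 ((1 - ∑ j ∈ Finset.Icc (k0 + 1) n, p j * A j k0) / A k0 k0),
        fun j => ?_, fun k h1 h2 => ?_⟩
      · by_cases h : j = k0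
        · subst h
          rw [Function.update_self]
          exact div_nonneg (by linarith) hA.le
        · rw [Function.update_of_ne h]
          exact hp0 j
      · rcases eq_or_ne k k0 with rfl | hne
        · rw [← Finset.insert_Icc_succ_left_eq_Icc h2, Finset.sum_insert (by simp),
            Function.update_self]
          change _ + ∑ j ∈ Finset.Icc (n - i + 1) n, _ = _
          rw [hsum _ _ _ (by omega), div_mul_cancel₀ _ hA.ne']
          ring
        · rw [hsum _ _ _ (by omega)]
          exact hp k (by omega) h2
  obtain ⟨p, hp0, hp⟩ := key n le_rfl
  exact ⟨p, hp0, fun k h1 h2 => hp k (by omega) h2⟩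

namespace IsComplementary

variable {A : ℕ → ℕ → ℝ} {n : ℕ} {p : ℕ → ℝ}

lemma sum_swap (f : ℕ → ℕ → ℝ) :
    ∑ j ∈ Finset.Icc 1 n, ∑ k ∈ Finset.Icc 1 j, f j k
      = ∑ k ∈ Finset.Icc 1 n, ∑ j ∈ Finset.Icc k n, f j k := by
  apply Finset.sum_comm'
  intro x y
  simp only [Finset.mem_Icc]
  omega

lemma sum_mul_convolution (hp : IsComplementary A n p) (v : ℕ → ℝ) :
    ∑ j ∈ Finset.Icc 1 n, p j * ∑ k ∈ Finset.Icc 1 j, A j k * (v k - v (k - 1)) = v n - v 0 := by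
  simp_rw [Finset.mul_sum]
  rw [sum_swap]
  have : ∀ k ∈ Finset.Icc 1 n, ∑ j ∈ Finset.Icc k n, p j * (A j k * (v k - v (k - 1)))
      = v k - v (k - 1) := by
    intro k hk
    rw [Finset.mem_Icc] at hk
    simp_rw [← mul_assoc]
    rw [← Finset.sum_mul, hp.2 k hk.1 hk.2, one_mul]
  rw [Finset.sum_congr rfl this]
  clear this hp
  induction n with
  | zero => simp
  | succ n ih => rw [Finset.sum_Icc_succ_top (by omega), ih]; simp

lemma sum_increment (hp : IsComplementary A n p) {k : ℕ} (h1 : 1 ≤ k) (hk : k < n) :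
    ∑ j ∈ Finset.Icc (k + 1) n, p j * (A j (k + 1) - A j k) = p k * A k k := by
  have e1 := hp.2 k h1 hk.le
  have e2 := hp.2 (k + 1) (by omega) hk
  rw [← Finset.insert_Icc_succ_left_eq_Icc hk.le, Finset.sum_insert (by simp)] at e1
  simp only [Order.succ_eq_add_one] at e1
  simp_rw [mul_sub]
  rw [Finset.sum_sub_distrib, e2]
  linarith

lemma mul_diag_le_one (hp : IsComplementary A n p)
    (hA : ∀ k j, 1 ≤ k → k ≤ j → j ≤ n → 0 ≤ A j k) {k : ℕ} (h1 : 1 ≤ k) (hk : k ≤ n) :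
    p k * A k k ≤ 1 := by
  rw [← hp.2 k h1 hk]
  refine Finset.single_le_sum (f := fun j => p j * A j k) (fun j hj => ?_)
    (Finset.mem_Icc.2 ⟨le_rfl, hk⟩)
  rw [Finset.mem_Icc] at hj
  exact mul_nonneg (hp.1 j) (hA k j h1 hj.1 hj.2)

end IsComplementary

section stability

variable {α T : ℝ} {N : ℕ} {t : ℕ → ℝ}

lemma exists_complementary_kernelA (hα : α ∈ Ioo (0 : ℝ) 1) (hm : IsMesh T N t)
    (hr : RatioBound N t) :
    ∃ P : ℕ → ℕ → ℝ, ∀ n ≤ N, IsComplementary (kernelA α t) n (P n) := by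
  have : ∀ n, ∃ p, n ≤ N → IsComplementary (kernelA α t) n p := by
    intro n
    by_cases hn : n ≤ N
    · obtain ⟨p, hp⟩ := exists_isComplementary (A := kernelA α t) (n := n)
        (fun j h1 hj => kernelA_pos hα hm hr h1 le_rfl (by omega))
        (fun k j h1 hk hj => kernelA_mono hα hm hr h1 hk (by omega))
      exact ⟨p, fun _ => hp⟩
    · exact ⟨0, fun h => absurd h hn⟩
  choose P hP using this
  exact ⟨P, hP⟩

lemma sum_complementary_omega_le (hα : α ∈ Ioo (0 : ℝ) 1) (hm : IsMesh T N t)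
    (hr : RatioBound N t) {n : ℕ} {p : ℕ → ℝ} (h1 : 1 ≤ n) (hn : n ≤ N)
    (hp : IsComplementary (kernelA α t) n p) :
    ∑ j ∈ Finset.Icc 1 n, p j * omega (1 - α) (t j) ≤ 11 / 4 := by
  have h : ∑ j ∈ Finset.Icc 1 n, p j * (4 / 11 * omega (1 - α) (t j)) ≤ 1 := by
    refine le_trans ?_ (hp.2 1 le_rfl h1).le
    refine Finset.sum_le_sum fun j hj => mul_le_mul_of_nonneg_left ?_ (hp.1 j)
    rw [Finset.mem_Icc] at hj
    have := kernelA_ge_omega hα hm hr le_rfl hj.1 (by omega : j ≤ N)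
    simpa [hm.2.1] using this
  have e : ∑ j ∈ Finset.Icc 1 n, p j * (4 / 11 * omega (1 - α) (t j))
      = 4 / 11 * ∑ j ∈ Finset.Icc 1 n, p j * omega (1 - α) (t j) := by
    rw [Finset.mul_sum]
    exact Finset.sum_congr rfl fun j _ => by ring
  rw [e] at h
  linarith

lemma mul_rpow_le_rpow_sub {L x y : ℝ} (hα : α ∈ Ioo (0 : ℝ) 1) (hy : 0 ≤ y) (hyx : y ≤ x)
    (hx : 0 < x) (hL : x ≤ L) : α * L ^ (α - 1) * (x - y) ≤ x ^ α - y ^ α := by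
  have h1 : y ^ α ≤ x ^ α + α * x ^ (α - 1) * (y - x) := by
    have h := rpow_one_add_le_one_add_mul_self (s := y / x - 1) (p := α)
      (by have : 0 ≤ y / x := by positivity
          linarith) hα.1.le hα.2.le
    rw [show 1 + (y / x - 1) = y / x by ring, Real.div_rpow hy hx.le,
      div_le_iff₀ (Real.rpow_pos_of_pos hx _)] at h
    refine h.trans (le_of_eq ?_)
    rw [Real.rpow_sub_one hx.ne']
    field_simp
  have h2 : L ^ (α - 1) ≤ x ^ (α - 1) :=
    Real.rpow_le_rpow_of_nonpos hx hL (by linarith [hα.2])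
  have h3 : α * L ^ (α - 1) * (x - y) ≤ α * x ^ (α - 1) * (x - y) :=
    mul_le_mul_of_nonneg_right (mul_le_mul_of_nonneg_left h2 hα.1.le) (by linarith)
  linarith

lemma sum_Icc_telescope (f : ℕ → ℝ) {k j : ℕ} (hk : k ≤ j) :
    ∑ i ∈ Finset.Icc k j, (f (i - 1) - f i) = f (k - 1) - f j := by
  induction j, hk using Nat.le_induction with
  | base => simp
  | succ j hkj ih => rw [Finset.sum_Icc_succ_top (by omega), ih]; simp

/-- The sums of the complementary kernel behave like `(t_n - t_{k-1})^α`: the discrete Caputo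
derivative of `(t - t_{k-1})_+^α` is bounded below. -/
lemma sum_complementary_le (hα : α ∈ Ioo (0 : ℝ) 1) (hm : IsMesh T N t)
    (hr : RatioBound N t) {n k : ℕ} {p : ℕ → ℝ} (h1 : 1 ≤ k) (hk : k ≤ n) (hn : n ≤ N)
    (hp : IsComplementary (kernelA α t) n p) :
    ∑ j ∈ Finset.Icc k n, p j ≤ 11 / 4 * Real.Gamma (2 - α) / α * (t n - t (k - 1)) ^ α := by
  set v : ℕ → ℝ := fun i => (max 0 (t i - t (k - 1))) ^ α with hv
  have hG := Gamma_two_sub_pos hα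
  have hα0 := hα.1
  have hvmono : ∀ i, 1 ≤ i → i ≤ N → v (i - 1) ≤ v i := fun i h h' =>
    Real.rpow_le_rpow (le_max_left _ _)
      (max_le_max le_rfl (by linarith [hm.mono (by omega : i - 1 ≤ i) h'])) hα.1.le
  have hterm : ∀ j ∈ Finset.Icc 1 n, (if k ≤ j then 4 / 11 * (α / Real.Gamma (2 - α)) else 0)
      ≤ ∑ i ∈ Finset.Icc 1 j, kernelA α t j i * (v i - v (i - 1)) := by
    intro j hj
    rw [Finset.mem_Icc] at hj
    have hnn : ∀ i ∈ Finset.Icc 1 j, 0 ≤ kernelA α t j i * (v i - v (i - 1)) := by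
      intro i hi
      rw [Finset.mem_Icc] at hi
      exact mul_nonneg (kernelA_pos hα hm hr hi.1 hi.2 (by omega)).le
        (sub_nonneg.2 (hvmono i hi.1 (by omega)))
    split_ifs with h
    · set L := t j - t (k - 1) with hL
      have hLpos : 0 < L := by
        have a := hm.tau_pos h1 (by omega)
        have b := hm.mono h (by omega)
        unfold tau at a
        linarith
      have h2 : ∀ i ∈ Finset.Icc k j, α * L ^ (α - 1) * (4 / 11 *
          (((t j - t (i - 1)) ^ (1 - α) - (t j - t i) ^ (1 - α)) / Real.Gamma (2 - α)))
          ≤ kernelA α t j i * (v i - v (i - 1)) := by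
        intro i hi
        rw [Finset.mem_Icc] at hi
        have a1 := kernelA_ge hα hm hr (by omega : 1 ≤ i) hi.2 (by omega : j ≤ N)
        rw [integral_omega hα] at a1
        have b1 := hm.mono (by omega : k - 1 ≤ i - 1) (by omega)
        have b2 := hm.tau_pos (by omega : 1 ≤ i) (by omega)
        have b3 := hm.mono hi.2 (by omega)
        have b4 : t i - t (i - 1) = tau t i := rfl
        have a2 := mul_rpow_le_rpow_sub (L := L) (x := t i - t (k - 1)) (y := t (i - 1) - t (k - 1))
          hα (by linarith) (by linarith) (by linarith) (by linarith)
        have a3 : v i - v (i - 1) = (t i - t (k - 1)) ^ α - (t (i - 1) - t (k - 1)) ^ α := by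
          simp only [hv]
          rw [max_eq_right (by linarith), max_eq_right (by linarith)]
        rw [show t i - t (k - 1) - (t (i - 1) - t (k - 1)) = tau t i by rw [← b4]; ring] at a2
        have hA := kernelA_pos hα hm hr (by omega : 1 ≤ i) hi.2 (by omega : j ≤ N)
        rw [a3]
        calc _ ≤ α * L ^ (α - 1) * (kernelA α t j i * tau t i) := by gcongr
          _ = kernelA α t j i * (α * L ^ (α - 1) * tau t i) := by ring
          _ ≤ _ := by gcongr
      have h3 : ∑ i ∈ Finset.Icc k j, α * L ^ (α - 1) * (4 / 11 *
          (((t j - t (i - 1)) ^ (1 - α) - (t j - t i) ^ (1 - α)) / Real.Gamma (2 - α)))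
          = 4 / 11 * (α / Real.Gamma (2 - α)) := by
        rw [← Finset.mul_sum, ← Finset.mul_sum, ← Finset.sum_div,
          sum_Icc_telescope (fun i => (t j - t i) ^ (1 - α)) h]
        rw [sub_self, Real.zero_rpow (by linarith [hα.2]), sub_zero]
        change α * L ^ (α - 1) * (4 / 11 * (L ^ (1 - α) / _)) = _
        have : L ^ (α - 1) * L ^ (1 - α) = 1 := by
          rw [← Real.rpow_add hLpos]; simp
        calc _ = 4 / 11 * (α / Real.Gamma (2 - α)) * (L ^ (α - 1) * L ^ (1 - α)) := by ring
          _ = _ := by rw [this, mul_one]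
      rw [← h3]
      refine (Finset.sum_le_sum h2).trans
        (Finset.sum_le_sum_of_subset_of_nonneg (Finset.Icc_subset_Icc_left h1) ?_)
      exact fun i hi _ => hnn i hi
    · exact Finset.sum_nonneg hnn
  have h4 := hp.sum_mul_convolution v
  have h5 : ∑ j ∈ Finset.Icc 1 n, p j * (if k ≤ j then 4 / 11 * (α / Real.Gamma (2 - α)) else 0)
      ≤ v n - v 0 := by
    rw [← h4]
    exact Finset.sum_le_sum fun j hj => mul_le_mul_of_nonneg_left (hterm j hj) (hp.1 j)
  have h6 : ∑ j ∈ Finset.Icc 1 n, p j * (if k ≤ j then 4 / 11 * (α / Real.Gamma (2 - α)) else 0)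
      = (∑ j ∈ Finset.Icc k n, p j) * (4 / 11 * (α / Real.Gamma (2 - α))) := by
    simp_rw [mul_ite, mul_zero]
    rw [← Finset.sum_filter, Finset.sum_mul]
    refine Finset.sum_congr ?_ fun _ _ => rfl
    ext j
    simp only [Finset.mem_filter, Finset.mem_Icc]
    omega
  have h7 : v 0 = 0 := by
    have : t 0 - t (k - 1) ≤ 0 := by linarith [hm.mono (Nat.zero_le (k - 1)) (by omega)]
    simp only [hv]
    rw [max_eq_left this, Real.zero_rpow hα.1.ne']
  have h8 : v n = (t n - t (k - 1)) ^ α := by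
    have := hm.mono (by omega : k - 1 ≤ n) hn
    simp only [hv]
    rw [max_eq_right (by linarith)]
  rw [h6, h7, h8, sub_zero] at h5
  have h9 : 0 < 4 / 11 * (α / Real.Gamma (2 - α)) := by positivity
  rw [← le_div_iff₀ h9] at h5
  refine h5.trans (le_of_eq ?_)
  field_simp

/-- Alikhanov's inequality: the offset makes the discrete Caputo derivative positive in the
sense of energies. With `z = v^{n-θ}` the difference of the two sides is
`∑_k A_{n,k} ((z - v_{k-1})² - (z - v_k)²)`. The terms `k < n` sum to at least
`-A_{n,n-1} (z - v_{n-1})²`, and `kernelA_offset` absorbs this in the term `k = n`. -/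
lemma kernelA_energy (hα : α ∈ Ioo (0 : ℝ) 1) (hm : IsMesh T N t) (hr : RatioBound N t)
    {n : ℕ} (h1 : 1 ≤ n) (hn : n ≤ N) (v : ℕ → ℝ) :
    ∑ k ∈ Finset.Icc 1 n, kernelA α t n k * (v k ^ 2 - v (k - 1) ^ 2)
      ≤ 2 * wavg α v n * discCaputo α t v n := by
  set z := wavg α v n with hz
  obtain ⟨m, rfl⟩ : ∃ m, n = m + 1 := ⟨n - 1, by omega⟩
  -- summation by parts in the increments of `(z - v_k)²`, by monotonicity of the kernel
  have key : ∀ i ≤ m, 1 ≤ i → -(kernelA α t (m + 1) i * (z - v i) ^ 2)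
      ≤ ∑ k ∈ Finset.Icc 1 i, kernelA α t (m + 1) k * ((z - v (k - 1)) ^ 2 - (z - v k) ^ 2) := by
    intro i hi h
    induction i, h using Nat.le_induction with
    | base =>
      simp only [Finset.Icc_self, Finset.sum_singleton]
      have := kernelA_pos hα hm hr le_rfl h1 hn
      nlinarith [sq_nonneg (z - v (1 - 1))]
    | succ i h ih =>
      rw [Finset.sum_Icc_succ_top (by omega)]
      have a1 := kernelA_mono hα hm hr h (by omega : i < m + 1) hn
      have a2 := ih (by omega)
      simp only [Nat.add_sub_cancel]
      nlinarith [mul_le_mul_of_nonneg_right a1 (sq_nonneg (z - v i))]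
  have e : 2 * z * discCaputo α t v (m + 1)
      - ∑ k ∈ Finset.Icc 1 (m + 1), kernelA α t (m + 1) k * (v k ^ 2 - v (k - 1) ^ 2)
      = ∑ k ∈ Finset.Icc 1 (m + 1),
        kernelA α t (m + 1) k * ((z - v (k - 1)) ^ 2 - (z - v k) ^ 2) := by
    rw [discCaputo, Finset.mul_sum, ← Finset.sum_sub_distrib]
    exact Finset.sum_congr rfl fun k _ => by ring
  rw [← sub_nonneg, e, Finset.sum_Icc_succ_top (by omega)]
  simp only [Nat.add_sub_cancel]
  have hz' : z = theta α * v m + (1 - theta α) * v (m + 1) := by rw [hz, wavg]; simp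
  have h2 : theta α = α / 2 := rfl
  set x := v (m + 1) - v m
  have q1 : (z - v m) ^ 2 - (z - v (m + 1)) ^ 2 = (1 - α) * x ^ 2 := by
    rw [hz', h2]; simp only [x]; ring
  have hA := kernelA_pos hα hm hr (by omega : 1 ≤ m + 1) le_rfl hn
  have h5 : 0 < 1 - α := by linarith [hα.2]
  rw [q1]
  rcases Nat.eq_zero_or_pos m with rfl | hmpos
  · simp
    positivity
  · have k1 := key m le_rfl hmpos
    have k2 := kernelA_offset hα hm hr hmpos rfl hn
    have q2 : (z - v m) ^ 2 = (1 - theta α) ^ 2 * x ^ 2 := by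
      rw [hz']; simp only [x]; ring
    rw [q2] at k1
    have h6 := one_sub_theta_pos hα
    have h7 : 1 - theta α ≤ 1 := by rw [h2]; linarith [hα.1]
    have hA' := kernelA_pos hα hm hr hmpos (by omega : m ≤ m + 1) hn
    have k3 : kernelA α t (m + 1) m * ((1 - theta α) ^ 2 * x ^ 2)
        ≤ (1 - α) * kernelA α t (m + 1) (m + 1) * x ^ 2 := by
      calc _ = (1 - theta α) * ((1 - theta α) * kernelA α t (m + 1) m) * x ^ 2 := by ring
        _ ≤ 1 * ((1 - theta α) * kernelA α t (m + 1) m) * x ^ 2 := by gcongr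
        _ ≤ 1 * ((1 - α) * kernelA α t (m + 1) (m + 1)) * x ^ 2 := by gcongr
        _ = _ := by ring
    nlinarith

lemma Gamma_two_sub_le_one (hα : α ∈ Ioo (0 : ℝ) 1) : Real.Gamma (2 - α) ≤ 1 := by
  have h := Real.convexOn_Gamma.2 (x := 1) (y := 2) (by simp) (by simp) hα.1.le
    (by linarith [hα.2] : 0 ≤ 1 - α) (by ring)
  simp only [smul_eq_mul, Real.Gamma_one, Real.Gamma_two] at h
  rw [show α * 1 + (1 - α) * 2 = 2 - α by ring] at h
  linarith

lemma rpow_le_one_add {x p : ℝ} (hx : 0 ≤ x) (h0 : 0 ≤ p) (h1 : p ≤ 1) : x ^ p ≤ 1 + x := by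
  rcases le_total x 1 with h | h
  · linarith [Real.rpow_le_one hx h h0]
  · have := Real.rpow_le_rpow_of_exponent_le h h1
    rw [Real.rpow_one] at this
    linarith

/-- The discrete fractional Grönwall inequality, for energies `v_n²` that satisfy an inequality
with linear and quadratic data. The sizes are compared with an exponential weight `e^{Λ t}`. -/
lemma exists_gronwall {α0 T l : ℝ} (hα0 : 0 < α0) (hT : 0 < T) (hl : 0 < l) :
    ∃ C : ℝ, 0 < C ∧ ∀ (α : ℝ) (N : ℕ) (t : ℕ → ℝ), α ∈ Ioo (0 : ℝ) 1 → α0 ≤ α → IsMesh T N t →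
      RatioBound N t → (∀ k, 1 ≤ k → k ≤ N → 3 * l ≤ kernelA α t k k) →
      ∀ P : ℕ → ℕ → ℝ, (∀ n ≤ N, IsComplementary (kernelA α t) n (P n)) →
      ∀ v ξ η : ℕ → ℝ, (∀ j, 0 ≤ v j) → v 0 = 0 → (∀ j, 1 ≤ j → j ≤ N → 0 ≤ ξ j) →
      (∀ j, 1 ≤ j → j ≤ N → ∑ k ∈ Finset.Icc 1 j, kernelA α t j k * (v k ^ 2 - v (k - 1) ^ 2)
        ≤ l * max (v (j - 1)) (v j) ^ 2 + 2 * ξ j * max (v (j - 1)) (v j) + η j ^ 2) →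
      ∀ n, 1 ≤ n → n ≤ N → ∀ S Q : ℝ, 0 ≤ S → 0 ≤ Q →
      (∀ m, 1 ≤ m → m ≤ n → ∑ j ∈ Finset.Icc 1 m, P m j * ξ j ≤ S) →
      (∀ m, 1 ≤ m → m ≤ n → ∑ j ∈ Finset.Icc 1 m, P m j * η j ^ 2 ≤ Q ^ 2) →
      v n ≤ C * (S + Q) := by
  set C1 : ℝ := 11 / 4 / α0 with hC1
  have hC1pos : 0 < C1 := by positivity
  -- the last stretch of length `δ` contributes little because of `sum_complementary_le`, and what
  -- lies before it because of the exponential weight with large `Λ`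
  obtain ⟨δ, hδ0, hδ1, hδ⟩ : ∃ δ : ℝ, 0 < δ ∧ δ ≤ 1 ∧ l * (C1 * δ ^ α0) ≤ 1 / 12 := by
    refine ⟨min 1 ((1 / (12 * l * C1)) ^ (1 / α0)), by positivity, min_le_left _ _, ?_⟩
    have h : (min 1 ((1 / (12 * l * C1)) ^ (1 / α0))) ^ α0 ≤ 1 / (12 * l * C1) := by
      calc _ ≤ ((1 / (12 * l * C1)) ^ (1 / α0)) ^ α0 :=
            Real.rpow_le_rpow (by positivity) (min_le_right _ _) hα0.le
        _ = _ := by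
            rw [← Real.rpow_mul (by positivity), one_div_mul_cancel hα0.ne', Real.rpow_one]
    calc _ ≤ l * (C1 * (1 / (12 * l * C1))) := by gcongr
      _ = 1 / 12 := by field_simp
  obtain ⟨Λ, hΛ0, hΛ⟩ : ∃ Λ : ℝ, 0 ≤ Λ ∧ l * (C1 * (1 + T)) * Real.exp (-(2 * Λ * δ)) ≤ 1 / 12 := by
    refine ⟨12 * l * (C1 * (1 + T)) / (2 * δ), by positivity, ?_⟩
    have e : 2 * (12 * l * (C1 * (1 + T)) / (2 * δ)) * δ = 12 * l * (C1 * (1 + T)) := by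
      field_simp
    rw [e, Real.exp_neg, ← div_eq_mul_inv, div_le_iff₀ (Real.exp_pos _)]
    have := Real.add_one_le_exp (12 * l * (C1 * (1 + T)))
    linarith
  refine ⟨4 * Real.exp (Λ * T), by positivity, ?_⟩
  intro α N t hα hαα hm hr hstep P hP v ξ η hv hv0 hξ hineq n h1 hn S Q hS hQ hSb hQb
  -- `m` is the level at which the weighted size `e^{-Λ t_k} v_k` is largest
  obtain ⟨m, hmem, hmax⟩ := Finset.exists_max_image (Finset.range (n + 1))
    (fun k => Real.exp (-(Λ * t k)) * v k) ⟨0, by simp⟩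
  rw [Finset.mem_range] at hmem
  have hvk : ∀ k ≤ n, v k ≤ Real.exp (Λ * (t k - t m)) * v m := by
    intro k hk
    have h := hmax k (Finset.mem_range.2 (by omega))
    have h2 : Real.exp (Λ * t k) * (Real.exp (-(Λ * t k)) * v k)
        ≤ Real.exp (Λ * t k) * (Real.exp (-(Λ * t m)) * v m) :=
      mul_le_mul_of_nonneg_left h (Real.exp_pos _).le
    rw [← mul_assoc, ← mul_assoc, ← Real.exp_add, ← Real.exp_add] at h2
    rw [show Λ * (t k - t m) = Λ * t k + -(Λ * t m) by ring]
    simpa using h2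
  have hfin : v m ≤ 4 * (S + Q) → v n ≤ 4 * Real.exp (Λ * T) * (S + Q) := by
    intro h
    have h2 := hvk n le_rfl
    have h3 : Real.exp (Λ * (t n - t m)) ≤ Real.exp (Λ * T) := by
      apply Real.exp_le_exp.2 (mul_le_mul_of_nonneg_left _ hΛ0)
      linarith [hm.le_T hn, hm.nonneg (by omega : m ≤ N)]
    calc v n ≤ _ := h2
      _ ≤ Real.exp (Λ * T) * (4 * (S + Q)) := by
        apply mul_le_mul h3 h (hv m) (Real.exp_pos _).le
      _ = _ := by ring
  apply hfin
  rcases Nat.eq_zero_or_pos m with rfl | hm1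
  · rw [hv0]; positivity
  have hmN : m ≤ N := by omega
  have hp := hP m hmN
  have hPl : ∀ k, 1 ≤ k → k ≤ m → l * P m k ≤ 1 / 3 := by
    intro k hk hkm
    have a := hp.mul_diag_le_one
      (fun k j h h' h'' => (kernelA_pos hα hm hr h h' (by omega)).le) hk hkm
    have b := hstep k hk (by omega)
    have := mul_le_mul_of_nonneg_left b (hp.1 k)
    linarith
  have hsumle : ∀ k, 1 ≤ k → k ≤ m →
      ∑ j ∈ Finset.Icc k m, P m j ≤ C1 * (t m - t (k - 1)) ^ α := by
    intro k hk hkm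
    refine (sum_complementary_le hα hm hr hk hkm hmN hp).trans ?_
    have hb := hm.mono (by omega : k - 1 ≤ m) hmN
    apply mul_le_mul_of_nonneg_right _ (Real.rpow_nonneg (by linarith) _)
    have := Gamma_two_sub_le_one hα
    have := Gamma_two_sub_pos hα
    calc 11 / 4 * Real.Gamma (2 - α) / α ≤ 11 / 4 * 1 / α0 := by gcongr
      _ = C1 := by rw [hC1]; ring
  -- the weighted sum of the complementary kernel is small: it splits into the first level `k` within
  -- distance `δ` of `t_m`, the levels after it and those before it
  have hweight : l * ∑ j ∈ Finset.Icc 1 m, P m j * Real.exp (2 * (Λ * (t j - t m))) ≤ 1 / 2 := by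
    have hex : ∃ k, 1 ≤ k ∧ t m - δ ≤ t k := ⟨m, hm1, by linarith⟩
    classical
    obtain ⟨hk1, hk2⟩ := Nat.find_spec hex
    set k := Nat.find hex with hk
    have hkm : k ≤ m := Nat.find_min' hex ⟨hm1, by linarith⟩
    have hlt : ∀ j, 1 ≤ j → j < k → t j < t m - δ := by
      intro j hj hjk
      by_contra hcon
      exact Nat.find_min hex hjk ⟨hj, not_lt.1 hcon⟩
    have hpt : ∀ j ∈ Finset.Icc 1 m, P m j * Real.exp (2 * (Λ * (t j - t m)))
        ≤ (if j = k then P m j else 0) + (if k + 1 ≤ j then P m j else 0)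
          + P m j * Real.exp (-(2 * Λ * δ)) := by
      intro j hj
      rw [Finset.mem_Icc] at hj
      have hpj := hp.1 j
      have hmj := hm.mono hj.2 hmN
      have hle1 : Real.exp (2 * (Λ * (t j - t m))) ≤ 1 :=
        Real.exp_le_one_iff.2 (by nlinarith)
      have hle1' : P m j * Real.exp (2 * (Λ * (t j - t m))) ≤ P m j :=
        mul_le_of_le_one_right hpj hle1
      have hnn : 0 ≤ P m j * Real.exp (-(2 * Λ * δ)) := by positivity
      rcases lt_trichotomy j k with h | h | h
      · rw [if_neg (by omega), if_neg (by omega), zero_add, zero_add]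
        apply mul_le_mul_of_nonneg_left _ hpj
        apply Real.exp_le_exp.2
        have := hlt j hj.1 h
        nlinarith
      · rw [if_pos h, if_neg (by omega)]
        linarith
      · rw [if_neg (by omega), if_pos (by omega)]
        linarith
    have hsum := Finset.sum_le_sum hpt
    rw [Finset.sum_add_distrib, Finset.sum_add_distrib, ← Finset.sum_mul,
      Finset.sum_ite_eq' , if_pos (Finset.mem_Icc.2 ⟨hk1, hkm⟩)] at hsum
    have e2 : ∑ j ∈ Finset.Icc 1 m, (if k + 1 ≤ j then P m j else 0)
        = ∑ j ∈ Finset.Icc (k + 1) m, P m j := by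
      rw [← Finset.sum_filter]
      refine Finset.sum_congr ?_ fun _ _ => rfl
      ext j
      simp only [Finset.mem_filter, Finset.mem_Icc]
      omega
    rw [e2] at hsum
    have b1 := hPl k hk1 hkm
    have b2 : l * ∑ j ∈ Finset.Icc (k + 1) m, P m j ≤ 1 / 12 := by
      rcases hkm.lt_or_eq with h | h
      · have a := hsumle (k + 1) (by omega) h
        rw [Nat.add_sub_cancel] at a
        have hb := hm.mono hkm hmN
        have a2 : (t m - t k) ^ α ≤ δ ^ α0 :=
          (Real.rpow_le_rpow (by linarith) (by linarith) hα.1.le).trans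
            (Real.rpow_le_rpow_of_exponent_ge hδ0 hδ1 hαα)
        calc _ ≤ l * (C1 * δ ^ α0) := by
              apply mul_le_mul_of_nonneg_left (a.trans _) hl.le
              gcongr
          _ ≤ _ := hδ
      · rw [Finset.Icc_eq_empty (by omega)]
        simp
    have b3 : l * ((∑ j ∈ Finset.Icc 1 m, P m j) * Real.exp (-(2 * Λ * δ))) ≤ 1 / 12 := by
      have a := hsumle 1 le_rfl hm1
      have a2 : (t m - t (1 - 1)) ^ α ≤ 1 + T := by
        rw [Nat.sub_self, hm.2.1, sub_zero]
        have := rpow_le_one_add (hm.nonneg hmN) hα.1.le hα.2.le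
        linarith [hm.le_T hmN]
      calc _ ≤ l * ((C1 * (1 + T)) * Real.exp (-(2 * Λ * δ))) := by
            gcongr
            exact a.trans (by gcongr)
        _ ≤ _ := by rw [← mul_assoc]; exact hΛ
    have := mul_le_mul_of_nonneg_left hsum hl.le
    linarith
  have hmaxle : ∀ j ∈ Finset.Icc 1 m,
      max (v (j - 1)) (v j) ≤ Real.exp (Λ * (t j - t m)) * v m := by
    intro j hj
    rw [Finset.mem_Icc] at hj
    refine max_le ((hvk (j - 1) (by omega)).trans ?_) (hvk j (by omega))
    apply mul_le_mul_of_nonneg_right _ (hv m)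
    apply Real.exp_le_exp.2 (mul_le_mul_of_nonneg_left _ hΛ0)
    linarith [hm.mono (by omega : j - 1 ≤ j) (by omega)]
  have hmain := hp.sum_mul_convolution (fun k => v k ^ 2)
  have hbound : ∑ j ∈ Finset.Icc 1 m, P m j *
      ∑ k ∈ Finset.Icc 1 j, kernelA α t j k * (v k ^ 2 - v (k - 1) ^ 2)
      ≤ ∑ j ∈ Finset.Icc 1 m, (l * (P m j * Real.exp (2 * (Λ * (t j - t m)))) * v m ^ 2
        + 2 * v m * (P m j * ξ j) + P m j * η j ^ 2) := by
    refine Finset.sum_le_sum fun j hj => ?_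
    have hM := hmaxle j hj
    rw [Finset.mem_Icc] at hj
    have hpj := hp.1 j
    have h0 : 0 ≤ max (v (j - 1)) (v j) := (hv j).trans (le_max_right _ _)
    have hM2 : max (v (j - 1)) (v j) ≤ v m := by
      refine hM.trans (mul_le_of_le_one_left (hv m) (Real.exp_le_one_iff.2 ?_))
      have := hm.mono hj.2 hmN
      nlinarith
    have hsq : max (v (j - 1)) (v j) ^ 2 ≤ Real.exp (2 * (Λ * (t j - t m))) * v m ^ 2 := by
      have := pow_le_pow_left₀ h0 hM 2
      rwa [mul_pow, ← Real.exp_nat_mul] at this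
    have hξj := hξ j hj.1 (by omega)
    calc _ ≤ P m j * (l * max (v (j - 1)) (v j) ^ 2 + 2 * ξ j * max (v (j - 1)) (v j) + η j ^ 2) :=
          mul_le_mul_of_nonneg_left (hineq j hj.1 (by omega)) hpj
      _ ≤ P m j * (l * (Real.exp (2 * (Λ * (t j - t m))) * v m ^ 2) + 2 * ξ j * v m + η j ^ 2) := by
          gcongr
      _ = _ := by ring
  rw [hmain, Finset.sum_add_distrib, Finset.sum_add_distrib, ← Finset.sum_mul, ← Finset.mul_sum,
    ← Finset.mul_sum, hv0] at hbound
  have c1 := mul_le_mul_of_nonneg_right hweight (sq_nonneg (v m))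
  have c2 := mul_le_mul_of_nonneg_left (hSb m hm1 (by omega)) (mul_nonneg zero_le_two (hv m))
  have c3 := hQb m hm1 (by omega)
  have c4 : v m ^ 2 / 2 ≤ 2 * v m * S + Q ^ 2 := by
    have : (fun k => v k ^ 2) m - (0 : ℝ) ^ 2 = v m ^ 2 := by simp
    linarith
  -- `v_m² / 2 ≤ 2 v_m S + Q²` excludes `v_m > 4 (S + Q)`
  by_contra hcon
  rw [not_le] at hcon
  nlinarith [hv m]

end stability

/-! ### Taylor remainders of functions with a singularity at `t = 0` -/

lemma abs_sub_le_of_deriv_le_rpow {H H' : ℝ → ℝ} {x y K σ : ℝ} (hx : 0 < x) (hxy : x ≤ y)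
    (hσ : 0 < σ) (hK : 0 ≤ K) (hd : ∀ r ∈ Icc x y, HasDerivWithinAt H (H' r) (Icc x y) r)
    (hb : ∀ r ∈ Icc x y, |H' r| ≤ K * r ^ (σ - 1)) : |H y - H x| ≤ K * (y ^ σ / σ) := by
  have h := image_norm_le_of_norm_deriv_right_le_deriv_boundary' (f := fun r => H r - H x)
    (f' := H') (a := x) (b := y) (B := fun r => K * (r ^ σ / σ)) (B' := fun r => K * r ^ (σ - 1))
    (fun r hr => ((hd r hr).continuousWithinAt.sub continuousWithinAt_const))
    (fun r hr => ((hd r (Ico_subset_Icc_self hr)).sub_const _).mono_of_mem_nhdsWithin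
      (Icc_mem_nhdsGE_of_mem hr))
    (by simp only [sub_self, norm_zero]; positivity)
    (fun r hr => ContinuousWithinAt.const_mul (ContinuousWithinAt.div_const
      (continuousWithinAt_id.rpow_const (Or.inr hσ.le)) _) _)
    (fun r hr => ?_) (fun r hr => hb r (Ico_subset_Icc_self hr)) ⟨hxy, le_rfl⟩
  · simpa using h
  · have hr0 : 0 < r := hx.trans_le hr.1
    have := ((Real.hasDerivAt_rpow_const (p := σ) (Or.inl hr0.ne')).div_const σ).const_mul K
    refine HasDerivAt.hasDerivWithinAt (this.congr_deriv ?_)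
    field_simp

lemma abs_sub_le_of_deriv_le {H H' : ℝ → ℝ} {x y B : ℝ} (hxy : x ≤ y)
    (hd : ∀ r ∈ Icc x y, HasDerivWithinAt H (H' r) (Icc x y) r)
    (hb : ∀ r ∈ Icc x y, |H' r| ≤ B) : |H y - H x| ≤ B * (y - x) := by
  have := (convex_Icc x y).norm_image_sub_le_of_norm_hasDerivWithin_le hd hb
    (left_mem_Icc.2 hxy) (right_mem_Icc.2 hxy)
  rwa [Real.norm_eq_abs, Real.norm_eq_abs, abs_of_nonneg (sub_nonneg.2 hxy)] at this

/-- `g` is continuous on `[0,T]` and three times differentiable on `(0,T]`, with derivatives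
`g1`, `g2`, `g3`, the first of which is integrable, and `|g3 t| ≤ K t^{σ-3}`. -/
structure TimeReg (T σ K : ℝ) (g g1 g2 g3 : ℝ → ℝ) : Prop where
  cont : ContinuousOn g (Icc 0 T)
  d1 : ∀ t ∈ Ioc 0 T, HasDerivWithinAt g (g1 t) (Ioc 0 T) t
  d2 : ∀ t ∈ Ioc 0 T, HasDerivWithinAt g1 (g2 t) (Ioc 0 T) t
  d3 : ∀ t ∈ Ioc 0 T, HasDerivWithinAt g2 (g3 t) (Ioc 0 T) t
  int : IntervalIntegrable g1 volume 0 T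
  bound : ∀ t ∈ Ioc 0 T, |g3 t| ≤ K * t ^ (σ - 3)

/-- The remainder of the quadratic Taylor polynomial of `g` at `c`. -/
noncomputable def rem2 (g g1 g2 : ℝ → ℝ) (c s : ℝ) : ℝ :=
  g s - (g c + g1 c * (s - c) + g2 c / 2 * (s - c) ^ 2)

/-- The derivative of the remainder of the quadratic Taylor polynomial of `g` at `c`. -/
noncomputable def rem2' (g1 g2 : ℝ → ℝ) (c s : ℝ) : ℝ :=
  g1 s - (g1 c + g2 c * (s - c))

lemma Icc_subset_Ioc_of_pos {x y T : ℝ} (hx : 0 < x) (hy : y ≤ T) : Icc x y ⊆ Ioc 0 T :=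
  fun _ hr => ⟨hx.trans_le hr.1, hr.2.trans hy⟩

section taylor

variable {T σ K : ℝ} {g g1 g2 g3 : ℝ → ℝ}

lemma hasDerivWithinAt_taylor {S : Set ℝ} {r s : ℝ} (h1 : HasDerivWithinAt g (g1 r) S r)
    (h2 : HasDerivWithinAt g1 (g2 r) S r) (h3 : HasDerivWithinAt g2 (g3 r) S r) :
    HasDerivWithinAt (fun r => g r + g1 r * (s - r) + g2 r / 2 * (s - r) ^ 2)
      (g3 r / 2 * (s - r) ^ 2) S r := by
  have hs : HasDerivWithinAt (fun r : ℝ => s - r) (-1) S r := (hasDerivWithinAt_id r S).const_sub s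
  refine ((h1.fun_add (h2.fun_mul hs)).fun_add ((h3.div_const 2).fun_mul (hs.fun_pow 2))).congr_deriv ?_
  norm_num
  ring

lemma TimeReg.derivs_Icc (h : TimeReg T σ K g g1 g2 g3) {x y : ℝ} (hx : 0 < x) (hy : y ≤ T)
    (s r : ℝ) (hr : r ∈ Icc x y) :
    HasDerivWithinAt (fun r => g r + g1 r * (s - r) + g2 r / 2 * (s - r) ^ 2)
      (g3 r / 2 * (s - r) ^ 2) (Icc x y) r := by
  have hsub := Icc_subset_Ioc_of_pos hx hy
  exact hasDerivWithinAt_taylor ((h.d1 r (hsub hr)).mono hsub) ((h.d2 r (hsub hr)).mono hsub)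
    ((h.d3 r (hsub hr)).mono hsub)

lemma rpow_sub_le {p x r : ℝ} (hx : 0 < x) (hr : x ≤ r) (hp : p ≤ 0) : r ^ p ≤ x ^ p :=
  Real.rpow_le_rpow_of_nonpos hx hr hp

lemma TimeReg.rem2_le (h : TimeReg T σ K g g1 g2 g3) (hσ : σ ≤ 3) (hK : 0 ≤ K) {x s c : ℝ}
    (hx : 0 < x) (hxs : x ≤ s) (hxc : x ≤ c) (hs : s ≤ T) (hc : c ≤ T) :
    |rem2 g g1 g2 c s| ≤ K * x ^ (σ - 3) / 2 * |s - c| ^ 3 := by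
  have hb : ∀ r, min s c ≤ r → r ≤ max s c →
      |g3 r / 2 * (s - r) ^ 2| ≤ K * x ^ (σ - 3) / 2 * (s - c) ^ 2 := by
    intro r h1 h2
    have hxr : x ≤ r := (le_min hxs hxc).trans h1
    rw [abs_mul, abs_div, abs_of_nonneg (sq_nonneg (s - r)), abs_two]
    have := h.bound r ⟨hx.trans_le hxr, h2.trans (max_le hs hc)⟩
    have h3 := mul_le_mul_of_nonneg_left (rpow_sub_le hx hxr (by linarith : σ - 3 ≤ 0)) hK
    have h4 : (s - r) ^ 2 ≤ (s - c) ^ 2 := by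
      rcases le_total s c with h' | h'
      · rw [min_eq_left h'] at h1; rw [max_eq_right h'] at h2; nlinarith
      · rw [min_eq_right h'] at h1; rw [max_eq_left h'] at h2; nlinarith
    gcongr
    linarith
  rcases le_total s c with hsc | hsc
  · rw [min_eq_left hsc, max_eq_right hsc] at hb
    have := abs_sub_le_of_deriv_le hsc
      (fun r hr => h.derivs_Icc (hx.trans_le hxs) hc s r hr) (fun r hr => hb r hr.1 hr.2)
    rw [abs_of_nonpos (sub_nonpos.2 hsc), rem2, abs_sub_comm]
    refine le_trans (le_of_eq ?_) (this.trans (le_of_eq ?_))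
    · simp
    · ring
  · rw [min_eq_right hsc, max_eq_left hsc] at hb
    have := abs_sub_le_of_deriv_le hsc
      (fun r hr => h.derivs_Icc (hx.trans_le hxc) hs s r hr) (fun r hr => hb r hr.1 hr.2)
    rw [abs_of_nonneg (sub_nonneg.2 hsc), rem2]
    refine le_trans (le_of_eq ?_) (this.trans (le_of_eq ?_))
    · simp
    · ring

/-- A bound for the remainder that holds up to the singularity. -/
lemma TimeReg.rem2_le_sing (h : TimeReg T σ K g g1 g2 g3) (hσ : 0 < σ) (hK : 0 ≤ K) {s c : ℝ}
    (hs : 0 ≤ s) (hsc : s ≤ c) (hc0 : 0 < c) (hc : c ≤ T) :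
    |rem2 g g1 g2 c s| ≤ K / 2 * (c ^ σ / σ) := by
  have key : ∀ s ∈ Ioc 0 c, |rem2 g g1 g2 c s| ≤ K / 2 * (c ^ σ / σ) := by
    intro s hs
    have := abs_sub_le_of_deriv_le_rpow (σ := σ) (K := K / 2) hs.1 hs.2 hσ (by positivity)
      (fun r hr => h.derivs_Icc hs.1 hc s r hr) (fun r hr => ?_)
    · rw [rem2, abs_sub_comm]
      refine le_trans (le_of_eq ?_) this
      simp
    · have hr0 : 0 < r := hs.1.trans_le hr.1
      have hb := h.bound r ⟨hr0, hr.2.trans hc⟩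
      rw [abs_mul, abs_div, abs_two, abs_of_nonneg (sq_nonneg (s - r))]
      have h2 : (s - r) ^ 2 ≤ r ^ 2 := by nlinarith [hs.1, hr.1]
      calc |g3 r| / 2 * (s - r) ^ 2 ≤ K * r ^ (σ - 3) / 2 * r ^ 2 := by gcongr
        _ = K / 2 * (r ^ (σ - 3) * r ^ (2 : ℝ)) := by rw [Real.rpow_two]; ring
        _ = _ := by rw [← Real.rpow_add hr0]; congr 2; ring
  rcases hs.eq_or_lt with rfl | hs
  · have hcont : ContinuousOn (fun s => |rem2 g g1 g2 c s|) (Icc 0 c) := by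
      unfold rem2
      exact ((h.cont.mono (Icc_subset_Icc_right hc)).sub (by fun_prop)).abs
    have hmem : (0 : ℝ) ∈ closure (Ioc 0 c) := by
      rw [closure_Ioc hc0.ne]; exact ⟨le_rfl, hsc⟩
    exact ContinuousWithinAt.closure_le hmem
      ((hcont 0 ⟨le_rfl, hsc⟩).mono Ioc_subset_Icc_self) continuousWithinAt_const key
  · exact key s ⟨hs, hsc⟩

lemma TimeReg.rem2'_le (h : TimeReg T σ K g g1 g2 g3) (hσ : σ ≤ 3) (hK : 0 ≤ K) {x s c : ℝ}
    (hx : 0 < x) (hxs : x ≤ s) (hsc : s ≤ c) (hc : c ≤ T) :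
    |rem2' g1 g2 c s| ≤ K * x ^ (σ - 3) * (c - s) ^ 2 := by
  have hs0 : 0 < s := hx.trans_le hxs
  have hsub := Icc_subset_Ioc_of_pos hs0 hc
  have := abs_sub_le_of_deriv_le (H := fun r => g1 r + g2 r * (s - r))
    (H' := fun r => g3 r * (s - r)) (B := K * x ^ (σ - 3) * (c - s)) hsc (fun r hr => ?_)
    (fun r hr => ?_)
  · rw [rem2', abs_sub_comm]
    refine le_trans (le_of_eq ?_) (this.trans (le_of_eq ?_))
    · simp
    · ring
  · have hs : HasDerivWithinAt (fun r : ℝ => s - r) (-1) (Icc s c) r :=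
      (hasDerivWithinAt_id r _).const_sub s
    refine (((h.d2 r (hsub hr)).mono hsub).fun_add
      (((h.d3 r (hsub hr)).mono hsub).fun_mul hs)).congr_deriv ?_
    ring
  · rw [abs_mul]
    have h2 := h.bound r (hsub hr)
    have h3 := mul_le_mul_of_nonneg_left
      (rpow_sub_le hx (hxs.trans hr.1) (by linarith : σ - 3 ≤ 0)) hK
    have h4 : |s - r| ≤ c - s := by
      rw [abs_of_nonpos (by linarith [hr.1])]; linarith [hr.2]
    gcongr
    linarith

/-! ### The weighted average at the offset point -/

lemma linear_taylor_le {x s c : ℝ} (hσ : σ ≤ 2) (hK : 0 ≤ K)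
    (d1 : ∀ t ∈ Ioc 0 T, HasDerivWithinAt g (g1 t) (Ioc 0 T) t)
    (d2 : ∀ t ∈ Ioc 0 T, HasDerivWithinAt g1 (g2 t) (Ioc 0 T) t)
    (hb : ∀ t ∈ Ioc 0 T, |g2 t| ≤ K * t ^ (σ - 2))
    (hx : 0 < x) (hxs : x ≤ s) (hxc : x ≤ c) (hs : s ≤ T) (hc : c ≤ T) :
    |g s - (g c + g1 c * (s - c))| ≤ K * x ^ (σ - 2) * (s - c) ^ 2 := by
  have hd : ∀ y z, 0 < y → z ≤ T → ∀ r ∈ Icc y z,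
      HasDerivWithinAt (fun r => g r + g1 r * (s - r)) (g2 r * (s - r)) (Icc y z) r := by
    intro y z hy hz r hr
    have hsub := Icc_subset_Ioc_of_pos hy hz
    have hs : HasDerivWithinAt (fun r : ℝ => s - r) (-1) (Icc y z) r :=
      (hasDerivWithinAt_id r _).const_sub s
    refine (((d1 r (hsub hr)).mono hsub).fun_add
      (((d2 r (hsub hr)).mono hsub).fun_mul hs)).congr_deriv ?_
    ring
  have hbd : ∀ r, min s c ≤ r → r ≤ max s c → |g2 r * (s - r)| ≤ K * x ^ (σ - 2) * |s - c| := by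
    intro r h1 h2
    have hxr : x ≤ r := (le_min hxs hxc).trans h1
    rw [abs_mul]
    have := hb r ⟨hx.trans_le hxr, h2.trans (max_le hs hc)⟩
    have h3 := mul_le_mul_of_nonneg_left (rpow_sub_le hx hxr (by linarith : σ - 2 ≤ 0)) hK
    have h4 : |s - r| ≤ |s - c| := by
      rcases le_total s c with h' | h'
      · rw [min_eq_left h'] at h1; rw [max_eq_right h'] at h2
        rw [abs_of_nonpos (by linarith), abs_of_nonpos (by linarith)]; linarith
      · rw [min_eq_right h'] at h1; rw [max_eq_left h'] at h2
        rw [abs_of_nonneg (by linarith), abs_of_nonneg (by linarith)]; linarith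
    gcongr
    linarith
  rcases le_total s c with hsc | hsc
  · rw [min_eq_left hsc, max_eq_right hsc, abs_of_nonpos (sub_nonpos.2 hsc)] at hbd
    have := abs_sub_le_of_deriv_le hsc (hd s c (hx.trans_le hxs) hc) (fun r hr => hbd r hr.1 hr.2)
    rw [abs_sub_comm]
    refine le_trans (le_of_eq ?_) (this.trans (le_of_eq ?_))
    · simp
    · ring
  · rw [min_eq_right hsc, max_eq_left hsc, abs_of_nonneg (sub_nonneg.2 hsc)] at hbd
    have := abs_sub_le_of_deriv_le hsc (hd c s (hx.trans_le hxc) hs) (fun r hr => hbd r hr.1 hr.2)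
    refine le_trans (le_of_eq ?_) (this.trans (le_of_eq ?_))
    · simp
    · ring

lemma linear_taylor_le_sing {c : ℝ} (hσ : 0 < σ) (hK : 0 ≤ K) (hcont : ContinuousOn g (Icc 0 T))
    (d1 : ∀ t ∈ Ioc 0 T, HasDerivWithinAt g (g1 t) (Ioc 0 T) t)
    (d2 : ∀ t ∈ Ioc 0 T, HasDerivWithinAt g1 (g2 t) (Ioc 0 T) t)
    (hb : ∀ t ∈ Ioc 0 T, |g2 t| ≤ K * t ^ (σ - 2)) (hc0 : 0 < c) (hc : c ≤ T) :
    |g 0 - (g c + g1 c * (0 - c))| ≤ K * (c ^ σ / σ) := by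
  have key : ∀ s ∈ Ioc 0 c, |g s - (g c + g1 c * (s - c))| ≤ K * (c ^ σ / σ) := by
    intro s hs
    have := abs_sub_le_of_deriv_le_rpow (H := fun r => g r + g1 r * (s - r))
      (H' := fun r => g2 r * (s - r)) (σ := σ) (K := K) hs.1 hs.2 hσ hK
      (fun r hr => ?_) (fun r hr => ?_)
    · rw [abs_sub_comm]
      refine le_trans (le_of_eq ?_) this
      simp
    · have hsub := Icc_subset_Ioc_of_pos hs.1 hc
      have hs : HasDerivWithinAt (fun r : ℝ => s - r) (-1) (Icc s c) r :=
        (hasDerivWithinAt_id r _).const_sub s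
      refine (((d1 r (hsub hr)).mono hsub).fun_add
        (((d2 r (hsub hr)).mono hsub).fun_mul hs)).congr_deriv ?_
      ring
    · have hr0 : 0 < r := hs.1.trans_le hr.1
      have hb := hb r ⟨hr0, hr.2.trans hc⟩
      rw [abs_mul, abs_of_nonpos (show s - r ≤ 0 by linarith [hr.1])]
      have h2 : -(s - r) ≤ r := by linarith [hs.1]
      have h3 : 0 ≤ -(s - r) := by linarith [hr.1]
      calc |g2 r| * -(s - r) ≤ K * r ^ (σ - 2) * r := by gcongr
        _ = K * (r ^ (σ - 2) * r ^ (1 : ℝ)) := by rw [Real.rpow_one]; ring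
        _ = _ := by rw [← Real.rpow_add hr0, show σ - 2 + 1 = σ - 1 by ring]
  have hcont' : ContinuousOn (fun s => |g s - (g c + g1 c * (s - c))|) (Icc 0 c) :=
    ((hcont.mono (Icc_subset_Icc_right hc)).sub (by fun_prop)).abs
  have hmem : (0 : ℝ) ∈ closure (Ioc 0 c) := by
    rw [closure_Ioc hc0.ne]; exact ⟨le_rfl, hc0.le⟩
  exact ContinuousWithinAt.closure_le hmem
    ((hcont' 0 ⟨le_rfl, hc0.le⟩).mono Ioc_subset_Icc_self) continuousWithinAt_const key

/-- The size of the error of the weighted average at `t_{n-θ}`. -/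
noncomputable def avgErr (σ : ℝ) (t : ℕ → ℝ) (n : ℕ) : ℝ :=
  if n = 1 then tau t 1 ^ σ / σ else t (n - 1) ^ (σ - 2) * tau t n ^ 2

lemma quarter_rpow_le {x p : ℝ} (hx : 0 < x) (hp : -3 ≤ p) :
    (x / 4) ^ p ≤ 64 * x ^ p := by
  rw [Real.div_rpow hx.le (by norm_num)]
  rw [div_le_iff₀ (by positivity)]
  have : (4 : ℝ) ^ (-3 : ℝ) ≤ 4 ^ p := Real.rpow_le_rpow_of_exponent_le (by norm_num) hp
  have h2 : (4 : ℝ) ^ (-3 : ℝ) = 1 / 64 := by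
    rw [Real.rpow_neg (by norm_num)]; norm_num
  rw [h2] at this
  have := Real.rpow_pos_of_pos hx p
  nlinarith

/-- The error of the weighted average is that of the linear Taylor polynomial at the offset point,
since `θ (t_{n-1} - t_{n-θ}) + (1 - θ) (t_n - t_{n-θ}) = 0`. On the first interval the singular
bound at `t = 0` is used. -/
lemma wavg_sub_le {α : ℝ} {N : ℕ} {t : ℕ → ℝ} (hα : α ∈ Ioo (0 : ℝ) 1) (hm : IsMesh T N t)
    (hσ : 0 < σ) (hσ2 : σ ≤ 2) (hK : 0 ≤ K) (hcont : ContinuousOn g (Icc 0 T))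
    (d1 : ∀ t ∈ Ioc 0 T, HasDerivWithinAt g (g1 t) (Ioc 0 T) t)
    (d2 : ∀ t ∈ Ioc 0 T, HasDerivWithinAt g1 (g2 t) (Ioc 0 T) t)
    (hb : ∀ t ∈ Ioc 0 T, |g2 t| ≤ K * t ^ (σ - 2)) {n : ℕ} (h1 : 1 ≤ n) (hn : n ≤ N) :
    |wavg α (fun k => g (t k)) n - g (tOff α t n)| ≤ 130 * K * avgErr σ t n := by
  have hlt := lt_tOff hα hm h1 hn
  have hgt := tOff_lt hα hm h1 hn
  have hτ := hm.tau_pos h1 hn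
  have hT := hm.le_T hn
  have hθ0 : 0 ≤ theta α := by unfold theta; linarith [hα.1]
  have hθ1 : 0 ≤ 1 - theta α := (one_sub_theta_pos hα).le
  have hn0 := hm.nonneg (by omega : n - 1 ≤ N)
  set c := tOff α t n with hc
  have e0 : t n - t (n - 1) = tau t n := rfl
  have e : wavg α (fun k => g (t k)) n - g c
      = theta α * (g (t (n - 1)) - (g c + g1 c * (t (n - 1) - c)))
        + (1 - theta α) * (g (t n) - (g c + g1 c * (t n - c))) := by
    have hc' : theta α * (t (n - 1) - c) + (1 - theta α) * (t n - c) = 0 := by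
      rw [hc, tOff]; ring
    have : theta α * (g1 c * (t (n - 1) - c)) + (1 - theta α) * (g1 c * (t n - c)) = 0 := by
      calc _ = g1 c * (theta α * (t (n - 1) - c) + (1 - theta α) * (t n - c)) := by ring
        _ = 0 := by rw [hc', mul_zero]
    rw [wavg]
    linarith
  have comb : ∀ E : ℝ, |g (t (n - 1)) - (g c + g1 c * (t (n - 1) - c))| ≤ E →
      |g (t n) - (g c + g1 c * (t n - c))| ≤ E →
      |wavg α (fun k => g (t k)) n - g c| ≤ E := by
    intro E h1 h2
    rw [e]
    calc _ ≤ theta α * |g (t (n - 1)) - (g c + g1 c * (t (n - 1) - c))|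
          + (1 - theta α) * |g (t n) - (g c + g1 c * (t n - c))| := by
          refine (abs_add_le _ _).trans ?_
          rw [abs_mul, abs_mul, abs_of_nonneg hθ0, abs_of_nonneg hθ1]
      _ ≤ theta α * E + (1 - theta α) * E := by gcongr
      _ = E := by ring
  have sq_le : ∀ s, t (n - 1) ≤ s → s ≤ t n → (s - c) ^ 2 ≤ tau t n ^ 2 := by
    intro s h h'
    apply sq_le_sq'
    · linarith
    · linarith
  unfold avgErr
  split_ifs with hn1
  · subst hn1
    have ht0 : t 0 = 0 := hm.2.1
    have ht1 : t 1 = tau t 1 := hm.tau_one.symm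
    simp only [Nat.sub_self, ht0, ht1] at *
    set y := tau t 1
    have hc0 : 0 < c := by linarith
    apply comb
    · refine (linear_taylor_le_sing hσ hK hcont d1 d2 hb hc0 (by linarith)).trans ?_
      have : c ^ σ ≤ y ^ σ := Real.rpow_le_rpow hc0.le hgt.le hσ.le
      calc K * (c ^ σ / σ) ≤ K * (y ^ σ / σ) := by gcongr
        _ ≤ 130 * K * (y ^ σ / σ) := by
          have : 0 ≤ K * (y ^ σ / σ) := by positivity
          linarith
    · refine (linear_taylor_le (x := y / 4) hσ2 hK d1 d2 hb (by positivity) (by linarith)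
        (by linarith) (by linarith) (by linarith)).trans ?_
      have a := quarter_rpow_le hτ (by linarith : -3 ≤ σ - 2)
      have b := sq_le y (by linarith) le_rfl
      have e3 : y ^ (σ - 2) * y ^ 2 = y ^ σ := by
        rw [← Real.rpow_natCast, ← Real.rpow_add hτ]; norm_num
      calc K * (y / 4) ^ (σ - 2) * (y - c) ^ 2 ≤ K * (64 * y ^ (σ - 2)) * y ^ 2 := by gcongr
        _ = 64 * K * y ^ σ := by rw [← e3]; ring
        _ ≤ 64 * K * (2 * (y ^ σ / σ)) := by
          gcongr
          rw [← mul_div_assoc, le_div_iff₀ hσ]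
          have := Real.rpow_pos_of_pos hτ σ
          nlinarith
        _ ≤ 130 * K * (y ^ σ / σ) := by
          have : 0 ≤ K * (y ^ σ / σ) := by positivity
          linarith
  · have hpos := hm.pos (by omega : 1 ≤ n - 1) (by omega)
    have fin : ∀ s, t (n - 1) ≤ s → s ≤ t n →
        |g s - (g c + g1 c * (s - c))| ≤ 130 * K * (t (n - 1) ^ (σ - 2) * tau t n ^ 2) := by
      intro s h h'
      refine (linear_taylor_le (x := t (n - 1)) hσ2 hK d1 d2 hb hpos h
        (by linarith) (by linarith) (by linarith)).trans ?_
      have b := sq_le s h h'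
      have : 0 ≤ K * (t (n - 1) ^ (σ - 2) * tau t n ^ 2) := by positivity
      calc _ ≤ K * t (n - 1) ^ (σ - 2) * tau t n ^ 2 := by gcongr
        _ ≤ _ := by linarith
    exact comb _ (fin _ le_rfl (by linarith)) (fin _ (by linarith) le_rfl)

end taylor

/-! ### The truncation error of the Alikhanov formula -/

/-- The truncation error `(∂_τ^α g)^{n-θ} - (∂_t^α g)(t_{n-θ})`. -/
noncomputable def truncErr (α : ℝ) (t : ℕ → ℝ) (g : ℝ → ℝ) (n : ℕ) : ℝ :=
  discCaputo α t (fun k => g (t k)) n - caputo α g (tOff α t n)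

/-- The size of the cubic Taylor remainder on the interval `[t_{k-1}, t_k]`. -/
noncomputable def stepErr (σ : ℝ) (t : ℕ → ℝ) (k : ℕ) : ℝ :=
  if k = 1 then tau t 1 ^ σ / σ else t (k - 1) ^ (σ - 3) * tau t k ^ 3

/-- The size of the error of the quadratic interpolation on `[t_{k-1}, t_k]`. -/
noncomputable def histErr (σ : ℝ) (t : ℕ → ℝ) (k : ℕ) : ℝ :=
  2 * stepErr σ t k + (tau t k / tau t (k + 1)) ^ 2 * stepErr σ t (k + 1)

lemma abs_integral_mul_deriv_le {w w' F F' : ℝ → ℝ} {x y E : ℝ} (hxy : x ≤ y)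
    (hw : ∀ s ∈ Icc x y, HasDerivAt w (w' s) s) (hc : ContinuousOn w' (Icc x y))
    (h0 : ∀ s ∈ Icc x y, 0 ≤ w' s) (hF : ContinuousOn F (Icc x y))
    (hF' : ∀ s ∈ Ioo x y, HasDerivAt F (F' s) s) (hi : IntervalIntegrable F' volume x y)
    (hE : ∀ s ∈ Icc x y, |F s| ≤ E) :
    |∫ s in x..y, w s * F' s| ≤ |w y * F y - w x * F x| + E * (w y - w x) := by
  have hu : uIcc x y = Icc x y := uIcc_of_le hxy
  have hwi : IntervalIntegrable w' volume x y := (hu ▸ hc).intervalIntegrable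
  have hint : ∫ s in x..y, w' s = w y - w x :=
    intervalIntegral.integral_eq_sub_of_hasDerivAt (by rwa [hu]) hwi
  rw [intervalIntegral.integral_mul_deriv_eq_deriv_mul_of_hasDerivAt (u := w) (v := F)
    (fun s hs => (hw s (hu ▸ hs)).continuousAt.continuousWithinAt) (hu ▸ hF)
    (fun s hs => hw s (by rw [min_eq_left hxy, max_eq_right hxy] at hs; exact Ioo_subset_Icc_self hs))
    (fun s hs => hF' s (by rwa [min_eq_left hxy, max_eq_right hxy] at hs)) hwi hi]
  refine (abs_sub _ _).trans (add_le_add le_rfl ?_)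
  rw [← hint, ← intervalIntegral.integral_const_mul]
  refine (intervalIntegral.abs_integral_le_integral_abs hxy).trans
    (intervalIntegral.integral_mono_on hxy ?_ (hwi.const_mul _) fun s hs => ?_)
  · exact (ContinuousOn.intervalIntegrable (by rw [hu]; exact (hc.mul hF).abs))
  · rw [abs_mul, abs_of_nonneg (h0 s hs), mul_comm]
    exact mul_le_mul_of_nonneg_right (hE s hs) (h0 s hs)

section trunc

variable {α T σ K : ℝ} {N : ℕ} {t : ℕ → ℝ} {g g1 g2 g3 : ℝ → ℝ}

lemma continuousOn_wt {n : ℕ} {x y : ℝ} (hy : y < tOff α t n) :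
    ContinuousOn (wt α t n) (Icc x y) := fun _ hs =>
  (hasDerivAt_omega (hs.2.trans_lt hy)).continuousAt.continuousWithinAt

lemma TimeReg.continuousOn_g1 (h : TimeReg T σ K g g1 g2 g3) {x y : ℝ} (hx : 0 < x) (hy : y ≤ T) :
    ContinuousOn g1 (Icc x y) := fun s hs =>
  ((h.d2 s (Icc_subset_Ioc_of_pos hx hy hs)).mono (Icc_subset_Ioc_of_pos hx hy)).continuousWithinAt

lemma TimeReg.hasDerivAt (h : TimeReg T σ K g g1 g2 g3) {s : ℝ} (hs : s ∈ Ioo 0 T) :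
    HasDerivAt g (g1 s) s :=
  (h.d1 s (Ioo_subset_Ioc_self hs)).hasDerivAt (Ioc_mem_nhds hs.1 hs.2)

lemma tOff_lt_T (hα : α ∈ Ioo (0 : ℝ) 1) (hm : IsMesh T N t) {n : ℕ} (h1 : 1 ≤ n) (hn : n ≤ N) :
    tOff α t n < T := (tOff_lt hα hm h1 hn).trans_le (hm.le_T hn)

lemma tOff_pos (hα : α ∈ Ioo (0 : ℝ) 1) (hm : IsMesh T N t) {n : ℕ} (h1 : 1 ≤ n) (hn : n ≤ N) :
    0 < tOff α t n := by
  have := lt_tOff hα hm h1 hn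
  have := hm.tau_pos h1 hn
  have := hm.nonneg (by omega : n - 1 ≤ N)
  linarith

lemma TimeReg.intervalIntegrable_mul (h : TimeReg T σ K g g1 g2 g3) (hα : α ∈ Ioo (0 : ℝ) 1)
    (hm : IsMesh T N t) {n : ℕ} (h1 : 1 ≤ n) (hn : n ≤ N) {x y : ℝ} (hx : 0 ≤ x) (hxy : x ≤ y)
    (hy : y ≤ tOff α t n) : IntervalIntegrable (fun s => wt α t n s * g1 s) volume x y := by
  have hT := tOff_lt_T hα hm h1 hn
  have hp := tOff_pos hα hm h1 hn
  set c := tOff α t n with hc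
  have hsub : ∀ {x y : ℝ}, 0 ≤ x → x ≤ y → y ≤ T → IntervalIntegrable g1 volume x y := by
    intro x y h0 h1 h2
    exact h.int.mono_set (by
      rw [uIcc_of_le h1, uIcc_of_le (h0.trans (h1.trans h2))]; exact Icc_subset_Icc h0 h2)
  have i1 : IntervalIntegrable (fun s => wt α t n s * g1 s) volume 0 (c / 2) :=
    (hsub le_rfl (by linarith) (by linarith)).continuousOn_mul
      (by rw [uIcc_of_le (by linarith)]; exact continuousOn_wt (by linarith))
  have i2 : IntervalIntegrable (fun s => wt α t n s * g1 s) volume (c / 2) c :=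
    (intervalIntegrable_omega hα c _ _).mul_continuousOn
      (by rw [uIcc_of_le (by linarith)]; exact h.continuousOn_g1 (by linarith) hT.le)
  exact (i1.trans i2).mono_set (by
    rw [uIcc_of_le hxy, uIcc_of_le hp.le]; exact Icc_subset_Icc hx hy)

lemma TimeReg.caputo_eq (h : TimeReg T σ K g g1 g2 g3) (hα : α ∈ Ioo (0 : ℝ) 1)
    (hm : IsMesh T N t) {n : ℕ} (h1 : 1 ≤ n) (hn : n ≤ N) :
    caputo α g (tOff α t n) = ∫ s in (0 : ℝ)..tOff α t n, wt α t n s * g1 s := by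
  have hT := tOff_lt_T hα hm h1 hn
  have hp := tOff_pos hα hm h1 hn
  unfold caputo
  refine intervalIntegral.integral_congr_ae (Filter.Eventually.of_forall fun s hs => ?_)
  rw [uIoc_of_le hp.le] at hs
  rw [(h.hasDerivAt ⟨hs.1, hs.2.trans_lt hT⟩).deriv]
  rfl

lemma sum_kernel_rearrange (a b q x : ℕ → ℝ) (m : ℕ) :
    ∑ k ∈ Finset.Icc 1 (m + 1), (a k + (if 2 ≤ k then q (k - 1) else 0)
      - (if k < m + 1 then b k else 0)) * x k
      = ∑ k ∈ Finset.Icc 1 m, (a k * x k + (q k * x (k + 1) - b k * x k))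
        + a (m + 1) * x (m + 1) := by
  have e1 : ∀ m, ∑ k ∈ Finset.Icc 1 (m + 1), (if 2 ≤ k then q (k - 1) else 0) * x k
      = ∑ k ∈ Finset.Icc 1 m, q k * x (k + 1) := by
    intro m
    induction m with
    | zero => simp
    | succ m ih =>
      rw [Finset.sum_Icc_succ_top (by omega), ih, Finset.sum_Icc_succ_top (by omega)]
      simp
  have e2 : ∑ k ∈ Finset.Icc 1 (m + 1), (if k < m + 1 then b k else 0) * x k
      = ∑ k ∈ Finset.Icc 1 m, b k * x k := by
    rw [Finset.sum_Icc_succ_top (by omega)]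
    simp only [lt_irrefl, if_false, zero_mul, add_zero]
    refine Finset.sum_congr rfl fun k hk => ?_
    rw [Finset.mem_Icc] at hk
    rw [if_pos (by omega)]
  simp_rw [sub_mul, add_mul]
  rw [Finset.sum_sub_distrib, Finset.sum_add_distrib, e1, e2, Finset.sum_Icc_succ_top (by omega),
    Finset.sum_add_distrib, Finset.sum_sub_distrib]
  ring

/-- The derivative of the quadratic interpolant of `g` at `t_{k-1}, t_k, t_{k+1}`. -/
noncomputable def quadDeriv (t : ℕ → ℝ) (g : ℝ → ℝ) (k : ℕ) (s : ℝ) : ℝ :=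
  (g (t k) - g (t (k - 1))) / tau t k
    + 2 * (ratio t k * (g (t (k + 1)) - g (t k)) - (g (t k) - g (t (k - 1))))
      / (tau t k * (tau t k + tau t (k + 1))) * (s - (t (k - 1) + t k) / 2)

lemma sum_integral_pieces {f : ℝ → ℝ} {m : ℕ} (hf : ∀ k, 1 ≤ k → k ≤ m →
    IntervalIntegrable f volume (t (k - 1)) (t k)) :
    ∑ k ∈ Finset.Icc 1 m, ∫ s in t (k - 1)..t k, f s = ∫ s in t 0..t m, f s := by
  induction m with
  | zero => simp
  | succ m ih =>
    have hi : ∀ j ≤ m, IntervalIntegrable f volume (t 0) (t j) := by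
      intro j
      induction j with
      | zero => simp
      | succ j ihj => exact fun hj => (ihj (by omega)).trans (by simpa using hf (j + 1) (by omega) (by omega))
    rw [Finset.sum_Icc_succ_top (by omega), ih fun k h1 h2 => hf k h1 (by omega),
      Nat.add_sub_cancel, intervalIntegral.integral_add_adjacent_intervals (hi m le_rfl)
        (by simpa using hf (m + 1) (by omega) le_rfl)]

/-- The formula integrates the derivative of the piecewise interpolant exactly. -/
lemma TimeReg.truncErr_eq (h : TimeReg T σ K g g1 g2 g3) (hα : α ∈ Ioo (0 : ℝ) 1)
    (hm : IsMesh T N t) {n : ℕ} (h1 : 1 ≤ n) (hn : n ≤ N) :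
    truncErr α t g n
      = (∑ k ∈ Finset.Icc 1 (n - 1),
          ∫ s in t (k - 1)..t k, wt α t n s * (quadDeriv t g k s - g1 s))
        + ∫ s in t (n - 1)..tOff α t n,
            wt α t n s * ((g (t n) - g (t (n - 1))) / tau t n - g1 s) := by
  obtain ⟨m, rfl⟩ : ∃ m, n = m + 1 := ⟨n - 1, by omega⟩
  have hlast := lt_tOff_of_lt hα hm (Nat.lt_succ_self m) hn
  have hwi : ∀ x y, IntervalIntegrable (wt α t (m + 1)) volume x y := fun x y =>
    intervalIntegrable_omega hα _ x y
  have hint : ∀ k, 1 ≤ k → k ≤ m →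
      IntervalIntegrable (fun s => wt α t (m + 1) s * g1 s) volume (t (k - 1)) (t k) :=
    fun k hk hkm => h.intervalIntegrable_mul hα hm h1 hn (hm.nonneg (by omega))
      (hm.mono (by omega) (by omega)) ((hm.mono hkm (by omega)).trans hlast.le)
  have hint' := h.intervalIntegrable_mul hα hm h1 hn (hm.nonneg (by omega : m ≤ N)) hlast.le le_rfl
  simp only [Nat.add_sub_cancel]
  have hpiece : ∀ k ∈ Finset.Icc 1 m,
      ∫ s in t (k - 1)..t k, wt α t (m + 1) s * (quadDeriv t g k s - g1 s)
      = (coefA α t (m + 1) k * (g (t k) - g (t (k - 1)))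
        + (ratio t k * coefB α t (m + 1) k * (g (t (k + 1)) - g (t k))
          - coefB α t (m + 1) k * (g (t k) - g (t (k - 1)))))
        - ∫ s in t (k - 1)..t k, wt α t (m + 1) s * g1 s := by
    intro k hk
    rw [Finset.mem_Icc] at hk
    have hτ := hm.tau_pos hk.1 (by omega)
    have hτ' := hm.tau_pos (by omega : 1 ≤ k + 1) (by omega)
    set c1 := (g (t k) - g (t (k - 1))) / tau t k with hc1
    set c2 := 2 * (ratio t k * (g (t (k + 1)) - g (t k)) - (g (t k) - g (t (k - 1))))
      / (tau t k * (tau t k + tau t (k + 1))) with hc2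
    have e : ∀ s, wt α t (m + 1) s * (quadDeriv t g k s - g1 s)
        = (c1 * wt α t (m + 1) s + c2 * ((s - (t (k - 1) + t k) / 2) * wt α t (m + 1) s))
          - wt α t (m + 1) s * g1 s := by
      intro s
      rw [quadDeriv]
      ring
    simp_rw [e]
    have i2 : IntervalIntegrable
        (fun s => (s - (t (k - 1) + t k) / 2) * wt α t (m + 1) s) volume (t (k - 1)) (t k) :=
      (hwi _ _).continuousOn_mul (by fun_prop)
    rw [intervalIntegral.integral_sub (((hwi _ _).const_mul _).add (i2.const_mul _))
      (hint k hk.1 hk.2), intervalIntegral.integral_add ((hwi _ _).const_mul _) (i2.const_mul _),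
      intervalIntegral.integral_const_mul, intervalIntegral.integral_const_mul,
      coefA_of_lt (by omega), coefB]
    simp only [wt]
    rw [hc1, hc2]
    ring
  have hlastpiece : ∫ s in t m..tOff α t (m + 1),
      wt α t (m + 1) s * ((g (t (m + 1)) - g (t m)) / tau t (m + 1) - g1 s)
      = coefA α t (m + 1) (m + 1) * (g (t (m + 1)) - g (t m))
        - ∫ s in t m..tOff α t (m + 1), wt α t (m + 1) s * g1 s := by
    simp_rw [mul_sub]
    rw [intervalIntegral.integral_sub (((hwi _ _).mul_const _)) hint',
      intervalIntegral.integral_mul_const, coefA, if_pos rfl]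
    simp only [wt, Nat.add_sub_cancel]
    ring
  have hsplit : caputo α g (tOff α t (m + 1))
      = ∑ k ∈ Finset.Icc 1 m, (∫ s in t (k - 1)..t k, wt α t (m + 1) s * g1 s)
        + ∫ s in t m..tOff α t (m + 1), wt α t (m + 1) s * g1 s := by
    rw [h.caputo_eq hα hm h1 hn, sum_integral_pieces hint, hm.2.1,
      intervalIntegral.integral_add_adjacent_intervals _ hint']
    exact h.intervalIntegrable_mul hα hm h1 hn le_rfl (hm.nonneg (by omega)) hlast.le
  rw [Finset.sum_congr rfl hpiece, Finset.sum_sub_distrib, hlastpiece, truncErr, hsplit, discCaputo]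
  have := sum_kernel_rearrange (coefA α t (m + 1)) (coefB α t (m + 1))
    (fun k => ratio t k * coefB α t (m + 1) k) (fun k => g (t k) - g (t (k - 1))) m
  unfold kernelA
  simp only [Nat.add_sub_cancel] at this
  rw [this]
  ring

lemma stepErr_nonneg (hm : IsMesh T N t) (hσ : 0 < σ) {k : ℕ} (h1 : 1 ≤ k) (hk : k ≤ N) :
    0 ≤ stepErr σ t k := by
  have := hm.tau_pos h1 hk
  have := hm.nonneg (by omega : k - 1 ≤ N)
  unfold stepErr
  split_ifs with h
  · subst h; positivity
  · positivity

lemma TimeReg.rem2_le_stepErr (h : TimeReg T σ K g g1 g2 g3) (hσ : 0 < σ) (hσ3 : σ ≤ 3)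
    (hK : 0 ≤ K) (hm : IsMesh T N t) {k : ℕ} (h1 : 1 ≤ k) (hk : k ≤ N) {s : ℝ}
    (hs : s ∈ Icc (t (k - 1)) (t k)) : |rem2 g g1 g2 (t k) s| ≤ K / 2 * stepErr σ t k := by
  have hT := hm.le_T hk
  unfold stepErr
  split_ifs with h'
  · subst h'
    rw [hm.tau_one]
    exact h.rem2_le_sing hσ hK ((hm.nonneg (by omega)).trans hs.1) hs.2 (hm.pos le_rfl hk) hT
  · have h0 := hm.pos (by omega : 1 ≤ k - 1) (by omega)
    refine (h.rem2_le hσ3 hK h0 hs.1 (hm.mono (by omega) hk) (hs.2.trans hT) hT).trans ?_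
    have : |s - t k| ^ 3 ≤ tau t k ^ 3 := by
      refine pow_le_pow_left₀ (abs_nonneg _) ?_ 3
      rw [abs_of_nonpos (by linarith [hs.2])]
      unfold tau; linarith [hs.1]
    calc _ ≤ K * t (k - 1) ^ (σ - 3) / 2 * tau t k ^ 3 := by gcongr
      _ = _ := by ring

lemma hasDerivAt_rem2 {c s : ℝ} (hg : HasDerivAt g (g1 s) s) :
    HasDerivAt (rem2 g g1 g2 c) (rem2' g1 g2 c s) s := by
  have hs : HasDerivAt (fun r : ℝ => r - c) 1 s := (hasDerivAt_id' s).sub_const c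
  refine (hg.fun_sub (((hs.const_mul (g1 c)).const_add (g c)).fun_add
    ((hs.fun_pow 2).const_mul (g2 c / 2)))).congr_deriv ?_
  unfold rem2'
  norm_num
  ring

/-- The contribution of an earlier interval to the truncation error: integration by parts moves the
derivative from the interpolation error `F`, which vanishes at both ends of the interval, to the
monotone weight. -/
lemma TimeReg.hist_le (h : TimeReg T σ K g g1 g2 g3) (hα : α ∈ Ioo (0 : ℝ) 1) (hσ : 0 < σ)
    (hσ3 : σ ≤ 3) (hK : 0 ≤ K) (hm : IsMesh T N t) {n k : ℕ} (h1 : 1 ≤ k) (hk : k < n)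
    (hn : n ≤ N) :
    |∫ s in t (k - 1)..t k, wt α t n s * (quadDeriv t g k s - g1 s)|
      ≤ K * histErr σ t k * (wt α t n (t k) - wt α t n (t (k - 1))) := by
  have hlast := lt_tOff_of_lt hα hm hk hn
  have hle := hm.mono (by omega : k - 1 ≤ k) (by omega)
  have hτ := hm.tau_pos h1 (by omega)
  have hτ' := hm.tau_pos (by omega : 1 ≤ k + 1) (by omega)
  have htk := hm.pos h1 (by omega)
  have hT1 := hm.le_T (by omega : k + 1 ≤ N)
  set G := rem2 g g1 g2 (t k) with hG
  set m := K / 2 * stepErr σ t k with hmdef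
  have hGm : ∀ s ∈ Icc (t (k - 1)) (t k), |G s| ≤ m := fun s hs =>
    h.rem2_le_stepErr hσ hσ3 hK hm h1 (by omega) hs
  have hm0 : 0 ≤ m := (abs_nonneg _).trans (hGm _ ⟨hle, le_rfl⟩)
  have hG1 : |G (t (k + 1))| ≤ K / 2 * stepErr σ t (k + 1) := by
    have hle' := hm.mono (by omega : k ≤ k + 1) (by omega)
    refine (h.rem2_le hσ3 hK htk hle' le_rfl hT1 (hle'.trans hT1)).trans (le_of_eq ?_)
    rw [stepErr, if_neg (by omega), ← tau_succ, abs_of_pos hτ', Nat.add_sub_cancel]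
    ring
  have hGk : G (t k) = 0 := by rw [hG, rem2]; ring
  -- quadratic polynomials are interpolated exactly, so `F` is the interpolation error of the
  -- Taylor remainder `G`; the interpolant is written in Newton form, with `G (t_k) = 0`
  set D := (G (t (k + 1)) / tau t (k + 1) + G (t (k - 1)) / tau t k)
    / (tau t k + tau t (k + 1)) with hD
  set F : ℝ → ℝ := fun s => (G (t (k - 1)) * (1 - (s - t (k - 1)) / tau t k)
    + D * ((s - t (k - 1)) * (s - t k))) - G s with hF
  have htau : t k = t (k - 1) + tau t k := by unfold tau; ring
  have htau' : t (k + 1) = t (k - 1) + tau t k + tau t (k + 1) := by unfold tau; simp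
  have hFd : ∀ s ∈ Ioo (t (k - 1)) (t k), HasDerivAt F (quadDeriv t g k s - g1 s) s := by
    intro s hs
    have hs0 : s ∈ Ioo 0 T := ⟨(hm.nonneg (by omega)).trans_lt hs.1,
      hs.2.trans_le (hm.le_T (by omega))⟩
    have d1 : HasDerivAt (fun s : ℝ => s - t (k - 1)) 1 s := (hasDerivAt_id' s).sub_const _
    have d2 : HasDerivAt (fun s : ℝ => s - t k) 1 s := (hasDerivAt_id' s).sub_const _
    refine (((((d1.div_const (tau t k)).const_sub 1).const_mul (G (t (k - 1)))).fun_add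
      ((d1.fun_mul d2).const_mul D)).fun_sub (hasDerivAt_rem2 (h.hasDerivAt hs0))).congr_deriv ?_
    rw [hD, hG, quadDeriv, ratio, rem2', rem2, rem2]
    generalize g (t (k + 1)) = A1
    generalize g (t (k - 1)) = A2
    generalize g (t k) = A3
    generalize g1 (t k) = B1
    generalize g2 (t k) = B2
    rw [htau', htau]
    generalize t (k - 1) = z
    field_simp
    ring
  have hFc : ContinuousOn F (Icc (t (k - 1)) (t k)) := by
    have : ContinuousOn G (Icc (t (k - 1)) (t k)) := by
      rw [hG]; unfold rem2
      exact (h.cont.mono (Icc_subset_Icc (hm.nonneg (by omega)) (hm.le_T (by omega)))).sub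
        (by fun_prop)
    rw [hF]
    exact ContinuousOn.sub (by fun_prop) this
  have hFE : ∀ s ∈ Icc (t (k - 1)) (t k), |F s| ≤ K * histErr σ t k := by
    intro s hs
    have a1 : |G (t (k - 1)) * (1 - (s - t (k - 1)) / tau t k)| ≤ m := by
      rw [abs_mul]
      have hq : (s - t (k - 1)) / tau t k ≤ 1 := by
        rw [div_le_one hτ]; unfold tau; linarith [hs.2]
      have hq0 : 0 ≤ (s - t (k - 1)) / tau t k := div_nonneg (by linarith [hs.1]) hτ.le
      have : |1 - (s - t (k - 1)) / tau t k| ≤ 1 := by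
        rw [abs_le]; constructor <;> linarith
      calc _ ≤ m * 1 := by
            apply mul_le_mul (hGm _ ⟨le_rfl, hle⟩) this (abs_nonneg _) hm0
        _ = m := mul_one m
    have a2 : |(s - t (k - 1)) * (s - t k)| ≤ tau t k ^ 2 := by
      rw [abs_mul, abs_of_nonneg (by linarith [hs.1]), abs_of_nonpos (by linarith [hs.2]), sq]
      apply mul_le_mul _ _ (by linarith [hs.2]) hτ.le
      · unfold tau; linarith [hs.2]
      · unfold tau; linarith [hs.1]
    have a3 : |D| * tau t k ^ 2
        ≤ (tau t k / tau t (k + 1)) ^ 2 * (K / 2 * stepErr σ t (k + 1)) + m := by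
      have b1 : |D| ≤ (K / 2 * stepErr σ t (k + 1) / tau t (k + 1) + m / tau t k)
          / (tau t k + tau t (k + 1)) := by
        rw [hD, abs_div, abs_of_pos (by positivity : 0 < tau t k + tau t (k + 1))]
        gcongr
        refine (abs_add_le _ _).trans ?_
        rw [abs_div, abs_div, abs_of_pos hτ, abs_of_pos hτ']
        have := hGm _ ⟨le_rfl, hle⟩
        gcongr
      have hS := (abs_nonneg _).trans hG1
      set S := K / 2 * stepErr σ t (k + 1)
      set p := tau t k
      set q := tau t (k + 1)
      calc |D| * p ^ 2 ≤ ((S / q + m / p) / (p + q)) * p ^ 2 := by gcongr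
        _ = S * (p ^ 2 / (q * (p + q))) + m * (p / (p + q)) := by field_simp
        _ ≤ S * (p ^ 2 / (q * q)) + m * 1 := by
          gcongr
          · linarith
          · rw [div_le_one (by positivity)]; linarith
        _ = _ := by field_simp
    calc |F s| ≤ |G (t (k - 1)) * (1 - (s - t (k - 1)) / tau t k)|
          + |D * ((s - t (k - 1)) * (s - t k))| + |G s| :=
          (abs_sub _ _).trans (add_le_add (abs_add_le _ _) le_rfl)
      _ ≤ m + |D| * tau t k ^ 2 + m := by
          rw [abs_mul D]
          have := hGm s hs
          gcongr
      _ ≤ m + ((tau t k / tau t (k + 1)) ^ 2 * (K / 2 * stepErr σ t (k + 1)) + m) + m := by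
          gcongr
      _ ≤ K * histErr σ t k := by
          have hS : 0 ≤ (tau t k / tau t (k + 1)) ^ 2 * (K / 2 * stepErr σ t (k + 1)) :=
            mul_nonneg (sq_nonneg _) ((abs_nonneg _).trans hG1)
          unfold histErr
          rw [hmdef] at hm0 ⊢
          linarith
  have hgi : IntervalIntegrable g1 volume (t (k - 1)) (t k) := h.int.mono_set (by
    rw [uIcc_of_le hle, uIcc_of_le (htk.le.trans (hm.le_T (by omega)))]
    exact Icc_subset_Icc (hm.nonneg (by omega)) (hm.le_T (by omega)))
  have := abs_integral_mul_deriv_le (w := wt α t n) hle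
    (fun s hs => hasDerivAt_omega (hs.2.trans_lt hlast)) (continuousOn_omegaDeriv hlast)
    (fun s hs => omegaDeriv_nonneg hα (hs.2.trans_lt hlast)) hFc hFd
    ((Continuous.intervalIntegrable (by unfold quadDeriv; fun_prop) _ _).sub hgi) hFE
  have hF0 : F (t (k - 1)) = 0 := by simp [hF]
  have hF1 : F (t k) = 0 := by
    have : t k - t (k - 1) = tau t k := rfl
    simp [hF, hGk, this, hτ.ne']
  rw [hF0, hF1] at this
  simpa using this

lemma integral_wt (hα : α ∈ Ioo (0 : ℝ) 1) (n : ℕ) (x : ℝ) : ∫ s in x..tOff α t n, wt α t n s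
    = (tOff α t n - x) ^ (1 - α) / Real.Gamma (2 - α) := by
  unfold wt
  rw [integral_omega hα, sub_self, Real.zero_rpow (by linarith [hα.2]), sub_zero]

lemma integral_wt_last_le (hα : α ∈ Ioo (0 : ℝ) 1) (hm : IsMesh T N t) {n : ℕ} (h1 : 1 ≤ n)
    (hn : n ≤ N) : ∫ s in t (n - 1)..tOff α t n, wt α t n s
      ≤ tau t n * (tau t n ^ (-α) / Real.Gamma (2 - α)) := by
  have h2 := hm.tau_pos h1 hn
  have h := coefA_self_le hα hm h1 hn
  rw [coefA, if_pos rfl, div_le_iff₀ h2] at h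
  rw [mul_comm]
  exact h

/-- With the offset `θ = α/2` the linear interpolation on the last interval is exact for
quadratic polynomials. -/
lemma integral_wt_mul_sub_mid (hα : α ∈ Ioo (0 : ℝ) 1) (hm : IsMesh T N t) {n : ℕ} (h1 : 1 ≤ n)
    (hn : n ≤ N) : ∫ s in t (n - 1)..tOff α t n, wt α t n s * (s - (t (n - 1) + t n) / 2) = 0 := by
  have hlast := lt_tOff_of_lt hα hm (by omega : n - 1 < n) hn
  have hτ := hm.tau_pos h1 hn
  set c := tOff α t n with hc
  set mid := (t (n - 1) + t n) / 2 with hmid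
  have e : ∫ s in t (n - 1)..c, wt α t n s * (s - mid)
      = ∫ s in t (n - 1)..c, ((c - mid) * wt α t n s
        - (c - s) ^ (1 - α) / Real.Gamma (1 - α)) := by
    refine intervalIntegral.integral_congr fun s hs => ?_
    rw [uIcc_of_le hlast.le] at hs
    have h0 : 0 ≤ c - s := by linarith [hs.2]
    have : (c - s) ^ (1 - α) = (c - s) ^ (1 - α - 1) * (c - s) := by
      rw [← Real.rpow_add_one' h0 (by linarith [hα.2])]
      ring_nf
    simp only [wt, omega, this, ← hc]
    ring
  have hi : IntervalIntegrable (fun s => (c - s) ^ (1 - α) / Real.Gamma (1 - α)) volume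
      (t (n - 1)) c := by
    apply Continuous.intervalIntegrable
    exact (Continuous.rpow_const (by fun_prop)
      fun s => Or.inr (by linarith [hα.2])).div_const _
  have hwi : IntervalIntegrable (wt α t n) volume (t (n - 1)) c :=
    intervalIntegrable_omega hα _ _ _
  rw [e, intervalIntegral.integral_sub (hwi.const_mul _) hi,
    intervalIntegral.integral_const_mul, integral_wt hα, intervalIntegral.integral_div,
    intervalIntegral.integral_comp_sub_left (fun r => r ^ (1 - α)) c,
    integral_rpow (Or.inl (by linarith [hα.2])), sub_self,
    Real.zero_rpow (by linarith [hα.2]), Gamma_two_sub hα, ← hc]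
  have hL : c - t (n - 1) = (1 - α / 2) * tau t n := by
    rw [hc, tOff_eq]; unfold theta; ring
  have hcm : c - mid = (1 - α) / 2 * tau t n := by
    rw [hc, hmid, tOff_eq]; unfold theta tau; ring
  have hLpos : 0 < c - t (n - 1) := by linarith
  rw [show 1 - α + 1 = (1 - α) + 1 by ring, Real.rpow_add_one hLpos.ne', hcm]
  have hG := (Gamma_one_sub_pos hα).ne'
  have h3 : 1 - α ≠ 0 := by linarith [hα.2]
  have h4 : 1 - α + 1 ≠ 0 := by linarith [hα.2]
  generalize (c - t (n - 1)) ^ (1 - α) = X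
  rw [hL]
  field_simp
  ring

/-- The contribution of the last interval to the truncation error. The quadratic Taylor polynomial at
`t_n` contributes nothing by `integral_wt_mul_sub_mid`, so that only its remainder is left. -/
lemma TimeReg.last_le (h : TimeReg T σ K g g1 g2 g3) (hα : α ∈ Ioo (0 : ℝ) 1) (hσ : 0 < σ)
    (hσ3 : σ ≤ 3) (hK : 0 ≤ K) (hm : IsMesh T N t) {n : ℕ} (h1 : 1 ≤ n) (hn : n ≤ N) :
    |∫ s in t (n - 1)..tOff α t n, wt α t n s * ((g (t n) - g (t (n - 1))) / tau t n - g1 s)|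
      ≤ 300 * K * (stepErr σ t n * (tau t n ^ (-α) / Real.Gamma (2 - α))) := by
  have hlast := lt_tOff_of_lt hα hm (by omega : n - 1 < n) hn
  have hmidlt := lt_tOff hα hm h1 hn
  have hτ := hm.tau_pos h1 hn
  have hgt := tOff_lt hα hm h1 hn
  have hT := hm.le_T hn
  have hΓ := Gamma_two_sub_pos hα
  have hn0 := hm.nonneg (by omega : n - 1 ≤ N)
  have hle : t (n - 1) ≤ t n := by linarith
  set c := tOff α t n with hc
  set S := stepErr σ t n with hS
  have hS0 : 0 ≤ S := stepErr_nonneg hm hσ h1 hn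
  set ω := tau t n ^ (-α) / Real.Gamma (2 - α) with hω
  have hω0 : 0 < ω := by positivity
  set G0 := rem2 g g1 g2 (t n) (t (n - 1)) with hG0
  have hG0le : |G0| ≤ K / 2 * S := h.rem2_le_stepErr hσ hσ3 hK hm h1 hn ⟨le_rfl, hle⟩
  have hwi : ∀ x y, IntervalIntegrable (wt α t n) volume x y := fun x y =>
    intervalIntegrable_omega hα _ x y
  have hg1i := h.intervalIntegrable_mul hα hm h1 hn hn0 hlast.le le_rfl
  have hwsi : ∀ (r x y : ℝ), IntervalIntegrable (fun s => wt α t n s * (s - r)) volume x y :=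
    fun r x y => (hwi x y).mul_continuousOn (by fun_prop)
  have hri : IntervalIntegrable (fun s => wt α t n s * rem2' g1 g2 (t n) s) volume
      (t (n - 1)) c := by
    have : (fun s => wt α t n s * rem2' g1 g2 (t n) s) = fun s => wt α t n s * g1 s
        - (wt α t n s * g1 (t n) + g2 (t n) * (wt α t n s * (s - t n))) := by
      ext s; rw [rem2']; ring
    rw [this]
    exact hg1i.sub (((hwi _ _).mul_const _).add ((hwsi _ _ _).const_mul _))
  have e : ∫ s in t (n - 1)..c, wt α t n s * ((g (t n) - g (t (n - 1))) / tau t n - g1 s)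
      = -(G0 / tau t n) * (∫ s in t (n - 1)..c, wt α t n s)
        - ∫ s in t (n - 1)..c, wt α t n s * rem2' g1 g2 (t n) s := by
    have e1 : ∀ s, wt α t n s * ((g (t n) - g (t (n - 1))) / tau t n - g1 s)
        = (-(G0 / tau t n) * wt α t n s - wt α t n s * rem2' g1 g2 (t n) s)
          - g2 (t n) * (wt α t n s * (s - (t (n - 1) + t n) / 2)) := by
      intro s
      have htau : t n = t (n - 1) + tau t n := by unfold tau; ring
      rw [hG0, rem2, rem2']
      generalize g (t (n - 1)) = A2
      generalize g (t n) = A3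
      generalize g1 (t n) = B1
      generalize g2 (t n) = B2
      rw [htau]
      field_simp
      ring
    simp_rw [e1]
    rw [intervalIntegral.integral_sub (((hwi _ _).const_mul _).sub hri)
      ((hwsi _ _ _).const_mul _), intervalIntegral.integral_const_mul (g2 (t n)),
      integral_wt_mul_sub_mid hα hm h1 hn, mul_zero, sub_zero,
      intervalIntegral.integral_sub ((hwi _ _).const_mul _) hri,
      intervalIntegral.integral_const_mul]
  have hW := integral_wt_last_le hα hm h1 hn
  rw [← hc, ← hω] at hW
  have hW0 : 0 ≤ ∫ s in t (n - 1)..c, wt α t n s :=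
    intervalIntegral.integral_nonneg hlast.le fun s hs => wt_nonneg hα hs.2
  have hfirst : |-(G0 / tau t n) * (∫ s in t (n - 1)..c, wt α t n s)| ≤ K * (S * ω) := by
    rw [abs_mul, abs_neg, abs_div, abs_of_pos hτ, abs_of_nonneg hW0]
    calc |G0| / tau t n * (∫ s in t (n - 1)..c, wt α t n s)
        ≤ K / 2 * S / tau t n * (tau t n * ω) := by gcongr
      _ = K / 2 * (S * ω) := by field_simp
      _ ≤ _ := by
        have : 0 ≤ K * (S * ω) := by positivity
        linarith
  -- where `|rem2'| ≤ B`, the weight contributes at most its integral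
  have hpart : ∀ x B : ℝ, t (n - 1) ≤ x → x ≤ c → 0 ≤ B →
      (∀ s ∈ Icc x c, |rem2' g1 g2 (t n) s| ≤ B) →
      |∫ s in x..c, wt α t n s * rem2' g1 g2 (t n) s| ≤ B * (tau t n * ω) := by
    intro x B hx hxc hB hb
    have hii := hri.mono_set (by
      rw [uIcc_of_le hxc, uIcc_of_le hlast.le]; exact Icc_subset_Icc_left hx :
        uIcc x c ⊆ uIcc (t (n - 1)) c)
    calc _ ≤ ∫ s in x..c, |wt α t n s * rem2' g1 g2 (t n) s| :=
          intervalIntegral.abs_integral_le_integral_abs hxc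
      _ ≤ ∫ s in x..c, B * wt α t n s := by
          apply intervalIntegral.integral_mono_on hxc hii.abs ((hwi _ _).const_mul _)
          intro s hs
          rw [abs_mul, abs_of_nonneg (wt_nonneg hα hs.2), mul_comm]
          exact mul_le_mul_of_nonneg_right (hb s hs) (wt_nonneg hα hs.2)
      _ = B * ∫ s in x..c, wt α t n s := intervalIntegral.integral_const_mul _ _
      _ ≤ B * ∫ s in t (n - 1)..c, wt α t n s := by
          apply mul_le_mul_of_nonneg_left _ hB
          rw [integral_wt hα, integral_wt hα]
          have : (c - x) ^ (1 - α) ≤ (c - t (n - 1)) ^ (1 - α) :=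
            Real.rpow_le_rpow (by linarith) (by linarith) (by linarith [hα.2])
          rw [← hc]
          gcongr
      _ ≤ B * (tau t n * ω) := by gcongr
  have hsecond : |∫ s in t (n - 1)..c, wt α t n s * rem2' g1 g2 (t n) s| ≤ 299 * K * (S * ω) := by
    by_cases hn1 : n = 1
    · subst hn1
      have ht0 : t 0 = 0 := hm.2.1
      have ht1 : t 1 = tau t 1 := hm.tau_one.symm
      have hSe : S = tau t 1 ^ σ / σ := by rw [hS, stepErr, if_pos rfl]
      simp only [Nat.sub_self, ht0, zero_add] at *
      set y := tau t 1
      have i1 := hri.mono_set (by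
        rw [uIcc_of_le (by linarith), uIcc_of_le (by linarith)]
        exact Icc_subset_Icc_right (by linarith) : uIcc 0 (c / 2) ⊆ uIcc 0 c)
      have i2 := hri.mono_set (by
        rw [uIcc_of_le (by linarith), uIcc_of_le (by linarith)]
        exact Icc_subset_Icc_left (by linarith) : uIcc (c / 2) c ⊆ uIcc 0 c)
      rw [← intervalIntegral.integral_add_adjacent_intervals i1 i2]
      -- away from zero the remainder is regular
      have p2 := hpart (c / 2) (192 * K * S / y) (by linarith) (by linarith) (by positivity)
        (fun s hs => by
          refine (h.rem2'_le (x := y / 4) hσ3 hK (by positivity) (by linarith [hs.1])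
            (by linarith [hs.2]) hT).trans ?_
          have a := quarter_rpow_le hτ (by linarith : -3 ≤ σ - 3)
          have b : (t 1 - s) ^ 2 ≤ y ^ 2 := by
            apply sq_le_sq' <;> linarith [hs.1, hs.2]
          have e3 : y ^ (σ - 3) * y ^ 2 = y ^ σ / y := by
            rw [eq_div_iff hτ.ne', mul_assoc, ← pow_succ, ← Real.rpow_natCast,
              ← Real.rpow_add hτ]
            norm_num
          calc K * (y / 4) ^ (σ - 3) * (t 1 - s) ^ 2 ≤ K * (64 * y ^ (σ - 3)) * y ^ 2 := by gcongr
            _ = 64 * K * (y ^ (σ - 3) * y ^ 2) := by ring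
            _ = 64 * K * (σ * S) / y := by rw [e3, hSe]; field_simp
            _ ≤ 64 * K * (3 * S) / y := by gcongr
            _ = _ := by ring)
      -- near zero the derivative is moved to the weight
      have p1 : |∫ s in (0 : ℝ)..c / 2, wt α t 1 s * rem2' g1 g2 (t 1) s| ≤ 64 * K * (S * ω) := by
        have hcT : c < T := tOff_lt_T hα hm le_rfl hn
        have hc0 : 0 < c := by linarith
        have hc2 : c / 2 < c := by linarith
        have hGE : ∀ s ∈ Icc 0 (c / 2), |rem2 g g1 g2 (t 1) s| ≤ K / 2 * S := fun s hs =>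
          h.rem2_le_stepErr hσ hσ3 hK hm le_rfl hn ⟨by rw [Nat.sub_self, hm.2.1]; exact hs.1,
            by linarith [hs.2]⟩
        have hg1i' : IntervalIntegrable (rem2' g1 g2 (t 1)) volume 0 (c / 2) := by
          unfold rem2'
          refine IntervalIntegrable.sub (h.int.mono_set ?_)
            (Continuous.intervalIntegrable (by fun_prop) _ _)
          rw [uIcc_of_le (by linarith), uIcc_of_le (by linarith)]
          exact Icc_subset_Icc_right (by linarith)
        have := abs_integral_mul_deriv_le (w := wt α t 1) (by linarith : 0 ≤ c / 2)
          (fun s hs => hasDerivAt_omega (hs.2.trans_lt hc2)) (continuousOn_omegaDeriv hc2)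
          (fun s hs => omegaDeriv_nonneg hα (hs.2.trans_lt hc2))
          (F := rem2 g g1 g2 (t 1)) (by
            unfold rem2
            exact (h.cont.mono (Icc_subset_Icc_right (by linarith))).sub (by fun_prop))
          (fun s hs => hasDerivAt_rem2 (h.hasDerivAt ⟨hs.1, by linarith [hs.2]⟩)) hg1i' hGE
        have w0 : 0 ≤ wt α t 1 0 := wt_nonneg hα hc0.le
        have w1 : 0 ≤ wt α t 1 (c / 2) := wt_nonneg hα hc2.le
        have hw : wt α t 1 (c / 2) ≤ 64 * ω := by
          rw [wt, omega, ← hc, show c - c / 2 = c / 2 by ring, show 1 - α - 1 = -α by ring, hω,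
            Gamma_two_sub hα]
          have hG := Gamma_one_sub_pos hα
          have b : (c / 2) ^ (-α) ≤ 64 * y ^ (-α) :=
            (Real.rpow_le_rpow_of_nonpos (by positivity) (by linarith : y / 4 ≤ c / 2)
              (by linarith [hα.1])).trans (quarter_rpow_le hτ (by linarith [hα.2]))
          have h1α : 0 < 1 - α := by linarith [hα.2]
          calc _ ≤ 64 * y ^ (-α) / Real.Gamma (1 - α) := by gcongr
            _ = 64 * (y ^ (-α) / (1 * Real.Gamma (1 - α))) := by rw [one_mul]; ring
            _ ≤ _ := by
              gcongr
              linarith [hα.1]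
        have b1 : |wt α t 1 (c / 2) * rem2 g g1 g2 (t 1) (c / 2) - wt α t 1 0 * rem2 g g1 g2 (t 1) 0|
            ≤ wt α t 1 (c / 2) * (K / 2 * S) + wt α t 1 0 * (K / 2 * S) := by
          refine (abs_sub _ _).trans ?_
          rw [abs_mul, abs_mul, abs_of_nonneg w0, abs_of_nonneg w1]
          have g1 := hGE (c / 2) ⟨by linarith, le_rfl⟩
          have g2 := hGE 0 ⟨le_rfl, by linarith⟩
          gcongr
        calc _ ≤ 2 * (K / 2 * S) * wt α t 1 (c / 2) := by linarith
          _ ≤ 2 * (K / 2 * S) * (64 * ω) := by gcongr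
          _ = _ := by ring
      calc _ ≤ 64 * K * (S * ω) + 192 * K * S / y * (y * ω) := (abs_add_le _ _).trans (add_le_add p1 p2)
        _ = 256 * (K * (S * ω)) := by field_simp; ring
        _ ≤ _ := by
          have : 0 ≤ K * (S * ω) := by positivity
          linarith
    · have hpos := hm.pos (by omega : 1 ≤ n - 1) (by omega)
      have hSe : S = t (n - 1) ^ (σ - 3) * tau t n ^ 3 := by rw [hS, stepErr, if_neg hn1]
      have := hpart (t (n - 1)) (K * S / tau t n) le_rfl hlast.le (by positivity)
        (fun s hs => by
          refine (h.rem2'_le hσ3 hK hpos hs.1 (by linarith [hs.2]) hT).trans ?_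
          have b : (t n - s) ^ 2 ≤ tau t n ^ 2 := by
            have : t n - t (n - 1) = tau t n := rfl
            apply sq_le_sq' <;> linarith [hs.1, hs.2]
          calc _ ≤ K * t (n - 1) ^ (σ - 3) * tau t n ^ 2 := by gcongr
            _ = _ := by rw [hSe]; field_simp)
      refine this.trans ?_
      have h0 : 0 ≤ K * (S * ω) := by positivity
      calc _ = K * (S * ω) := by field_simp
        _ ≤ _ := by linarith
  rw [e]
  refine (abs_sub _ _).trans ?_
  linarith

/-- A bound for the truncation error that depends on the mesh and on `σ` only. -/
noncomputable def truncBound (α σ : ℝ) (t : ℕ → ℝ) (n : ℕ) : ℝ :=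
  ∑ k ∈ Finset.Icc 1 (n - 1), histErr σ t k * (wt α t n (t k) - wt α t n (t (k - 1)))
    + 300 * (stepErr σ t n * (tau t n ^ (-α) / Real.Gamma (2 - α)))

theorem TimeReg.truncErr_le (h : TimeReg T σ K g g1 g2 g3) (hα : α ∈ Ioo (0 : ℝ) 1) (hσ : 0 < σ)
    (hσ3 : σ ≤ 3) (hK : 0 ≤ K) (hm : IsMesh T N t) {n : ℕ} (h1 : 1 ≤ n) (hn : n ≤ N) :
    |truncErr α t g n| ≤ K * truncBound α σ t n := by
  rw [h.truncErr_eq hα hm h1 hn, truncBound, mul_add, Finset.mul_sum]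
  refine (abs_add_le _ _).trans (add_le_add ((Finset.abs_sum_le_sum_abs _ _).trans
    (Finset.sum_le_sum fun k hk => ?_)) ?_)
  · rw [Finset.mem_Icc] at hk
    rw [← mul_assoc]
    exact h.hist_le hα hσ hσ3 hK hm hk.1 (by omega) hn
  · refine (h.last_le hα hσ hσ3 hK hm h1 hn).trans (le_of_eq ?_)
    ring

end trunc

/-! ### Summation of the truncation errors -/

section global

variable {α T σ : ℝ} {N : ℕ} {t : ℕ → ℝ}

lemma quarter_le_Gamma_two_sub (hα : α ∈ Ioo (0 : ℝ) 1) : 1 / 4 ≤ Real.Gamma (2 - α) := by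
  have h0 := hα.1
  have h1 := hα.2
  have hpos := Gamma_two_sub_pos hα
  obtain ⟨_, hcv⟩ := Real.convexOn_Gamma
  rcases le_total α (3 / 5) with h | h
  · -- convexity on `[2 - α, 3]`, at the point `2`
    have hc := hcv (show 2 - α ∈ Ioi (0 : ℝ) by simp only [mem_Ioi]; linarith)
      (show (3 : ℝ) ∈ Ioi (0 : ℝ) by simp) (show 0 ≤ 1 / (1 + α) by positivity)
      (show 0 ≤ α / (1 + α) by positivity) (by field_simp)
    have e : (1 / (1 + α)) • (2 - α) + (α / (1 + α)) • (3 : ℝ) = 2 := by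
      simp only [smul_eq_mul]; field_simp; ring
    have e3 : Real.Gamma 3 = 2 := by
      rw [show (3 : ℝ) = 2 + 1 by norm_num, Real.Gamma_add_one two_ne_zero, Real.Gamma_two, mul_one]
    rw [e, Real.Gamma_two, e3, smul_eq_mul, smul_eq_mul, ← mul_le_mul_iff_left₀
      (by positivity : 0 < 1 + α)] at hc
    have : (1 / (1 + α) * Real.Gamma (2 - α) + α / (1 + α) * 2) * (1 + α)
        = Real.Gamma (2 - α) + 2 * α := by field_simp
    rw [this] at hc
    linarith
  · -- convexity on `[1/2, 2 - α]`, at the point `1`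
    have hd : 0 < 3 / 2 - α := by linarith
    have hc := hcv (show (1 / 2 : ℝ) ∈ Ioi (0 : ℝ) by simp)
      (show 2 - α ∈ Ioi (0 : ℝ) by simp only [mem_Ioi]; linarith)
      (show 0 ≤ (1 - α) / (3 / 2 - α) from div_nonneg (by linarith) hd.le)
      (show 0 ≤ 1 / 2 / (3 / 2 - α) by positivity) (by
        rw [← add_div, div_eq_one_iff_eq hd.ne']; ring)
    have e : ((1 - α) / (3 / 2 - α)) • (1 / 2 : ℝ) + (1 / 2 / (3 / 2 - α)) • (2 - α) = 1 := by
      rw [smul_eq_mul, smul_eq_mul, div_mul_eq_mul_div, div_mul_eq_mul_div, ← add_div,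
        div_eq_one_iff_eq hd.ne']
      ring
    rw [e, Real.Gamma_one, Real.Gamma_one_half_eq, smul_eq_mul, smul_eq_mul,
      ← mul_le_mul_iff_left₀ hd] at hc
    have : ((1 - α) / (3 / 2 - α) * √Real.pi + 1 / 2 / (3 / 2 - α) * Real.Gamma (2 - α))
        * (3 / 2 - α) = (1 - α) * √Real.pi + 1 / 2 * Real.Gamma (2 - α) := by
      rw [add_mul, mul_right_comm, div_mul_cancel₀ _ hd.ne', mul_right_comm,
        div_mul_cancel₀ _ hd.ne']
    rw [this] at hc
    have hπ : √Real.pi ≤ 1.78 := by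
      rw [Real.sqrt_le_left (by norm_num)]
      linarith [Real.pi_lt_d2]
    nlinarith

lemma sum_pred_swap (f : ℕ → ℕ → ℝ) (n : ℕ) :
    ∑ j ∈ Finset.Icc 1 n, ∑ k ∈ Finset.Icc 1 (j - 1), f j k
      = ∑ k ∈ Finset.Icc 1 (n - 1), ∑ j ∈ Finset.Icc (k + 1) n, f j k := by
  apply Finset.sum_comm'
  intro x y
  simp only [Finset.mem_Icc]
  omega

lemma histErr_nonneg (hm : IsMesh T N t) (hσ : 0 < σ) {k : ℕ} (h1 : 1 ≤ k) (hk : k + 1 ≤ N) :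
    0 ≤ histErr σ t k := by
  have := stepErr_nonneg hm hσ h1 (by omega : k ≤ N)
  have := stepErr_nonneg hm hσ (by omega : 1 ≤ k + 1) hk
  unfold histErr
  positivity

lemma ratio_sq_le (hm : IsMesh T N t) (hr : RatioBound N t) {k : ℕ} (h1 : 1 ≤ k)
    (hk : k + 1 ≤ N) : (tau t k / tau t (k + 1)) ^ 2 ≤ 4 := by
  have h := hr k h1 hk
  rw [ratio] at h
  have : 0 ≤ tau t k / tau t (k + 1) :=
    div_nonneg (hm.tau_pos h1 (by omega)).le (hm.tau_pos (by omega) hk).le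
  nlinarith

/-- The mesh quantity that governs the truncation error. -/
noncomputable def histTerm (α σ : ℝ) (t : ℕ → ℝ) (k : ℕ) : ℝ :=
  t k ^ α * t (k - 1) ^ (σ - 3) * tau t k ^ 3 / tau t (k - 1) ^ α

lemma stepErr_mul_rpow_le (hm : IsMesh T N t) {k : ℕ}
    (h2 : 2 ≤ k) (hk : k ≤ N) {M2 : ℝ} (hM : histTerm α σ t k ≤ M2) :
    stepErr σ t k * tau t (k - 1) ^ (-α) ≤ M2 * t k ^ (-α) := by
  have hτ := hm.tau_pos (by omega : 1 ≤ k - 1) (by omega)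
  have ht := hm.pos (by omega : 1 ≤ k) hk
  rw [stepErr, if_neg (by omega), Real.rpow_neg hτ.le, Real.rpow_neg ht.le]
  have hp := Real.rpow_pos_of_pos ht α
  have hq := Real.rpow_pos_of_pos hτ α
  rw [← div_eq_mul_inv, ← div_eq_mul_inv, le_div_iff₀ hp]
  refine le_trans (le_of_eq ?_) hM
  rw [histTerm]
  ring

lemma stepErr_mul_diag_le (hα : α ∈ Ioo (0 : ℝ) 1) (hm : IsMesh T N t) (hr : RatioBound N t)
    (hσ : 0 < σ) {k : ℕ} (h2 : 2 ≤ k) (hk : k ≤ N) {M2 : ℝ} (hM : histTerm α σ t k ≤ M2) :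
    stepErr σ t k * tau t k ^ (-α) ≤ 2 * (M2 * t k ^ (-α)) := by
  have h := stepErr_mul_rpow_le hm h2 hk hM
  have hτ' := hm.tau_pos (by omega : 1 ≤ k - 1) (by omega)
  have hτ := hm.tau_pos (by omega : 1 ≤ k) hk
  have hS := stepErr_nonneg hm hσ (by omega : 1 ≤ k) hk
  have hρ := hr.tau_le hm (by omega : 1 ≤ k - 1) (by omega)
  rw [Nat.sub_add_cancel (by omega)] at hρ
  have h3 : tau t k ^ (-α) ≤ 2 * tau t (k - 1) ^ (-α) := by
    have e1 : (2 * tau t k) ^ (-α) ≤ tau t (k - 1) ^ (-α) :=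
      Real.rpow_le_rpow_of_nonpos hτ' (by linarith) (by linarith [hα.1])
    rw [Real.mul_rpow (by norm_num) hτ.le] at e1
    have e2 : (1 / 2 : ℝ) ≤ 2 ^ (-α) := by
      have := Real.rpow_le_rpow_of_exponent_le (by norm_num : (1 : ℝ) ≤ 2)
        (by linarith [hα.2] : -1 ≤ -α)
      rw [Real.rpow_neg_one] at this
      linarith
    have := Real.rpow_pos_of_pos hτ (-α)
    nlinarith
  calc _ ≤ stepErr σ t k * (2 * tau t (k - 1) ^ (-α)) := by gcongr
    _ ≤ _ := by linarith

lemma rpow_neg_div_Gamma (hα : α ∈ Ioo (0 : ℝ) 1) (x : ℝ) :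
    x ^ (-α) / Real.Gamma (2 - α) = omega (1 - α) x / (1 - α) := by
  rw [Gamma_two_sub hα, omega, show 1 - α - 1 = -α by ring, div_div, mul_comm]

/-- The global truncation error: the complementary kernel turns the increments of the weight,
which dominate each truncation error, into its diagonal values. -/
theorem sum_truncBound_le (hα : α ∈ Ioo (0 : ℝ) 1) (hm : IsMesh T N t) (hr : RatioBound N t)
    (hσ : 0 < σ) (hσ2 : σ ≤ 2) {n : ℕ} (h1 : 1 ≤ n) (hn : n ≤ N) {p : ℕ → ℝ}
    (hp : IsComplementary (kernelA α t) n p) {M2 : ℝ} (hM0 : 0 ≤ M2)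
    (hM : ∀ k, 2 ≤ k → k ≤ n → histTerm α σ t k ≤ M2) :
    ∑ j ∈ Finset.Icc 1 n, p j * truncBound α σ t j
      ≤ 5000 / (σ * (1 - α)) * (tau t 1 ^ σ + M2) := by
  have h1α : 0 < 1 - α := by linarith [hα.2]
  have hΓ := Gamma_two_sub_pos hα
  have hτ1 := hm.tau_pos le_rfl (by omega : 1 ≤ N)
  set X := tau t 1 ^ σ / σ with hX
  have hX0 : 0 ≤ X := by positivity
  have hdiag : ∀ k, 1 ≤ k → k ≤ n → p k * kernelA α t k k ≤ 1 := fun k hk hkn =>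
    hp.mul_diag_le_one (fun k j h h' h'' => (kernelA_pos hα hm hr h h' (by omega)).le) hk hkn
  have hω0 : ∀ k, 1 ≤ k → k ≤ n → 0 ≤ p k * omega (1 - α) (t k) := fun k hk hkn =>
    mul_nonneg (hp.1 k) (omega_nonneg hα (hm.nonneg (by omega)))
  -- the earlier intervals
  have hA : ∀ k, 1 ≤ k → k ≤ n - 1 → histErr σ t k * (p k * kernelA α t k k)
      ≤ (if k = 1 then 2 * X + 4 * M2 else 0) + 24 * M2 / (1 - α) * (p k * omega (1 - α) (t k)) := by
    intro k hk hkn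
    have hh := histErr_nonneg hm hσ hk (by omega)
    have hρ2 := ratio_sq_le hm hr hk (by omega)
    have hS1 := stepErr_nonneg hm hσ (by omega : 1 ≤ k + 1) (by omega)
    have hτk := hm.tau_pos hk (by omega)
    have htk := hm.pos hk (by omega)
    have hS' := stepErr_mul_rpow_le hm (by omega : 2 ≤ k + 1) (by omega)
      (hM (k + 1) (by omega) (by omega))
    rw [Nat.add_sub_cancel] at hS'
    have htt : t (k + 1) ^ (-α) ≤ t k ^ (-α) := Real.rpow_le_rpow_of_nonpos htk
      (hm.mono (by omega) (by omega)) (by linarith [hα.1])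
    have hle : histErr σ t k ≤ 2 * stepErr σ t k + 4 * stepErr σ t (k + 1) := by
      unfold histErr; gcongr
    split_ifs with h
    · subst h
      have e1 : stepErr σ t 1 = X := by rw [stepErr, if_pos rfl]
      have e2 : stepErr σ t (1 + 1) ≤ M2 := by
        have hq : t 2 ^ (-α) ≤ t 1 ^ (-α) := htt
        rw [hm.tau_one] at hS'
        have hpos := Real.rpow_pos_of_pos htk (-α)
        have : stepErr σ t (1 + 1) * t 1 ^ (-α) ≤ M2 * t 1 ^ (-α) :=
          hS'.trans (mul_le_mul_of_nonneg_left htt hM0)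
        exact le_of_mul_le_mul_right this hpos
      have h3 := hω0 1 le_rfl (by omega)
      have h4 : 0 ≤ 24 * M2 / (1 - α) * (p 1 * omega (1 - α) (t 1)) := by positivity
      have h5 : histErr σ t 1 * (p 1 * kernelA α t 1 1) ≤ histErr σ t 1 :=
        mul_le_of_le_one_right hh (hdiag 1 le_rfl (by omega))
      linarith
    · have hS := stepErr_mul_diag_le hα hm hr hσ (by omega : 2 ≤ k) (by omega)
        (hM k (by omega) (by omega))
      have hpk := hp.1 k
      have hK := kernelA_self_le hα hm hr hk (by omega)
      have e3 : stepErr σ t (k + 1) * tau t k ^ (-α) ≤ M2 * t k ^ (-α) :=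
        hS'.trans (mul_le_mul_of_nonneg_left htt hM0)
      have hτp := Real.rpow_pos_of_pos hτk (-α)
      have e4 : histErr σ t k * tau t k ^ (-α) ≤ 8 * (M2 * t k ^ (-α)) := by
        have := mul_le_mul_of_nonneg_right hle hτp.le
        linarith
      have e5 := rpow_neg_div_Gamma hα (t k)
      calc histErr σ t k * (p k * kernelA α t k k)
          ≤ histErr σ t k * (p k * (3 * (tau t k ^ (-α) / Real.Gamma (2 - α)))) := by gcongr
        _ = 3 * p k * (histErr σ t k * tau t k ^ (-α)) / Real.Gamma (2 - α) := by ring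
        _ ≤ 3 * p k * (8 * (M2 * t k ^ (-α))) / Real.Gamma (2 - α) := by gcongr
        _ = 24 * M2 * p k * (t k ^ (-α) / Real.Gamma (2 - α)) := by ring
        _ = _ := by rw [e5]; ring
  -- the last intervals
  have hB : ∀ j, 1 ≤ j → j ≤ n →
      p j * (300 * (stepErr σ t j * (tau t j ^ (-α) / Real.Gamma (2 - α))))
      ≤ (if j = 1 then 600 * X else 0) + 600 * M2 / (1 - α) * (p j * omega (1 - α) (t j)) := by
    intro j hj hjn
    have hpj := hp.1 j
    split_ifs with h
    · subst h
      have e1 : stepErr σ t 1 = X := by rw [stepErr, if_pos rfl]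
      have h3 := hω0 1 le_rfl (by omega)
      have h4 : 0 ≤ 600 * M2 / (1 - α) * (p 1 * omega (1 - α) (t 1)) := by positivity
      have h5 := kernelA_self_ge hα hm le_rfl (by omega : 1 ≤ N)
      have h6 := hdiag 1 le_rfl (by omega)
      have h7 : p 1 * (tau t 1 ^ (-α) / Real.Gamma (2 - α)) ≤ 2 := by
        have := mul_le_mul_of_nonneg_left h5 hpj
        linarith
      rw [e1]
      have := mul_le_mul_of_nonneg_left h7 hX0
      linarith
    · have hS := stepErr_mul_diag_le hα hm hr hσ (by omega : 2 ≤ j) (by omega)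
        (hM j (by omega) (by omega))
      have e5 := rpow_neg_div_Gamma hα (t j)
      calc _ = 300 * p j * (stepErr σ t j * tau t j ^ (-α)) / Real.Gamma (2 - α) := by ring
        _ ≤ 300 * p j * (2 * (M2 * t j ^ (-α))) / Real.Gamma (2 - α) := by gcongr
        _ = 600 * M2 * p j * (t j ^ (-α) / Real.Gamma (2 - α)) := by ring
        _ = _ := by rw [e5]; ring
  have hsumω := sum_complementary_omega_le hα hm hr h1 hn hp
  have hsumω' : ∑ k ∈ Finset.Icc 1 (n - 1), p k * omega (1 - α) (t k) ≤ 11 / 4 := by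
    refine (Finset.sum_le_sum_of_subset_of_nonneg
      (Finset.Icc_subset_Icc_right (by omega)) fun k hk _ => ?_).trans hsumω
    rw [Finset.mem_Icc] at hk
    exact hω0 k hk.1 hk.2
  -- exchange of the sums, after which the complementary kernel acts on the differences of `A`
  have hhist : ∑ j ∈ Finset.Icc 1 n, p j * ∑ k ∈ Finset.Icc 1 (j - 1),
      histErr σ t k * (wt α t j (t k) - wt α t j (t (k - 1)))
      ≤ 6 * ∑ k ∈ Finset.Icc 1 (n - 1), histErr σ t k * (p k * kernelA α t k k) := by
    simp_rw [Finset.mul_sum]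
    rw [sum_pred_swap]
    refine Finset.sum_le_sum fun k hk => ?_
    rw [Finset.mem_Icc] at hk
    have hh := histErr_nonneg hm hσ hk.1 (by omega)
    rw [← hp.sum_increment hk.1 (by omega), Finset.mul_sum, Finset.mul_sum]
    refine Finset.sum_le_sum fun j hj => ?_
    rw [Finset.mem_Icc] at hj
    have := wt_increment_le_kernelA hα hm hr hk.1 (by omega : k < j) (by omega)
    have hpj := hp.1 j
    have h6 : wt α t j (t k) - wt α t j (t (k - 1))
        ≤ 6 * (kernelA α t j (k + 1) - kernelA α t j k) := by linarith
    calc _ ≤ p j * (histErr σ t k * (6 * (kernelA α t j (k + 1) - kernelA α t j k))) := by gcongr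
      _ = _ := by ring
  have hite : ∀ (s : Finset ℕ) (c : ℝ), 0 ≤ c → ∑ k ∈ s, (if k = 1 then c else 0) ≤ c := by
    intro s c hc
    rw [Finset.sum_ite_eq']
    split_ifs <;> linarith
  have hS1 : ∑ k ∈ Finset.Icc 1 (n - 1), histErr σ t k * (p k * kernelA α t k k)
      ≤ (2 * X + 4 * M2) + 24 * M2 / (1 - α) * (11 / 4) := by
    refine (Finset.sum_le_sum fun k hk => hA k (Finset.mem_Icc.1 hk).1
      (Finset.mem_Icc.1 hk).2).trans ?_
    rw [Finset.sum_add_distrib, ← Finset.mul_sum]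
    have := hite (Finset.Icc 1 (n - 1)) (2 * X + 4 * M2) (by positivity)
    gcongr
  have hS2 : ∑ j ∈ Finset.Icc 1 n,
      p j * (300 * (stepErr σ t j * (tau t j ^ (-α) / Real.Gamma (2 - α))))
      ≤ 600 * X + 600 * M2 / (1 - α) * (11 / 4) := by
    refine (Finset.sum_le_sum fun k hk => hB k (Finset.mem_Icc.1 hk).1
      (Finset.mem_Icc.1 hk).2).trans ?_
    rw [Finset.sum_add_distrib, ← Finset.mul_sum]
    have := hite (Finset.Icc 1 n) (600 * X) (by positivity)
    gcongr
  have hM1 : M2 ≤ M2 / (1 - α) := by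
    rw [le_div_iff₀ h1α]; nlinarith [hα.1]
  have hX1 : X ≤ X / (1 - α) := by
    rw [le_div_iff₀ h1α]; nlinarith [hα.1]
  have hM3 : M2 / (1 - α) ≤ 2 * (M2 / (1 - α) / σ) := by
    have : 0 ≤ M2 / (1 - α) := by positivity
    rw [← mul_div_assoc, le_div_iff₀ hσ]
    nlinarith
  have e : ∑ j ∈ Finset.Icc 1 n, p j * truncBound α σ t j
      = ∑ j ∈ Finset.Icc 1 n, p j * ∑ k ∈ Finset.Icc 1 (j - 1),
          histErr σ t k * (wt α t j (t k) - wt α t j (t (k - 1)))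
        + ∑ j ∈ Finset.Icc 1 n,
          p j * (300 * (stepErr σ t j * (tau t j ^ (-α) / Real.Gamma (2 - α)))) := by
    rw [← Finset.sum_add_distrib]
    exact Finset.sum_congr rfl fun j _ => by rw [truncBound, mul_add]
  have e2 : 5000 / (σ * (1 - α)) * (tau t 1 ^ σ + M2)
      = 5000 * (X / (1 - α)) + 5000 * (M2 / (1 - α) / σ) := by
    rw [hX]; field_simp
  have e3 : 24 * M2 / (1 - α) * (11 / 4) = 66 * (M2 / (1 - α)) := by ring
  have e4 : 600 * M2 / (1 - α) * (11 / 4) = 1650 * (M2 / (1 - α)) := by ring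
  have hMnn : 0 ≤ M2 / (1 - α) := by positivity
  have hXnn : 0 ≤ X / (1 - α) := by positivity
  rw [e, e2]
  rw [e3] at hS1
  rw [e4] at hS2
  linarith

lemma half_tau_succ_le (hα : α ∈ Ioo (0 : ℝ) 1) (hm : IsMesh T N t) {n k : ℕ} (hk : k < n)
    (hn : n ≤ N) : tau t (k + 1) / 2 ≤ tOff α t n - t k := by
  have h := lt_tOff hα hm (by omega : 1 ≤ n) hn
  have hτ := hm.tau_pos (by omega : 1 ≤ k + 1) (by omega)
  rcases (Nat.succ_le_of_lt hk).eq_or_lt with h' | h'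
  · obtain rfl : n = k + 1 := h'.symm
    rw [Nat.add_sub_cancel] at h
    linarith
  · have h2 := hm.mono (by omega : k + 1 ≤ n - 1) (by omega)
    have h3 := hm.tau_pos (by omega : 1 ≤ n) hn
    rw [tau_succ] at hτ ⊢
    linarith

lemma wt_increment_le_integral (hα : α ∈ Ioo (0 : ℝ) 1) (hm : IsMesh T N t) {n k : ℕ}
    (h1 : 1 ≤ k) (hk : k < n) (hn : n ≤ N) :
    wt α t n (t k) - wt α t n (t (k - 1))
      ≤ 2 / tau t (k + 1) * ∫ s in t (k - 1)..t k, wt α t n s := by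
  have hlast := lt_tOff_of_lt hα hm hk hn
  have hle := hm.mono (by omega : k - 1 ≤ k) (by omega)
  have hτ := hm.tau_pos (by omega : 1 ≤ k + 1) (by omega)
  have hhalf := half_tau_succ_le hα hm hk hn
  have hΓ := Gamma_one_sub_pos hα
  have hu : uIcc (t (k - 1)) (t k) = Icc (t (k - 1)) (t k) := uIcc_of_le hle
  have hi : IntervalIntegrable (omegaDeriv α (tOff α t n)) volume (t (k - 1)) (t k) :=
    (hu ▸ continuousOn_omegaDeriv hlast).intervalIntegrable
  have e : ∫ s in t (k - 1)..t k, omegaDeriv α (tOff α t n) s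
      = wt α t n (t k) - wt α t n (t (k - 1)) :=
    intervalIntegral.integral_eq_sub_of_hasDerivAt
      (fun s hs => hasDerivAt_omega ((hu ▸ hs).2.trans_lt hlast)) hi
  rw [← e, ← intervalIntegral.integral_const_mul]
  have hwi : IntervalIntegrable (wt α t n) volume (t (k - 1)) (t k) :=
    intervalIntegrable_omega hα _ _ _
  apply intervalIntegral.integral_mono_on hle hi (hwi.const_mul _)
  intro s hs
  have hpos : 0 < tOff α t n - s := by linarith [hs.2]
  have h3 : α / (tOff α t n - s) ≤ 2 / tau t (k + 1) := by
    rw [div_le_div_iff₀ hpos hτ]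
    nlinarith [hα.2, hs.2]
  have h4 : omegaDeriv α (tOff α t n) s = α / (tOff α t n - s) * wt α t n s := by
    rw [omegaDeriv, wt, omega, Real.rpow_sub_one hpos.ne', show 1 - α - 1 = -α by ring]
    ring
  rw [h4]
  exact mul_le_mul_of_nonneg_right h3 (wt_nonneg hα (by linarith))

lemma half_rpow_neg_le {x p : ℝ} (hx : 0 < x) (h1 : p ≤ 1) :
    (x / 2) ^ (-p) ≤ 2 * x ^ (-p) := by
  rw [Real.div_rpow hx.le (by norm_num), div_le_iff₀ (by positivity)]
  have := Real.rpow_le_rpow_of_exponent_le (by norm_num : (1 : ℝ) ≤ 2) (by linarith : -1 ≤ -p)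
  rw [Real.rpow_neg_one] at this
  have := Real.rpow_pos_of_pos hx (-p)
  nlinarith

set_option maxHeartbeats 800000 in
/-- The pointwise truncation error of a function that is smooth up to `t = 0`. The increments of the
weight are integrals of its derivative, which costs one power of the step, and
`τ_k² ≤ τ_1² + m₂ t_k^{-α/2}` leaves an integral of `s^{-α/2} (t_{n-θ} - s)^{-α}`. -/
theorem truncBound_smooth_le (hα : α ∈ Ioo (0 : ℝ) 1) (hm : IsMesh T N t) (hr : RatioBound N t)
    {n : ℕ} (h1 : 1 ≤ n) (hn : n ≤ N) {m2 : ℝ} (hM0 : 0 ≤ m2)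
    (hM : ∀ k, 2 ≤ k → k ≤ n → t k ^ (α / 2) * tau t k ^ 2 ≤ m2) :
    t n ^ (α / 2) * truncBound α 3 t n ≤ 2000 * (1 + T) ^ 2 * (tau t 1 ^ 2 + m2) := by
  have hα0 := hα.1
  have hα1 := hα.2
  have hΓ := Gamma_two_sub_pos hα
  have hΓ1 := Gamma_one_sub_pos hα
  have hc0 := tOff_pos hα hm h1 hn
  have hlast := lt_tOff_of_lt hα hm (by omega : n - 1 < n) hn
  have hT0 : 0 < T := hc0.trans (tOff_lt_T hα hm h1 hn)
  have hcT := (tOff_lt_T hα hm h1 hn).le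
  have htn := hm.pos h1 hn
  have htn2 : t n ≤ 2 * tOff α t n := by
    have := lt_tOff hα hm h1 hn
    have := hm.nonneg (by omega : n - 1 ≤ N)
    unfold tau at *
    linarith
  set c := tOff α t n with hc
  have hwi : ∀ x y, IntervalIntegrable (wt α t n) volume x y := fun x y =>
    intervalIntegrable_omega hα _ x y
  have hsi : ∀ x y, IntervalIntegrable (fun s : ℝ => s ^ (-(α / 2))) volume x y := fun x y =>
    intervalIntegral.intervalIntegrable_rpow' (by linarith)
  have hstep : ∀ k, 1 ≤ k → k ≤ N → stepErr 3 t k ≤ tau t k ^ 3 := by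
    intro k hk hkN
    have hτ := hm.tau_pos hk hkN
    unfold stepErr
    split_ifs with h
    · subst h
      have : tau t 1 ^ (3 : ℝ) = tau t 1 ^ 3 := by norm_cast
      rw [this]
      have := pow_pos hτ 3
      linarith
    · norm_num
  have hsq : ∀ k, 1 ≤ k → k ≤ n → tau t k ^ 2 ≤ tau t 1 ^ 2 + m2 * t k ^ (-(α / 2)) := by
    intro k hk hkn
    have htk := hm.pos hk (by omega)
    have hp := Real.rpow_pos_of_pos htk (-(α / 2))
    rcases eq_or_ne k 1 with rfl | hk1
    · have : 0 ≤ m2 * t 1 ^ (-(α / 2)) := by positivity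
      linarith
    · have h := mul_le_mul_of_nonneg_right (hM k (by omega) hkn) hp.le
      have e : t k ^ (α / 2) * tau t k ^ 2 * t k ^ (-(α / 2)) = tau t k ^ 2 := by
        rw [mul_right_comm, ← Real.rpow_add htk, add_neg_cancel, Real.rpow_zero, one_mul]
      rw [e] at h
      have := sq_nonneg (tau t 1)
      linarith
  -- comparison of the product of two singular powers with their sum
  set φ : ℝ → ℝ := fun s => 2 * c ^ (-(α / 2)) * wt α t n s
    + 2 * c ^ (-α) / Real.Gamma (1 - α) * s ^ (-(α / 2)) with hφ
  have hφi : ∀ x y, IntervalIntegrable φ volume x y := fun x y =>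
    ((hwi x y).const_mul _).add ((hsi x y).const_mul _)
  have hterm : ∀ k ∈ Finset.Icc 1 (n - 1),
      histErr 3 t k * (wt α t n (t k) - wt α t n (t (k - 1)))
      ≤ 9 * ∫ s in t (k - 1)..t k, (tau t 1 ^ 2 * wt α t n s + m2 * φ s) := by
    intro k hk
    rw [Finset.mem_Icc] at hk
    have hkn : k < n := by omega
    have hlk := lt_tOff_of_lt hα hm hkn hn
    have hle := hm.mono (by omega : k - 1 ≤ k) (by omega)
    have hτ := hm.tau_pos hk.1 (by omega)
    have hτ' := hm.tau_pos (by omega : 1 ≤ k + 1) (by omega)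
    have hρ := hr.tau_le hm hk.1 (by omega)
    have hh : histErr 3 t k ≤ 9 / 2 * tau t k ^ 2 * tau t (k + 1) := by
      have a1 := hstep k hk.1 (by omega)
      have a2 := hstep (k + 1) (by omega) (by omega)
      unfold histErr
      calc _ ≤ 2 * tau t k ^ 3 + (tau t k / tau t (k + 1)) ^ 2 * tau t (k + 1) ^ 3 := by gcongr
        _ = tau t k ^ 2 * (2 * tau t k + tau t (k + 1)) := by field_simp
        _ ≤ tau t k ^ 2 * (9 / 2 * tau t (k + 1)) := by gcongr; linarith
        _ = _ := by ring
    have hw0 : 0 ≤ wt α t n (t k) - wt α t n (t (k - 1)) :=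
      sub_nonneg.2 (wt_mono hα hle hlk)
    have hI0 : 0 ≤ ∫ s in t (k - 1)..t k, wt α t n s :=
      intervalIntegral.integral_nonneg hle fun s hs => wt_nonneg hα (by linarith [hs.2])
    calc _ ≤ 9 / 2 * tau t k ^ 2 * tau t (k + 1)
          * (2 / tau t (k + 1) * ∫ s in t (k - 1)..t k, wt α t n s) := by
          have := wt_increment_le_integral hα hm hk.1 hkn hn
          gcongr
      _ = 9 * (tau t k ^ 2 * ∫ s in t (k - 1)..t k, wt α t n s) := by field_simp
      _ = 9 * ∫ s in t (k - 1)..t k, tau t k ^ 2 * wt α t n s := by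
          rw [intervalIntegral.integral_const_mul]
      _ ≤ _ := by
          apply mul_le_mul_of_nonneg_left _ (by norm_num)
          apply intervalIntegral.integral_mono_on_of_le_Ioo hle ((hwi _ _).const_mul _)
            (((hwi _ _).const_mul _).add ((hφi _ _).const_mul _))
          intro s hs
          have hs0 : 0 < s := (hm.nonneg (by omega)).trans_lt hs.1
          have hsc : s < c := hs.2.trans hlk
          have hws := wt_nonneg hα hsc.le (α := α) (t := t) (n := n)
          have b1 := hsq k hk.1 (by omega)
          have b2 : t k ^ (-(α / 2)) ≤ s ^ (-(α / 2)) :=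
            Real.rpow_le_rpow_of_nonpos hs0 hs.2.le (by linarith)
          have b3 : s ^ (-(α / 2)) * wt α t n s ≤ φ s := by
            have hsp := Real.rpow_pos_of_pos hs0 (-(α / 2))
            have hcp1 := Real.rpow_pos_of_pos hc0 (-(α / 2))
            have hcp2 := Real.rpow_pos_of_pos hc0 (-α)
            rw [hφ]
            rcases le_total s (c / 2) with h | h
            · have : wt α t n s ≤ 2 * c ^ (-α) / Real.Gamma (1 - α) := by
                rw [wt, omega, show 1 - α - 1 = -α by ring, ← hc]
                have : (c - s) ^ (-α) ≤ 2 * c ^ (-α) :=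
                  (Real.rpow_le_rpow_of_nonpos (by positivity) (by linarith : c / 2 ≤ c - s)
                    (by linarith)).trans (half_rpow_neg_le hc0 hα1.le)
                gcongr
              have := mul_le_mul_of_nonneg_right this hsp.le
              have h0 : 0 ≤ 2 * c ^ (-(α / 2)) * wt α t n s := by positivity
              simp only
              linarith
            · have : s ^ (-(α / 2)) ≤ 2 * c ^ (-(α / 2)) :=
                (Real.rpow_le_rpow_of_nonpos (by positivity) h (by linarith)).trans
                  (half_rpow_neg_le hc0 (by linarith))
              have := mul_le_mul_of_nonneg_right this hws
              have h0 : 0 ≤ 2 * c ^ (-α) / Real.Gamma (1 - α) * s ^ (-(α / 2)) := by positivity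
              simp only
              linarith
          calc tau t k ^ 2 * wt α t n s
              ≤ (tau t 1 ^ 2 + m2 * s ^ (-(α / 2))) * wt α t n s := by
                apply mul_le_mul_of_nonneg_right (b1.trans _) hws
                gcongr
            _ = tau t 1 ^ 2 * wt α t n s + m2 * (s ^ (-(α / 2)) * wt α t n s) := by ring
            _ ≤ _ := by gcongr
  have hsum : ∑ k ∈ Finset.Icc 1 (n - 1), histErr 3 t k * (wt α t n (t k) - wt α t n (t (k - 1)))
      ≤ 9 * ∫ s in (0 : ℝ)..c, (tau t 1 ^ 2 * wt α t n s + m2 * φ s) := by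
    refine (Finset.sum_le_sum hterm).trans ?_
    have hii : ∀ x y, IntervalIntegrable (fun s => tau t 1 ^ 2 * wt α t n s + m2 * φ s)
        volume x y := fun x y => ((hwi _ _).const_mul _).add ((hφi _ _).const_mul _)
    rw [← Finset.mul_sum, sum_integral_pieces (fun k _ _ => hii _ _), hm.2.1]
    apply mul_le_mul_of_nonneg_left _ (by norm_num)
    apply intervalIntegral.integral_mono_interval le_rfl (hm.nonneg (by omega)) hlast.le _ (hii _ _)
    filter_upwards [self_mem_ae_restrict measurableSet_Ioc] with s hs
    have hws := wt_nonneg hα hs.2 (α := α) (t := t) (n := n)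
    have hs0 := hs.1
    have : 0 ≤ φ s := by
      rw [hφ]; positivity
    simp only [Pi.zero_apply]
    positivity
  have hI1 : ∫ s in (0 : ℝ)..c, wt α t n s = c ^ (1 - α) / Real.Gamma (2 - α) := by
    rw [hc, integral_wt hα, sub_zero]
  have hI2 : ∫ s in (0 : ℝ)..c, s ^ (-(α / 2)) = c ^ (1 - α / 2) / (1 - α / 2) := by
    rw [integral_rpow (Or.inl (by linarith)), Real.zero_rpow (by linarith), sub_zero]
    rw [show -(α / 2) + 1 = 1 - α / 2 by ring]
  have hI3 : ∫ s in (0 : ℝ)..c, (tau t 1 ^ 2 * wt α t n s + m2 * φ s)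
      = tau t 1 ^ 2 * (c ^ (1 - α) / Real.Gamma (2 - α))
        + m2 * (2 * c ^ (-(α / 2)) * (c ^ (1 - α) / Real.Gamma (2 - α))
          + 2 * c ^ (-α) / Real.Gamma (1 - α) * (c ^ (1 - α / 2) / (1 - α / 2))) := by
    rw [intervalIntegral.integral_add ((hwi _ _).const_mul _) ((hφi _ _).const_mul _),
      intervalIntegral.integral_const_mul, intervalIntegral.integral_const_mul, hI1]
    simp only [hφ]
    rw [intervalIntegral.integral_add ((hwi _ _).const_mul _) ((hsi _ _).const_mul _),
      intervalIntegral.integral_const_mul, intervalIntegral.integral_const_mul, hI1, hI2]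
  have ht1 : t n ^ (α / 2) ≤ 1 + T :=
    (rpow_le_one_add htn.le (by linarith) (by linarith)).trans (by linarith [hm.le_T hn])
  have hc1 : c ^ (1 - α) ≤ 1 + T :=
    (rpow_le_one_add hc0.le (by linarith) (by linarith)).trans (by linarith)
  have htc : t n ^ (α / 2) ≤ 2 * c ^ (α / 2) := by
    have h := Real.rpow_le_rpow htn.le htn2 (by linarith : 0 ≤ α / 2)
    rw [Real.mul_rpow (by norm_num) hc0.le] at h
    have h2 : (2 : ℝ) ^ (α / 2) ≤ 2 := by
      calc (2 : ℝ) ^ (α / 2) ≤ 2 ^ (1 : ℝ) :=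
            Real.rpow_le_rpow_of_exponent_le (by norm_num) (by linarith)
        _ = 2 := Real.rpow_one 2
    have := Real.rpow_pos_of_pos hc0 (α / 2)
    nlinarith
  set ψ := Real.Gamma (2 - α) with hψ
  -- the second integral, times `t_n^{α/2}`
  have hbr : t n ^ (α / 2) * (2 * c ^ (-(α / 2)) * (c ^ (1 - α) / ψ)
      + 2 * c ^ (-α) / Real.Gamma (1 - α) * (c ^ (1 - α / 2) / (1 - α / 2))) ≤ 12 * ((1 + T) / ψ) := by
    have e1 : 1 / Real.Gamma (1 - α) ≤ 1 / ψ := by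
      apply one_div_le_one_div_of_le hΓ
      rw [hψ, Gamma_two_sub hα]
      nlinarith
    have e2 : 1 / (1 - α / 2) ≤ 2 := by
      rw [div_le_iff₀ (by linarith)]; linarith
    have c0 : ∀ p : ℝ, 0 < c ^ p := fun p => Real.rpow_pos_of_pos hc0 p
    have e3 : c ^ (α / 2) * (c ^ (-(α / 2)) * c ^ (1 - α)) = c ^ (1 - α) := by
      rw [← Real.rpow_add hc0, ← Real.rpow_add hc0]; congr 1; ring
    have e4 : c ^ (α / 2) * (c ^ (-α) * c ^ (1 - α / 2)) = c ^ (1 - α) := by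
      rw [← Real.rpow_add hc0, ← Real.rpow_add hc0]; congr 1; ring
    have hpos1 := c0 (-(α / 2))
    have hpos2 := c0 (1 - α)
    have hpos3 := c0 (-α)
    have hpos4 := c0 (1 - α / 2)
    have hpos5 := c0 (α / 2)
    have hbr0 : 2 * c ^ (-(α / 2)) * (c ^ (1 - α) / ψ)
        + 2 * c ^ (-α) / Real.Gamma (1 - α) * (c ^ (1 - α / 2) / (1 - α / 2))
        ≤ 2 * (c ^ (-(α / 2)) * c ^ (1 - α)) * (1 / ψ)
          + 2 * (c ^ (-α) * c ^ (1 - α / 2)) * (1 / ψ * 2) := by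
      have e5 : 2 * c ^ (-α) / Real.Gamma (1 - α) * (c ^ (1 - α / 2) / (1 - α / 2))
          = 2 * (c ^ (-α) * c ^ (1 - α / 2)) * (1 / Real.Gamma (1 - α) * (1 / (1 - α / 2))) := by
        ring
      rw [e5]
      have h12 : 0 < 1 - α / 2 := by linarith
      apply add_le_add (le_of_eq (by ring))
      gcongr
    calc _ ≤ (2 * c ^ (α / 2)) * (2 * (c ^ (-(α / 2)) * c ^ (1 - α)) * (1 / ψ)
          + 2 * (c ^ (-α) * c ^ (1 - α / 2)) * (1 / ψ * 2)) := by
          apply mul_le_mul htc hbr0 _ (by positivity)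
          have h12 : 0 < 1 - α / 2 := by linarith
          positivity
      _ = 4 * (c ^ (α / 2) * (c ^ (-(α / 2)) * c ^ (1 - α))) * (1 / ψ)
          + 8 * (c ^ (α / 2) * (c ^ (-α) * c ^ (1 - α / 2))) * (1 / ψ) := by ring
      _ = 12 * (c ^ (1 - α) / ψ) := by rw [e3, e4]; ring
      _ ≤ _ := by gcongr
  have hlastterm : t n ^ (α / 2) * (stepErr 3 t n * (tau t n ^ (-α) / ψ))
      ≤ (tau t 1 ^ 2 + m2) * ((1 + T) ^ 2 / ψ) := by
    have hτ := hm.tau_pos h1 hn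
    have htauT : tau t n ≤ T := (hm.tau_le hn).trans (hm.le_T hn)
    have e1 : tau t n ^ 3 * tau t n ^ (-α) = tau t n ^ 2 * tau t n ^ (1 - α) := by
      rw [sub_eq_add_neg, Real.rpow_add hτ, Real.rpow_one]; ring
    have e2 : tau t n ^ (1 - α) ≤ 1 + T :=
      (rpow_le_one_add hτ.le (by linarith) (by linarith)).trans (by linarith)
    have e3 : t n ^ (α / 2) * tau t n ^ 2 ≤ (1 + T) * (tau t 1 ^ 2 + m2) := by
      rcases eq_or_ne n 1 with rfl | hn1
      · calc _ ≤ (1 + T) * tau t 1 ^ 2 := by gcongr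
          _ ≤ _ := by gcongr; linarith
      · have := hM n (by omega) le_rfl
        have : 0 ≤ tau t 1 ^ 2 := sq_nonneg _
        nlinarith
    calc _ ≤ t n ^ (α / 2) * (tau t n ^ 3 * (tau t n ^ (-α) / ψ)) := by
          have := hstep n h1 hn
          gcongr
      _ = t n ^ (α / 2) * tau t n ^ 2 * tau t n ^ (1 - α) / ψ := by
          rw [← mul_div_assoc, e1]; ring
      _ ≤ (1 + T) * (tau t 1 ^ 2 + m2) * (1 + T) / ψ := by gcongr
      _ = _ := by ring
  have hfirst : t n ^ (α / 2) * (tau t 1 ^ 2 * (c ^ (1 - α) / ψ))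
      ≤ tau t 1 ^ 2 * ((1 + T) ^ 2 / ψ) := by
    calc _ ≤ (1 + T) * (tau t 1 ^ 2 * ((1 + T) / ψ)) := by gcongr
      _ = _ := by ring
  have hψ4 : (1 + T) ^ 2 / ψ ≤ 4 * (1 + T) ^ 2 := by
    have := quarter_le_Gamma_two_sub hα
    rw [div_le_iff₀ hΓ]
    have := sq_nonneg (1 + T)
    nlinarith
  have hTψ : (1 + T) / ψ ≤ (1 + T) ^ 2 / ψ := by
    apply div_le_div_of_nonneg_right _ hΓ.le
    nlinarith
  rw [hI3] at hsum
  have htp : 0 ≤ t n ^ (α / 2) := by positivity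
  have hA := mul_le_mul_of_nonneg_left hsum htp
  have hB := mul_le_mul_of_nonneg_left hbr hM0
  have hC := mul_le_mul_of_nonneg_left hTψ hM0
  have hD := mul_le_mul_of_nonneg_left hψ4 (by positivity : 0 ≤ tau t 1 ^ 2 + m2)
  have hE : 0 ≤ (tau t 1 ^ 2) * ((1 + T) ^ 2 / ψ) := by positivity
  have hF : 0 ≤ m2 * ((1 + T) ^ 2 / ψ) := by positivity
  rw [truncBound, mul_add]
  linarith

end global

/-! ### Sobolev functions of one variable -/

section sobolev

variable {a b : ℝ}

/-- `v` is a primitive of the integrable function `g` on `[a,b]`, that is, `v` is absolutely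
continuous with derivative `g`. -/
def IsPrim (a b : ℝ) (v g : ℝ → ℝ) : Prop :=
  IntervalIntegrable g volume a b ∧ ∀ x ∈ Icc a b, ∀ y ∈ Icc a b, v y - v x = ∫ s in x..y, g s

namespace IsPrim

variable {v g : ℝ → ℝ}

lemma intervalIntegrable (h : IsPrim a b v g) {x y : ℝ} (hx : x ∈ Icc a b) (hy : y ∈ Icc a b) :
    IntervalIntegrable g volume x y := by
  have hab : a ≤ b := hx.1.trans hx.2
  refine h.1.mono_set ?_
  rw [uIcc_of_le hab]
  exact uIcc_subset_Icc hx hy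

lemma continuousOn (h : IsPrim a b v g) : ContinuousOn v (Icc a b) := by
  rcases lt_or_ge b a with hab | hab
  · rw [Icc_eq_empty (not_le.2 hab)]; exact continuousOn_empty _
  have h1 : ContinuousOn (fun x => v a + ∫ s in a..x, g s) (Icc a b) := by
    rw [← uIcc_of_le hab]
    exact continuousOn_const.add
      (intervalIntegral.continuousOn_primitive_interval' h.1 left_mem_uIcc)
  refine h1.congr fun x hx => ?_
  simp only [← h.2 a (left_mem_Icc.2 hab) x hx, add_sub_cancel]

lemma hasDerivAt (h : IsPrim a b v g) (hg : ContinuousOn g (Icc a b)) {x : ℝ} (hx : x ∈ Ioo a b) :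
    HasDerivAt v (g x) x := by
  have hab : a ≤ b := (hx.1.trans hx.2).le
  have hxI := Ioo_subset_Icc_self hx
  have h1 : HasDerivAt (fun y => v a + ∫ s in a..y, g s) (g x) x := by
    refine (intervalIntegral.integral_hasDerivAt_right
      (h.intervalIntegrable (left_mem_Icc.2 hab) hxI) ?_ ?_).const_add _
    · exact ContinuousOn.stronglyMeasurableAtFilter isOpen_Ioo (hg.mono Ioo_subset_Icc_self) x hx
    · exact hg.continuousAt (Icc_mem_nhds hx.1 hx.2)
  refine h1.congr_of_eventuallyEq ?_
  filter_upwards [Icc_mem_nhds hx.1 hx.2] with y hy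
  rw [← h.2 a (left_mem_Icc.2 hab) y hy]; ring

lemma of_hasDerivWithinAt (hab : a ≤ b) (hd : ∀ x ∈ Icc a b, HasDerivWithinAt v (g x) (Icc a b) x)
    (hg : ContinuousOn g (Icc a b)) : IsPrim a b v g := by
  refine ⟨hg.intervalIntegrable_of_Icc hab, fun x hx y hy => ?_⟩
  have hs : uIcc x y ⊆ Icc a b := uIcc_subset_Icc hx hy
  symm
  apply intervalIntegral.integral_eq_sub_of_hasDeriv_right
    (fun z hz => (hd z (hs hz)).continuousWithinAt.mono hs) _
    ((hg.mono hs).intervalIntegrable)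
  intro z hz
  have hz' : a < z ∧ z < b := by
    have h1 : a ≤ min x y := le_min hx.1 hy.1
    have h2 : max x y ≤ b := max_le hx.2 hy.2
    exact ⟨h1.trans_lt hz.1, hz.2.trans_le h2⟩
  exact ((hd z ⟨hz'.1.le, hz'.2.le⟩).hasDerivAt (Icc_mem_nhds hz'.1 hz'.2)).hasDerivWithinAt

/-- Integration by parts against a continuously differentiable function. -/
lemma integral_mul_deriv (h : IsPrim a b v g) {φ : ℝ → ℝ} (hφ : ContDiff ℝ 1 φ)
    {x y : ℝ} (hx : x ∈ Icc a b) (hy : y ∈ Icc a b) :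
    ∫ s in x..y, v s * deriv φ s = v y * φ y - v x * φ x - ∫ s in x..y, g s * φ s := by
  have hs : uIcc x y ⊆ Icc a b := uIcc_subset_Icc hx hy
  have hi := h.intervalIntegrable hx hy
  have hac := hi.absolutelyContinuousOnInterval_intervalIntegral (c := x) left_mem_uIcc
  have hacφ : AbsolutelyContinuousOnInterval φ x y := by
    obtain ⟨K, hK⟩ := (hφ.contDiffOn (s := uIcc x y)).exists_lipschitzOnWith one_ne_zero
      (convex_uIcc x y) isCompact_uIcc
    exact hK.absolutelyContinuousOnInterval
  have key := hac.integral_mul_deriv_eq_deriv_mul hacφ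
  have hd : ∀ᵐ s, s ∈ uIcc x y → HasDerivAt (fun z => ∫ r in x..z, g r) (g s) s :=
    hi.ae_hasDerivAt_integral.mono fun s hs' hs => hs' hs x left_mem_uIcc
  have e1 : ∫ s in x..y, deriv (fun z => ∫ r in x..z, g r) s * φ s = ∫ s in x..y, g s * φ s := by
    apply intervalIntegral.integral_congr_ae
    filter_upwards [hd] with s h1 h2
    rw [(h1 (uIoc_subset_uIcc h2)).deriv]
  rw [e1, intervalIntegral.integral_same, zero_mul, sub_zero] at key
  have e2 : ∫ s in x..y, v s * deriv φ s
      = ∫ s in x..y, (v x * deriv φ s + (∫ r in x..s, g r) * deriv φ s) := by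
    apply intervalIntegral.integral_congr
    intro s hs'
    simp only
    rw [← h.2 x hx s (hs hs')]; ring
  have hφc : Continuous (deriv φ) := hφ.continuous_deriv le_rfl
  rw [e2, intervalIntegral.integral_add (hφc.intervalIntegrable _ _ |>.const_mul _) ?_,
    intervalIntegral.integral_const_mul, key, ← h.2 x hx y hy,
    intervalIntegral.integral_deriv_eq_sub (fun s _ => hφ.differentiable one_ne_zero s)
      (hφc.intervalIntegrable _ _)]
  · ring
  · exact (hac.continuousOn.mul hφc.continuousOn).intervalIntegrable

end IsPrim

lemma L2.intervalIntegrable (hab : a ≤ b) (v : L2 a b) : IntervalIntegrable v volume a b := by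
  rw [intervalIntegrable_iff_integrableOn_Ioo_of_le hab]
  exact (Lp.memLp v).integrable (by norm_num)

/-- A function all of whose integrals against derivatives of test functions vanish is constant. -/
lemma ae_eq_const_of_integral_deriv_eq_zero (hab : a < b) {f : ℝ → ℝ}
    (hf : IntegrableOn f (Ioo a b))
    (h : ∀ φ, IsTest a b φ → ∫ x in Ioo a b, f x * deriv φ x = 0) :
    ∃ c : ℝ, f =ᵐ[volume.restrict (Ioo a b)] fun _ => c := by
  -- for a test function `η` with integral one, `ψ - (∫ ψ) η` has integral zero, hence is the
  -- derivative of a test function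
  let β : ContDiffBump ((a + b) / 2) := ⟨(b - a) / 8, (b - a) / 4, by linarith, by linarith⟩
  set η : ℝ → ℝ := β.normed volume with hη
  have hηs : ContDiff ℝ (⊤ : ℕ∞) η := β.contDiff_normed
  have hηt : tsupport η ⊆ Icc ((3 * a + b) / 4) ((a + 3 * b) / 4) := by
    rw [hη, β.tsupport_normed_eq, Real.closedBall_eq_Icc]
    apply Icc_subset_Icc <;> simp only [β] <;> linarith
  have hη1 : ∫ x, η x = 1 := β.integral_normed
  have hηc : HasCompactSupport η := β.hasCompactSupport_normed
  have hmul : ∀ ψ : ℝ → ℝ, Continuous ψ → IntegrableOn (fun x => f x * ψ x) (Ioo a b) := by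
    intro ψ hψ
    have h1 : IntegrableOn f (Icc a b) := (integrableOn_Icc_iff_integrableOn_Ioo).2 hf
    exact (h1.mul_continuousOn hψ.continuousOn isCompact_Icc).mono_set Ioo_subset_Icc_self
  refine ⟨∫ x in Ioo a b, f x * η x, ?_⟩
  set c := ∫ x in Ioo a b, f x * η x with hc
  have key : ∀ ψ : ℝ → ℝ, ContDiff ℝ (⊤ : ℕ∞) ψ → HasCompactSupport ψ → tsupport ψ ⊆ Ioo a b →
      ∫ x in Ioo a b, f x * ψ x = (∫ x, ψ x) * c := by
    intro ψ hψ hψc hψt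
    set m := ∫ x, ψ x with hm
    obtain ⟨p, q, hap, hqb, hpq⟩ : ∃ p q, a < p ∧ q < b ∧ tsupport ψ ⊆ Icc p q := by
      rcases (tsupport ψ).eq_empty_or_nonempty with he | hne
      · exact ⟨b, a, hab, hab, by rw [he]; exact empty_subset _⟩
      · obtain ⟨p, hp, hp'⟩ := hψc.isCompact.exists_isLeast hne
        obtain ⟨q, hq, hq'⟩ := hψc.isCompact.exists_isGreatest hne
        exact ⟨p, q, (hψt hp).1, (hψt hq).2, fun x hx => ⟨hp' hx, hq' hx⟩⟩
    set p' := min p ((3 * a + b) / 4) with hp'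
    set q' := max q ((a + 3 * b) / 4) with hq'
    have hap' : a < p' := lt_min hap (by linarith)
    have hqb' : q' < b := max_lt hqb (by linarith)
    set ψ0 : ℝ → ℝ := fun x => ψ x - m * η x with hψ0
    have hψ0s : ContDiff ℝ (⊤ : ℕ∞) ψ0 := hψ.sub (contDiff_const.mul hηs)
    have hz : ∀ x, x ∉ Icc p' q' → ψ0 x = 0 := by
      intro x hx
      have h1 : x ∉ tsupport ψ := fun hh => hx ⟨(min_le_left _ _).trans (hpq hh).1,
        (hpq hh).2.trans (le_max_left _ _)⟩
      have h2 : x ∉ tsupport η := fun hh => hx ⟨(min_le_right _ _).trans (hηt hh).1,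
        (hηt hh).2.trans (le_max_right _ _)⟩
      rw [hψ0]
      simp only [image_eq_zero_of_notMem_tsupport h1, image_eq_zero_of_notMem_tsupport h2]
      ring
    have hii : ∀ x y, IntervalIntegrable ψ0 volume x y := fun x y =>
      hψ0s.continuous.intervalIntegrable _ _
    have hint : ∫ x, ψ0 x = 0 := by
      rw [hψ0, integral_sub (hψ.continuous.integrable_of_hasCompactSupport hψc)
        ((hηs.continuous.integrable_of_hasCompactSupport hηc).const_mul _), integral_const_mul, hη1,
        hm]
      ring
    set φ : ℝ → ℝ := fun x => ∫ s in a..x, ψ0 s with hφ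
    have hφd : ∀ x, HasDerivAt φ (ψ0 x) x := fun x =>
      intervalIntegral.integral_hasDerivAt_right (hii _ _)
        (hψ0s.continuous.stronglyMeasurableAtFilter _ _) hψ0s.continuous.continuousAt
    have hφ' : deriv φ = ψ0 := funext fun x => (hφd x).deriv
    have hφz : ∀ x, x ∉ Icc p' q' → φ x = 0 := by
      intro x hx
      rcases lt_or_ge x p' with h1 | h1
      · rw [hφ]
        simp only
        rw [intervalIntegral.integral_congr (g := fun _ => (0 : ℝ)),
          intervalIntegral.integral_zero]
        intro s hs
        refine hz s fun hh => ?_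
        have := (mem_uIcc.1 hs)
        rcases this with h2 | h2 <;> linarith [hh.1, h2.2]
      · have h2 : q' < x := by
          by_contra hcon
          exact hx ⟨h1, not_lt.1 hcon⟩
        rw [← hint, hφ]
        apply intervalIntegral.integral_eq_integral_of_support_subset
        intro s hs
        by_contra hcon
        exact hs (hz s fun hh => hcon ⟨hap'.trans_le hh.1, hh.2.trans h2.le⟩)
    have hφt : tsupport φ ⊆ Icc p' q' := by
      apply closure_minimal _ isClosed_Icc
      intro x hx
      by_contra hcon
      exact hx (hφz x hcon)
    have hφs : ContDiff ℝ (⊤ : ℕ∞) φ := by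
      rw [contDiff_infty_iff_deriv, hφ']
      exact ⟨fun x => (hφd x).differentiableAt, hψ0s⟩
    have hT : IsTest a b φ := ⟨hφs, HasCompactSupport.of_support_subset_isCompact isCompact_Icc
      (subset_closure.trans hφt), hφt.trans (Icc_subset_Ioo hap' hqb')⟩
    have h0 := h φ hT
    rw [hφ'] at h0
    have e : ∫ x in Ioo a b, f x * ψ0 x
        = ∫ x in Ioo a b, (f x * ψ x - m * (f x * η x)) := by
      congr 1; funext x; rw [hψ0]; ring
    rw [e, integral_sub (hmul ψ hψ.continuous) ((hmul η hηs.continuous).const_mul _),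
      integral_const_mul, ← hc] at h0
    linarith
  have hfin := isOpen_Ioo.ae_eq_zero_of_integral_contDiff_smul_eq_zero (μ := volume)
    (U := Ioo a b) (f := fun x => f x - c)
    ((hf.sub (integrableOn_const (by simp))).locallyIntegrableOn) (by
      intro ψ hψ hψc hψt
      have h1 := key ψ hψ hψc hψt
      have hsupp : ∀ F : ℝ → ℝ, ∫ x in Ioo a b, F x * ψ x = ∫ x, F x * ψ x := by
        intro F
        apply setIntegral_eq_integral_of_forall_compl_eq_zero
        intro x hx
        rw [image_eq_zero_of_notMem_tsupport (fun hh => hx (hψt hh)), mul_zero]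
      have h2 : ∫ x, ψ x • (f x - c) = ∫ x in Ioo a b, (f x * ψ x - c * ψ x) := by
        rw [← (by simpa [mul_comm] using hsupp (fun x => f x - c) :
          ∫ x in Ioo a b, (f x - c) * ψ x = ∫ x, ψ x • (f x - c))]
        congr 1; funext x; ring
      have h3 := hsupp fun _ => 1
      simp only [one_mul] at h3
      rw [h2, integral_sub (hmul ψ hψ.continuous)
        ((hψ.continuous.integrable_of_hasCompactSupport hψc).integrableOn.const_mul _),
        integral_const_mul, h1, h3]
      ring)
  rw [Filter.EventuallyEq, ae_restrict_iff' measurableSet_Ioo]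
  filter_upwards [hfin] with x hx hxI
  linarith [hx hxI]

/-- An `L²` function with a weak derivative in `L²` has an absolutely continuous representative. -/
lemma exists_isPrim (hab : a < b) {v g : L2 a b} (h : IsWeakDeriv a b 1 v g) :
    ∃ d : ℝ → ℝ, IsPrim a b d g ∧ v =ᵐ[volume.restrict (Ioo a b)] d := by
  have hgi := L2.intervalIntegrable hab.le g
  have hvi := (intervalIntegrable_iff_integrableOn_Ioo_of_le hab.le).1
    (L2.intervalIntegrable hab.le v)
  set G : ℝ → ℝ := fun x => ∫ s in a..x, g s with hG
  have hGp : IsPrim a b G g := by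
    refine ⟨hgi, fun x hx y hy => ?_⟩
    have hI : ∀ z ∈ Icc a b, IntervalIntegrable g volume a z := fun z hz =>
      hgi.mono_set (by
        rw [uIcc_of_le hab.le]
        exact uIcc_subset_Icc (left_mem_Icc.2 hab.le) hz)
    exact intervalIntegral.integral_interval_sub_left (hI y hy) (hI x hx)
  have hGi : IntegrableOn G (Ioo a b) :=
    (hGp.continuousOn.integrableOn_Icc).mono_set Ioo_subset_Icc_self
  obtain ⟨c, hc⟩ := ae_eq_const_of_integral_deriv_eq_zero hab (f := fun x => v x - G x)
    (hvi.sub hGi) (by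
      intro φ hφ
      have h1 := h φ hφ
      have hφ0 : φ a = 0 ∧ φ b = 0 := by
        constructor <;>
        exact image_eq_zero_of_notMem_tsupport (fun hh => by simpa using hφ.2.2 hh)
      have hφ1 : ContDiff ℝ 1 φ := hφ.1.of_le (by exact_mod_cast le_top)
      have h2 := hGp.integral_mul_deriv hφ1 (left_mem_Icc.2 hab.le) (right_mem_Icc.2 hab.le)
      rw [hφ0.1, hφ0.2, intervalIntegral.integral_of_le hab.le,
        intervalIntegral.integral_of_le hab.le, integral_Ioc_eq_integral_Ioo,
        integral_Ioc_eq_integral_Ioo] at h2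
      simp only [iteratedDeriv_one] at h1
      have hi1 := hφ.integrable 1 v
      rw [iteratedDeriv_one] at hi1
      have hi2 : IntegrableOn (fun x => G x * deriv φ x) (Ioo a b) :=
        ((hGp.continuousOn.mul
          (hφ1.continuous_deriv le_rfl).continuousOn).integrableOn_Icc).mono_set Ioo_subset_Icc_self
      calc _ = ∫ x in Ioo a b, (v x * deriv φ x - G x * deriv φ x) := by
            congr 1; funext x; ring
        _ = 0 := by
            rw [integral_sub hi1 hi2, h1, h2]; ring)
  refine ⟨fun x => c + G x, ⟨hgi, fun x hx y hy => ?_⟩, ?_⟩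
  · rw [← hGp.2 x hx y hy]; ring
  · filter_upwards [hc] with x hx
    linarith

/-- Consecutive components of an element of `H^k` are weak derivatives of one another. -/
lemma H.isWeakDeriv_succ {k : ℕ} (W : H a b k) (i j : Fin (k + 1)) (hij : (j : ℕ) = i + 1) :
    IsWeakDeriv a b 1 ((W : PiLp 2 (fun _ : Fin (k + 1) => L2 a b)) i)
      ((W : PiLp 2 (fun _ : Fin (k + 1) => L2 a b)) j) := by
  intro φ hφ
  have hφ' : IsTest a b (deriv φ) :=
    ⟨(contDiff_infty_iff_deriv.1 hφ.1).2, hφ.2.1.deriv,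
      (closure_mono support_deriv_subset).trans
        (by rw [(isClosed_tsupport φ).closure_eq]; exact hφ.2.2)⟩
  have h1 := W.2 i (deriv φ) hφ'
  have h2 := W.2 j φ hφ
  rw [hij, iteratedDeriv_succ'] at h2
  rw [h1, pow_succ, mul_assoc] at h2
  have h3 := mul_left_cancel₀ (pow_ne_zero _ (by norm_num)) h2
  rw [iteratedDeriv_one, h3]
  simp

/-- The `j`-th component of an element of `H^k`, that is, its `j`-th weak derivative. -/
noncomputable def H.comp (a b : ℝ) (k : ℕ) (j : Fin (k + 1)) : H a b k →L[ℝ] L2 a b :=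
  (PiLp.proj 2 (fun _ : Fin (k + 1) => L2 a b) j).comp (H a b k).subtypeL

lemma H.norm_comp_le {k : ℕ} (j : Fin (k + 1)) (W : H a b k) : ‖H.comp a b k j W‖ ≤ ‖W‖ :=
  PiLp.norm_apply_le (W : PiLp 2 (fun _ : Fin (k + 1) => L2 a b)) j

/-- The functional `w ↦ ∫ q w` on `L²`, for a square integrable `q`. -/
noncomputable def L2.dual {q : ℝ → ℝ} (hq : MemLp q 2 (volume.restrict (Ioo a b))) :
    L2 a b →L[ℝ] ℝ := innerSL ℝ (hq.toLp q)

lemma L2.dual_apply {q : ℝ → ℝ} (hq : MemLp q 2 (volume.restrict (Ioo a b))) (w : L2 a b) :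
    L2.dual hq w = ∫ s in Ioo a b, q s * w s := by
  rw [L2.dual, innerSL_apply_apply, L2.inner_def]
  refine integral_congr_ae ?_
  filter_upwards [hq.coeFn_toLp] with s hs
  rw [hs]
  simp [mul_comm]

/-- The kernel of the evaluation functional at `x`. -/
noncomputable def evalKernel (a b x s : ℝ) : ℝ := if s ≤ x then s - a else s - b

lemma memLp_evalKernel (a b x : ℝ) : MemLp (evalKernel a b x) 2 (volume.restrict (Ioo a b)) := by
  refine MemLp.of_bound (C := b - a) ?_ ?_
  · refine (Measurable.ite measurableSet_Iic ?_ ?_).aestronglyMeasurable <;> fun_prop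
  · filter_upwards [self_mem_ae_restrict measurableSet_Ioo] with s hs
    rw [Real.norm_eq_abs, evalKernel]
    split_ifs
    · rw [abs_of_nonneg (by linarith [hs.1])]; linarith [hs.2]
    · rw [abs_of_nonpos (by linarith [hs.2])]; linarith [hs.1]

/-- Evaluation at `x` of the continuous representative of an element of `H^{k+1}`. It is written
in terms of the function and of its first derivative, so that it is manifestly a bounded
functional. -/
noncomputable def H.eval (a b x : ℝ) (k : ℕ) : H a b (k + 1) →L[ℝ] ℝ :=
  (b - a)⁻¹ • ((L2.dual (memLp_const (1 : ℝ))).comp (H.comp a b (k + 1) 0)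
    + (L2.dual (memLp_evalKernel a b x)).comp (H.comp a b (k + 1) 1))

lemma IsPrim.mul_eq_add {v g : ℝ → ℝ} (h : IsPrim a b v g) (hab : a < b) {x : ℝ}
    (hx : x ∈ Icc a b) :
    (b - a) * v x = (∫ s in Ioo a b, v s) + ∫ s in Ioo a b, evalKernel a b x s * g s := by
  have ha := left_mem_Icc.2 hab.le
  have hb := right_mem_Icc.2 hab.le
  have h1 := h.integral_mul_deriv (φ := fun s => s - a) (by fun_prop) ha hx
  have h2 := h.integral_mul_deriv (φ := fun s => s - b) (by fun_prop) hx hb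
  simp only [deriv_sub_const, deriv_id'', mul_one, sub_self, mul_zero, sub_zero] at h1 h2
  have hc := h.continuousOn
  have e1 : ∫ s in Ioo a b, v s = (∫ s in a..x, v s) + ∫ s in x..b, v s := by
    rw [intervalIntegral.integral_add_adjacent_intervals, intervalIntegral.integral_of_le hab.le,
      integral_Ioc_eq_integral_Ioo]
    · exact (hc.mono (Icc_subset_Icc_right hx.2)).intervalIntegrable_of_Icc hx.1
    · exact (hc.mono (Icc_subset_Icc_left hx.1)).intervalIntegrable_of_Icc hx.2
  have k1 : ∫ s in Ioc a x, evalKernel a b x s * g s = ∫ s in a..x, g s * (s - a) := by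
    rw [intervalIntegral.integral_of_le hx.1]
    apply setIntegral_congr_fun measurableSet_Ioc
    intro s hs
    simp only [evalKernel, if_pos hs.2]
    ring
  have k2 : ∫ s in Ioc x b, evalKernel a b x s * g s = ∫ s in x..b, g s * (s - b) := by
    rw [intervalIntegral.integral_of_le hx.2]
    apply setIntegral_congr_fun measurableSet_Ioc
    intro s hs
    simp only [evalKernel, if_neg (not_le.2 hs.1)]
    ring
  have i1 : IntegrableOn (fun s => evalKernel a b x s * g s) (Ioc a x) := by
    have : IntervalIntegrable (fun s => g s * (s - a)) volume a x :=
      (h.intervalIntegrable ha hx).mul_continuousOn (by fun_prop)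
    rw [intervalIntegrable_iff_integrableOn_Ioc_of_le hx.1] at this
    refine this.congr_fun (fun s hs => ?_) measurableSet_Ioc
    simp only [evalKernel, if_pos hs.2]
    ring
  have i2 : IntegrableOn (fun s => evalKernel a b x s * g s) (Ioc x b) := by
    have : IntervalIntegrable (fun s => g s * (s - b)) volume x b :=
      (h.intervalIntegrable hx hb).mul_continuousOn (by fun_prop)
    rw [intervalIntegrable_iff_integrableOn_Ioc_of_le hx.2] at this
    refine this.congr_fun (fun s hs => ?_) measurableSet_Ioc
    simp only [evalKernel, if_neg (not_le.2 hs.1)]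
    ring
  have e2 : ∫ s in Ioo a b, evalKernel a b x s * g s
      = (∫ s in a..x, g s * (s - a)) + ∫ s in x..b, g s * (s - b) := by
    rw [← integral_Ioc_eq_integral_Ioo, ← Ioc_union_Ioc_eq_Ioc hx.1 hx.2,
      setIntegral_union (Ioc_disjoint_Ioc_of_le le_rfl) measurableSet_Ioc i1 i2, k1, k2]
  rw [e1, e2, h1, h2]
  ring

lemma H.eval_eq (hab : a < b) {k : ℕ} (W : H a b (k + 1)) {d : ℝ → ℝ}
    (hd : IsPrim a b d (H.comp a b (k + 1) 1 W))
    (hW : H.comp a b (k + 1) 0 W =ᵐ[volume.restrict (Ioo a b)] d) {x : ℝ} (hx : x ∈ Icc a b) :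
    H.eval a b x k W = d x := by
  have h0 : 0 < b - a := sub_pos.2 hab
  have e : ∫ s in Ioo a b, 1 * H.comp a b (k + 1) 0 W s = ∫ s in Ioo a b, d s := by
    refine integral_congr_ae ?_
    filter_upwards [hW] with s hs
    rw [one_mul, hs]
  rw [H.eval, _root_.smul_apply, _root_.add_apply,
    ContinuousLinearMap.comp_apply, ContinuousLinearMap.comp_apply, L2.dual_apply, L2.dual_apply,
    e, ← hd.mul_eq_add hab hx, smul_eq_mul, inv_mul_cancel_left₀ h0.ne']

lemma H.isPrim_eval (hab : a < b) {k : ℕ} (W : H a b (k + 1)) :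
    IsPrim a b (fun x => H.eval a b x k W) (H.comp a b (k + 1) 1 W) := by
  obtain ⟨d, hd, hW⟩ := exists_isPrim hab (H.isWeakDeriv_succ W 0 1 (by simp))
  refine ⟨hd.1, fun x hx y hy => ?_⟩
  simp only
  rw [H.eval_eq hab W hd hW hx, H.eval_eq hab W hd hW hy]
  exact hd.2 x hx y hy

/-- A continuous function that represents `W` is given by evaluation. -/
lemma Represents.eq_eval (hab : a < b) {k : ℕ} {W : H a b (k + 1)} {v : ℝ → ℝ}
    (h : Represents W v) (hv : ContinuousOn v (Icc a b)) {x : ℝ} (hx : x ∈ Icc a b) :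
    v x = H.eval a b x k W := by
  obtain ⟨d, hd, hW⟩ := exists_isPrim hab (H.isWeakDeriv_succ W 0 1 (by simp))
  rw [H.eval_eq hab W hd hW hx]
  have hvd : v =ᵐ[volume.restrict (Ioo a b)] d := by
    filter_upwards [h, hW] with s h1 h2
    rw [← h1, h2]
  rw [restrict_Ioo_eq_restrict_Icc] at hvd
  exact Measure.eqOn_Icc_of_ae_eq volume hab.ne hvd hv hd.continuousOn hx

lemma L2.integral_sq (w : L2 a b) : ∫ s in Ioo a b, w s ^ 2 = ‖w‖ ^ 2 := by
  rw [← real_inner_self_eq_norm_sq, L2.inner_def]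
  congr 1; funext s; simp [sq]

lemma L2.integrableOn_sq (w : L2 a b) : IntegrableOn (fun s => w s ^ 2) (Ioo a b) :=
  (Lp.memLp w).integrable_sq

/-- The Cauchy-Schwarz inequality on a subinterval. -/
lemma L2.sq_integral_abs_le (w : L2 a b) {x y : ℝ} (hx : x ∈ Icc a b) (hy : y ∈ Icc a b)
    (hxy : x ≤ y) : (∫ s in x..y, |w s|) ^ 2 ≤ (y - x) * ∫ s in x..y, w s ^ 2 := by
  have hab : a ≤ b := hx.1.trans hx.2
  have hss : Ioc x y ⊆ Ioc a b := Ioc_subset_Ioc hx.1 hy.2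
  have i2 : IntervalIntegrable (fun s => w s ^ 2) volume x y := by
    rw [intervalIntegrable_iff_integrableOn_Ioc_of_le hxy]
    exact ((integrableOn_Ioc_iff_integrableOn_Ioo).2 w.integrableOn_sq).mono_set hss
  have i1 : IntervalIntegrable (fun s => |w s|) volume x y :=
    ((L2.intervalIntegrable hab w).mono_set (by
      rw [uIcc_of_le hab]; exact uIcc_subset_Icc hx hy)).abs
  rcases eq_or_lt_of_le hxy with rfl | hlt
  · simp
  have hl : 0 < y - x := sub_pos.2 hlt
  set m := ∫ s in x..y, |w s| with hm
  -- expand the square of `|w| - m / (y - x)`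
  have h0 : 0 ≤ ∫ s in x..y, (w s ^ 2 - 2 * (m / (y - x)) * |w s| + (m / (y - x)) ^ 2) := by
    apply intervalIntegral.integral_nonneg hxy
    intro s _
    rw [← sq_abs (w s)]
    nlinarith [sq_nonneg (|w s| - m / (y - x))]
  rw [intervalIntegral.integral_add (i2.sub (i1.const_mul _)) intervalIntegrable_const,
    intervalIntegral.integral_sub i2 (i1.const_mul _), intervalIntegral.integral_const_mul,
    intervalIntegral.integral_const, ← hm, smul_eq_mul] at h0
  have e : (y - x) * ((∫ s in x..y, w s ^ 2) - 2 * (m / (y - x)) * m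
      + (y - x) * (m / (y - x)) ^ 2) = (y - x) * (∫ s in x..y, w s ^ 2) - m ^ 2 := by
    field_simp; ring
  have := mul_nonneg hl.le h0
  rw [e] at this
  linarith

lemma L2.integral_abs_le (hab : a ≤ b) (w : L2 a b) :
    ∫ s in a..b, |w s| ≤ √(b - a) * ‖w‖ := by
  have h := w.sq_integral_abs_le (left_mem_Icc.2 hab) (right_mem_Icc.2 hab) hab
  rw [intervalIntegral.integral_of_le hab (f := fun s => w s ^ 2), integral_Ioc_eq_integral_Ioo,
    w.integral_sq] at h
  apply abs_le_of_sq_le_sq' _ (by positivity) |>.2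
  rw [mul_pow, Real.sq_sqrt (sub_nonneg.2 hab)]
  exact h

/-- The constant of the embedding of `H¹` into the continuous functions. -/
noncomputable def embConst (a b : ℝ) : ℝ := √(b - a) / (b - a) + √(b - a)

lemma embConst_nonneg (hab : a < b) : 0 ≤ embConst a b := by
  have := sub_pos.2 hab
  unfold embConst; positivity

lemma abs_le_of_isPrim (hab : a < b) {v g : L2 a b} {d : ℝ → ℝ} (hd : IsPrim a b d g)
    (hv : v =ᵐ[volume.restrict (Ioo a b)] d) {x : ℝ} (hx : x ∈ Icc a b) {B : ℝ} (h1 : ‖v‖ ≤ B)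
    (h2 : ‖g‖ ≤ B) : |d x| ≤ embConst a b * B := by
  have hl : 0 < b - a := sub_pos.2 hab
  have h := hd.mul_eq_add hab hx
  have e1 : |∫ s in Ioo a b, d s| ≤ √(b - a) * ‖v‖ := by
    refine le_trans ?_ (L2.integral_abs_le hab.le v)
    have e : ∫ s in Ioo a b, d s = ∫ s in Ioo a b, v s := (integral_congr_ae hv).symm
    rw [e, intervalIntegral.integral_of_le hab.le,
      integral_Ioc_eq_integral_Ioo]
    exact norm_integral_le_integral_norm (fun s => v s)
  have hgi : IntegrableOn g (Ioo a b) :=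
    (intervalIntegrable_iff_integrableOn_Ioo_of_le hab.le).1 hd.1
  have e2 : |∫ s in Ioo a b, evalKernel a b x s * g s| ≤ (b - a) * (√(b - a) * ‖g‖) := by
    refine le_trans ?_ (mul_le_mul_of_nonneg_left (L2.integral_abs_le hab.le g) hl.le)
    rw [intervalIntegral.integral_of_le hab.le, integral_Ioc_eq_integral_Ioo,
      ← integral_const_mul, ← Real.norm_eq_abs]
    have hga : Integrable (fun s => |g s|) (volume.restrict (Ioo a b)) := hgi.abs
    refine norm_integral_le_of_norm_le (hga.const_mul (b - a)) ?_
    filter_upwards [self_mem_ae_restrict measurableSet_Ioo] with s hs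
    rw [norm_mul, Real.norm_eq_abs, Real.norm_eq_abs]
    apply mul_le_mul_of_nonneg_right _ (abs_nonneg _)
    rw [evalKernel]
    split_ifs
    · rw [abs_of_nonneg (by linarith [hs.1])]; linarith [hs.2]
    · rw [abs_of_nonpos (by linarith [hs.2])]; linarith [hs.1]
  have h3 : (b - a) * |d x| ≤ √(b - a) * B + (b - a) * (√(b - a) * B) := by
    rw [← abs_of_pos hl, ← abs_mul, h, abs_of_pos hl]
    refine (abs_add_le _ _).trans (add_le_add (e1.trans ?_) (e2.trans ?_)) <;> gcongr
  have e : (b - a) * (embConst a b * B) = √(b - a) * B + (b - a) * (√(b - a) * B) := by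
    rw [embConst]; field_simp
  rw [← e] at h3
  exact le_of_mul_le_mul_left h3 hl

lemma H.abs_eval_le (hab : a < b) {k : ℕ} (W : H a b (k + 1)) {x : ℝ} (hx : x ∈ Icc a b) :
    |H.eval a b x k W| ≤ embConst a b * ‖W‖ := by
  obtain ⟨d, hd, hW⟩ := exists_isPrim hab (H.isWeakDeriv_succ W 0 1 (by simp))
  rw [H.eval_eq hab W hd hW hx]
  exact abs_le_of_isPrim hab hd hW hx (H.norm_comp_le 0 W) (H.norm_comp_le 1 W)

/-- Intermediate derivatives have absolutely continuous representatives, too. -/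
lemma H.exists_isPrim_succ (hab : a < b) {k : ℕ} (W : H a b k) (i j : Fin (k + 1))
    (hij : (j : ℕ) = i + 1) :
    ∃ d : ℝ → ℝ, IsPrim a b d (H.comp a b k j W) ∧
      H.comp a b k i W =ᵐ[volume.restrict (Ioo a b)] d ∧
      ∀ x ∈ Icc a b, |d x| ≤ embConst a b * ‖W‖ := by
  obtain ⟨d, hd, hW⟩ := exists_isPrim hab (H.isWeakDeriv_succ W i j hij)
  exact ⟨d, hd, hW, fun x hx =>
    abs_le_of_isPrim hab hd hW hx (H.norm_comp_le i W) (H.norm_comp_le j W)⟩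

lemma IsPrim.congr_ae (hab : a ≤ b) {v g g' : ℝ → ℝ} (h : IsPrim a b v g)
    (hg : g =ᵐ[volume.restrict (Ioo a b)] g') : IsPrim a b v g' := by
  rw [restrict_Ioo_eq_restrict_Ioc] at hg
  refine ⟨h.1.congr_ae (by rwa [uIoc_of_le hab]), fun x hx y hy => ?_⟩
  rw [h.2 x hx y hy]
  apply intervalIntegral.integral_congr_ae
  rw [Filter.EventuallyEq, ae_restrict_iff' measurableSet_Ioc] at hg
  filter_upwards [hg] with s hs hs'
  apply hs
  rw [uIoc] at hs'
  exact ⟨(le_min hx.1 hy.1).trans_lt hs'.1, hs'.2.trans (max_le hx.2 hy.2)⟩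

end sobolev

/-! ### Scalar functions obtained from vector-valued ones by bounded functionals -/

section functionals

variable {X : Type*} [NormedAddCommGroup X] [NormedSpace ℝ X] {σ T K : ℝ} {U : ℝ → X}

/-- A constant `D` with `1 + t ^ p ≤ D t ^ p` for `0 < t ≤ T` and `-3 ≤ p ≤ 0`. -/
noncomputable def timeConst (T : ℝ) : ℝ := 1 + (1 + T) ^ 3

lemma timeConst_pos (hT : 0 < T) : 0 < timeConst T := by
  unfold timeConst; positivity

lemma one_add_rpow_le {s p : ℝ} (hs : s ∈ Ioc 0 T) (hp : p ≤ 0) (hp3 : -3 ≤ p) :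
    1 + s ^ p ≤ timeConst T * s ^ p := by
  have hs0 := hs.1
  have h1 : s ^ (-p) ≤ (1 + T) ^ 3 := by
    calc s ^ (-p) ≤ (1 + T) ^ (-p) :=
          Real.rpow_le_rpow hs0.le (by linarith [hs.2]) (by linarith)
      _ ≤ (1 + T) ^ (3 : ℝ) :=
          Real.rpow_le_rpow_of_exponent_le (by linarith [hs.2]) (by linarith)
      _ = (1 + T) ^ 3 := by norm_cast
  have h2 : s ^ (-p) * s ^ p = 1 := by
    rw [← Real.rpow_add hs0, neg_add_cancel, Real.rpow_zero]
  have h3 := Real.rpow_pos_of_pos hs0 p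
  have h4 := mul_le_mul_of_nonneg_right h1 h3.le
  unfold timeConst
  linarith

lemma CSigma.hasDerivWithinAt {m : ℕ} (hU : CSigma m σ T K U) (Φ : X →L[ℝ] ℝ) {l : ℕ} (hl : l < m)
    {s : ℝ} (hs : s ∈ Ioc 0 T) :
    HasDerivWithinAt (fun r => Φ (iteratedDerivWithin l U (Ioc 0 T) r))
      (Φ (iteratedDerivWithin (l + 1) U (Ioc 0 T) s)) (Ioc 0 T) s := by
  have h1 := hU.2.1.differentiableOn_iteratedDerivWithin (m := l) (by exact_mod_cast hl)
    (uniqueDiffOn_Ioc 0 T) s hs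
  have h2 := h1.hasDerivWithinAt
  rw [← iteratedDerivWithin_succ] at h2
  exact Φ.hasFDerivAt.comp_hasDerivWithinAt s h2

/-- A bounded functional applied to a function in `C³_σ`. -/
lemma CSigma.timeReg (hU : CSigma 3 σ T K U) (hσ : 0 < σ) (hσ2 : σ < 2) (hT : 0 < T)
    (Φ : X →L[ℝ] ℝ) {C : ℝ} (hC0 : 0 ≤ C) (hC : ∀ w, |Φ w| ≤ C * ‖w‖) {g : ℝ → ℝ}
    (hg : ∀ s ∈ Icc 0 T, g s = Φ (U s)) :
    TimeReg T σ (C * K * timeConst T) g (fun s => Φ (iteratedDerivWithin 1 U (Ioc 0 T) s))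
      (fun s => Φ (iteratedDerivWithin 2 U (Ioc 0 T) s))
      (fun s => Φ (iteratedDerivWithin 3 U (Ioc 0 T) s)) := by
  have hb : ∀ l : ℕ, 1 ≤ l → l ≤ 3 → ∀ s ∈ Ioc 0 T,
      |Φ (iteratedDerivWithin l U (Ioc 0 T) s)| ≤ C * (K * (1 + s ^ (σ - l))) :=
    fun l h1 h3 s hs => (hC _).trans (mul_le_mul_of_nonneg_left (hU.2.2 l h1 h3 s hs) hC0)
  have hK : 0 ≤ K := by
    have h1 := (norm_nonneg _).trans (hU.2.2 1 le_rfl (by norm_num) T ⟨hT, le_rfl⟩)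
    have h2 := Real.rpow_pos_of_pos hT (σ - (1 : ℕ))
    exact nonneg_of_mul_nonneg_left h1 (by linarith)
  refine ⟨?_, ?_, fun s hs => hU.hasDerivWithinAt Φ (by norm_num) hs,
    fun s hs => hU.hasDerivWithinAt Φ (by norm_num) hs, ?_, ?_⟩
  · exact (Φ.continuous.comp_continuousOn hU.1).congr hg
  · intro s hs
    have h := hU.hasDerivWithinAt Φ (l := 0) (by norm_num) hs
    simp only [iteratedDerivWithin_zero] at h
    exact h.congr (fun r hr => hg r (Ioc_subset_Icc_self hr)) (hg s (Ioc_subset_Icc_self hs))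
  · rw [intervalIntegrable_iff_integrableOn_Ioc_of_le hT.le]
    have hbi : IntegrableOn (fun s : ℝ => C * (K * (1 + s ^ (σ - (1 : ℕ))))) (Ioc 0 T) := by
      rw [← intervalIntegrable_iff_integrableOn_Ioc_of_le hT.le]
      exact ((intervalIntegrable_const.add
        (intervalIntegral.intervalIntegrable_rpow' (by push_cast; linarith))).const_mul _).const_mul _
    refine Integrable.mono' hbi ?_ ?_
    · have hc : ContinuousOn (fun s => Φ (iteratedDerivWithin 1 U (Ioc 0 T) s)) (Ioc 0 T) :=
        fun s hs => (hU.hasDerivWithinAt Φ (by norm_num) hs).continuousWithinAt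
      exact hc.aestronglyMeasurable measurableSet_Ioc
    · filter_upwards [self_mem_ae_restrict measurableSet_Ioc] with s hs
      exact hb 1 le_rfl (by norm_num) s hs
  · intro s hs
    refine (hb 3 (by norm_num) le_rfl s hs).trans ?_
    have := one_add_rpow_le hs (p := σ - 3) (by linarith) (by linarith)
    have e : ((3 : ℕ) : ℝ) = 3 := by norm_num
    rw [e, mul_assoc, mul_assoc, ← mul_assoc C, ← mul_assoc C]
    gcongr

variable {α : ℝ} {N : ℕ} {t : ℕ → ℝ} {ι : Type*}

/-- The truncation errors of a vector of functions, tested with arbitrary weights: they are the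
truncation error of a single scalar function, whose regularity is measured by the norm of the
functional that the weights define. -/
theorem CSigma.abs_sum_truncErr_le (hU : CSigma 3 σ T K U) (hα : α ∈ Ioo (0 : ℝ) 1) (hσ : 0 < σ)
    (hσ2 : σ < 2) (hK : 0 ≤ K) (hm : IsMesh T N t) {n : ℕ} (h1 : 1 ≤ n) (hn : n ≤ N)
    (I : Finset ι) (Φ : ι → X →L[ℝ] ℝ) (q : ι → ℝ) {C : ℝ} (hC0 : 0 ≤ C)
    (hC : ∀ w, |∑ i ∈ I, q i * Φ i w| ≤ C * ‖w‖) {u : ι → ℝ → ℝ}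
    (hu : ∀ i ∈ I, ∀ s ∈ Icc 0 T, u i s = Φ i (U s)) :
    |∑ i ∈ I, q i * truncErr α t (u i) n| ≤ C * K * timeConst T * truncBound α σ t n := by
  have hT : 0 < T := (hm.pos h1 hn).trans_le (hm.le_T hn)
  set Ψ : X →L[ℝ] ℝ := ∑ i ∈ I, q i • Φ i with hΨ
  have hΨa : ∀ w, Ψ w = ∑ i ∈ I, q i * Φ i w := by
    intro w
    rw [hΨ, _root_.sum_apply]
    rfl
  have hreg := hU.timeReg hσ hσ2 hT Ψ hC0 (fun w => by rw [hΨa]; exact hC w)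
    (g := fun s => ∑ i ∈ I, q i * u i s) (fun s hs => by
      rw [hΨa]; exact Finset.sum_congr rfl fun i hi => by rw [hu i hi s hs])
  have hregi := fun i (hi : i ∈ I) =>
    hU.timeReg hσ hσ2 hT (Φ i) (norm_nonneg (Φ i)) (fun w => (Φ i).le_opNorm w) (hu i hi)
  have hcap : ∑ i ∈ I, q i * caputo α (u i) (tOff α t n)
      = caputo α (fun s => ∑ i ∈ I, q i * u i s) (tOff α t n) := by
    rw [hreg.caputo_eq hα hm h1 hn]
    simp only [hΨa, Finset.mul_sum]
    rw [intervalIntegral.integral_finsetSum]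
    · refine Finset.sum_congr rfl fun i hi => ?_
      rw [(hregi i hi).caputo_eq hα hm h1 hn, ← intervalIntegral.integral_const_mul]
      congr 1; funext s; ring
    · intro i hi
      have := ((hregi i hi).intervalIntegrable_mul hα hm h1 hn le_rfl
        (tOff_pos hα hm h1 hn).le le_rfl).const_mul (q i)
      refine this.congr (fun s _ => ?_)
      ring
  have hdisc : ∑ i ∈ I, q i * discCaputo α t (fun k => u i (t k)) n
      = discCaputo α t (fun k => ∑ i ∈ I, q i * u i (t k)) n := by
    simp only [discCaputo, Finset.mul_sum, ← Finset.sum_sub_distrib]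
    rw [Finset.sum_comm]
    exact Finset.sum_congr rfl fun k _ => Finset.sum_congr rfl fun i _ => by ring
  have e : ∑ i ∈ I, q i * truncErr α t (u i) n
      = truncErr α t (fun s => ∑ i ∈ I, q i * u i s) n := by
    simp only [truncErr, mul_sub, Finset.sum_sub_distrib]
    rw [hcap, hdisc]
  rw [e]
  exact hreg.truncErr_le hα hσ (by linarith) (by have := timeConst_pos hT; positivity) hm h1 hn

/-- The errors of the weighted values of a vector of functions, tested with arbitrary weights. -/
theorem CSigma.abs_sum_wavg_sub_le (hU : CSigma 2 σ T K U) (hα : α ∈ Ioo (0 : ℝ) 1) (hσ : 0 < σ)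
    (hσ2 : σ < 2) (hK : 0 ≤ K) (hm : IsMesh T N t) {n : ℕ} (h1 : 1 ≤ n) (hn : n ≤ N)
    (Ψ : X →L[ℝ] ℝ) {C : ℝ} (hC0 : 0 ≤ C) (hC : ∀ w, |Ψ w| ≤ C * ‖w‖) {g : ℝ → ℝ}
    (hg : ∀ s ∈ Icc 0 T, g s = Ψ (U s)) :
    |wavg α (fun k => g (t k)) n - g (tOff α t n)|
      ≤ 130 * (C * K * timeConst T) * avgErr σ t n := by
  have hT : 0 < T := (hm.pos h1 hn).trans_le (hm.le_T hn)
  refine wavg_sub_le (g1 := fun s => Ψ (iteratedDerivWithin 1 U (Ioc 0 T) s))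
    (g2 := fun s => Ψ (iteratedDerivWithin 2 U (Ioc 0 T) s)) hα hm hσ hσ2.le
    (by have := timeConst_pos hT; positivity) ?_ ?_
    (fun s hs => hU.hasDerivWithinAt Ψ (by norm_num) hs) ?_ h1 hn
  · exact (Ψ.continuous.comp_continuousOn hU.1).congr hg
  · intro s hs
    have h := hU.hasDerivWithinAt Ψ (l := 0) (by norm_num) hs
    simp only [iteratedDerivWithin_zero] at h
    exact h.congr (fun r hr => hg r (Ioc_subset_Icc_self hr)) (hg s (Ioc_subset_Icc_self hs))
  · intro s hs
    refine (hC _).trans ?_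
    have h2 := hU.2.2 2 (by norm_num) le_rfl s hs
    have := one_add_rpow_le hs (p := σ - 2) (by linarith) (by linarith)
    have e : ((2 : ℕ) : ℝ) = 2 := by norm_num
    rw [e] at h2
    calc _ ≤ C * (K * (timeConst T * s ^ (σ - 2))) := by
          refine mul_le_mul_of_nonneg_left (h2.trans ?_) hC0
          gcongr
      _ = _ := by ring

/-- Boundary values are smooth up to `t = 0`. -/
lemma BoundarySmooth.timeReg {a b x : ℝ} {ub : ℝ → ℝ → ℝ} (h : BoundarySmooth a b T K ub)
    (hT : 0 < T) (hx : x = a ∨ x = b) {g : ℝ → ℝ} (hgc : ContinuousOn g (Icc 0 T))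
    (hg : ∀ s ∈ Ioc 0 T, g s = ub s x) :
    TimeReg T 3 K g (fun s => iteratedDerivWithin 1 (fun r => ub r x) (Icc 0 T) s)
      (fun s => iteratedDerivWithin 2 (fun r => ub r x) (Icc 0 T) s)
      (fun s => iteratedDerivWithin 3 (fun r => ub r x) (Icc 0 T) s) := by
  obtain ⟨hC, hb⟩ := h x hx
  have hd : ∀ l : ℕ, l < 3 → ∀ s ∈ Icc 0 T,
      HasDerivWithinAt (fun r => iteratedDerivWithin l (fun r => ub r x) (Icc 0 T) r)
        (iteratedDerivWithin (l + 1) (fun r => ub r x) (Icc 0 T) s) (Icc 0 T) s := by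
    intro l hl s hs
    have h1 := hC.differentiableOn_iteratedDerivWithin (m := l) (by exact_mod_cast hl)
      (uniqueDiffOn_Icc hT) s hs
    have h2 := h1.hasDerivWithinAt
    rwa [← iteratedDerivWithin_succ] at h2
  have hd' : ∀ l : ℕ, l < 3 → ∀ s ∈ Ioc 0 T,
      HasDerivWithinAt (fun r => iteratedDerivWithin l (fun r => ub r x) (Icc 0 T) r)
        (iteratedDerivWithin (l + 1) (fun r => ub r x) (Icc 0 T) s) (Ioc 0 T) s :=
    fun l hl s hs => (hd l hl s (Ioc_subset_Icc_self hs)).mono Ioc_subset_Icc_self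
  refine ⟨hgc, fun s hs => ?_, hd' 1 (by norm_num), hd' 2 (by norm_num), ?_, fun s hs => ?_⟩
  · have h0 := hd' 0 (by norm_num) s hs
    simp only [iteratedDerivWithin_zero] at h0
    exact h0.congr hg (hg s hs)
  · have hc : ContinuousOn (fun r => iteratedDerivWithin 1 (fun r => ub r x) (Icc 0 T) r)
        (Icc 0 T) := fun s hs => (hd 1 (by norm_num) s hs).continuousWithinAt
    exact hc.intervalIntegrable_of_Icc hT.le
  · simpa using hb s (Ioc_subset_Icc_self hs)

end functionals

/-! ### Taylor expansion with absolutely continuous remainders -/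

section taylor

variable {a b : ℝ}

namespace IsPrim

variable {v g f f1 f2 f3 : ℝ → ℝ}

lemma abs_sub_le (h : IsPrim a b v g) {x y : ℝ} (hx : x ∈ Icc a b) (hy : y ∈ Icc a b) {B : ℝ}
    (hB : ∀ s ∈ uIcc x y, |g s| ≤ B) : |v y - v x| ≤ B * |y - x| := by
  rw [h.2 x hx y hy, ← Real.norm_eq_abs]
  exact intervalIntegral.norm_integral_le_of_norm_le_const fun s hs => hB s (uIoc_subset_uIcc hs)

lemma sub_deriv (h : IsPrim a b v g) {P p : ℝ → ℝ} (hP : ∀ s, HasDerivAt P (p s) s)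
    (hp : Continuous p) : IsPrim a b (fun s => v s - P s) (fun s => g s - p s) := by
  refine ⟨h.1.sub (hp.intervalIntegrable _ _), fun x hx y hy => ?_⟩
  rw [intervalIntegral.integral_sub (h.intervalIntegrable hx hy) (hp.intervalIntegrable _ _),
    ← h.2 x hx y hy, intervalIntegral.integral_eq_sub_of_hasDerivAt (fun s _ => hP s)
      (hp.intervalIntegrable _ _)]
  ring

lemma taylor_one (h : IsPrim a b v g) {x y : ℝ} (hx : x ∈ Icc a b) (hy : y ∈ Icc a b) {p B : ℝ}
    (hB : ∀ s ∈ uIcc x y, |g s - p| ≤ B) : |v y - v x - (y - x) * p| ≤ B * |y - x| := by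
  have h1 := h.sub_deriv (P := fun s => (s - x) * p) (p := fun _ => p)
    (fun s => by simpa using ((hasDerivAt_id s).sub_const x).mul_const p) continuous_const
  have := h1.abs_sub_le hx hy hB
  simp only [sub_self, zero_mul, sub_zero] at this
  rwa [sub_right_comm]

lemma taylor_two (h : IsPrim a b f f1) (h1 : IsPrim a b f1 f2) {x y : ℝ} (hx : x ∈ Icc a b)
    (hy : y ∈ Icc a b) {B : ℝ} (hB0 : 0 ≤ B) (hB : ∀ s ∈ uIcc x y, |f2 s - f2 x| ≤ B) :
    |f y - f x - (y - x) * f1 x - (y - x) ^ 2 / 2 * f2 x| ≤ B * |y - x| ^ 2 := by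
  have hsub : uIcc x y ⊆ Icc a b := uIcc_subset_Icc hx hy
  have hP := h.sub_deriv (P := fun s => (s - x) * f1 x + (s - x) ^ 2 / 2 * f2 x)
    (p := fun s => f1 x + (s - x) * f2 x) (fun s => by
      have hs := (hasDerivAt_id s).sub_const x
      have h2 := (hs.mul_const (f1 x)).add (((hs.pow 2).div_const 2).mul_const (f2 x))
      refine h2.congr_deriv ?_
      simp only [id]
      push_cast
      ring) (by fun_prop)
  have key := hP.abs_sub_le hx hy (B := B * |y - x|) (fun s hs => by
    have h3 := h1.taylor_one hx (hsub hs) (p := f2 x) (B := B)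
      (fun r hr => hB r (uIcc_subset_uIcc_left hs hr))
    rw [← sub_sub]
    refine h3.trans (mul_le_mul_of_nonneg_left ?_ hB0)
    exact abs_sub_left_of_mem_uIcc hs)
  refine le_trans (le_of_eq ?_) (key.trans (le_of_eq ?_))
  · congr 1; ring
  · ring

lemma taylor_three (h : IsPrim a b f f1) (h1 : IsPrim a b f1 f2) (h2 : IsPrim a b f2 f3) {x y : ℝ}
    (hx : x ∈ Icc a b) (hy : y ∈ Icc a b) {B : ℝ} (hB0 : 0 ≤ B)
    (hB : ∀ s ∈ uIcc x y, |f3 s - f3 x| ≤ B) :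
    |f y - f x - (y - x) * f1 x - (y - x) ^ 2 / 2 * f2 x - (y - x) ^ 3 / 6 * f3 x|
      ≤ B * |y - x| ^ 3 := by
  have hsub : uIcc x y ⊆ Icc a b := uIcc_subset_Icc hx hy
  have hP := h.sub_deriv
    (P := fun s => (s - x) * f1 x + (s - x) ^ 2 / 2 * f2 x + (s - x) ^ 3 / 6 * f3 x)
    (p := fun s => f1 x + (s - x) * f2 x + (s - x) ^ 2 / 2 * f3 x) (fun s => by
      have hs := (hasDerivAt_id s).sub_const x
      have h2 := ((hs.mul_const (f1 x)).add (((hs.pow 2).div_const 2).mul_const (f2 x))).add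
        (((hs.pow 3).div_const 6).mul_const (f3 x))
      refine h2.congr_deriv ?_
      simp only [id]
      push_cast
      ring) (by fun_prop)
  have key := hP.abs_sub_le hx hy (B := B * |y - x| ^ 2) (fun s hs => by
    have h3 := h1.taylor_two h2 hx (hsub hs) hB0
      (fun r hr => hB r (uIcc_subset_uIcc_left hs hr))
    rw [← sub_sub, ← sub_sub]
    refine h3.trans (mul_le_mul_of_nonneg_left ?_ hB0)
    have := abs_sub_left_of_mem_uIcc hs
    gcongr)
  refine le_trans (le_of_eq ?_) (key.trans (le_of_eq ?_))
  · congr 1; ring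
  · ring

/-- The oscillation of an absolutely continuous function is at most the integral of the modulus of
its derivative. -/
lemma abs_sub_le_integral (h : IsPrim a b v g) {p q x y : ℝ} (hp : p ∈ Icc a b) (hq : q ∈ Icc a b)
    (hx : x ∈ Icc p q) (hy : y ∈ Icc p q) : |v y - v x| ≤ ∫ s in p..q, |g s| := by
  have hx' : x ∈ Icc a b := ⟨hp.1.trans hx.1, hx.2.trans hq.2⟩
  have hy' : y ∈ Icc a b := ⟨hp.1.trans hy.1, hy.2.trans hq.2⟩
  have hi := (h.intervalIntegrable hp hq).abs
  have hmain : ∀ x y : ℝ, x ∈ Icc p q → y ∈ Icc p q → x ≤ y →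
      |v y - v x| ≤ ∫ s in p..q, |g s| := by
    intro x y hx hy hxy
    rw [h.2 x ⟨hp.1.trans hx.1, hx.2.trans hq.2⟩ y ⟨hp.1.trans hy.1, hy.2.trans hq.2⟩]
    refine (intervalIntegral.abs_integral_le_integral_abs hxy).trans ?_
    exact intervalIntegral.integral_mono_interval hx.1 hxy hy.2
      (Filter.Eventually.of_forall fun s => abs_nonneg _) hi
  rcases le_total x y with hxy | hxy
  · exact hmain x y hx hy hxy
  · rw [abs_sub_comm]; exact hmain y x hy hx hxy

end IsPrim

end taylor

/-! ### The spatial difference operator -/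

section space

variable {a b : ℝ}

/-- A coefficient `μ` with derivatives `m1`, `m2`: all three are bounded by `B`, and `m2` is Lipschitz
continuous with constant `B`. -/
structure SmoothCoeff (a b B : ℝ) (μ m1 m2 : ℝ → ℝ) : Prop where
  prim : IsPrim a b μ m1
  prim1 : IsPrim a b m1 m2
  bound : ∀ x ∈ Icc a b, |μ x| ≤ B
  bound1 : ∀ x ∈ Icc a b, |m1 x| ≤ B
  bound2 : ∀ x ∈ Icc a b, |m2 x| ≤ B
  lip : ∀ x ∈ Icc a b, ∀ y ∈ Icc a b, |m2 y - m2 x| ≤ B * |y - x|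

lemma exists_smoothCoeff (hab : a < b) {μ : ℝ → ℝ} (hμ : ContDiffOn ℝ 3 μ (Icc a b)) :
    ∃ B m1 m2, 0 ≤ B ∧ SmoothCoeff a b B μ m1 m2 := by
  have hd : ∀ l : ℕ, l < 3 → ∀ s ∈ Icc a b,
      HasDerivWithinAt (iteratedDerivWithin l μ (Icc a b))
        (iteratedDerivWithin (l + 1) μ (Icc a b) s) (Icc a b) s := by
    intro l hl s hs
    have h1 := hμ.differentiableOn_iteratedDerivWithin (m := l) (by exact_mod_cast hl)
      (uniqueDiffOn_Icc hab) s hs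
    have h2 := h1.hasDerivWithinAt
    rwa [← iteratedDerivWithin_succ] at h2
  have hc : ∀ l : ℕ, l ≤ 3 → ContinuousOn (iteratedDerivWithin l μ (Icc a b)) (Icc a b) :=
    fun l hl => hμ.continuousOn_iteratedDerivWithin (by exact_mod_cast hl) (uniqueDiffOn_Icc hab)
  have hp : ∀ l : ℕ, l < 3 → IsPrim a b (iteratedDerivWithin l μ (Icc a b))
      (iteratedDerivWithin (l + 1) μ (Icc a b)) := fun l hl =>
    IsPrim.of_hasDerivWithinAt hab.le (hd l hl) (hc (l + 1) hl)
  have hbd : ∀ l : ℕ, l ≤ 3 → ∃ B, ∀ x ∈ Icc a b, |iteratedDerivWithin l μ (Icc a b) x| ≤ B :=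
    fun l hl => isCompact_Icc.exists_bound_of_continuousOn (hc l hl)
  obtain ⟨B0, h0⟩ := hbd 0 (by norm_num)
  obtain ⟨B1, h1⟩ := hbd 1 (by norm_num)
  obtain ⟨B2, h2⟩ := hbd 2 (by norm_num)
  obtain ⟨B3, h3⟩ := hbd 3 le_rfl
  have ha := left_mem_Icc.2 hab.le
  have p0 := (abs_nonneg _).trans (h0 a ha)
  have p1 := (abs_nonneg _).trans (h1 a ha)
  have p2 := (abs_nonneg _).trans (h2 a ha)
  have p3 := (abs_nonneg _).trans (h3 a ha)
  have hp0 := hp 0 (by norm_num)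
  rw [iteratedDerivWithin_zero] at hp0 h0
  refine ⟨B0 + B1 + B2 + B3, _, _, by positivity, hp0, hp 1 (by norm_num),
    fun x hx => (h0 x hx).trans (by linarith), fun x hx => (h1 x hx).trans (by linarith),
    fun x hx => (h2 x hx).trans (by linarith), fun x hx y hy => ?_⟩
  exact (hp 2 (by norm_num)).abs_sub_le hx hy fun s hs =>
    (h3 s (uIcc_subset_Icc hx hy hs)).trans (by linarith)

/-- The three-point difference operator with mesh width `h` at the point `x`. -/
noncomputable def flux (μ v : ℝ → ℝ) (x h : ℝ) : ℝ :=
  -(μ (x + h / 2) * ((v (x + h) - v x) / h) - μ (x - h / 2) * ((v x - v (x - h)) / h)) / h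

/-- A discrete product rule: the difference operator is a mean of `μ` times the second difference,
plus a difference quotient of `μ` times the central difference. -/
lemma flux_eq (μ v : ℝ → ℝ) (x : ℝ) {h : ℝ} (hh : h ≠ 0) :
    flux μ v x h = -((μ (x + h / 2) + μ (x - h / 2)) / 2 *
        ((v (x + h) - 2 * v x + v (x - h)) / h ^ 2)
      + (μ (x + h / 2) - μ (x - h / 2)) / h * ((v (x + h) - v (x - h)) / (2 * h))) := by
  unfold flux
  field_simp
  ring

variable {B : ℝ} {μ m1 m2 : ℝ → ℝ}

/-- Stability of the difference operator: it is bounded by second derivatives in the mean. -/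
lemma abs_flux_le (hμ : SmoothCoeff a b B μ m1 m2) (hB : 0 ≤ B) {v v1 v2 : ℝ → ℝ}
    (hv : IsPrim a b v v1) (hv1 : IsPrim a b v1 v2) {E : ℝ} (hE : ∀ s ∈ Icc a b, |v1 s| ≤ E)
    {x h : ℝ} (hh : 0 < h) (hl : a ≤ x - h) (hr : x + h ≤ b) :
    |flux μ v x h| ≤ B * E + B * ((∫ s in (x - h)..(x + h), |v2 s|) / h) := by
  have hx : x ∈ Icc a b := ⟨by linarith, by linarith⟩
  have hxp : x + h ∈ Icc a b := ⟨by linarith, by linarith⟩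
  have hxm : x - h ∈ Icc a b := ⟨by linarith, by linarith⟩
  have hyp : x + h / 2 ∈ Icc a b := ⟨by linarith, by linarith⟩
  have hym : x - h / 2 ∈ Icc a b := ⟨by linarith, by linarith⟩
  have hE0 : 0 ≤ E := (abs_nonneg _).trans (hE x hx)
  set J := ∫ s in (x - h)..(x + h), |v2 s| with hJ
  have i1 : IntervalIntegrable (fun s => |v2 s|) volume (x - h) x :=
    (hv1.intervalIntegrable hxm hx).abs
  have i2 : IntervalIntegrable (fun s => |v2 s|) volume x (x + h) :=
    (hv1.intervalIntegrable hx hxp).abs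
  have hsplit := intervalIntegral.integral_add_adjacent_intervals i1 i2
  have t1 := hv.taylor_one hx hxp (p := v1 x) (B := ∫ s in x..(x + h), |v2 s|) (fun s hs => by
    rw [uIcc_of_le (by linarith)] at hs
    exact hv1.abs_sub_le_integral hx hxp ⟨le_rfl, by linarith⟩ hs)
  have t2 := hv.taylor_one hx hxm (p := v1 x) (B := ∫ s in (x - h)..x, |v2 s|) (fun s hs => by
    rw [uIcc_of_ge (by linarith)] at hs
    exact hv1.abs_sub_le_integral hxm hx ⟨by linarith, le_rfl⟩ hs)
  have e1 : |x + h - x| = h := by rw [add_sub_cancel_left, abs_of_pos hh]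
  have e2 : |x - h - x| = h := by rw [sub_sub_cancel_left, abs_neg, abs_of_pos hh]
  rw [e1] at t1
  rw [e2] at t2
  have hd2 : |(v (x + h) - 2 * v x + v (x - h)) / h ^ 2| ≤ J / h := by
    rw [abs_div, abs_of_pos (by positivity : 0 < h ^ 2), div_le_div_iff₀ (by positivity) hh]
    have : |v (x + h) - 2 * v x + v (x - h)| ≤ J * h := by
      have := abs_add_le (v (x + h) - v x - (x + h - x) * v1 x)
        (v (x - h) - v x - (x - h - x) * v1 x)
      rw [show v (x + h) - v x - (x + h - x) * v1 x + (v (x - h) - v x - (x - h - x) * v1 x)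
        = v (x + h) - 2 * v x + v (x - h) by ring] at this
      rw [hJ, ← hsplit]
      linarith
    calc _ ≤ J * h * h := by gcongr
      _ = _ := by ring
  have hd1 : |(v (x + h) - v (x - h)) / (2 * h)| ≤ E := by
    rw [abs_div, abs_of_pos (by positivity : 0 < 2 * h), div_le_iff₀ (by positivity)]
    have := hv.abs_sub_le hxm hxp (B := E) (fun s hs => hE s (uIcc_subset_Icc hxm hxp hs))
    rwa [show x + h - (x - h) = 2 * h by ring, abs_of_pos (by positivity : 0 < 2 * h)] at this
  have hm1 : |(μ (x + h / 2) - μ (x - h / 2)) / h| ≤ B := by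
    rw [abs_div, abs_of_pos hh, div_le_iff₀ hh]
    have := hμ.prim.abs_sub_le hym hyp (B := B)
      (fun s hs => hμ.bound1 s (uIcc_subset_Icc hym hyp hs))
    rwa [show x + h / 2 - (x - h / 2) = h by ring, abs_of_pos hh] at this
  have hm0 : |(μ (x + h / 2) + μ (x - h / 2)) / 2| ≤ B := by
    rw [abs_div, abs_two, div_le_iff₀ two_pos]
    have := abs_add_le (μ (x + h / 2)) (μ (x - h / 2))
    linarith [hμ.bound _ hyp, hμ.bound _ hym]
  rw [flux_eq μ v x hh.ne', abs_neg]
  refine (abs_add_le _ _).trans ?_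
  rw [abs_mul, abs_mul, add_comm]
  gcongr

/-- Consistency of the difference operator. The part of the error that stems from the second
difference is only bounded in the mean. -/
lemma abs_flux_sub_le (hμ : SmoothCoeff a b B μ m1 m2) (hB : 0 ≤ B) {v v1 v2 v3 v4 : ℝ → ℝ}
    (hv : IsPrim a b v v1) (hv1 : IsPrim a b v1 v2) (hv2 : IsPrim a b v2 v3)
    (hv3 : IsPrim a b v3 v4) {E : ℝ} (hE1 : ∀ s ∈ Icc a b, |v1 s| ≤ E)
    (hE2 : ∀ s ∈ Icc a b, |v2 s| ≤ E) (hE3 : ∀ s ∈ Icc a b, |v3 s| ≤ E)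
    {x h : ℝ} (hh : 0 < h) (hl : a ≤ x - h) (hr : x + h ≤ b) :
    |flux μ v x h + (m1 x * v1 x + μ x * v2 x)|
      ≤ 2 * B * E * h ^ 2 + 2 * B * (1 + h ^ 2) * (h * ∫ s in (x - h)..(x + h), |v4 s|) := by
  have hx : x ∈ Icc a b := ⟨by linarith, by linarith⟩
  have hxp : x + h ∈ Icc a b := ⟨by linarith, by linarith⟩
  have hxm : x - h ∈ Icc a b := ⟨by linarith, by linarith⟩
  have hyp : x + h / 2 ∈ Icc a b := ⟨by linarith, by linarith⟩
  have hym : x - h / 2 ∈ Icc a b := ⟨by linarith, by linarith⟩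
  have hE0 : 0 ≤ E := (abs_nonneg _).trans (hE1 x hx)
  set J := ∫ s in (x - h)..(x + h), |v4 s| with hJ
  have hJ0 : 0 ≤ J := intervalIntegral.integral_nonneg (by linarith) fun s _ => abs_nonneg _
  have hsubp : uIcc x (x + h) ⊆ Icc (x - h) (x + h) := by
    rw [uIcc_of_le (by linarith)]; exact Icc_subset_Icc_left (by linarith)
  have hsubm : uIcc x (x - h) ⊆ Icc (x - h) (x + h) := by
    rw [uIcc_of_ge (by linarith)]; exact Icc_subset_Icc_right (by linarith)
  have hxI : x ∈ Icc (x - h) (x + h) := ⟨by linarith, by linarith⟩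
  have e1 : |x + h - x| = h := by rw [add_sub_cancel_left, abs_of_pos hh]
  have e2 : |x - h - x| = h := by rw [sub_sub_cancel_left, abs_neg, abs_of_pos hh]
  have e3 : |x + h / 2 - x| = h / 2 := by rw [add_sub_cancel_left, abs_of_pos (by positivity)]
  have e4 : |x - h / 2 - x| = h / 2 := by
    rw [sub_sub_cancel_left, abs_neg, abs_of_pos (by positivity)]
  -- second difference
  have hd2 : |(v (x + h) - 2 * v x + v (x - h)) / h ^ 2 - v2 x| ≤ 2 * (h * J) := by
    have t1 := hv.taylor_three hv1 hv2 hx hxp hJ0 (fun s hs =>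
      hv3.abs_sub_le_integral hxm hxp hxI (hsubp hs))
    have t2 := hv.taylor_three hv1 hv2 hx hxm hJ0 (fun s hs =>
      hv3.abs_sub_le_integral hxm hxp hxI (hsubm hs))
    rw [e1] at t1
    rw [e2] at t2
    have e : (v (x + h) - 2 * v x + v (x - h)) / h ^ 2 - v2 x
        = ((v (x + h) - v x - (x + h - x) * v1 x - (x + h - x) ^ 2 / 2 * v2 x
            - (x + h - x) ^ 3 / 6 * v3 x)
          + (v (x - h) - v x - (x - h - x) * v1 x - (x - h - x) ^ 2 / 2 * v2 x
            - (x - h - x) ^ 3 / 6 * v3 x)) / h ^ 2 := by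
      field_simp; ring
    rw [e, abs_div, abs_of_pos (by positivity : 0 < h ^ 2), div_le_iff₀ (by positivity)]
    refine (abs_add_le _ _).trans ((add_le_add t1 t2).trans (le_of_eq ?_))
    ring
  -- central difference
  have hd1 : |(v (x + h) - v (x - h)) / (2 * h) - v1 x| ≤ E * h ^ 2 := by
    have hosc : ∀ s ∈ Icc (x - h) (x + h), |v2 s - v2 x| ≤ E * h := by
      intro s hs
      have hs' : s ∈ Icc a b := ⟨hxm.1.trans hs.1, hs.2.trans hxp.2⟩
      refine (hv2.abs_sub_le hx hs' fun r hr => hE3 r (uIcc_subset_Icc hx hs' hr)).trans ?_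
      have : |s - x| ≤ h := abs_le.2 ⟨by linarith [hs.1], by linarith [hs.2]⟩
      gcongr
    have t1 := hv.taylor_two hv1 hx hxp (B := E * h) (by positivity) (fun s hs => hosc s (hsubp hs))
    have t2 := hv.taylor_two hv1 hx hxm (B := E * h) (by positivity) (fun s hs => hosc s (hsubm hs))
    rw [e1] at t1
    rw [e2] at t2
    have e : (v (x + h) - v (x - h)) / (2 * h) - v1 x
        = ((v (x + h) - v x - (x + h - x) * v1 x - (x + h - x) ^ 2 / 2 * v2 x)
          - (v (x - h) - v x - (x - h - x) * v1 x - (x - h - x) ^ 2 / 2 * v2 x)) / (2 * h) := by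
      field_simp; ring
    rw [e, abs_div, abs_of_pos (by positivity : 0 < 2 * h), div_le_iff₀ (by positivity)]
    refine (abs_sub _ _).trans ((add_le_add t1 t2).trans (le_of_eq ?_))
    ring
  have hm1 : |(μ (x + h / 2) - μ (x - h / 2)) / h - m1 x| ≤ B * h ^ 2 / 4 := by
    have hosc : ∀ y ∈ Icc a b, |y - x| = h / 2 → ∀ s ∈ uIcc x y, |m2 s - m2 x| ≤ B * (h / 2) := by
      intro y hy hyx s hs
      refine (hμ.lip x hx s (uIcc_subset_Icc hx hy hs)).trans ?_
      have := abs_sub_left_of_mem_uIcc hs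
      rw [hyx] at this
      gcongr
    have t1 := hμ.prim.taylor_two hμ.prim1 hx hyp (by positivity) (hosc _ hyp e3)
    have t2 := hμ.prim.taylor_two hμ.prim1 hx hym (by positivity) (hosc _ hym e4)
    rw [e3] at t1
    rw [e4] at t2
    have e : (μ (x + h / 2) - μ (x - h / 2)) / h - m1 x
        = ((μ (x + h / 2) - μ x - (x + h / 2 - x) * m1 x - (x + h / 2 - x) ^ 2 / 2 * m2 x)
          - (μ (x - h / 2) - μ x - (x - h / 2 - x) * m1 x - (x - h / 2 - x) ^ 2 / 2 * m2 x)) / h := by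
      field_simp; ring
    rw [e, abs_div, abs_of_pos hh, div_le_iff₀ hh]
    refine (abs_sub _ _).trans ((add_le_add t1 t2).trans (le_of_eq ?_))
    ring
  have hm0 : |(μ (x + h / 2) + μ (x - h / 2)) / 2 - μ x| ≤ B * h ^ 2 / 4 := by
    have hosc : ∀ y ∈ Icc a b, |y - x| = h / 2 → ∀ s ∈ uIcc x y, |m1 s - m1 x| ≤ B * (h / 2) := by
      intro y hy hyx s hs
      have hs' := uIcc_subset_Icc hx hy hs
      refine (hμ.prim1.abs_sub_le hx hs' fun r hr =>
        hμ.bound2 r (uIcc_subset_Icc hx hs' hr)).trans ?_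
      have := abs_sub_left_of_mem_uIcc hs
      rw [hyx] at this
      gcongr
    have t1 := hμ.prim.taylor_one hx hyp (hosc _ hyp e3)
    have t2 := hμ.prim.taylor_one hx hym (hosc _ hym e4)
    rw [e3] at t1
    rw [e4] at t2
    have e : (μ (x + h / 2) + μ (x - h / 2)) / 2 - μ x
        = ((μ (x + h / 2) - μ x - (x + h / 2 - x) * m1 x)
          + (μ (x - h / 2) - μ x - (x - h / 2 - x) * m1 x)) / 2 := by
      ring
    rw [e, abs_div, abs_two, div_le_iff₀ two_pos]
    refine (abs_add_le _ _).trans ((add_le_add t1 t2).trans (le_of_eq ?_))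
    ring
  have hδc : |(v (x + h) - v (x - h)) / (2 * h)| ≤ E := by
    rw [abs_div, abs_of_pos (by positivity : 0 < 2 * h), div_le_iff₀ (by positivity)]
    have := hv.abs_sub_le hxm hxp (B := E) (fun s hs => hE1 s (uIcc_subset_Icc hxm hxp hs))
    rwa [show x + h - (x - h) = 2 * h by ring, abs_of_pos (by positivity : 0 < 2 * h)] at this
  have hv2x := hE2 x hx
  have hμx := hμ.bound x hx
  have hm1x := hμ.bound1 x hx
  rw [flux_eq μ v x hh.ne']
  generalize (μ (x + h / 2) + μ (x - h / 2)) / 2 = μa at hm0 ⊢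
  generalize (μ (x + h / 2) - μ (x - h / 2)) / h = μd at hm1 ⊢
  generalize (v (x + h) - v (x - h)) / (2 * h) = vc at hd1 hδc ⊢
  generalize (v (x + h) - 2 * v x + v (x - h)) / h ^ 2 = vd at hd2 ⊢
  have hvd : |vd| ≤ E + 2 * (h * J) := by
    have := abs_add_le (vd - v2 x) (v2 x)
    rw [sub_add_cancel] at this
    linarith
  have e : -(μa * vd + μd * vc) + (m1 x * v1 x + μ x * v2 x)
      = -(((μa - μ x) * vd + μ x * (vd - v2 x)) + ((μd - m1 x) * vc + m1 x * (vc - v1 x))) := by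
    ring
  rw [e, abs_neg]
  calc _ ≤ (|μa - μ x| * |vd| + |μ x| * |vd - v2 x|)
        + (|μd - m1 x| * |vc| + |m1 x| * |vc - v1 x|) := by
        rw [← abs_mul, ← abs_mul, ← abs_mul, ← abs_mul]
        exact (abs_add_le _ _).trans (add_le_add (abs_add_le _ _) (abs_add_le _ _))
    _ ≤ (B * h ^ 2 / 4 * (E + 2 * (h * J)) + B * (2 * (h * J)))
        + (B * h ^ 2 / 4 * E + B * (E * h ^ 2)) := by gcongr
    _ ≤ _ := by
        have : 0 ≤ B * E * h ^ 2 := by positivity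
        have : 0 ≤ B * h ^ 2 * (h * J) := by positivity
        nlinarith

end space

/-! ### Grid functions -/

section grid

variable {a b : ℝ} {M : ℕ} {μ : ℝ → ℝ}

lemma width_pos (hab : a < b) (hM : 1 ≤ M) : 0 < width a b M :=
  div_pos (sub_pos.2 hab) (by exact_mod_cast hM)

lemma natCast_mul_width (hM : 1 ≤ M) : (M : ℝ) * width a b M = b - a := by
  have : (M : ℝ) ≠ 0 := by positivity
  rw [width]; field_simp

lemma width_le (hab : a < b) (hM : 1 ≤ M) : width a b M ≤ b - a := by
  rw [← natCast_mul_width (a := a) (b := b) hM]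
  have := width_pos hab hM
  have : (1 : ℝ) ≤ M := by exact_mod_cast hM
  nlinarith

lemma pt_mem (hab : a < b) (hM : 1 ≤ M) {s : ℝ} (h0 : 0 ≤ s) (h1 : s ≤ M) :
    pt a b M s ∈ Icc a b := by
  have hw := width_pos hab hM
  have e := natCast_mul_width (a := a) (b := b) hM
  constructor <;> rw [pt] <;> nlinarith

lemma pt_mem_Ioo (hab : a < b) (hM : 1 ≤ M) {s : ℝ} (h0 : 0 < s) (h1 : s < M) :
    pt a b M s ∈ Ioo a b := by
  have hw := width_pos hab hM
  have e := natCast_mul_width (a := a) (b := b) hM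
  constructor <;> rw [pt] <;> nlinarith

lemma pt_add (s r : ℝ) : pt a b M (s + r) = pt a b M s + r * width a b M := by
  unfold pt; ring

lemma pt_zero : pt a b M 0 = a := by simp [pt]

lemma pt_last (hM : 1 ≤ M) : pt a b M M = b := by
  rw [pt, natCast_mul_width hM]; ring

lemma discEllip_eq_flux (F : ℝ → ℝ) {i : ℕ} (hi : 1 ≤ i) :
    discEllip a b M μ (fun j => F (pt a b M j)) i = flux μ F (pt a b M i) (width a b M) := by
  unfold discEllip flux
  simp only
  rw [pt_add, sub_eq_add_neg (i : ℝ), pt_add, Nat.cast_add, pt_add, Nat.cast_sub hi,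
    sub_eq_add_neg (i : ℝ) ((1 : ℕ) : ℝ), pt_add]
  push_cast
  rw [show pt a b M i + 1 / 2 * width a b M = pt a b M i + width a b M / 2 by ring,
    show pt a b M i + -(1 / 2) * width a b M = pt a b M i - width a b M / 2 by ring,
    show pt a b M i + 1 * width a b M = pt a b M i + width a b M by ring,
    show pt a b M i + -1 * width a b M = pt a b M i - width a b M by ring]

lemma discEllip_add (v w : ℕ → ℝ) (i : ℕ) :
    discEllip a b M μ (fun j => v j + w j) i = discEllip a b M μ v i + discEllip a b M μ w i := by
  unfold discEllip; ring

lemma discEllip_sub (v w : ℕ → ℝ) (i : ℕ) :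
    discEllip a b M μ (fun j => v j - w j) i = discEllip a b M μ v i - discEllip a b M μ w i := by
  unfold discEllip; ring

/-- The inner product `h ∑_{0 < i < M} v_i w_i`. -/
noncomputable def discInner (a b : ℝ) (M : ℕ) (v w : ℕ → ℝ) : ℝ :=
  width a b M * ∑ i ∈ Finset.Ioo 0 M, v i * w i

/-- The bilinear form of the seminorm `|·|_1`. -/
noncomputable def discForm (a b : ℝ) (M : ℕ) (μ : ℝ → ℝ) (v w : ℕ → ℝ) : ℝ :=
  width a b M * ∑ i ∈ Finset.Icc 1 M, μ (pt a b M (i - 1 / 2)) *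
    ((v i - v (i - 1)) / width a b M * ((w i - w (i - 1)) / width a b M))

lemma discNormSq_nonneg (hab : a < b) (hM : 1 ≤ M) (v : ℕ → ℝ) : 0 ≤ discNormSq a b M v :=
  mul_nonneg (width_pos hab hM).le (Finset.sum_nonneg fun _ _ => sq_nonneg _)

lemma discInner_self (v : ℕ → ℝ) : discInner a b M v v = discNormSq a b M v := by
  unfold discInner discNormSq; simp only [sq]

lemma abs_discInner_le (hab : a < b) (hM : 1 ≤ M) (v w : ℕ → ℝ) :
    |discInner a b M v w| ≤ √(discNormSq a b M v) * √(discNormSq a b M w) := by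
  have hw := width_pos hab hM
  rw [← Real.sqrt_mul (discNormSq_nonneg hab hM v)]
  apply Real.abs_le_sqrt
  have h := Finset.sum_mul_sq_le_sq_mul_sq (Finset.Ioo 0 M) v w
  unfold discInner discNormSq
  rw [mul_pow]
  calc _ ≤ width a b M ^ 2 * ((∑ i ∈ Finset.Ioo 0 M, v i ^ 2) * ∑ i ∈ Finset.Ioo 0 M, w i ^ 2) := by
        gcongr
    _ = _ := by ring

lemma discNormSq_le_of_abs_le (hab : a < b) (hM : 1 ≤ M) {v : ℕ → ℝ} {S : ℝ}
    (hv : ∀ i, 1 ≤ i → i < M → |v i| ≤ S) :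
    discNormSq a b M v ≤ (b - a) * S ^ 2 := by
  have hw := width_pos hab hM
  have h : ∑ i ∈ Finset.Ioo 0 M, v i ^ 2 ≤ M * S ^ 2 := by
    calc _ ≤ ∑ _i ∈ Finset.Ioo 0 M, S ^ 2 := by
          refine Finset.sum_le_sum fun i hi => ?_
          rw [Finset.mem_Ioo] at hi
          exact sq_le_sq.2 ((hv i hi.1 hi.2).trans (le_abs_self _))
      _ = ((Finset.Ioo 0 M).card : ℝ) * S ^ 2 := by rw [Finset.sum_const, nsmul_eq_mul]
      _ ≤ _ := by
          gcongr
          rw [Nat.card_Ioo]; omega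
  rw [discNormSq, ← natCast_mul_width (a := a) (b := b) hM]
  calc _ ≤ width a b M * (M * S ^ 2) := by gcongr
    _ = _ := by ring

lemma weight_nonneg (hab : a < b) (hM : 1 ≤ M) (hμ : ∀ x ∈ Icc a b, 0 ≤ μ x) {i : ℕ}
    (hi : i ∈ Finset.Icc 1 M) : 0 ≤ μ (pt a b M (i - 1 / 2)) := by
  rw [Finset.mem_Icc] at hi
  have h1 : (1 : ℝ) ≤ i := by exact_mod_cast hi.1
  have h2 : (i : ℝ) ≤ M := by exact_mod_cast hi.2
  exact hμ _ (pt_mem hab hM (by linarith) (by linarith))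

lemma discForm_self_nonneg (hab : a < b) (hM : 1 ≤ M) (hμ : ∀ x ∈ Icc a b, 0 ≤ μ x) (v : ℕ → ℝ) :
    0 ≤ discForm a b M μ v v :=
  mul_nonneg (width_pos hab hM).le (Finset.sum_nonneg fun _ hi =>
    mul_nonneg (weight_nonneg hab hM hμ hi) (mul_self_nonneg _))

lemma discH1_sq (hab : a < b) (hM : 1 ≤ M) (hμ : ∀ x ∈ Icc a b, 0 ≤ μ x) (v : ℕ → ℝ) :
    discH1 a b M μ v ^ 2 = discForm a b M μ v v := by
  have h := discForm_self_nonneg hab hM hμ v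
  have e : discForm a b M μ v v = width a b M * ∑ i ∈ Finset.Icc 1 M,
      μ (pt a b M (i - 1 / 2)) * ((v i - v (i - 1)) / width a b M) ^ 2 := by
    unfold discForm; simp only [sq]
  rw [e] at h
  rw [discH1, Real.sq_sqrt h, e]

lemma discH1_nonneg (v : ℕ → ℝ) : 0 ≤ discH1 a b M μ v := Real.sqrt_nonneg _

lemma abs_discForm_le (hab : a < b) (hM : 1 ≤ M) (hμ : ∀ x ∈ Icc a b, 0 ≤ μ x) (v w : ℕ → ℝ) :
    |discForm a b M μ v w| ≤ discH1 a b M μ v * discH1 a b M μ w := by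
  have hw := width_pos hab hM
  apply abs_le_of_sq_le_sq _ (mul_nonneg (discH1_nonneg _) (discH1_nonneg _))
  rw [mul_pow, discH1_sq hab hM hμ, discH1_sq hab hM hμ]
  have h := Finset.sum_sq_le_sum_mul_sum_of_sq_le_mul (Finset.Icc 1 M)
    (r := fun i => μ (pt a b M (i - 1 / 2)) *
      ((v i - v (i - 1)) / width a b M * ((w i - w (i - 1)) / width a b M)))
    (f := fun i => μ (pt a b M (i - 1 / 2)) *
      ((v i - v (i - 1)) / width a b M * ((v i - v (i - 1)) / width a b M)))
    (g := fun i => μ (pt a b M (i - 1 / 2)) *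
      ((w i - w (i - 1)) / width a b M * ((w i - w (i - 1)) / width a b M)))
    (fun i hi => mul_nonneg (weight_nonneg hab hM hμ hi) (mul_self_nonneg _))
    (fun i hi => mul_nonneg (weight_nonneg hab hM hμ hi) (mul_self_nonneg _))
    (fun i _ => le_of_eq (by ring))
  unfold discForm
  rw [mul_pow]
  calc _ ≤ width a b M ^ 2 * _ := mul_le_mul_of_nonneg_left h (sq_nonneg _)
    _ = _ := by ring

lemma discForm_sub_left (v v' w : ℕ → ℝ) :
    discForm a b M μ (fun i => v i - v' i) w = discForm a b M μ v w - discForm a b M μ v' w := by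
  unfold discForm
  rw [← mul_sub, ← Finset.sum_sub_distrib]
  congr 1
  exact Finset.sum_congr rfl fun i _ => by ring

/-- Convexity of the squared seminorm. -/
lemma discH1_wavg_le {α : ℝ} (hα : α ∈ Ioo (0 : ℝ) 1) (hab : a < b) (hM : 1 ≤ M)
    (hμ : ∀ x ∈ Icc a b, 0 ≤ μ x) (e : ℕ → ℕ → ℝ) (n : ℕ) :
    discH1 a b M μ (fun i => wavg α (fun k => e k i) n)
      ≤ max (discH1 a b M μ (e (n - 1))) (discH1 a b M μ (e n)) := by
  have hθ0 : 0 ≤ theta α := by unfold theta; linarith [hα.1]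
  have hθ1 := one_sub_theta_pos hα
  have hw := width_pos hab hM
  set m := max (discH1 a b M μ (e (n - 1))) (discH1 a b M μ (e n)) with hm
  have hm0 : 0 ≤ m := (discH1_nonneg _).trans (le_max_left _ _)
  apply abs_le_of_sq_le_sq' _ hm0 |>.2
  have h1 : discForm a b M μ (e (n - 1)) (e (n - 1)) ≤ m ^ 2 := by
    rw [← discH1_sq hab hM hμ]
    exact pow_le_pow_left₀ (discH1_nonneg _) (le_max_left _ _) 2
  have h2 : discForm a b M μ (e n) (e n) ≤ m ^ 2 := by
    rw [← discH1_sq hab hM hμ]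
    exact pow_le_pow_left₀ (discH1_nonneg _) (le_max_right _ _) 2
  rw [discH1_sq hab hM hμ]
  have h3 : discForm a b M μ (fun i => wavg α (fun k => e k i) n)
      (fun i => wavg α (fun k => e k i) n)
      ≤ theta α * discForm a b M μ (e (n - 1)) (e (n - 1))
        + (1 - theta α) * discForm a b M μ (e n) (e n) := by
    unfold discForm
    rw [mul_left_comm, mul_left_comm (1 - theta α), ← mul_add, Finset.mul_sum _ _ (theta α),
      Finset.mul_sum _ _ (1 - theta α), ← Finset.sum_add_distrib]
    apply mul_le_mul_of_nonneg_left _ hw.le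
    refine Finset.sum_le_sum fun i hi => ?_
    have hq := weight_nonneg hab hM hμ hi
    set p := (e (n - 1) i - e (n - 1) (i - 1)) / width a b M with hp
    set r := (e n i - e n (i - 1)) / width a b M with hr
    have e1 : (wavg α (fun k => e k i) n - wavg α (fun k => e k (i - 1)) n) / width a b M
        = theta α * p + (1 - theta α) * r := by
      rw [hp, hr]; unfold wavg; ring
    rw [e1]
    have : (theta α * p + (1 - theta α) * r) * (theta α * p + (1 - theta α) * r)
        ≤ theta α * (p * p) + (1 - theta α) * (r * r) := by
      have := mul_nonneg (mul_nonneg hθ0 hθ1.le) (sq_nonneg (p - r))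
      nlinarith
    have := mul_le_mul_of_nonneg_left this hq
    linarith
  calc _ ≤ _ := h3
    _ ≤ theta α * m ^ 2 + (1 - theta α) * m ^ 2 := by gcongr
    _ = m ^ 2 := by ring

/-- Summation by parts for a grid function `v` that vanishes at both ends. -/
lemma discForm_eq_discInner (hab : a < b) (hM : 1 ≤ M) {v w : ℕ → ℝ} (h0 : v 0 = 0)
    (h1 : v M = 0) :
    discForm a b M μ v w = discInner a b M v (discEllip a b M μ w) := by
  have hw := width_pos hab hM
  unfold discForm discInner
  congr 1
  obtain ⟨m, rfl⟩ : ∃ m, M = m + 1 := ⟨M - 1, by omega⟩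
  have key : ∀ d : ℝ, d ≠ 0 → ∀ q : ℝ → ℝ, ∀ m : ℕ,
      ∑ i ∈ Finset.Icc 1 (m + 1), q (i - 1 / 2) * ((v i - v (i - 1)) / d * ((w i - w (i - 1)) / d))
      = (∑ i ∈ Finset.Ioo 0 (m + 1), v i * (-(q (i + 1 / 2) * ((w (i + 1) - w i) / d)
          - q (i - 1 / 2) * ((w i - w (i - 1)) / d)) / d))
        + q ((m + 1 : ℕ) - 1 / 2) * ((w (m + 1) - w m) / d) * v (m + 1) / d := by
    intro d hd q m
    induction m with
    | zero =>
      have hE : Finset.Ioo 0 (0 + 1) = (∅ : Finset ℕ) := by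
        decide
      rw [hE, Finset.sum_empty]
      simp [h0]
      field_simp
    | succ m ih =>
      have hI : Finset.Ioo 0 (m + 1 + 1) = insert (m + 1) (Finset.Ioo 0 (m + 1)) := by
        ext x; simp only [Finset.mem_Ioo, Finset.mem_insert]; omega
      rw [Finset.sum_Icc_succ_top (by omega), ih, hI, Finset.sum_insert (by simp)]
      have e : ((m + 1 : ℕ) : ℝ) + 1 / 2 = ((m + 1 + 1 : ℕ) : ℝ) - 1 / 2 := by
        push_cast; ring
      simp only [Nat.add_sub_cancel, e]
      generalize (∑ i ∈ Finset.Ioo 0 (m + 1), v i * (-(q (i + 1 / 2) * ((w (i + 1) - w i) / d)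
          - q (i - 1 / 2) * ((w i - w (i - 1)) / d)) / d)) = S
      field_simp
      ring
  have := key (width a b (m + 1)) hw.ne' (fun s => μ (pt a b (m + 1) s)) m
  rw [h1, mul_zero, zero_div, add_zero] at this
  exact this

/-- A linear functional of the values at the grid points is a weighted sum of these values. -/
lemma exists_weights (F : (ℕ → ℝ) →ₗ[ℝ] ℝ)
    (hF : ∀ r r' : ℕ → ℝ, (∀ i ≤ M, r i = r' i) → F r = F r') :
    ∃ p : ℕ → ℝ, ∀ r, F r = ∑ i ∈ Finset.range (M + 1), p i * r i := by
  refine ⟨fun i => F (Pi.single i 1), fun r => ?_⟩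
  rw [hF r (∑ i ∈ Finset.range (M + 1), r i • Pi.single i (1 : ℝ))]
  · rw [map_sum]
    exact Finset.sum_congr rfl fun i _ => by rw [map_smul, smul_eq_mul, mul_comm]
  · intro j hj
    rw [Finset.sum_apply, Finset.sum_eq_single j]
    · simp
    · intro i _ hij
      simp [Pi.single_eq_of_ne hij.symm]
    · intro h
      exact absurd (Finset.mem_range.2 (by omega)) h

/-- Integrals over the pairs of adjacent cells add up to at most twice the integral. -/
lemma sum_integral_cells_le (hab : a < b) (hM : 1 ≤ M) {f : ℝ → ℝ} (hf : ∀ s, 0 ≤ f s)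
    (hfi : IntervalIntegrable f volume a b) :
    ∑ i ∈ Finset.Ioo 0 M, ∫ s in (pt a b M i - width a b M)..(pt a b M i + width a b M), f s
      ≤ 2 * ∫ s in a..b, f s := by
  have hw := width_pos hab hM
  have hii : ∀ x ∈ Icc a b, ∀ y ∈ Icc a b, IntervalIntegrable f volume x y := fun x hx y hy =>
    hfi.mono_set (by rw [uIcc_of_le hab.le]; exact uIcc_subset_Icc hx hy)
  have hmem : ∀ i : ℕ, i ≤ M → pt a b M i ∈ Icc a b := fun i hi =>
    pt_mem hab hM (by positivity) (by exact_mod_cast hi)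
  have hprev : ∀ i : ℕ, 1 ≤ i → pt a b M i - width a b M = pt a b M (i - 1 : ℕ) := by
    intro i hi
    rw [Nat.cast_sub hi, sub_eq_add_neg (i : ℝ), pt_add]; push_cast; ring
  have hnext : ∀ i : ℕ, pt a b M i + width a b M = pt a b M (i + 1 : ℕ) := by
    intro i
    rw [Nat.cast_add, pt_add]; push_cast; ring
  have hpieces := sum_integral_pieces (t := fun i : ℕ => pt a b M i) (f := f) (m := M)
    (fun k h1 hk => hii _ (hmem _ (by omega)) _ (hmem _ hk))
  simp only [Nat.cast_zero, pt_zero, pt_last hM] at hpieces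
  have hn : ∀ k ∈ Finset.Icc 1 M, 0 ≤ ∫ s in (pt a b M (k - 1 : ℕ))..(pt a b M k), f s := by
    intro k hk
    rw [Finset.mem_Icc] at hk
    refine intervalIntegral.integral_nonneg ?_ fun s _ => hf s
    rw [← hprev k hk.1]; linarith
  have hsplit : ∀ i ∈ Finset.Ioo 0 M,
      ∫ s in (pt a b M i - width a b M)..(pt a b M i + width a b M), f s
      = (∫ s in (pt a b M (i - 1 : ℕ))..(pt a b M i), f s)
        + ∫ s in (pt a b M (i + 1 - 1 : ℕ))..(pt a b M (i + 1 : ℕ)), f s := by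
    intro i hi
    rw [Finset.mem_Ioo] at hi
    rw [hprev i hi.1, hnext i, Nat.add_sub_cancel,
      intervalIntegral.integral_add_adjacent_intervals (hii _ (hmem _ (by omega)) _ (hmem _ hi.2.le))
        (hii _ (hmem _ hi.2.le) _ (hmem _ (by omega)))]
  rw [Finset.sum_congr rfl hsplit, Finset.sum_add_distrib, two_mul]
  apply add_le_add
  · rw [← hpieces]
    refine Finset.sum_le_sum_of_subset_of_nonneg ?_ fun k hk _ => hn k hk
    intro i; simp only [Finset.mem_Ioo, Finset.mem_Icc]; omega
  · rw [← hpieces, ← Finset.sum_image (s := Finset.Ioo 0 M) (g := fun i => i + 1)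
      (f := fun k => ∫ s in (pt a b M (k - 1 : ℕ))..(pt a b M k), f s)
      (fun i _ j _ h => by simpa using h)]
    refine Finset.sum_le_sum_of_subset_of_nonneg ?_ fun k hk _ => hn k hk
    intro i; simp only [Finset.mem_image, Finset.mem_Ioo, Finset.mem_Icc]
    rintro ⟨j, hj, rfl⟩; omega

end grid

/-! ### Sobolev functions on the grid -/

section sobolevGrid

variable {a b : ℝ} {M : ℕ} {μ m1 m2 : ℝ → ℝ} {B : ℝ}

lemma IsPrim.congr_left {v v' g : ℝ → ℝ} (h : IsPrim a b v g) (hv : ∀ x ∈ Icc a b, v' x = v x) :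
    IsPrim a b v' g :=
  ⟨h.1, fun x hx y hy => by rw [hv x hx, hv y hy, h.2 x hx y hy]⟩

lemma L2.intervalIntegral_sq (hab : a ≤ b) (w : L2 a b) : ∫ s in a..b, w s ^ 2 = ‖w‖ ^ 2 := by
  rw [intervalIntegral.integral_of_le hab, integral_Ioc_eq_integral_Ioo, w.integral_sq]

lemma L2.intervalIntegrable_sq (hab : a ≤ b) (w : L2 a b) :
    IntervalIntegrable (fun s => w s ^ 2) volume a b := by
  rw [intervalIntegrable_iff_integrableOn_Ioo_of_le hab]
  exact w.integrableOn_sq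

/-- Sums over the grid of squared cell integrals, by the Cauchy-Schwarz inequality. -/
lemma sum_sq_integral_cells_le (hab : a < b) (hM : 1 ≤ M) (w : L2 a b) :
    ∑ i ∈ Finset.Ioo 0 M,
      (∫ s in (pt a b M i - width a b M)..(pt a b M i + width a b M), |w s|) ^ 2
      ≤ 4 * width a b M * ‖w‖ ^ 2 := by
  have hw := width_pos hab hM
  have h := sum_integral_cells_le hab hM (f := fun s => w s ^ 2) (fun s => sq_nonneg _)
    (w.intervalIntegrable_sq hab.le)
  rw [w.intervalIntegral_sq hab.le] at h
  calc _ ≤ ∑ i ∈ Finset.Ioo 0 M, 2 * width a b M *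
        ∫ s in (pt a b M i - width a b M)..(pt a b M i + width a b M), w s ^ 2 := by
        refine Finset.sum_le_sum fun i hi => ?_
        rw [Finset.mem_Ioo] at hi
        have h1 : (1 : ℝ) ≤ i := by exact_mod_cast hi.1
        have h2 : (i : ℝ) + 1 ≤ M := by exact_mod_cast hi.2
        have e1 : pt a b M i - width a b M = pt a b M (i - 1) := by
          rw [sub_eq_add_neg (i : ℝ), pt_add]; ring
        have e2 : pt a b M i + width a b M = pt a b M (i + 1) := by rw [pt_add]; ring
        have := w.sq_integral_abs_le (x := pt a b M i - width a b M)
          (y := pt a b M i + width a b M) (by rw [e1]; exact pt_mem hab hM (by linarith) (by linarith))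
          (by rw [e2]; exact pt_mem hab hM (by linarith) (by linarith)) (by linarith)
        refine this.trans (le_of_eq ?_)
        ring
    _ = 2 * width a b M * _ := by rw [Finset.mul_sum]
    _ ≤ 2 * width a b M * (2 * ‖w‖ ^ 2) := by gcongr
    _ = _ := by ring

/-- Pointwise bounds that consist of a constant and of a cell integral, in the discrete norm. -/
lemma discNormSq_le_of_cells (hab : a < b) (hM : 1 ≤ M) (w : L2 a b) {v : ℕ → ℝ} {p q : ℝ}
    (hv : ∀ i, 1 ≤ i → i < M → |v i| ≤ p + q *
      ∫ s in (pt a b M i - width a b M)..(pt a b M i + width a b M), |w s|) :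
    discNormSq a b M v
      ≤ 2 * (b - a) * p ^ 2 + 8 * width a b M ^ 2 * q ^ 2 * ‖w‖ ^ 2 := by
  have hw := width_pos hab hM
  have h := sum_sq_integral_cells_le hab hM w
  have hconst : ∑ _i ∈ Finset.Ioo 0 M, 2 * p ^ 2 ≤ M * (2 * p ^ 2) := by
    rw [Finset.sum_const, nsmul_eq_mul]
    gcongr
    rw [Nat.card_Ioo]; omega
  unfold discNormSq
  calc _ ≤ width a b M * ∑ i ∈ Finset.Ioo 0 M, (2 * p ^ 2 + 2 * q ^ 2 *
        (∫ s in (pt a b M i - width a b M)..(pt a b M i + width a b M), |w s|) ^ 2) := by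
        gcongr with i hi
        rw [Finset.mem_Ioo] at hi
        have h1 := hv i hi.1 hi.2
        set J := ∫ s in (pt a b M i - width a b M)..(pt a b M i + width a b M), |w s|
        have h2 := sq_le_sq.2 (h1.trans (le_abs_self _))
        nlinarith [sq_nonneg (p - q * J)]
    _ ≤ width a b M * (M * (2 * p ^ 2) + 2 * q ^ 2 * (4 * width a b M * ‖w‖ ^ 2)) := by
        rw [Finset.sum_add_distrib, ← Finset.mul_sum (Finset.Ioo 0 M) _ (2 * q ^ 2)]
        exact mul_le_mul_of_nonneg_left
          (add_le_add hconst (mul_le_mul_of_nonneg_left h (by positivity))) hw.le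
    _ = 2 * ((M : ℝ) * width a b M) * p ^ 2 + 8 * width a b M ^ 2 * q ^ 2 * ‖w‖ ^ 2 := by ring
    _ = _ := by rw [natCast_mul_width hM]

lemma cell_mem (hab : a < b) (hM : 1 ≤ M) {i : ℕ} (h1 : 1 ≤ i) (hi : i < M) :
    a ≤ pt a b M i - width a b M ∧ pt a b M i + width a b M ≤ b := by
  have h1 : (1 : ℝ) ≤ i := by exact_mod_cast h1
  have h2 : (i : ℝ) + 1 ≤ M := by exact_mod_cast hi
  have e1 : pt a b M i - width a b M = pt a b M (i - 1) := by
    rw [sub_eq_add_neg (i : ℝ), pt_add]; ring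
  have e2 : pt a b M i + width a b M = pt a b M (i + 1) := by rw [pt_add]; ring
  rw [e1, e2]
  exact ⟨(pt_mem hab hM (by linarith) (by linarith)).1,
    (pt_mem hab hM (by linarith) (by linarith)).2⟩

/-- Stability of the difference operator on `H²`. -/
lemma discNormSq_discEllip_le (hμ : SmoothCoeff a b B μ m1 m2) (hB : 0 ≤ B) (hab : a < b)
    (hM : 1 ≤ M) (W : H a b 2) :
    discNormSq a b M (discEllip a b M μ (fun j => H.eval a b (pt a b M j) 1 W))
      ≤ (2 * (b - a) * (B * embConst a b) ^ 2 + 8 * B ^ 2) * ‖W‖ ^ 2 := by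
  have hw := width_pos hab hM
  have hl : 0 < b - a := sub_pos.2 hab
  obtain ⟨d, hd, hWd, hdb⟩ := H.exists_isPrim_succ hab W 1 2 (by simp)
  have hv := (H.isPrim_eval hab W).congr_ae hab.le hWd
  have h := discNormSq_le_of_cells hab hM (H.comp a b 2 2 W)
    (v := discEllip a b M μ (fun j => H.eval a b (pt a b M j) 1 W))
    (p := B * (embConst a b * ‖W‖)) (q := B / width a b M) (fun i h1 hi => by
      obtain ⟨c1, c2⟩ := cell_mem hab hM h1 hi
      have := abs_flux_le hμ hB hv hd hdb hw c1 c2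
      rw [discEllip_eq_flux (fun x => H.eval a b x 1 W) h1]
      refine this.trans (le_of_eq ?_)
      ring)
  have hn := H.norm_comp_le 2 W
  calc _ ≤ _ := h
    _ ≤ 2 * (b - a) * (B * (embConst a b * ‖W‖)) ^ 2
        + 8 * width a b M ^ 2 * (B / width a b M) ^ 2 * ‖W‖ ^ 2 := by gcongr
    _ = _ := by field_simp

lemma ellip_eq (hμ : SmoothCoeff a b B μ m1 m2) {v v1 v2 : ℝ → ℝ} (hv : IsPrim a b v v1)
    (hv1 : IsPrim a b v1 v2) (hv2 : ContinuousOn v2 (Icc a b)) {x : ℝ} (hx : x ∈ Ioo a b) :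
    ellip μ v x = -(m1 x * v1 x + μ x * v2 x) := by
  have h1 := (hμ.prim.hasDerivAt hμ.prim1.continuousOn hx).mul (hv1.hasDerivAt hv2 hx)
  have h2 : HasDerivAt (fun y => μ y * deriv v y) (m1 x * v1 x + μ x * v2 x) x := by
    refine h1.congr_of_eventuallyEq ?_
    filter_upwards [isOpen_Ioo.mem_nhds hx] with y hy
    rw [(hv.hasDerivAt hv1.continuousOn hy).deriv]
    rfl
  rw [ellip, h2.deriv]

/-- The constant in the bound for the consistency error of the difference operator. -/
noncomputable def consConst (a b B : ℝ) : ℝ :=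
  2 * (b - a) * (2 * B * embConst a b) ^ 2 + 8 * (2 * B * (1 + (b - a) ^ 2)) ^ 2

/-- Consistency of the difference operator on `H⁴`. -/
lemma discNormSq_consistency_le (hμ : SmoothCoeff a b B μ m1 m2) (hB : 0 ≤ B) (hab : a < b)
    (hM : 1 ≤ M) (W : H a b 4) {v : ℝ → ℝ} (hv : ∀ x ∈ Icc a b, v x = H.eval a b x 3 W) :
    discNormSq a b M (fun i => discEllip a b M μ (fun j => v (pt a b M j)) i
        - ellip μ v (pt a b M i))
      ≤ consConst a b B * (width a b M ^ 2 * ‖W‖) ^ 2 := by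
  have hw := width_pos hab hM
  have hwl := width_le hab hM
  have hl : 0 < b - a := sub_pos.2 hab
  obtain ⟨d1, hd1, hW1, hb1⟩ := H.exists_isPrim_succ hab W 1 2 (by simp)
  obtain ⟨d2, hd2, hW2, hb2⟩ := H.exists_isPrim_succ hab W 2 3 (by simp)
  obtain ⟨d3, hd3, hW3, hb3⟩ := H.exists_isPrim_succ hab W 3 4 (by simp)
  have p0 : IsPrim a b v d1 := ((H.isPrim_eval hab W).congr_ae hab.le hW1).congr_left hv
  have p1 := hd1.congr_ae hab.le hW2
  have p2 := hd2.congr_ae hab.le hW3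
  have h := discNormSq_le_of_cells hab hM (H.comp a b 4 4 W)
    (v := fun i => discEllip a b M μ (fun j => v (pt a b M j)) i - ellip μ v (pt a b M i))
    (p := 2 * B * (embConst a b * ‖W‖) * width a b M ^ 2)
    (q := 2 * B * (1 + (b - a) ^ 2) * width a b M) (fun i h1 hi => by
      obtain ⟨c1, c2⟩ := cell_mem hab hM h1 hi
      have := abs_flux_sub_le hμ hB p0 p1 p2 hd3 hb1 hb2 hb3 hw c1 c2
      rw [discEllip_eq_flux v h1, ellip_eq hμ p0 p1 p2.continuousOn
        (pt_mem_Ioo hab hM (by exact_mod_cast h1) (by exact_mod_cast hi)), sub_neg_eq_add]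
      refine this.trans ?_
      have hJ : 0 ≤ ∫ s in (pt a b M i - width a b M)..(pt a b M i + width a b M),
          |H.comp a b 4 4 W s| :=
        intervalIntegral.integral_nonneg (by linarith) fun s _ => abs_nonneg _
      rw [← mul_assoc (2 * B * (1 + width a b M ^ 2))]
      gcongr)
  have hn := H.norm_comp_le 4 W
  calc _ ≤ _ := h
    _ ≤ 2 * (b - a) * (2 * B * (embConst a b * ‖W‖) * width a b M ^ 2) ^ 2
        + 8 * width a b M ^ 2 * (2 * B * (1 + (b - a) ^ 2) * width a b M) ^ 2 * ‖W‖ ^ 2 := by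
        gcongr
    _ = _ := by unfold consConst; ring

/-- The linear interpolant of the end values of a grid function. -/
noncomputable def linInterp (M : ℕ) (r : ℕ → ℝ) (i : ℕ) : ℝ := r 0 + i / M * (r M - r 0)

/-- The values at the grid points of an `H¹` function: each difference quotient is the mean of the
weak derivative over a cell. -/
lemma discH1_eval_le (hμ : SmoothCoeff a b B μ m1 m2) (hB : 0 ≤ B) (hμ0 : ∀ x ∈ Icc a b, 0 ≤ μ x)
    (hab : a < b) (hM : 1 ≤ M) (W : H a b 1) :
    discH1 a b M μ (fun j => H.eval a b (pt a b M j) 0 W) ≤ √B * ‖W‖ := by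
  have hw := width_pos hab hM
  set g := H.comp a b 1 1 W with hg
  have hp : IsPrim a b (fun x => H.eval a b x 0 W) g := H.isPrim_eval hab W
  have hmem : ∀ i : ℕ, i ≤ M → pt a b M i ∈ Icc a b := fun i hi =>
    pt_mem hab hM (by positivity) (by exact_mod_cast hi)
  have hi2 := g.intervalIntegrable_sq hab.le
  have hpieces := sum_integral_pieces (t := fun i : ℕ => pt a b M i) (f := fun s => g s ^ 2)
    (m := M) (fun k h1 hk => hi2.mono_set (by
      rw [uIcc_of_le hab.le]; exact uIcc_subset_Icc (hmem _ (by omega)) (hmem _ hk)))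
  simp only [Nat.cast_zero, pt_zero, pt_last hM, g.intervalIntegral_sq hab.le] at hpieces
  apply abs_le_of_sq_le_sq' _ (by positivity) |>.2
  rw [discH1_sq hab hM hμ0, mul_pow, Real.sq_sqrt hB]
  unfold discForm
  have hterm : ∀ i ∈ Finset.Icc 1 M, μ (pt a b M (i - 1 / 2)) *
      ((H.eval a b (pt a b M i) 0 W - H.eval a b (pt a b M (i - 1 : ℕ)) 0 W) / width a b M *
        ((H.eval a b (pt a b M i) 0 W - H.eval a b (pt a b M (i - 1 : ℕ)) 0 W) / width a b M))
      ≤ B / width a b M * ∫ s in (pt a b M (i - 1 : ℕ))..(pt a b M i), g s ^ 2 := by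
    intro i hi
    have hq := weight_nonneg hab hM hμ0 hi
    rw [Finset.mem_Icc] at hi
    have hle : pt a b M i - pt a b M (i - 1 : ℕ) = width a b M := by
      rw [Nat.cast_sub hi.1, sub_eq_add_neg (i : ℝ), pt_add]; push_cast; ring
    have hB' : μ (pt a b M (i - 1 / 2)) ≤ B := by
      have h1 : (1 : ℝ) ≤ i := by exact_mod_cast hi.1
      have h2 : (i : ℝ) ≤ M := by exact_mod_cast hi.2
      exact (le_abs_self _).trans (hμ.bound _ (pt_mem hab hM (by linarith) (by linarith)))
    have hcs := g.sq_integral_abs_le (hmem (i - 1) (by omega)) (hmem i hi.2) (by linarith)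
    rw [hle] at hcs
    have hdiff := hp.2 _ (hmem (i - 1) (by omega)) _ (hmem i hi.2)
    have hint := intervalIntegral.abs_integral_le_integral_abs (μ := volume) (f := g)
      (by linarith : pt a b M (i - 1 : ℕ) ≤ pt a b M i)
    rw [← hdiff] at hint
    have hsq : (H.eval a b (pt a b M i) 0 W - H.eval a b (pt a b M (i - 1 : ℕ)) 0 W) ^ 2
        ≤ width a b M * ∫ s in (pt a b M (i - 1 : ℕ))..(pt a b M i), g s ^ 2 :=
      (sq_le_sq.2 (hint.trans (le_abs_self _))).trans hcs
    rw [div_mul_div_comm, ← sq]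
    calc _ ≤ B * (width a b M * (∫ s in (pt a b M (i - 1 : ℕ))..(pt a b M i), g s ^ 2)
          / (width a b M * width a b M)) := by gcongr
      _ = _ := by field_simp
  calc _ ≤ width a b M * ∑ i ∈ Finset.Icc 1 M,
        B / width a b M * ∫ s in (pt a b M (i - 1 : ℕ))..(pt a b M i), g s ^ 2 :=
        mul_le_mul_of_nonneg_left (Finset.sum_le_sum hterm) hw.le
    _ = B * ‖g‖ ^ 2 := by
        rw [← Finset.mul_sum, hpieces]; field_simp
    _ ≤ _ := by
        have := H.norm_comp_le 1 W
        gcongr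

lemma discH1_linInterp_le (hμ : SmoothCoeff a b B μ m1 m2) (hB : 0 ≤ B)
    (hμ0 : ∀ x ∈ Icc a b, 0 ≤ μ x) (hab : a < b) (hM : 1 ≤ M) (W : H a b 1) :
    discH1 a b M μ (linInterp M (fun j => H.eval a b (pt a b M j) 0 W)) ≤ √B * ‖W‖ := by
  have hw := width_pos hab hM
  have hl : 0 < b - a := sub_pos.2 hab
  have hM0 : (0 : ℝ) < M := by exact_mod_cast hM
  set g := H.comp a b 1 1 W with hg
  have hp : IsPrim a b (fun x => H.eval a b x 0 W) g := H.isPrim_eval hab W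
  set s := H.eval a b b 0 W - H.eval a b a 0 W with hs
  have hsb : s ^ 2 ≤ (b - a) * ‖W‖ ^ 2 := by
    have h1 := hp.2 a (left_mem_Icc.2 hab.le) b (right_mem_Icc.2 hab.le)
    have h2 := intervalIntegral.abs_integral_le_integral_abs (μ := volume) (f := g) hab.le
    rw [← h1] at h2
    have h3 := h2.trans (g.integral_abs_le hab.le)
    have h4 := sq_le_sq.2 (h3.trans (le_abs_self _))
    rw [mul_pow, Real.sq_sqrt hl.le] at h4
    have := H.norm_comp_le 1 W
    calc _ ≤ _ := h4
      _ ≤ _ := by gcongr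
  apply abs_le_of_sq_le_sq' _ (by positivity) |>.2
  rw [discH1_sq hab hM hμ0, mul_pow, Real.sq_sqrt hB]
  unfold discForm
  have hterm : ∀ i ∈ Finset.Icc 1 M, μ (pt a b M (i - 1 / 2)) *
      ((linInterp M (fun j => H.eval a b (pt a b M j) 0 W) i
          - linInterp M (fun j => H.eval a b (pt a b M j) 0 W) (i - 1)) / width a b M *
        ((linInterp M (fun j => H.eval a b (pt a b M j) 0 W) i
          - linInterp M (fun j => H.eval a b (pt a b M j) 0 W) (i - 1)) / width a b M))
      ≤ B * (s / (b - a)) ^ 2 := by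
    intro i hi
    have hq := weight_nonneg hab hM hμ0 hi
    rw [Finset.mem_Icc] at hi
    have hB' : μ (pt a b M (i - 1 / 2)) ≤ B := by
      have h1 : (1 : ℝ) ≤ i := by exact_mod_cast hi.1
      have h2 : (i : ℝ) ≤ M := by exact_mod_cast hi.2
      exact (le_abs_self _).trans (hμ.bound _ (pt_mem hab hM (by linarith) (by linarith)))
    have e : (linInterp M (fun j => H.eval a b (pt a b M j) 0 W) i
          - linInterp M (fun j => H.eval a b (pt a b M j) 0 W) (i - 1)) / width a b M
        = s / (b - a) := by
      rw [← natCast_mul_width (a := a) (b := b) hM]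
      unfold linInterp
      simp only [Nat.cast_zero, pt_zero, pt_last hM, Nat.cast_sub hi.1, Nat.cast_one]
      rw [hs]
      field_simp
      ring
    rw [e, ← sq]
    gcongr
  calc _ ≤ width a b M * ∑ _i ∈ Finset.Icc 1 M, B * (s / (b - a)) ^ 2 :=
        mul_le_mul_of_nonneg_left (Finset.sum_le_sum hterm) hw.le
    _ = (M * width a b M) * (B * (s / (b - a)) ^ 2) := by
        rw [Finset.sum_const, Nat.card_Icc, nsmul_eq_mul, Nat.add_sub_cancel]; ring
    _ = B * (s ^ 2 / (b - a)) := by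
        rw [natCast_mul_width hM]; field_simp
    _ ≤ B * ‖W‖ ^ 2 := by
        gcongr
        rw [div_le_iff₀ hl]; linarith

end sobolevGrid

/-! ### The energy inequality for the error -/

section energy

variable {a b α T σ κ CΩ K : ℝ} {M N : ℕ} {μ c : ℝ → ℝ} {t : ℕ → ℝ}

lemma discInner_add_left (v w z : ℕ → ℝ) :
    discInner a b M (fun i => v i + w i) z = discInner a b M v z + discInner a b M w z := by
  unfold discInner
  rw [← mul_add, ← Finset.sum_add_distrib]
  congr 1
  exact Finset.sum_congr rfl fun i _ => by ring

lemma discInner_congr_left {v w : ℕ → ℝ} (z : ℕ → ℝ) (h : ∀ i, 1 ≤ i → i < M → v i = w i) :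
    discInner a b M v z = discInner a b M w z := by
  unfold discInner
  congr 1
  refine Finset.sum_congr rfl fun i hi => ?_
  rw [Finset.mem_Ioo] at hi
  rw [h i hi.1 hi.2]

lemma discNormSq_mul_le (hab : a < b) (hM : 1 ≤ M) {q v : ℕ → ℝ}
    (hq : ∀ i, 1 ≤ i → i < M → |q i| ≤ κ) :
    discNormSq a b M (fun i => q i * v i) ≤ κ ^ 2 * discNormSq a b M v := by
  have hw := width_pos hab hM
  unfold discNormSq
  rw [mul_left_comm, Finset.mul_sum _ _ (κ ^ 2)]
  apply mul_le_mul_of_nonneg_left _ hw.le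
  refine Finset.sum_le_sum fun i hi => ?_
  rw [Finset.mem_Ioo] at hi
  rw [mul_pow]
  have := sq_le_sq.2 ((hq i hi.1 hi.2).trans (le_abs_self _))
  gcongr

/-- Positivity of the discrete Caputo derivative in the energy seminorm. -/
lemma sum_kernelA_discH1_le (hα : α ∈ Ioo (0 : ℝ) 1) (hm : IsMesh T N t) (hr : RatioBound N t)
    (hab : a < b) (hM : 1 ≤ M) (hμ : ∀ x ∈ Icc a b, 0 ≤ μ x) {n : ℕ} (h1 : 1 ≤ n) (hn : n ≤ N)
    (e : ℕ → ℕ → ℝ) :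
    ∑ k ∈ Finset.Icc 1 n, kernelA α t n k *
        (discH1 a b M μ (e k) ^ 2 - discH1 a b M μ (e (k - 1)) ^ 2)
      ≤ 2 * discForm a b M μ (fun i => discCaputo α t (fun k => e k i) n)
        (fun i => wavg α (fun k => e k i) n) := by
  have hw := width_pos hab hM
  set d : ℕ → ℕ → ℝ := fun i k => (e k i - e k (i - 1)) / width a b M with hd
  have hL : ∑ k ∈ Finset.Icc 1 n, kernelA α t n k *
        (discH1 a b M μ (e k) ^ 2 - discH1 a b M μ (e (k - 1)) ^ 2)
      = width a b M * ∑ i ∈ Finset.Icc 1 M, μ (pt a b M (i - 1 / 2)) *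
        ∑ k ∈ Finset.Icc 1 n, kernelA α t n k * (d i k ^ 2 - d i (k - 1) ^ 2) := by
    simp only [discH1_sq hab hM hμ, discForm, Finset.mul_sum, mul_sub, Finset.sum_sub_distrib]
    congr 1
    · rw [Finset.sum_comm]
      refine Finset.sum_congr rfl fun i _ => Finset.sum_congr rfl fun k _ => ?_
      simp only [hd]; ring
    · rw [Finset.sum_comm]
      refine Finset.sum_congr rfl fun i _ => Finset.sum_congr rfl fun k _ => ?_
      simp only [hd]; ring
  have hR : 2 * discForm a b M μ (fun i => discCaputo α t (fun k => e k i) n)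
        (fun i => wavg α (fun k => e k i) n)
      = width a b M * ∑ i ∈ Finset.Icc 1 M, μ (pt a b M (i - 1 / 2)) *
        (2 * wavg α (d i) n * discCaputo α t (d i) n) := by
    unfold discForm
    rw [mul_left_comm, Finset.mul_sum]
    congr 1
    refine Finset.sum_congr rfl fun i _ => ?_
    have e1 : (discCaputo α t (fun k => e k i) n - discCaputo α t (fun k => e k (i - 1)) n)
        / width a b M = discCaputo α t (d i) n := by
      unfold discCaputo
      rw [← Finset.sum_sub_distrib, Finset.sum_div]
      refine Finset.sum_congr rfl fun k _ => ?_
      simp only [hd]; ring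
    have e2 : (wavg α (fun k => e k i) n - wavg α (fun k => e k (i - 1)) n) / width a b M
        = wavg α (d i) n := by
      unfold wavg
      simp only [hd]; ring
    rw [e1, e2]
    ring
  rw [hL, hR]
  apply mul_le_mul_of_nonneg_left _ hw.le
  exact Finset.sum_le_sum fun i hi => mul_le_mul_of_nonneg_left
    (kernelA_energy hα hm hr h1 hn (d i)) (weight_nonneg hab hM hμ hi)

lemma linInterp_zero (r : ℕ → ℝ) : linInterp M r 0 = r 0 := by simp [linInterp]

lemma linInterp_last (hM : 1 ≤ M) (r : ℕ → ℝ) : linInterp M r M = r M := by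
  have : (M : ℝ) ≠ 0 := by positivity
  rw [linInterp, div_self this]; ring

/-- The energy inequality: the error equation is tested with `ℒ_h` of the weighted error. The
consistency error `r` is split: the part that vanishes at the boundary is measured in the dual of
the energy seminorm, its linear interpolant and the remaining errors `s` in the `L²` norm. -/
theorem energy_inequality (hα : α ∈ Ioo (0 : ℝ) 1) (hm : IsMesh T N t) (hr : RatioBound N t)
    (hab : a < b) (hM : 1 ≤ M) (hμ : ∀ x ∈ Icc a b, 0 ≤ μ x)
    (hc : ∀ x ∈ Ioo a b, |c x| ≤ κ) (hC : 0 ≤ CΩ) (hemb : IsEmbeddingConst a b μ CΩ)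
    {n : ℕ} (h1 : 1 ≤ n) (hn : n ≤ N) {e : ℕ → ℕ → ℝ} (he0 : ∀ k ≤ n, e k 0 = 0)
    (heM : ∀ k ≤ n, e k M = 0) {r s : ℕ → ℝ}
    (heq : ∀ i, 1 ≤ i → i < M → discCaputo α t (fun k => e k i) n
        + discEllip a b M μ (fun j => wavg α (fun k => e k j) n) i
      = c (pt a b M i) * wavg α (fun k => e k i) n + r i + s i) {ξ E : ℝ} (hξ0 : 0 ≤ ξ)
    (hξ : discForm a b M μ (fun i => r i - linInterp M r i) (fun i => wavg α (fun k => e k i) n)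
      ≤ ξ * discH1 a b M μ (fun i => wavg α (fun k => e k i) n))
    (hE : discInner a b M (fun i => linInterp M r i + s i)
        (discEllip a b M μ (fun j => wavg α (fun k => e k j) n))
      ≤ E * √(discNormSq a b M (discEllip a b M μ (fun j => wavg α (fun k => e k j) n)))) :
    ∑ k ∈ Finset.Icc 1 n, kernelA α t n k *
        (discH1 a b M μ (e k) ^ 2 - discH1 a b M μ (e (k - 1)) ^ 2)
      ≤ κ ^ 2 * CΩ * max (discH1 a b M μ (e (n - 1))) (discH1 a b M μ (e n)) ^ 2
        + 2 * ξ * max (discH1 a b M μ (e (n - 1))) (discH1 a b M μ (e n)) + E ^ 2 := by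
  refine (sum_kernelA_discH1_le hα hm hr hab hM hμ h1 hn e).trans ?_
  have hmax := discH1_wavg_le hα hab hM hμ e n
  set m := max (discH1 a b M μ (e (n - 1))) (discH1 a b M μ (e n)) with hmdef
  set eb : ℕ → ℝ := fun i => wavg α (fun k => e k i) n with heb
  set Z := discEllip a b M μ eb with hZ
  set z := √(discNormSq a b M Z) with hz
  have hz2 : z ^ 2 = discNormSq a b M Z := Real.sq_sqrt (discNormSq_nonneg hab hM Z)
  have hD0 : discCaputo α t (fun k => e k 0) n = 0 := by
    unfold discCaputo
    refine Finset.sum_eq_zero fun k hk => ?_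
    rw [Finset.mem_Icc] at hk
    simp only [he0 k hk.2, he0 (k - 1) (by omega)]; ring
  have hDM : discCaputo α t (fun k => e k M) n = 0 := by
    unfold discCaputo
    refine Finset.sum_eq_zero fun k hk => ?_
    rw [Finset.mem_Icc] at hk
    simp only [heM k hk.2, heM (k - 1) (by omega)]; ring
  have heb0 : eb 0 = 0 := by
    simp only [heb, wavg]; rw [he0 n le_rfl, he0 (n - 1) (by omega)]; ring
  have hebM : eb M = 0 := by
    simp only [heb, wavg]; rw [heM n le_rfl, heM (n - 1) (by omega)]; ring
  rw [discForm_eq_discInner hab hM hD0 hDM]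
  rw [discForm_eq_discInner hab hM (by rw [linInterp_zero, sub_self])
    (by rw [linInterp_last hM, sub_self])] at hξ
  have hsplit : discInner a b M (fun i => discCaputo α t (fun k => e k i) n) Z
      = discInner a b M (fun i => c (pt a b M i) * eb i) Z
        + discInner a b M (fun i => r i - linInterp M r i) Z
        + discInner a b M (fun i => linInterp M r i + s i) Z - discNormSq a b M Z := by
    rw [← discInner_self, eq_sub_iff_add_eq, ← discInner_add_left, ← discInner_add_left,
      ← discInner_add_left]
    refine discInner_congr_left Z fun i hi1 hi2 => ?_
    rw [hZ, heq i hi1 hi2]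
    ring
  have hreact : discInner a b M (fun i => c (pt a b M i) * eb i) Z
      ≤ 1 / 2 * (κ ^ 2 * CΩ * m ^ 2) + 1 / 2 * z ^ 2 := by
    have e1 := (le_abs_self _).trans (abs_discInner_le hab hM (fun i => c (pt a b M i) * eb i) Z)
    have e2 : discNormSq a b M (fun i => c (pt a b M i) * eb i) ≤ κ ^ 2 * (CΩ * m ^ 2) := by
      refine (discNormSq_mul_le hab hM (q := fun i => c (pt a b M i)) fun i hi1 hi2 =>
        hc _ (pt_mem_Ioo hab hM (by exact_mod_cast hi1) (by exact_mod_cast hi2))).trans ?_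
      have e3 := hemb M eb hM heb0 hebM
      have e4 : discH1 a b M μ eb ^ 2 ≤ m ^ 2 := pow_le_pow_left₀ (discH1_nonneg _) hmax 2
      refine mul_le_mul_of_nonneg_left (e3.trans ?_) (sq_nonneg κ)
      gcongr
    rw [← hz] at e1
    have e5 := Real.sq_sqrt (discNormSq_nonneg hab hM (fun i => c (pt a b M i) * eb i))
    nlinarith [sq_nonneg (√(discNormSq a b M (fun i => c (pt a b M i) * eb i)) - z)]
  have hξm : ξ * discH1 a b M μ eb ≤ ξ * m := mul_le_mul_of_nonneg_left hmax hξ0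
  rw [hsplit]
  nlinarith [sq_nonneg (E - z)]


/-- The consistency error in time of a function in `C³_σ((0,T];H¹)`, up to its linear interpolant,
is bounded in the dual of the energy seminorm. -/
lemma abs_discForm_truncErr_le {m1 m2 : ℝ → ℝ} {B : ℝ} (hμB : SmoothCoeff a b B μ m1 m2)
    (hB : 0 ≤ B) (hα : α ∈ Ioo (0 : ℝ) 1) (hσ : 0 < σ) (hσ2 : σ < 2) (hK : 0 ≤ K)
    (hm : IsMesh T N t) (hab : a < b) (hM : 1 ≤ M) (hμ : ∀ x ∈ Icc a b, 0 ≤ μ x) {n : ℕ}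
    (h1 : 1 ≤ n) (hn : n ≤ N) {U : ℝ → H a b 1} (hU : CSigma 3 σ T K U) {u : ℝ → ℝ → ℝ}
    (hu : ∀ s ∈ Icc 0 T, ∀ x ∈ Icc a b, u s x = H.eval a b x 0 (U s)) (z r : ℕ → ℝ)
    (hr : ∀ i ≤ M, r i = truncErr α t (fun s => u s (pt a b M i)) n) :
    |discForm a b M μ (fun i => r i - linInterp M r i) z|
      ≤ 2 * √B * discH1 a b M μ z * K * timeConst T * truncBound α σ t n := by
  -- as a linear functional of the grid values, this is a weighted sum of point evaluations, hence
  -- bounded on `H¹`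
  let F : (ℕ → ℝ) →ₗ[ℝ] ℝ :=
    { toFun := fun w => discForm a b M μ (fun i => w i - linInterp M w i) z
      map_add' := fun v w => by
        unfold discForm linInterp
        rw [← mul_add, ← Finset.sum_add_distrib]
        congr 1
        refine Finset.sum_congr rfl fun i _ => ?_
        simp only [Pi.add_apply]; ring
      map_smul' := fun q w => by
        unfold discForm linInterp
        rw [RingHom.id_apply, smul_eq_mul, mul_left_comm, Finset.mul_sum _ _ q]
        congr 1
        refine Finset.sum_congr rfl fun i _ => ?_
        simp only [Pi.smul_apply, smul_eq_mul]; ring }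
  have hFa : ∀ w, F w = discForm a b M μ (fun i => w i - linInterp M w i) z := fun _ => rfl
  obtain ⟨p, hp⟩ := exists_weights (M := M) F (fun v w h => by
    rw [hFa, hFa]
    unfold discForm linInterp
    congr 1
    refine Finset.sum_congr rfl fun i hi => ?_
    rw [Finset.mem_Icc] at hi
    simp only [h 0 (by omega), h M le_rfl, h i hi.2, h (i - 1) (by omega)])
  have hmem : ∀ i : ℕ, i ≤ M → pt a b M i ∈ Icc a b := fun i hi =>
    pt_mem hab hM (by positivity) (by exact_mod_cast hi)
  have hz := discH1_nonneg (a := a) (b := b) (M := M) (μ := μ) z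
  have key := hU.abs_sum_truncErr_le hα hσ hσ2 hK hm h1 hn (Finset.range (M + 1))
    (fun i => H.eval a b (pt a b M i) 0) p (C := 2 * √B * discH1 a b M μ z) (by positivity)
    (fun w => by
      rw [← hp (fun i => H.eval a b (pt a b M i) 0 w), hFa, discForm_sub_left]
      refine (abs_sub _ _).trans ?_
      have e1 := abs_discForm_le hab hM hμ (fun i => H.eval a b (pt a b M i) 0 w) z
      have e2 := abs_discForm_le hab hM hμ (linInterp M fun i => H.eval a b (pt a b M i) 0 w) z
      have e3 := mul_le_mul_of_nonneg_right (discH1_eval_le hμB hB hμ hab hM w) hz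
      have e4 := mul_le_mul_of_nonneg_right (discH1_linInterp_le hμB hB hμ hab hM w) hz
      linarith)
    (u := fun i s => u s (pt a b M i))
    (fun i hi s hs => hu s hs _ (hmem i (by rw [Finset.mem_range] at hi; omega)))
  rw [← hFa, hp r]
  refine le_trans (le_of_eq ?_) key
  congr 1
  refine Finset.sum_congr rfl fun i hi => ?_
  rw [hr i (by rw [Finset.mem_range] at hi; omega)]

/-- The constant in the bound for the errors that stem from the weighted time levels. -/
noncomputable def avgConst (a b B κ : ℝ) : ℝ :=
  √(2 * (b - a) * (B * embConst a b) ^ 2 + 8 * B ^ 2) + κ * (√(b - a) * embConst a b)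

lemma discNormSq_eval_le (hab : a < b) (hM : 1 ≤ M) {k : ℕ} (W : H a b (k + 1)) :
    discNormSq a b M (fun i => H.eval a b (pt a b M i) k W)
      ≤ (√(b - a) * embConst a b * ‖W‖) ^ 2 := by
  refine (discNormSq_le_of_abs_le hab hM (S := embConst a b * ‖W‖) fun i _ hi =>
    H.abs_eval_le hab W (pt_mem hab hM (by positivity) (by exact_mod_cast hi.le))).trans ?_
  rw [mul_assoc, mul_pow (√(b - a)), Real.sq_sqrt (sub_pos.2 hab).le]

/-- The error that stems from the weighted time levels of a function in `C²_σ((0,T];H²)`. -/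
lemma abs_discInner_wavg_le {m1 m2 : ℝ → ℝ} {B : ℝ} (hμB : SmoothCoeff a b B μ m1 m2)
    (hB : 0 ≤ B) (hκ : 0 ≤ κ) (hc : ∀ x ∈ Ioo a b, |c x| ≤ κ) (hα : α ∈ Ioo (0 : ℝ) 1)
    (hσ : 0 < σ) (hσ2 : σ < 2) (hK : 0 ≤ K)
    (hm : IsMesh T N t) (hab : a < b) (hM : 1 ≤ M) {n : ℕ}
    (h1 : 1 ≤ n) (hn : n ≤ N) {U : ℝ → H a b 2} (hU : CSigma 2 σ T K U) {u : ℝ → ℝ → ℝ}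
    (hu : ∀ s ∈ Icc 0 T, ∀ x ∈ Icc a b, u s x = H.eval a b x 1 (U s)) (z w : ℕ → ℝ)
    (hw : ∀ i ≤ M, w i = wavg α (fun k => u (t k) (pt a b M i)) n - u (tOff α t n) (pt a b M i)) :
    |discInner a b M (fun i => discEllip a b M μ w i - c (pt a b M i) * w i) z|
      ≤ 130 * (avgConst a b B κ * √(discNormSq a b M z) * K * timeConst T) * avgErr σ t n := by
  -- as a linear functional of the grid values, this is a weighted sum of point evaluations, hence
  -- bounded on `H²`
  let F : (ℕ → ℝ) →ₗ[ℝ] ℝ :=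
    { toFun := fun w => discInner a b M (fun i => discEllip a b M μ w i - c (pt a b M i) * w i) z
      map_add' := fun v w => by
        unfold discInner discEllip
        rw [← mul_add, ← Finset.sum_add_distrib]
        congr 1
        refine Finset.sum_congr rfl fun i _ => ?_
        simp only [Pi.add_apply]; ring
      map_smul' := fun q w => by
        unfold discInner discEllip
        rw [RingHom.id_apply, smul_eq_mul, mul_left_comm, Finset.mul_sum _ _ q]
        congr 1
        refine Finset.sum_congr rfl fun i _ => ?_
        simp only [Pi.smul_apply, smul_eq_mul]; ring }
  have hFa : ∀ w, F w
    = discInner a b M (fun i => discEllip a b M μ w i - c (pt a b M i) * w i) z := fun _ => rfl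
  obtain ⟨p, hp⟩ := exists_weights (M := M) F (fun v w h => by
    rw [hFa, hFa]
    unfold discInner discEllip
    congr 1
    refine Finset.sum_congr rfl fun i hi => ?_
    rw [Finset.mem_Ioo] at hi
    simp only [h i hi.2.le, h (i - 1) (by omega), h (i + 1) (by omega)])
  have hmem : ∀ i : ℕ, i ≤ M → pt a b M i ∈ Icc a b := fun i hi =>
    pt_mem hab hM (by positivity) (by exact_mod_cast hi)
  have hz := Real.sqrt_nonneg (discNormSq a b M z)
  have hemb := embConst_nonneg hab
  set Ψ : H a b 2 →L[ℝ] ℝ :=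
    ∑ i ∈ Finset.range (M + 1), p i • H.eval a b (pt a b M i) 1 with hΨ
  have hΨa : ∀ W, Ψ W = F (fun i => H.eval a b (pt a b M i) 1 W) := by
    intro W
    rw [hp, hΨ, _root_.sum_apply]
    rfl
  have key := hU.abs_sum_wavg_sub_le hα hσ hσ2 hK hm h1 hn Ψ
    (C := avgConst a b B κ * √(discNormSq a b M z))
    (by unfold avgConst; positivity) (fun W => by
      rw [hΨa, hFa]
      set v : ℕ → ℝ := fun i => H.eval a b (pt a b M i) 1 W with hv
      have e0 : (fun i => discEllip a b M μ v i - c (pt a b M i) * v i)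
          = fun i => discEllip a b M μ v i + (-c (pt a b M i)) * v i := by
        funext i; ring
      rw [e0, discInner_add_left]
      refine (abs_add_le _ _).trans ?_
      have e1 := abs_discInner_le hab hM (fun i => discEllip a b M μ v i) z
      have e2 := abs_discInner_le hab hM (fun i => (-c (pt a b M i)) * v i) z
      have e3 : √(discNormSq a b M (fun i => discEllip a b M μ v i))
          ≤ √(2 * (b - a) * (B * embConst a b) ^ 2 + 8 * B ^ 2) * ‖W‖ := by
        refine (Real.sqrt_le_sqrt (discNormSq_discEllip_le hμB hB hab hM W)).trans (le_of_eq ?_)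
        rw [Real.sqrt_mul' _ (sq_nonneg _), Real.sqrt_sq (norm_nonneg _)]
      have e4 : √(discNormSq a b M (fun i => (-c (pt a b M i)) * v i))
          ≤ κ * (√(b - a) * embConst a b) * ‖W‖ := by
        apply Real.sqrt_le_left (by positivity) |>.2
        refine (discNormSq_mul_le hab hM (q := fun i => -c (pt a b M i)) (κ := κ)
          fun i hi1 hi2 => ?_).trans ?_
        · rw [abs_neg]
          exact hc _ (pt_mem_Ioo hab hM (by exact_mod_cast hi1) (by exact_mod_cast hi2))
        · calc _ ≤ κ ^ 2 * (√(b - a) * embConst a b * ‖W‖) ^ 2 :=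
                mul_le_mul_of_nonneg_left (discNormSq_eval_le hab hM W) (sq_nonneg κ)
            _ = _ := by ring
      have e5 := mul_le_mul_of_nonneg_right e3 hz
      have e6 := mul_le_mul_of_nonneg_right e4 hz
      unfold avgConst
      linarith)
    (g := fun s => F (fun i => u s (pt a b M i))) (fun s hs => by
      rw [hΨa, hp, hp]
      refine Finset.sum_congr rfl fun i hi => ?_
      rw [hu s hs _ (hmem i (by rw [Finset.mem_range] at hi; omega))])
  refine le_trans (le_of_eq ?_) key
  rw [← hFa, hp w, hp (fun i => u (tOff α t n) (pt a b M i))]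
  simp only [hp, wavg, Finset.mul_sum, ← Finset.sum_add_distrib, ← Finset.sum_sub_distrib]
  congr 1
  refine Finset.sum_congr rfl fun i hi => ?_
  rw [hw i (by rw [Finset.mem_range] at hi; omega)]
  unfold wavg
  ring

/-- The linear interpolant of values that are bounded at the ends. -/
lemma discNormSq_linInterp_le (hab : a < b) (hM : 1 ≤ M) {r : ℕ → ℝ} {S : ℝ} (h0 : |r 0| ≤ S)
    (h1 : |r M| ≤ S) : discNormSq a b M (linInterp M r) ≤ (b - a) * S ^ 2 := by
  have hM0 : (0 : ℝ) < M := by exact_mod_cast hM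
  refine discNormSq_le_of_abs_le hab hM fun i _ hi => ?_
  have h2 : (0 : ℝ) ≤ i / M := by positivity
  have h3 : (i : ℝ) / M ≤ 1 := by
    rw [div_le_one hM0]; exact_mod_cast hi.le
  have e : linInterp M r i = (1 - i / M) * r 0 + i / M * r M := by
    unfold linInterp; ring
  rw [e]
  refine (abs_add_le _ _).trans ?_
  rw [abs_mul, abs_mul, abs_of_nonneg h2, abs_of_nonneg (sub_nonneg.2 h3)]
  have := sub_nonneg.2 h3
  calc _ ≤ (1 - (i : ℝ) / M) * S + i / M * S := by gcongr
    _ = S := by ring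

end energy

/-! ### The error equation -/

section errorEquation

variable {a b α T σ κ CΩ K : ℝ} {M N : ℕ} {μ c : ℝ → ℝ} {t : ℕ → ℝ} {f ub u : ℝ → ℝ → ℝ}
  {u0 : ℝ → ℝ} {uh : ℕ → ℕ → ℝ}

lemma discCaputo_sub (v w : ℕ → ℝ) (n : ℕ) :
    discCaputo α t (fun k => v k - w k) n = discCaputo α t v n - discCaputo α t w n := by
  unfold discCaputo
  rw [← Finset.sum_sub_distrib]
  exact Finset.sum_congr rfl fun k _ => by ring

lemma truncBound_nonneg (hα : α ∈ Ioo (0 : ℝ) 1) (hσ : 0 < σ) (hm : IsMesh T N t) {n : ℕ}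
    (h1 : 1 ≤ n) (hn : n ≤ N) : 0 ≤ truncBound α σ t n := by
  have hΓ := Gamma_two_sub_pos hα
  have hτ := hm.tau_pos h1 hn
  have hS := stepErr_nonneg hm hσ h1 hn
  unfold truncBound
  refine add_nonneg (Finset.sum_nonneg fun k hk => ?_) (by positivity)
  rw [Finset.mem_Icc] at hk
  refine mul_nonneg (histErr_nonneg hm hσ hk.1 (by omega)) (sub_nonneg.2 ?_)
  exact wt_mono hα (hm.mono (by omega) (by omega)) (lt_tOff_of_lt hα hm (by omega) hn)

lemma SolRegular.nonneg (h : SolRegular a b T σ K u) (hT : 0 ≤ T) : 0 ≤ K := by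
  obtain ⟨U, _, _, hU⟩ := h.h4
  exact (norm_nonneg _).trans (hU 0 ⟨le_rfl, hT⟩)

/-- The datum of the energy inequality that is measured in the dual of the energy seminorm. -/
noncomputable def dualErr (T B K α σ : ℝ) (t : ℕ → ℝ) (n : ℕ) : ℝ :=
  2 * √B * K * timeConst T * truncBound α σ t n

/-- The datum of the energy inequality that is measured in the `L²` norm. -/
noncomputable def normErr (a b T B κ K α σ : ℝ) (M : ℕ) (t : ℕ → ℝ) (n : ℕ) : ℝ :=
  √(b - a) * (K * truncBound α 3 t n) + 130 * (avgConst a b B κ * K * timeConst T) * avgErr σ t n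
    + √(consConst a b B) * (width a b M ^ 2 * K)

/-- The energy inequality for the error of the scheme. The truncation error `r` of `u` at the grid
points is measured through the regularity of `u` in `H¹`; its end values are truncation errors of
the smooth boundary data. -/
theorem Setting.energy (S : Setting a b T κ CΩ K μ c α σ f ub u0 u N t M uh) (hab : a < b)
    (hμ : ∀ x ∈ Icc a b, 0 ≤ μ x) {m1 m2 : ℝ → ℝ} {B : ℝ} (hμB : SmoothCoeff a b B μ m1 m2)
    (hB : 0 ≤ B) (hκ : 0 ≤ κ) (hc : ∀ x ∈ Ioo a b, |c x| ≤ κ) (hC : 0 ≤ CΩ)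
    (hemb : IsEmbeddingConst a b μ CΩ) {n : ℕ} (h1 : 1 ≤ n) (hn : n ≤ N) :
    ∑ k ∈ Finset.Icc 1 n, kernelA α t n k *
        (h1Error a b M μ u t uh k ^ 2 - h1Error a b M μ u t uh (k - 1) ^ 2)
      ≤ κ ^ 2 * CΩ * max (h1Error a b M μ u t uh (n - 1)) (h1Error a b M μ u t uh n) ^ 2
        + 2 * dualErr T B K α σ t n *
          max (h1Error a b M μ u t uh (n - 1)) (h1Error a b M μ u t uh n)
        + normErr a b T B κ K α σ M t n ^ 2 := by
  have hα := S.alpha_mem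
  have hm := S.mesh
  have hM := S.grid
  have hσ : 0 < σ := by rcases S.sigma_mem with h | h <;> linarith [h.1]
  have hσ2 : σ < 2 := by rcases S.sigma_mem with h | h <;> linarith [h.2]
  have hT : 0 < T := (hm.pos h1 hn).trans_le (hm.le_T hn)
  have hK := S.regular.nonneg hT.le
  have hTC := timeConst_pos hT
  have hc0 := tOff_pos hα hm h1 hn
  have hcT := tOff_lt_T hα hm h1 hn
  have hcI : tOff α t n ∈ Icc 0 T := ⟨hc0.le, hcT.le⟩
  have hmem : ∀ i : ℕ, i ≤ M → pt a b M i ∈ Icc a b := fun i hi =>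
    pt_mem hab hM (by positivity) (by exact_mod_cast hi)
  obtain ⟨U4, hR4, -, hU4⟩ := S.regular.h4
  obtain ⟨U2, hR2, hU2⟩ := S.regular.h2
  obtain ⟨U1, hR1, hU1⟩ := S.regular.h1
  have hu1 : ∀ s ∈ Icc 0 T, ∀ x ∈ Icc a b, u s x = H.eval a b x 0 (U1 s) := fun s hs x hx =>
    (hR1 s hs).eq_eval hab (S.regular.cont s hs) hx
  have hu2 : ∀ s ∈ Icc 0 T, ∀ x ∈ Icc a b, u s x = H.eval a b x 1 (U2 s) := fun s hs x hx =>
    (hR2 s hs).eq_eval hab (S.regular.cont s hs) hx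
  have hu4 : ∀ s ∈ Icc 0 T, ∀ x ∈ Icc a b, u s x = H.eval a b x 3 (U4 s) := fun s hs x hx =>
    (hR4 s hs).eq_eval hab (S.regular.cont s hs) hx
  set e : ℕ → ℕ → ℝ := fun k i => u (t k) (pt a b M i) - uh k i with he
  have heB : ∀ k ≤ n, e k 0 = 0 ∧ e k M = 0 := by
    intro k hk
    simp only [he, Nat.cast_zero, pt_zero, pt_last hM]
    rcases Nat.eq_zero_or_pos k with rfl | hk0
    · rw [hm.2.1, S.solution.initial a (left_mem_Icc.2 hab.le),
        S.solution.initial b (right_mem_Icc.2 hab.le), S.discrete.initial 0 (by omega),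
        S.discrete.initial M le_rfl, Nat.cast_zero, pt_zero, pt_last hM]
      simp
    · have h := S.solution.boundary (t k) ⟨hm.pos hk0 (by omega), hm.le_T (by omega)⟩
      have h' := S.discrete.boundary k hk0 (by omega)
      rw [h.1, h.2, h'.1, h'.2]
      simp
  set r : ℕ → ℝ := fun i => truncErr α t (fun s => u s (pt a b M i)) n with hr
  set w : ℕ → ℝ := fun i =>
    wavg α (fun k => u (t k) (pt a b M i)) n - u (tOff α t n) (pt a b M i) with hw
  set s2 : ℕ → ℝ := fun i => discEllip a b M μ (fun j => u (tOff α t n) (pt a b M j)) i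
    - ellip μ (u (tOff α t n)) (pt a b M i) with hs2
  have hebar : (fun j => wavg α (fun k => e k j) n)
      = fun j => (w j + u (tOff α t n) (pt a b M j)) - wavg α (fun k => uh k j) n := by
    funext j
    simp only [he, hw, wavg]
    ring
  refine energy_inequality hα hm S.ratio_le hab hM hμ hc hC hemb h1 hn
    (fun k hk => (heB k hk).1) (fun k hk => (heB k hk).2) (r := r)
    (s := fun i => (discEllip a b M μ w i - c (pt a b M i) * w i) + s2 i) ?_ ?_ ?_ ?_
  · intro i hi1 hi2
    have hx : pt a b M i ∈ Ioo a b :=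
      pt_mem_Ioo hab hM (by exact_mod_cast hi1) (by exact_mod_cast hi2)
    have hp := S.solution.pde _ hx _ ⟨hc0, hcT.le⟩
    have hd := S.discrete.scheme n h1 hn i hi1 hi2
    have e1 : wavg α (fun k => e k i) n
        = (w i + u (tOff α t n) (pt a b M i)) - wavg α (fun k => uh k i) n := congrFun hebar i
    have e2 : discCaputo α t (fun k => e k i) n
        = discCaputo α t (fun k => u (t k) (pt a b M i)) n - discCaputo α t (fun k => uh k i) n :=
      discCaputo_sub _ _ _
    have e3 : r i = discCaputo α t (fun k => u (t k) (pt a b M i)) n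
        - caputo α (fun s => u s (pt a b M i)) (tOff α t n) := rfl
    rw [e1, e2, hebar, discEllip_sub, discEllip_add]
    simp only [hs2]
    linarith
  · have := truncBound_nonneg hα hσ hm h1 hn
    unfold dualErr
    positivity
  · refine (le_abs_self _).trans ((abs_discForm_truncErr_le hμB hB hα hσ hσ2 hK hm hab hM hμ h1 hn
      hU1 hu1 (fun i => wavg α (fun k => e k i) n) r (fun i _ => rfl)).trans (le_of_eq ?_))
    unfold dualErr
    ring
  · set Z := discEllip a b M μ (fun j => wavg α (fun k => e k j) n) with hZ
    have hbd : ∀ (i : ℕ) (x : ℝ), pt a b M i = x → (x = a ∨ x = b) →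
        |r i| ≤ K * truncBound α 3 t n := by
      intro i x hx hxab
      have hxI : x ∈ Icc a b := by
        rcases hxab with h | h <;> rw [h]
        exacts [left_mem_Icc.2 hab.le, right_mem_Icc.2 hab.le]
      refine (S.boundarySmooth.timeReg hT hxab (g := fun s => u s (pt a b M i)) ?_ ?_).truncErr_le
        hα (by norm_num) le_rfl hK hm h1 hn
      · rw [hx]
        exact ((H.eval a b x 0).continuous.comp_continuousOn hU1.1).congr fun s hs => hu1 s hs x hxI
      · intro s hs
        have := S.solution.boundary s hs
        rw [hx]
        rcases hxab with h | h <;> rw [h]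
        exacts [this.1, this.2]
    have hlin : discInner a b M (linInterp M r) Z
        ≤ √(b - a) * (K * truncBound α 3 t n) * √(discNormSq a b M Z) := by
      refine (le_abs_self _).trans ((abs_discInner_le hab hM _ _).trans ?_)
      refine mul_le_mul_of_nonneg_right ?_ (Real.sqrt_nonneg _)
      have h0 := truncBound_nonneg hα (σ := 3) (by norm_num) hm h1 hn
      refine (Real.sqrt_le_sqrt (discNormSq_linInterp_le hab hM
        (hbd 0 a (by simp [pt_zero]) (Or.inl rfl)) (hbd M b (pt_last hM) (Or.inr rfl)))).trans ?_
      rw [Real.sqrt_mul (sub_pos.2 hab).le, Real.sqrt_sq (by positivity)]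
    have havg := (le_abs_self _).trans (abs_discInner_wavg_le hμB hB hκ hc hα hσ hσ2 hK hm hab hM
      h1 hn hU2 hu2 Z w (fun i _ => rfl))
    have hcons : discInner a b M s2 Z
        ≤ √(consConst a b B) * (width a b M ^ 2 * K) * √(discNormSq a b M Z) := by
      refine (le_abs_self _).trans ((abs_discInner_le hab hM _ _).trans ?_)
      refine mul_le_mul_of_nonneg_right ?_ (Real.sqrt_nonneg _)
      refine (Real.sqrt_le_sqrt (discNormSq_consistency_le hμB hB hab hM (U4 (tOff α t n))
        (hu4 _ hcI))).trans ?_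
      rw [Real.sqrt_mul' _ (sq_nonneg _), Real.sqrt_sq (by positivity)]
      have := hU4 _ hcI
      gcongr
    rw [discInner_add_left, discInner_add_left]
    unfold normErr
    linarith

end errorEquation

/-! ### The error bound on general meshes -/

section errorBound

lemma le_maxOver {i j k : ℕ} (g : ℕ → ℝ) (hi : i ≤ k) (hj : k ≤ j) : g k ≤ maxOver i j g :=
  (Finset.le_fold_max _).2 (Or.inr ⟨k, Finset.mem_Icc.2 ⟨hi, hj⟩, le_rfl⟩)

lemma maxOver_nonneg (i j : ℕ) (g : ℕ → ℝ) : 0 ≤ maxOver i j g :=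
  (Finset.le_fold_max _).2 (Or.inl le_rfl)

lemma maxOver_le {i j : ℕ} {g : ℕ → ℝ} {S : ℝ} (hS : 0 ≤ S) (h : ∀ k, i ≤ k → k ≤ j → g k ≤ S) :
    maxOver i j g ≤ S :=
  (Finset.fold_max_le _).2 ⟨hS, fun k hk => h k (Finset.mem_Icc.1 hk).1 (Finset.mem_Icc.1 hk).2⟩

variable {a b α T σ κ CΩ K B : ℝ} {M N : ℕ} {μ c : ℝ → ℝ} {t : ℕ → ℝ} {f ub u : ℝ → ℝ → ℝ}
  {u0 : ℝ → ℝ} {uh : ℕ → ℕ → ℝ}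

lemma one_le_sq_mul_rpow {s : ℝ} (hs : s ∈ Ioc 0 T) (hσ : 0 < σ) (hσ2 : σ < 2) :
    1 ≤ (1 + T) ^ 2 * s ^ (σ - 2) := by
  have hs0 := hs.1
  have h1 : s ^ (2 - σ) ≤ (1 + T) ^ 2 := by
    calc s ^ (2 - σ) ≤ (1 + T) ^ (2 - σ) :=
          Real.rpow_le_rpow hs0.le (by linarith [hs.2]) (by linarith)
      _ ≤ (1 + T) ^ (2 : ℝ) :=
          Real.rpow_le_rpow_of_exponent_le (by linarith [hs.2]) (by linarith)
      _ = (1 + T) ^ 2 := by norm_cast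
  have h2 : s ^ (2 - σ) * s ^ (σ - 2) = 1 := by
    rw [← Real.rpow_add hs0, sub_add_sub_cancel, sub_self, Real.rpow_zero]
  have h3 := mul_le_mul_of_nonneg_right h1 (Real.rpow_pos_of_pos hs0 (σ - 2)).le
  rwa [h2] at h3

/-- The step-size restriction bounds the diagonal of the kernel from below. -/
lemma three_mul_le_kernelA_self (hα : α ∈ Ioo (0 : ℝ) 1) (hm : IsMesh T N t) (hκ : 0 < κ)
    (hC : 0 < CΩ)
    (hstep : maxStep N t ≤ 1 / (6 * Real.Gamma (2 - α) * κ ^ 2 * CΩ) ^ (1 / α)) {k : ℕ}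
    (h1 : 1 ≤ k) (hk : k ≤ N) : 3 * (κ ^ 2 * CΩ) ≤ kernelA α t k k := by
  have hΓ := Gamma_two_sub_pos hα
  have hτ := hm.tau_pos h1 hk
  have hα0 := hα.1
  set X := 6 * Real.Gamma (2 - α) * κ ^ 2 * CΩ with hX
  have hX0 : 0 < X := by positivity
  have h2 : tau t k ≤ 1 / X ^ (1 / α) := (le_maxOver (tau t) h1 hk).trans hstep
  have h3 : X ≤ tau t k ^ (-α) := by
    have hp := Real.rpow_pos_of_pos hX0 (1 / α)
    have h4 : X ^ (1 / α) ≤ (tau t k)⁻¹ := by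
      rw [le_inv_comm₀ hp hτ, ← one_div]; exact h2
    have h5 := Real.rpow_le_rpow hp.le h4 hα0.le
    rwa [← Real.rpow_mul hX0.le, one_div_mul_cancel hα0.ne', Real.rpow_one,
      Real.inv_rpow hτ.le, ← Real.rpow_neg hτ.le] at h5
  refine le_trans ?_ (kernelA_self_ge hα hm h1 hk)
  have e : 3 * (κ ^ 2 * CΩ) = 1 / 2 * (X / Real.Gamma (2 - α)) := by
    rw [hX]; field_simp; norm_num
  rw [e]
  gcongr

/-- The constant in the bound for `normErr`. -/
noncomputable def normConst (a b T B κ K : ℝ) : ℝ :=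
  2 * (2000 * (√(b - a) * K) * (1 + T) ^ 4 + 130 * (avgConst a b B κ * K * timeConst T) * (1 + T)
    + √(consConst a b B) * K)

lemma avgConst_nonneg (hab : a < b) (hκ : 0 ≤ κ) : 0 ≤ avgConst a b B κ := by
  have := embConst_nonneg hab
  unfold avgConst; positivity

/-- The factor `t_j^{α/2}` is what the sums `∑_j P_{n,j} η_j²` allow, because of
`∑_j P_{n,j} t_j^{-α} ≤ C`. -/
lemma rpow_mul_normErr_le (hα : α ∈ Ioo (0 : ℝ) 1) (hσ : 0 < σ) (hσ2 : σ < 2)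
    (hm : IsMesh T N t) (hr : RatioBound N t) (hab : a < b) (hκ : 0 ≤ κ) (hK : 0 ≤ K) {n : ℕ}
    (hn : n ≤ N) {M3 : ℝ} (hM0 : 0 ≤ M3)
    (hM3 : ∀ k, 2 ≤ k → k ≤ n → t k ^ (α / 2) * t (k - 1) ^ (σ - 2) * tau t k ^ 2 ≤ M3)
    {j : ℕ} (h1 : 1 ≤ j) (hj : j ≤ n) :
    t j ^ (α / 2) * normErr a b T B κ K α σ M t j
      ≤ normConst a b T B κ K / σ *
        (tau t 1 ^ σ + M3 + t n ^ (α / 2) * width a b M ^ 2) := by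
  have hα0 := hα.1
  have hα1 := hα.2
  have hT : 0 < T := (hm.pos h1 (hj.trans hn)).trans_le (hm.le_T (hj.trans hn))
  have hTC := timeConst_pos hT
  have hA := avgConst_nonneg (B := B) hab hκ
  have htj := hm.pos h1 (hj.trans hn)
  have hτ1 := hm.tau_pos le_rfl (by omega : 1 ≤ N)
  have hτ1T : tau t 1 ≤ T := (hm.tau_le (by omega)).trans (hm.le_T (by omega))
  set x := tau t 1 ^ σ with hx
  have hx0 : 0 < x := Real.rpow_pos_of_pos hτ1 σ
  set D := (1 + T) ^ 2 with hD
  have hD0 : 0 < D := by positivity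
  have hτ2 : tau t 1 ^ 2 ≤ D * x := by
    have h := one_le_sq_mul_rpow ⟨hτ1, hτ1T⟩ hσ hσ2
    have e : tau t 1 ^ (σ - 2) * tau t 1 ^ 2 = x := by
      rw [hx, ← Real.rpow_natCast (tau t 1) 2, ← Real.rpow_add hτ1]; norm_num
    calc tau t 1 ^ 2 = 1 * tau t 1 ^ 2 := (one_mul _).symm
      _ ≤ (D * tau t 1 ^ (σ - 2)) * tau t 1 ^ 2 := by gcongr
      _ = _ := by rw [mul_assoc, e]
  have hm2 : ∀ k, 2 ≤ k → k ≤ j → t k ^ (α / 2) * tau t k ^ 2 ≤ D * M3 := by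
    intro k hk hkj
    have htk := hm.nonneg (by omega : k ≤ N)
    have h := one_le_sq_mul_rpow (σ := σ) ⟨hm.pos (by omega : 1 ≤ k - 1) (by omega),
      hm.le_T (by omega)⟩ hσ hσ2
    calc t k ^ (α / 2) * tau t k ^ 2 = t k ^ (α / 2) * 1 * tau t k ^ 2 := by ring
      _ ≤ t k ^ (α / 2) * (D * t (k - 1) ^ (σ - 2)) * tau t k ^ 2 := by gcongr
      _ = D * (t k ^ (α / 2) * t (k - 1) ^ (σ - 2) * tau t k ^ 2) := by ring
      _ ≤ _ := by
          have := hM3 k hk (by omega)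
          gcongr
  have hB1 := truncBound_smooth_le hα hm hr h1 (hj.trans hn) (by positivity) hm2
  have hσ1 : 1 ≤ 2 / σ := by rw [le_div_iff₀ hσ]; linarith
  have hB1' : t j ^ (α / 2) * truncBound α 3 t j ≤ 2000 * (1 + T) ^ 4 * (2 / σ * (x + M3)) := by
    calc _ ≤ _ := hB1
      _ ≤ 2000 * D * (D * x + D * M3) := by gcongr
      _ = 2000 * (1 + T) ^ 4 * (1 * (x + M3)) := by rw [hD]; ring
      _ ≤ _ := by gcongr
  have hB2 : t j ^ (α / 2) * avgErr σ t j ≤ (1 + T) * (2 / σ * (x + M3)) := by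
    have hle : t j ^ (α / 2) ≤ 1 + T :=
      (rpow_le_one_add htj.le (by linarith) (by linarith)).trans
        (by linarith [hm.le_T (hj.trans hn)])
    unfold avgErr
    split_ifs with h
    · calc _ ≤ (1 + T) * (x / σ) := by gcongr
        _ ≤ (1 + T) * (2 / σ * (x + M3)) := by
            gcongr
            rw [div_mul_eq_mul_div]
            gcongr
            linarith
    · have h3 := hM3 j (by omega) hj
      rw [mul_assoc] at h3
      calc _ ≤ M3 := h3
        _ = 1 * (1 * M3) := by ring
        _ ≤ _ := by gcongr <;> linarith
  have hB3 : t j ^ (α / 2) * width a b M ^ 2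
      ≤ 2 / σ * (t n ^ (α / 2) * width a b M ^ 2) := by
    calc _ ≤ 1 * (t n ^ (α / 2) * width a b M ^ 2) := by
          rw [one_mul]
          have := hm.mono hj hn
          gcongr
      _ ≤ _ := by
          have := hm.nonneg hn
          gcongr
  set H := t n ^ (α / 2) * width a b M ^ 2 with hH
  have hH0 : 0 ≤ H := by have := hm.nonneg hn; positivity
  have hxM : 2 / σ * (x + M3) ≤ 2 / σ * (x + M3 + H) :=
    mul_le_mul_of_nonneg_left (by linarith) (by positivity)
  have hHM : 2 / σ * H ≤ 2 / σ * (x + M3 + H) :=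
    mul_le_mul_of_nonneg_left (by linarith) (by positivity)
  calc t j ^ (α / 2) * normErr a b T B κ K α σ M t j
      = √(b - a) * K * (t j ^ (α / 2) * truncBound α 3 t j)
        + 130 * (avgConst a b B κ * K * timeConst T) * (t j ^ (α / 2) * avgErr σ t j)
        + √(consConst a b B) * K * (t j ^ (α / 2) * width a b M ^ 2) := by
        unfold normErr; ring
    _ ≤ √(b - a) * K * (2000 * (1 + T) ^ 4 * (2 / σ * (x + M3 + H)))
        + 130 * (avgConst a b B κ * K * timeConst T) * ((1 + T) * (2 / σ * (x + M3 + H)))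
        + √(consConst a b B) * K * (2 / σ * (x + M3 + H)) := by
        have i1 : t j ^ (α / 2) * truncBound α 3 t j
            ≤ 2000 * (1 + T) ^ 4 * (2 / σ * (x + M3 + H)) :=
          hB1'.trans (mul_le_mul_of_nonneg_left hxM (by positivity))
        have i2 : t j ^ (α / 2) * avgErr σ t j ≤ (1 + T) * (2 / σ * (x + M3 + H)) :=
          hB2.trans (mul_le_mul_of_nonneg_left hxM (by positivity))
        have i3 := hB3.trans hHM
        gcongr
    _ = _ := by unfold normConst; ring

lemma avgErr_nonneg (hm : IsMesh T N t) (hσ : 0 < σ) {n : ℕ} (h1 : 1 ≤ n) (hn : n ≤ N) :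
    0 ≤ avgErr σ t n := by
  have := hm.tau_pos h1 hn
  have := hm.tau_pos le_rfl (h1.trans hn)
  have := hm.nonneg (by omega : n - 1 ≤ N)
  unfold avgErr
  split_ifs <;> positivity

/-- The error bound on general meshes: Grönwall's inequality applied to the errors in time. -/
theorem exists_h1Error_le {α0 : ℝ} (hab : a < b) (hT : 0 < T) (hμ : ∀ x ∈ Icc a b, 0 ≤ μ x)
    (hμC : ContDiffOn ℝ 3 μ (Icc a b)) (hκ : 0 < κ) (hc : ∀ x ∈ Ioo a b, |c x| ≤ κ)
    (hC : 0 < CΩ) (hemb : IsEmbeddingConst a b μ CΩ) (hα0 : 0 < α0) :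
    ∃ C : ℝ, 0 < C ∧ ∀ (α σ : ℝ) (f ub : ℝ → ℝ → ℝ) (u0 : ℝ → ℝ) (u : ℝ → ℝ → ℝ)
      (N : ℕ) (t : ℕ → ℝ) (M : ℕ) (uh : ℕ → ℕ → ℝ), α0 ≤ α →
      Setting a b T κ CΩ K μ c α σ f ub u0 u N t M uh → ∀ n : ℕ, 1 ≤ n → n ≤ N →
        h1Error a b M μ u t uh n ≤ C / (σ * (1 - α)) *
          (tau t 1 ^ σ + maxOver 2 n (histTerm α σ t)
            + maxOver 2 n (fun k => t k ^ (α / 2) * t (k - 1) ^ (σ - 2) * tau t k ^ 2)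
            + t n ^ (α / 2) * width a b M ^ 2) := by
  obtain ⟨B, m1, m2, hB, hμB⟩ := exists_smoothCoeff hab hμC
  obtain ⟨G, hG, hgr⟩ := exists_gronwall hα0 hT (by positivity : 0 < κ ^ 2 * CΩ)
  have hTC := timeConst_pos hT
  have hA := avgConst_nonneg (B := B) hab hκ.le
  have hN0 : 0 ≤ normConst a b T B κ |K| := by
    unfold normConst; positivity
  refine ⟨G * (5000 * (2 * √B * |K| * timeConst T) + 2 * normConst a b T B κ |K|) + 1,
    by positivity, ?_⟩
  intro α σ f ub u0 u N t M uh hα0α S n h1 hn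
  have hα := S.alpha_mem
  have h1α : 0 < 1 - α := by linarith [hα.2]
  have hm := S.mesh
  have hr := S.ratio_le
  have hM := S.grid
  have hσ : 0 < σ := by rcases S.sigma_mem with h | h <;> linarith [h.1]
  have hσ2 : σ < 2 := by rcases S.sigma_mem with h | h <;> linarith [h.2]
  have hK := S.regular.nonneg hT.le
  rw [abs_of_nonneg hK] at hN0 ⊢
  have hw := width_pos hab hM
  set x := tau t 1 ^ σ with hx
  have hx0 : 0 < x := Real.rpow_pos_of_pos (hm.tau_pos le_rfl (by omega)) σ
  set M2 := maxOver 2 n (histTerm α σ t) with hM2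
  have hM2p : 0 ≤ M2 := maxOver_nonneg _ _ _
  set M3 := maxOver 2 n (fun k => t k ^ (α / 2) * t (k - 1) ^ (σ - 2) * tau t k ^ 2) with hM3
  have hM3p : 0 ≤ M3 := maxOver_nonneg _ _ _
  set H := t n ^ (α / 2) * width a b M ^ 2 with hH
  have hH0 : 0 ≤ H := by have := hm.nonneg hn; positivity
  obtain ⟨P, hP⟩ := exists_complementary_kernelA hα hm hr
  set L := 2 * √B * K * timeConst T with hL
  have hL0 : 0 ≤ L := by positivity
  set Y := normConst a b T B κ K / σ * (x + M3 + H) with hY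
  have hY0 : 0 ≤ Y := by positivity
  have hΓ1 := Gamma_one_sub_pos hα
  have hΓ : Real.Gamma (1 - α) ≤ 1 / (1 - α) ^ 2 := by
    have h := Gamma_two_sub_le_one hα
    rw [Gamma_two_sub hα] at h
    rw [le_div_iff₀ (by positivity)]
    have := hα.1
    nlinarith
  have hv0 : h1Error a b M μ u t uh 0 = 0 := by
    have e : h1Error a b M μ u t uh 0 ^ 2 = 0 := by
      unfold h1Error
      rw [discH1_sq hab hM hμ]
      unfold discForm
      rw [Finset.sum_eq_zero, mul_zero]
      intro i hi
      rw [Finset.mem_Icc] at hi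
      have hz : ∀ j ≤ M, u (t 0) (pt a b M j) - uh 0 j = 0 := fun j hj => by
        rw [hm.2.1, S.solution.initial _ (pt_mem hab hM (by positivity) (by exact_mod_cast hj)),
          S.discrete.initial j hj, sub_self]
      simp only [hz i hi.2, hz (i - 1) (by omega)]
      ring
    exact pow_eq_zero_iff two_ne_zero |>.1 e
  have key := hgr α N t hα hα0α hm hr
    (fun k hk1 hk => three_mul_le_kernelA_self hα hm hκ hC S.step_le hk1 hk) P hP
    (h1Error a b M μ u t uh) (dualErr T B K α σ t) (normErr a b T B κ K α σ M t)
    (fun j => discH1_nonneg _) hv0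
    (fun j hj1 hj => by
      have := truncBound_nonneg hα hσ hm hj1 hj
      unfold dualErr; positivity)
    (fun j hj1 hj => S.energy hab hμ hμB hB hκ.le hc hC.le hemb hj1 hj) n h1 hn
    (L * (5000 / (σ * (1 - α)) * (x + M2))) (2 / (1 - α) * Y) (by positivity) (by positivity)
    (fun m hm1 hmn => by
      have h := sum_truncBound_le hα hm hr hσ hσ2.le hm1 (hmn.trans hn) (hP m (hmn.trans hn))
        hM2p (fun k hk2 hk => le_maxOver (histTerm α σ t) hk2 (hk.trans hmn))
      have e : ∑ j ∈ Finset.Icc 1 m, P m j * dualErr T B K α σ t j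
          = L * ∑ j ∈ Finset.Icc 1 m, P m j * truncBound α σ t j := by
        rw [Finset.mul_sum]
        refine Finset.sum_congr rfl fun j _ => ?_
        unfold dualErr; ring
      rw [e]
      exact mul_le_mul_of_nonneg_left h hL0)
    (fun m hm1 hmn => by
      have hPm := hP m (hmn.trans hn)
      have h := sum_complementary_omega_le hα hm hr hm1 (hmn.trans hn) hPm
      calc ∑ j ∈ Finset.Icc 1 m, P m j * normErr a b T B κ K α σ M t j ^ 2
          ≤ ∑ j ∈ Finset.Icc 1 m, Real.Gamma (1 - α) * Y ^ 2 * (P m j * omega (1 - α) (t j)) := by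
            refine Finset.sum_le_sum fun j hj => ?_
            rw [Finset.mem_Icc] at hj
            have htj := hm.pos hj.1 (by omega)
            have hb := rpow_mul_normErr_le (B := B) (M := M) hα hσ hσ2 hm hr hab hκ.le hK hn hM3p
              (fun k hk2 hk => le_maxOver
                (fun k => t k ^ (α / 2) * t (k - 1) ^ (σ - 2) * tau t k ^ 2) hk2 hk)
              hj.1 (hj.2.trans hmn)
            have hn0 : 0 ≤ normErr a b T B κ K α σ M t j := by
              have e1 := truncBound_nonneg hα (σ := 3) (by norm_num) hm hj.1 (by omega)
              have e2 := avgErr_nonneg hm hσ hj.1 (by omega)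
              unfold normErr; positivity
            have hsq := pow_le_pow_left₀ (by positivity) hb 2
            rw [← hY, mul_pow] at hsq
            have e1 : (t j ^ (α / 2)) ^ 2 = t j ^ α := by
              rw [← Real.rpow_natCast, ← Real.rpow_mul htj.le]; norm_num
            -- `η_j² ≤ t_j^{-α} Y²`, and `t_j^{-α}` is a multiple of `ω_{1-α}(t_j)`
            have e2 : Real.Gamma (1 - α) * omega (1 - α) (t j) = t j ^ (-α) := by
              rw [omega, show 1 - α - 1 = -α by ring]; field_simp
            have e3 : t j ^ (-α) * t j ^ α = 1 := by
              rw [← Real.rpow_add htj, neg_add_cancel, Real.rpow_zero]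
            rw [e1] at hsq
            have hp := Real.rpow_pos_of_pos htj (-α)
            calc _ = P m j * (t j ^ (-α) * t j ^ α * normErr a b T B κ K α σ M t j ^ 2) := by
                  rw [e3, one_mul]
              _ = P m j * t j ^ (-α) * (t j ^ α * normErr a b T B κ K α σ M t j ^ 2) := by ring
              _ ≤ P m j * t j ^ (-α) * Y ^ 2 :=
                  mul_le_mul_of_nonneg_left hsq (mul_nonneg (hPm.1 j) hp.le)
              _ = _ := by rw [← e2]; ring
        _ = Real.Gamma (1 - α) * Y ^ 2 * ∑ j ∈ Finset.Icc 1 m, P m j * omega (1 - α) (t j) := by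
            rw [Finset.mul_sum]
        _ ≤ Real.Gamma (1 - α) * Y ^ 2 * 4 :=
            mul_le_mul_of_nonneg_left (h.trans (by norm_num)) (by positivity)
        _ ≤ 1 / (1 - α) ^ 2 * Y ^ 2 * 4 := by gcongr
        _ = _ := by field_simp; norm_num)
  refine key.trans ?_
  have e : G * (L * (5000 / (σ * (1 - α)) * (x + M2)) + 2 / (1 - α) * Y)
      = (G * (5000 * L) * (x + M2) + G * (2 * normConst a b T B κ K) * (x + M3 + H))
        / (σ * (1 - α)) := by
    rw [hY]; field_simp
  rw [e, div_mul_eq_mul_div]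
  apply div_le_div_of_nonneg_right _ (by positivity)
  have i1 : G * (5000 * L) * (x + M2) ≤ G * (5000 * L) * (x + M2 + M3 + H) :=
    mul_le_mul_of_nonneg_left (by linarith) (by positivity)
  have i2 : G * (2 * normConst a b T B κ K) * (x + M3 + H)
      ≤ G * (2 * normConst a b T B κ K) * (x + M2 + M3 + H) :=
    mul_le_mul_of_nonneg_left (by linarith) (by positivity)
  have i3 : 0 ≤ x + M2 + M3 + H := by positivity
  calc _ ≤ _ := add_le_add i1 i2
    _ ≤ _ := by rw [← add_mul, ← mul_add, add_one_mul]; linarith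

end errorBound

/-! ### Graded meshes -/

section graded

variable {α T σ γ Cγ D : ℝ} {N k n : ℕ} {t : ℕ → ℝ}

lemma rpow_neg_le_pow_mul {x z p : ℝ} {m : ℕ} (hx : 0 < x) (hD : 1 ≤ D)
    (h : x ≤ D * z) (hp : 0 ≤ p) (hpm : p ≤ m) : z ^ (-p) ≤ D ^ m * x ^ (-p) := by
  have hD0 : 0 < D := by linarith
  calc z ^ (-p) ≤ (x / D) ^ (-p) :=
        Real.rpow_le_rpow_of_nonpos (by positivity) ((div_le_iff₀ hD0).2 (by linarith))
          (by linarith)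
    _ = D ^ p * x ^ (-p) := by
        rw [Real.div_rpow hx.le hD0.le, Real.rpow_neg hD0.le, div_inv_eq_mul, mul_comm]
    _ ≤ D ^ (m : ℝ) * x ^ (-p) := by gcongr
    _ = _ := by rw [Real.rpow_natCast]

/-- The quantity `t_k^σ (τ_k / t_k)²` that dominates every temporal term of the error bound.
On a graded mesh `τ_k / t_k ≤ C τ t_k^{-1/γ}`, so that with `β = min(γσ, 2)` it is at most
`t_k^σ (τ_k / t_k)^β ≤ C τ^β t_k^{σ - β/γ}`, where the last exponent is nonnegative. -/
lemma MeshConv.rpow_mul_sq_le (hg : MeshConv γ Cγ N t) (hm : IsMesh T N t) (hγ : 1 ≤ γ)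
    (hD : 1 ≤ D) (hDC : Cγ ≤ D) (hσ : 0 < σ) (hσ2 : σ ≤ 2) (hk1 : 1 ≤ k) (hk : k ≤ N) :
    t k ^ σ * (tau t k / t k) ^ 2 ≤ D ^ 2 * (1 + T) ^ 2 * maxStep N t ^ min (γ * σ) 2 := by
  have ht := hm.pos hk1 hk
  have hτ := hm.tau_pos hk1 hk
  have hT : t k ≤ T := hm.le_T hk
  have hγ0 : 0 < γ := by linarith
  have hmax : 0 ≤ maxStep N t := maxOver_nonneg 1 N (tau t)
  set β := min (γ * σ) 2 with hβ
  have hβ0 : 0 < β := lt_min (by positivity) (by norm_num)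
  have hβ2 : β ≤ 2 := min_le_right _ _
  have hβσ : β / γ ≤ σ := (div_le_iff₀ hγ0).2 (by linarith [min_le_left (γ * σ) 2])
  have hy0 : 0 < tau t k / t k := by positivity
  have hy1 : tau t k / t k ≤ 1 := (div_le_one ht).2 (hm.tau_le hk)
  have hyb : tau t k / t k ≤ D * maxStep N t * t k ^ (-(1 / γ)) := by
    rw [div_le_iff₀ ht]
    calc tau t k ≤ Cγ * maxStep N t * min 1 (t k ^ (1 - 1 / γ)) := hg.1 k hk1 hk
      _ ≤ D * maxStep N t * t k ^ (1 - 1 / γ) := by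
          have := Real.rpow_nonneg ht.le (1 - 1 / γ)
          gcongr
          exact min_le_right _ _
      _ = D * maxStep N t * t k ^ (-(1 / γ)) * t k := by
          rw [mul_assoc (D * maxStep N t), ← Real.rpow_add_one ht.ne']
          ring_nf
  calc t k ^ σ * (tau t k / t k) ^ 2 = t k ^ σ * (tau t k / t k) ^ (2 : ℝ) := by norm_cast
    _ ≤ t k ^ σ * (tau t k / t k) ^ β := by
        gcongr ?_ * ?_
        exact Real.rpow_le_rpow_of_exponent_ge hy0 hy1 hβ2
    _ ≤ t k ^ σ * (D * maxStep N t * t k ^ (-(1 / γ))) ^ β := by gcongr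
    _ = D ^ β * maxStep N t ^ β * t k ^ (σ - β / γ) := by
        rw [Real.mul_rpow (by positivity) (by positivity), Real.mul_rpow (by positivity) hmax,
          ← Real.rpow_mul ht.le, show σ - β / γ = σ + -(1 / γ) * β by ring, Real.rpow_add ht]
        ring
    _ ≤ D ^ (2 : ℝ) * maxStep N t ^ β * (1 + T) ^ (2 : ℝ) := by
        have h1 : t k ^ (σ - β / γ) ≤ (1 + T) ^ (2 : ℝ) :=
          (Real.rpow_le_rpow ht.le (by linarith) (by linarith)).trans
            (Real.rpow_le_rpow_of_exponent_le (by linarith)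
              (by linarith [div_pos hβ0 hγ0]))
        have h2 : D ^ β ≤ D ^ (2 : ℝ) := Real.rpow_le_rpow_of_exponent_le hD hβ2
        gcongr
    _ = _ := by norm_cast; ring

lemma MeshConv.histTerm_le (hg : MeshConv γ Cγ N t) (hm : IsMesh T N t) (hα : α ∈ Ioo (0 : ℝ) 1)
    (hD : 1 ≤ D) (hDC : Cγ ≤ D) (hσ : 0 < σ) (hσ2 : σ ≤ 2) (hk2 : 2 ≤ k) (hk : k ≤ N) :
    histTerm α σ t k ≤ D ^ 5 * (t k ^ σ * (tau t k / t k) ^ 2) := by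
  have ht := hm.pos (j := k) (by omega) hk
  have hs := hm.pos (j := k - 1) (by omega) (by omega)
  have hτ := hm.tau_pos (k := k) (by omega) hk
  have hτ' := hm.tau_pos (k := k - 1) (by omega) (by omega)
  have hD0 : 0 < D := by linarith
  have hts : t k ≤ D * t (k - 1) := (hg.2.1 k hk2 hk).trans (by gcongr)
  have hττ : tau t k ≤ D ^ 2 * tau t (k - 1) := by
    have h : tau t k / t k ≤ D * (tau t (k - 1) / t (k - 1)) :=
      (hg.2.2 k hk2 hk).trans (by gcongr)
    rw [div_le_iff₀ ht] at h
    calc tau t k ≤ D * (tau t (k - 1) / t (k - 1)) * t k := h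
      _ ≤ D * (tau t (k - 1) / t (k - 1)) * (D * t (k - 1)) := by gcongr
      _ = _ := by field_simp
  have e1 : t (k - 1) ^ (σ - 3) ≤ D ^ 3 * t k ^ (σ - 3) := by
    have := rpow_neg_le_pow_mul (p := 3 - σ) (m := 3) ht hD hts (by linarith)
      (by norm_num; linarith)
    rwa [neg_sub] at this
  have e2 : tau t (k - 1) ^ (-α) ≤ D ^ 2 * tau t k ^ (-α) := by
    have := rpow_neg_le_pow_mul (p := α) (m := 1) hτ (one_le_pow₀ hD (n := 2)) hττ hα.1.le
      (by norm_num; exact hα.2.le)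
    rwa [pow_one] at this
  have e3 : t k ^ α * t k ^ (σ - 3) * tau t k ^ 3 * tau t k ^ (-α)
      = t k ^ σ * (tau t k / t k) ^ (3 - α) := by
    rw [Real.div_rpow hτ.le ht.le, ← Real.rpow_add ht, sub_eq_add_neg 3 α, Real.rpow_add hτ,
      show α + (σ - 3) = σ - (3 + -α) by ring, Real.rpow_sub ht]
    norm_cast
    ring
  calc histTerm α σ t k = t k ^ α * t (k - 1) ^ (σ - 3) * tau t k ^ 3 * tau t (k - 1) ^ (-α) := by
        rw [histTerm, Real.rpow_neg hτ'.le, div_eq_mul_inv]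
    _ ≤ t k ^ α * (D ^ 3 * t k ^ (σ - 3)) * tau t k ^ 3 * (D ^ 2 * tau t k ^ (-α)) := by gcongr
    _ = D ^ 5 * (t k ^ α * t k ^ (σ - 3) * tau t k ^ 3 * tau t k ^ (-α)) := by ring
    _ = D ^ 5 * (t k ^ σ * (tau t k / t k) ^ (3 - α)) := by rw [e3]
    _ ≤ D ^ 5 * (t k ^ σ * (tau t k / t k) ^ (2 : ℝ)) := by
        gcongr D ^ 5 * (t k ^ σ * ?_)
        exact Real.rpow_le_rpow_of_exponent_ge (by positivity) ((div_le_one ht).2 (hm.tau_le hk))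
          (by linarith [hα.2])
    _ = _ := by norm_cast

lemma rpow_le_one_add_of_le {s p : ℝ} (hs : 0 ≤ s) (hsT : s ≤ T) (h0 : 0 ≤ p) (h1 : p ≤ 1) :
    s ^ p ≤ 1 + T :=
  (rpow_le_one_add hs h0 h1).trans (by linarith)

lemma MeshConv.avgTerm_le (hg : MeshConv γ Cγ N t) (hm : IsMesh T N t) (hα : α ∈ Ioo (0 : ℝ) 1)
    (hD : 1 ≤ D) (hDC : Cγ ≤ D) (hσ : 0 < σ) (hσ2 : σ ≤ 2) (hk2 : 2 ≤ k) (hk : k ≤ N) :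
    t k ^ (α / 2) * t (k - 1) ^ (σ - 2) * tau t k ^ 2
      ≤ (1 + T) * D ^ 2 * (t k ^ σ * (tau t k / t k) ^ 2) := by
  have ht := hm.pos (j := k) (by omega) hk
  have hs := hm.pos (j := k - 1) (by omega) (by omega)
  have hts : t k ≤ D * t (k - 1) := (hg.2.1 k hk2 hk).trans (by gcongr)
  have hT := rpow_le_one_add_of_le ht.le (hm.le_T hk) (p := α / 2) (by linarith [hα.1])
    (by linarith [hα.2])
  have e1 : t (k - 1) ^ (σ - 2) ≤ D ^ 2 * t k ^ (σ - 2) := by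
    have := rpow_neg_le_pow_mul (p := 2 - σ) (m := 2) ht hD hts (by linarith)
      (by norm_num; linarith)
    rwa [neg_sub] at this
  have hT0 : 0 ≤ 1 + T := (Real.rpow_nonneg ht.le _).trans hT
  calc _ ≤ (1 + T) * (D ^ 2 * t k ^ (σ - 2)) * tau t k ^ 2 := by gcongr
    _ = _ := by
      rw [Real.rpow_sub ht]
      norm_cast
      field_simp

/-- On a graded mesh the bound for general meshes is of order `τ^{min(γσ,2)} + h²`. -/
lemma MeshConv.errorBound_le (hg : MeshConv γ Cγ N t) (hm : IsMesh T N t)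
    (hα : α ∈ Ioo (0 : ℝ) 1) (hγ : 1 ≤ γ) (hD : 1 ≤ D) (hDC : Cγ ≤ D) (hσ : 0 < σ) (hσ2 : σ ≤ 2)
    (hn1 : 1 ≤ n) (hn : n ≤ N) {H : ℝ} (hH : 0 ≤ H) :
    tau t 1 ^ σ + maxOver 2 n (histTerm α σ t)
        + maxOver 2 n (fun k => t k ^ (α / 2) * t (k - 1) ^ (σ - 2) * tau t k ^ 2)
        + t n ^ (α / 2) * H
      ≤ ((1 + D ^ 5 + (1 + T) * D ^ 2) * (D ^ 2 * (1 + T) ^ 2) + (1 + T))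
        * (maxStep N t ^ min (γ * σ) 2 + H) := by
  have hT : 0 < 1 + T := by linarith [(hm.pos hn1 hn).le, hm.le_T hn]
  set X := maxStep N t ^ min (γ * σ) 2
  have hX : 0 ≤ X := Real.rpow_nonneg (maxOver_nonneg 1 N (tau t)) _
  have key : ∀ k, 1 ≤ k → k ≤ N →
      t k ^ σ * (tau t k / t k) ^ 2 ≤ D ^ 2 * (1 + T) ^ 2 * X := fun k h1 h2 =>
    hg.rpow_mul_sq_le hm hγ hD hDC hσ hσ2 h1 h2
  have i1 : tau t 1 ^ σ ≤ D ^ 2 * (1 + T) ^ 2 * X := by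
    have h := key 1 le_rfl (hn1.trans hn)
    rwa [hm.tau_one, div_self (hm.pos le_rfl (hn1.trans hn)).ne', one_pow, mul_one,
      ← hm.tau_one] at h
  have i2 : maxOver 2 n (histTerm α σ t) ≤ D ^ 5 * (D ^ 2 * (1 + T) ^ 2 * X) :=
    maxOver_le (by positivity) fun k h2 hkn =>
      (hg.histTerm_le hm hα hD hDC hσ hσ2 h2 (hkn.trans hn)).trans
        (mul_le_mul_of_nonneg_left (key k (by omega) (hkn.trans hn)) (by positivity))
  have i3 : maxOver 2 n (fun k => t k ^ (α / 2) * t (k - 1) ^ (σ - 2) * tau t k ^ 2)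
      ≤ (1 + T) * D ^ 2 * (D ^ 2 * (1 + T) ^ 2 * X) :=
    maxOver_le (by positivity) fun k h2 hkn =>
      (hg.avgTerm_le hm hα hD hDC hσ hσ2 h2 (hkn.trans hn)).trans
        (mul_le_mul_of_nonneg_left (key k (by omega) (hkn.trans hn)) (by positivity))
  have i4 : t n ^ (α / 2) * H ≤ (1 + T) * H :=
    mul_le_mul_of_nonneg_right (rpow_le_one_add_of_le (hm.pos hn1 hn).le (hm.le_T hn)
      (by linarith [hα.1]) (by linarith [hα.2])) hH
  have i5 : 0 ≤ (1 + T) * X := by positivity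
  have i6 : 0 ≤ (1 + D ^ 5 + (1 + T) * D ^ 2) * (D ^ 2 * (1 + T) ^ 2) * H := by positivity
  linarith

end graded

end FracCN

theorem theorem4p4
    (xl xr T μ0 μ1 κ CΩ α0 K : ℝ) (μ c : ℝ → ℝ)
    (hx : xl < xr) (hT : 0 < T)
    (hμ0 : 0 < μ0) (hμ : ∀ x ∈ Set.Icc xl xr, μ0 ≤ μ x ∧ μ x ≤ μ1)
    (hμC : ContDiffOn ℝ 3 μ (Set.Icc xl xr))
    (hκ : 0 < κ) (hc : ∀ x ∈ Set.Ioo xl xr, |c x| ≤ κ)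
    (hCΩ : 0 < CΩ) (hemb : FracCN.IsEmbeddingConst xl xr μ CΩ)
    (hα0 : 0 < α0) :
    (∃ C : ℝ, 0 < C ∧
      ∀ (α σ : ℝ) (f ub : ℝ → ℝ → ℝ) (u0 : ℝ → ℝ) (u : ℝ → ℝ → ℝ)
        (N : ℕ) (t : ℕ → ℝ) (M : ℕ) (uh : ℕ → ℕ → ℝ),
        α0 ≤ α →
        FracCN.Setting xl xr T κ CΩ K μ c α σ f ub u0 u N t M uh →
        ∀ n : ℕ, 1 ≤ n → n ≤ N →
          FracCN.h1Error xl xr M μ u t uh n ≤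
            C / (σ * (1 - α)) *
              (FracCN.tau t 1 ^ σ
                + FracCN.maxOver 2 n (fun k =>
                    t k ^ α * t (k - 1) ^ (σ - 3) * FracCN.tau t k ^ 3 / FracCN.tau t (k - 1) ^ α)
                + FracCN.maxOver 2 n (fun k =>
                    t k ^ (α / 2) * t (k - 1) ^ (σ - 2) * FracCN.tau t k ^ 2)
                + t n ^ (α / 2) * FracCN.width xl xr M ^ 2)) ∧
    (∀ γ Cγ : ℝ, 1 ≤ γ → 0 < Cγ →
      ∃ C : ℝ, 0 < C ∧
        ∀ (α σ : ℝ) (f ub : ℝ → ℝ → ℝ) (u0 : ℝ → ℝ) (u : ℝ → ℝ → ℝ)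
          (N : ℕ) (t : ℕ → ℝ) (M : ℕ) (uh : ℕ → ℕ → ℝ),
          α0 ≤ α →
          FracCN.Setting xl xr T κ CΩ K μ c α σ f ub u0 u N t M uh →
          FracCN.MeshConv γ Cγ N t →
          ∀ n : ℕ, 1 ≤ n → n ≤ N →
            FracCN.h1Error xl xr M μ u t uh n ≤
              C / (σ * (1 - α)) *
                (FracCN.maxStep N t ^ min (γ * σ) 2 + FracCN.width xl xr M ^ 2)) := by
  obtain ⟨C, hC, hmain⟩ := FracCN.exists_h1Error_le (K := K) hx hT
    (fun x hx => hμ0.le.trans (hμ x hx).1) hμC hκ hc hCΩ hemb hα0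
  refine ⟨⟨C, hC, hmain⟩, fun γ Cγ hγ _ => ?_⟩
  set D := max 1 Cγ
  have hD : 1 ≤ D := le_max_left _ _
  refine ⟨C * ((1 + D ^ 5 + (1 + T) * D ^ 2) * (D ^ 2 * (1 + T) ^ 2) + (1 + T)), by positivity, ?_⟩
  intro α σ f ub u0 u N t M uh hα hS hg n hn1 hn
  have hα1 : 0 < 1 - α := sub_pos.2 hS.alpha_mem.2
  obtain ⟨hσ, hσ2⟩ : 0 < σ ∧ σ ≤ 2 := by
    rcases hS.sigma_mem with h | h
    · exact ⟨h.1, by linarith [h.2]⟩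
    · exact ⟨by linarith [h.1], h.2.le⟩
  refine (hmain α σ f ub u0 u N t M uh hα hS n hn1 hn).trans ?_
  rw [mul_div_right_comm, mul_assoc]
  exact mul_le_mul_of_nonneg_left
    (hg.errorBound_le hS.mesh hS.alpha_mem hγ hD (le_max_right _ _) hσ hσ2 hn1 hn (sq_nonneg _))
    (by positivity)
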